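/- Let $m\ge 1$ be an integer and $0<q<1$. Write $[u]_p=\frac{p^u-1}{p-1}$, $[j]_p!=[1]_p\cdots[j]_p$, $\Gamma_p(t)=\prod_{k\ge0}\frac{1-p^{k+1}}{1-p^{t+k}}\,(1-p)^{1-t}$, $\mu=1+q^{2-m}$, $e_{p}(t)=\sum_{j\ge0}\frac{t^j}{[j]_{p}!}$ (continued analytically by $e_p(t)=1/E_p(-t)$) and $E_{p}(t)=\sum_{j\ge0}p^{j(j-1)/2}\frac{t^j}{[j]_{p}!}$. **Quantum Euclidean space.** Let $i'=m+1-i$ and $(\rho_1,\dots,\rho_m)=(\tfrac m2-1,\tfrac m2-2,\dots,1-\tfrac m2)$, with the two middle entries $0,0$ for even $m$ and the three middle entries $\tfrac12,0,-\tfrac12$ for odd $m\ge3$ (for $m=1$, $\rho_1=0$), so that $\rho_{i'}=-\rho_i$. Let $C^{ij}=C_{ij}=q^{-\rho_i}\delta_{ij'}$, and let $\hat R$ be the braid matrix of the quantum orthogonal group $O_q(m)$, $$\hat R^{ij}_{kl}=q^{\delta_{ij}-\delta_{ij'}}\delta_{il}\delta_{jk}+(q-q^{-1})\big([i<j]\,\delta_{ik}\delta_{jl}-[i<l]\,q^{\rho_l-\rho_i}\delta_{ji'}\delta_{kl'}\big),$$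 where $[\cdot]$ is $1$ if the condition holds and $0$ otherwise. It decomposes as $\hat R=q\mathcal P_S-q^{-1}\mathcal P_A+q^{1-m}\mathcal P_1$ with projections $\mathcal P_S+\mathcal P_A+\mathcal P_1=1$ and $(\mathcal P_1)^{ij}_{kl}=C^{ij}C_{kl}/(C^{ab}C_{ab})$. Repeated indices are summed. Let $\mathcal P$ be the complex algebra generated by $x^1,\dots,x^m$ with relations $(\mathcal P_A)^{ij}_{kl}x^kx^l=0$, and $\mathcal O_q$ the corresponding algebra of formal power series. Put $\mathbf x^2=x^iC_{ij}x^j$. The partial derivatives are determined by $\partial^i(1)=\overline{\partial}^i(1)=0$ and $$\partial^ix^j=C^{ij}+q(\hat R^{-1})^{ij}_{kl}x^k\partial^l,\qquad \overline{\partial}^ix^j=C^{ij}+q^{-1}\hat R^{ij}_{kl}x^k\overline{\partial}^l .$$ Let $\Delta=\partial^iC_{ij}\partial^j$, let $\mathcal S_k$ be the space of homogeneous $S\in\mathcal P$ of degree $k$ with $\Delta S=0$, and let $\Lambda^u$ act on homogeneous elements of degree $n$ as $q^{2un}$. For $f$ with a convergent Taylor expansion at the origin, $f(\mathbf x^2)\in\mathcal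 O_q$ is defined by that expansion. **The second Fourier transform.** Let $$J^{(2)}_\nu(x|q^2)=q^{\nu^2}\Big(\frac{x}{1+q}\Big)^{\nu}\sum_{i\ge0}\frac{(-1)^iq^{2i(i+\nu)}}{[i]_{q^2}!\,\Gamma_{q^2}(i+\nu+1)}\Big(\frac{x}{1+q}\Big)^{2i},\qquad \int_0^{\gamma\cdot\infty}f(t)\,d_pt=(1-p)\gamma\sum_{k\in\mathbb Z}f(p^k\gamma)p^k .$$ For $a>0$ let $\mathcal V_a=\mathcal P\cdot e_{q^2}(-aq^2\mathbf x^2/\mu)\subset\mathcal O_q$, and for $\alpha>0$ let $\mathcal V_{[\alpha]}=\bigcup_{j\ge0}\mathcal V_{q^{-2j}\alpha}$. Fix an arbitrary $\gamma>0$. On $\mathcal V_{[\alpha]}$ the transform $\mathcal F^\pm$ is the linear map given, for $S_k\in\mathcal S_k$ and $\psi(u)=p(u)\,e_{q^2}(-aq^2u/\mu)$ with $p$ a polynomial and $a=q^{-2j}\alpha$, by $$\mathcal F^\pm[S_k\psi(\mathbf x^2)]=\frac{(\pm i)^k}{c(a)}\,S_k\,\widehat\psi(\mathbf x^2),\qquad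 \widehat\psi(r^2)=\frac{1+q}{\mu}\int_0^{\gamma\cdot\infty}d_qt\,\frac{J^{(2)}_{\nu}\big(q\tfrac{1+q}{\mu}rt\,|\,q^2\big)}{(rt)^{\nu}}\,t^{2\nu+1}\psi(t^2),\quad \nu=\tfrac m2+k-1,$$ $$c(a)=\frac{q^{(\frac m2-1)\frac m2}}{\Gamma_{q^2}(\frac m2)}\int_0^{\frac{aq^2\gamma^2}{\mu}\cdot\infty}d_{q^2}u\;u^{\frac m2-1}e_{q^2}(-u).$$ On the sum $\mathcal V_{[q^{-m/2}]}+\mathcal V_{[q^{1-m/2}]}$ let $\mathcal F^\pm$ be the sum of the transforms on the two summands. **The harmonic oscillator.** Let $b_n,\overline b_n$ $(n\ge1)$ be complex numbers with $\overline b_n=q^{2-n}b_n$, and put $$a_n^{j+}=b_n\big(x^j-q^{2-n-\frac m2}\partial^j\big)\Lambda^{-\frac14},\qquad \overline a_n^{j+}=\overline b_n\big(x^j-q^{n-2-\frac m2}\overline{\partial}^j\big)\Lambda^{\frac14},$$ $$\psi_0=e_{q^2}\Big(-\frac{\mathbf x^2}{q^{m/2}\mu}\Big),\quad \overline\psi_0=E_{q^2}\Big(-\frac{q^{m/2}q^2\mathbf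 x^2}{\mu}\Big),\quad \psi_n^{i_n\cdots i_1}=a_n^{i_n+}\cdots a_1^{i_1+}\psi_0,\quad \overline\psi_n^{i_n\cdots i_1}=\overline a_n^{i_n+}\cdots\overline a_1^{i_1+}\overline\psi_0 .$$ Let $\mathbb V$ be the complex vector space of linear combinations of abstract elements $\Psi_n^{i_n\cdots i_1}$ $(n\ge0,\ 1\le i_s\le m)$, modulo the linear relations satisfied both by the $\psi_n^{i_n\cdots i_1}$ and by the $\overline\psi_n^{i_n\cdots i_1}$, and let $\Pi,\overline\Pi:\mathbb V\to\mathcal O_q$ be the linear maps with $\Pi(\Psi_n^{i_n\cdots i_1})=\psi_n^{i_n\cdots i_1}$ and $\overline\Pi(\Psi_n^{i_n\cdots i_1})=\overline\psi_n^{i_n\cdots i_1}$. **Theorem.** The maps $\Pi$ and $\overline\Pi$ are injective, the sum of $\mathcal V_{[q^{-m/2}]}$ and $\mathcal V_{[q^{1-m/2}]}$ is direct, $\mathcal F^\pm$ is well defined on it, $\Pi(\mathbb V)$ is contained in this space, and $\mathcal F^\pm(\Pi(\mathbb V))\subset\overline\Pi(\mathbb V)$. Hence $$\mathbb F^\pm=q^{-\frac{m^2}{4}}\,\overline\Pi^{-1}\circ\mathcal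 F^\pm\circ\Pi:\mathbb V\to\mathbb V$$ is a well-defined linear map, and it satisfies, for all $n\ge0$ and all $i_1,\dots,i_n\in\{1,\dots,m\}$, $$\mathbb F^\pm[\Psi_n^{i_n\cdots i_1}]=(\pm i)^n\,\Psi_n^{i_n\cdots i_1}.$$ -/

import Mathlib

open scoped Polynomial

noncomputable section

namespace QuantumEuclidean

/-! ### Scalar `q`-calculus -/

/-- The `p`-number `[u]_p = (p ^ u - 1) / (p - 1)`. -/
def qNumber (p u : ℝ) : ℝ := (p ^ u - 1) / (p - 1)

/-- The `p`-factorial `[n]_p! = [1]_p [2]_p ⋯ [n]_p`. -/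
def qFactorial (p : ℝ) (n : ℕ) : ℝ := ∏ k ∈ Finset.range n, qNumber p ((k : ℝ) + 1)

/-- The `p`-Gamma function `Γ_p(t) = (p; p)_∞ / (p ^ t; p)_∞ * (1 - p) ^ (1 - t)`. -/
def qGamma (p t : ℝ) : ℝ :=
  (∏' k : ℕ, (1 - p ^ (k + 1))) / (∏' k : ℕ, (1 - p ^ (t + (k : ℝ)))) * (1 - p) ^ (1 - t)

/-- The entire `p`-exponential `E_p(t) = ∑_j p ^ (j (j - 1) / 2) t ^ j / [j]_p!`. -/
def qExpBig (p t : ℝ) : ℝ := ∑' j : ℕ, p ^ (j.choose 2) * t ^ j / qFactorial p j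

/-- The `p`-exponential `e_p(t) = ∑_j t ^ j / [j]_p!`, analytically continued beyond the disc of
convergence of this series as `1 / E_p(-t)`. -/
def qExpSmall (p t : ℝ) : ℝ := 1 / qExpBig p (-t)

/-- The Taylor series `∑_j (a u) ^ j / [j]_p!` of `u ↦ e_p(a u)`. -/
def qExpSmallSeries (p a : ℝ) : PowerSeries ℂ :=
  PowerSeries.mk fun j => ((a ^ j / qFactorial p j : ℝ) : ℂ)

/-- The Taylor series `∑_j p ^ (j (j - 1) / 2) (a u) ^ j / [j]_p!` of `u ↦ E_p(a u)`. -/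
def qExpBigSeries (p a : ℝ) : PowerSeries ℂ :=
  PowerSeries.mk fun j => ((p ^ (j.choose 2) * a ^ j / qFactorial p j : ℝ) : ℂ)

/-- The infinite Jackson integral
`∫_0^{γ·∞} f(t) d_p t = (1 - p) γ ∑_{k ∈ ℤ} f(p ^ k γ) p ^ k`. -/
def jacksonIntegral (p γ : ℝ) (f : ℝ → ℂ) : ℂ :=
  (((1 - p) * γ : ℝ) : ℂ) * ∑' k : ℤ, f (p ^ k * γ) * ((p ^ k : ℝ) : ℂ)

/-- The second `q`-Bessel function `J_ν^{(2)}(x | q ^ 2)`. -/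
def besselTwo (q ν x : ℝ) : ℝ :=
  q ^ (ν ^ 2) * (x / (1 + q)) ^ ν *
    ∑' i : ℕ, q ^ (2 * (i : ℝ) * ((i : ℝ) + ν)) * (-1) ^ i /
      (qFactorial (q ^ 2) i * qGamma (q ^ 2) ((i : ℝ) + ν + 1)) * (x / (1 + q)) ^ (2 * i)

/-- The constant `μ = 1 + q ^ (2 - m)`. -/
def mu (m : ℕ) (q : ℝ) : ℝ := 1 + q ^ (2 - (m : ℝ))

/-- The second `q`-Hankel transform
`H_ν[f](r) = (1 + q) / μ ∫_0^{γ·∞} d_q t (J_ν^{(2)}(q (1 + q) / μ r t | q ^ 2) / (r t) ^ ν)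
t ^ (2 ν + 1) f(t)`. -/
def hankelTwo (m : ℕ) (q γ ν : ℝ) (f : ℝ → ℂ) (r : ℝ) : ℂ :=
  (((1 + q) / mu m q : ℝ) : ℂ) * jacksonIntegral q γ fun t =>
    ((besselTwo q ν (q * ((1 + q) / mu m q) * (r * t)) / (r * t) ^ ν *
      t ^ (2 * ν + 1) : ℝ) : ℂ) * f t

/-- The transform `F_ν` on functions of the squared radius:
`F_ν[ψ](r ^ 2) = H_ν[t ↦ ψ(t ^ 2)](r)`. -/
def radialTransform (m : ℕ) (q γ ν : ℝ) (ψ : ℝ → ℂ) (u : ℝ) : ℂ :=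
  hankelTwo m q γ ν (fun t => ψ (t ^ 2)) (Real.sqrt u)

/-- The normalization constant
`c = q ^ ((m/2 - 1) m/2) / Γ_{q²}(m/2) * ∫_0^{(α q² γ² / μ)·∞} d_{q²} u u ^ (m/2 - 1) e_{q²}(-u)`. -/
def fourierConst (m : ℕ) (q α γ : ℝ) : ℂ :=
  ((q ^ (((m : ℝ) / 2 - 1) * ((m : ℝ) / 2)) / qGamma (q ^ 2) ((m : ℝ) / 2) : ℝ) : ℂ) *
    jacksonIntegral (q ^ 2) (α * q ^ 2 * γ ^ 2 / mu m q) fun u =>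
      ((u ^ ((m : ℝ) / 2 - 1) * qExpSmall (q ^ 2) (-u) : ℝ) : ℂ)

/-- `s` is the Taylor series at the origin of the function `f` of the variable `u = r ^ 2 > 0`:
it converges to `f` for all small positive `u`. -/
def HasTaylorAtOrigin (f : ℝ → ℂ) (s : PowerSeries ℂ) : Prop :=
  ∃ δ > 0, ∀ u : ℝ, 0 < u → u < δ →
    HasSum (fun n : ℕ => PowerSeries.coeff n s * (u : ℂ) ^ n) (f u)

/-! ### The braid matrix of `O_q(m)` and the metric -/

/-- The numbers `ρ_i`: `(n - 1/2, …, 1/2, 0, -1/2, …, 1/2 - n)` for `m = 2 n + 1` and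
`(n - 1, …, 0, 0, …, 1 - n)` for `m = 2 n`. -/
def rho (m : ℕ) (i : Fin m) : ℝ :=
  if i < i.rev then (m : ℝ) / 2 - 1 - (i : ℕ)
  else if i = i.rev then 0
  else -((m : ℝ) / 2 - 1 - (i.rev : ℕ))

/-- The metric `C_{ij} = C^{ij} = q ^ (-ρ_i) δ_{i, j'}`, where `j' = m + 1 - j`. -/
def metric (m : ℕ) (q : ℝ) (i j : Fin m) : ℂ :=
  if j = i.rev then ((q ^ (-rho m i) : ℝ) : ℂ) else 0

/-- The braid matrix `R̂^{ij}_{kl}` (row `(i, j)`, column `(k, l)`) of the quantum orthogonal group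
`O_q(m)`. The first summand is the deformed flip, the second one carries `q - q⁻¹` on
`i < j`, `(k, l) = (i, j)`, the third one is
`-(q - q⁻¹) q ^ (ρ_l - ρ_i)` on `i < l`, `j = i'`, `k = l'`. -/
def braidMatrix (m : ℕ) (q : ℝ) : Matrix (Fin m × Fin m) (Fin m × Fin m) ℂ :=
  Matrix.of fun a b =>
    (if b.1 = a.2 ∧ b.2 = a.1 then
      (if a.1 = a.2 then (if a.1 = a.1.rev then 1 else (q : ℂ))
        else if a.2 = a.1.rev then (q : ℂ)⁻¹ else 1)
      else 0)
    + (if a.1 < a.2 ∧ b = a then (q : ℂ) - (q : ℂ)⁻¹ else 0)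
    - (if a.1 < b.2 ∧ a.2 = a.1.rev ∧ b.1 = b.2.rev then
        ((q : ℂ) - (q : ℂ)⁻¹) * ((q ^ (rho m b.2 - rho m a.1) : ℝ) : ℂ) else 0)

/-- The singlet projection `(P_1)^{ij}_{kl} = C^{ij} C_{kl} / C` with `C = C^{ij} C_{ij}`. -/
def singletProj (m : ℕ) (q : ℝ) : Matrix (Fin m × Fin m) (Fin m × Fin m) ℂ :=
  Matrix.of fun a b =>
    metric m q a.1 a.2 * metric m q b.1 b.2 / ∑ i, ∑ j, metric m q i j * metric m q i j

/-- The antisymmetric projection `P_A`, obtained by solving `1 = P_S + P_A + P_1` and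
`R̂ = q P_S - q⁻¹ P_A + q ^ (1 - m) P_1` for `P_A`. -/
def antisymProj (m : ℕ) (q : ℝ) : Matrix (Fin m × Fin m) (Fin m × Fin m) ℂ :=
  ((q : ℂ) + (q : ℂ)⁻¹)⁻¹ •
    ((q : ℂ) • (1 : Matrix (Fin m × Fin m) (Fin m × Fin m) ℂ) - braidMatrix m q +
      (((q ^ (1 - (m : ℝ)) : ℝ) : ℂ) - (q : ℂ)) • singletProj m q)

/-! ### Polynomials on quantum Euclidean space -/

/-- Noncommutative polynomials in `x^1, …, x^m`. -/
abbrev Words (m : ℕ) : Type := FreeAlgebra ℂ (Fin m)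

/-- The commutation relations `(P_A)^{ij}_{kl} x^k x^l = 0`. -/
inductive Commutation (m : ℕ) (q : ℝ) : Words m → Words m → Prop
  | rel (i j : Fin m) : Commutation m q
      (∑ k, ∑ l, antisymProj m q (i, j) (k, l) • (FreeAlgebra.ι ℂ k * FreeAlgebra.ι ℂ l)) 0

/-- The algebra of polynomials on quantum Euclidean space. -/
abbrev QPoly (m : ℕ) (q : ℝ) : Type := RingQuot (Commutation m q)

/-- The quotient map from noncommutative polynomials. -/
def toQPoly (m : ℕ) (q : ℝ) : Words m →ₐ[ℂ] QPoly m q := RingQuot.mkAlgHom ℂ (Commutation m q)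

/-- The coordinates `x^j`. -/
def coord (m : ℕ) (q : ℝ) (j : Fin m) : QPoly m q := toQPoly m q (FreeAlgebra.ι ℂ j)

/-- The norm squared `x^i C_{ij} x^j`. -/
def normSq (m : ℕ) (q : ℝ) : QPoly m q :=
  ∑ i, ∑ j, metric m q i j • (coord m q i * coord m q j)

/-- Homogeneous noncommutative polynomials of degree `n`. -/
def wordsHomog (m n : ℕ) : Submodule ℂ (Words m) :=
  (Submodule.span ℂ (Set.range (FreeAlgebra.ι ℂ))) ^ n

/-- Homogeneous polynomials of degree `n` on quantum Euclidean space. -/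
def homog (m : ℕ) (q : ℝ) (n : ℕ) : Submodule ℂ (QPoly m q) :=
  (Submodule.span ℂ (Set.range (coord m q))) ^ n

theorem homog_eq_map (m : ℕ) (q : ℝ) (n : ℕ) :
    homog m q n = (wordsHomog m n).map (toQPoly m q).toLinearMap := by
  unfold homog wordsHomog
  rw [Submodule.map_pow, Submodule.map_span, ← Set.range_comp]
  rfl

theorem coord_mem (m : ℕ) (q : ℝ) (j : Fin m) : coord m q j ∈ homog m q 1 := by
  unfold homog
  rw [pow_one]
  exact Submodule.subset_span ⟨j, rfl⟩

theorem mul_mem_homog {m : ℕ} {q : ℝ} {k l : ℕ} {f g : QPoly m q}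
    (hf : f ∈ homog m q k) (hg : g ∈ homog m q l) : f * g ∈ homog m q (k + l) := by
  unfold homog at *
  rw [pow_add]
  exact Submodule.mul_mem_mul hf hg

theorem one_mem_homog (m : ℕ) (q : ℝ) : (1 : QPoly m q) ∈ homog m q 0 := by
  unfold homog
  rw [pow_zero]
  exact Submodule.one_le.mp le_rfl

theorem normSq_mem (m : ℕ) (q : ℝ) : normSq m q ∈ homog m q 2 :=
  Submodule.sum_mem _ fun i _ => Submodule.sum_mem _ fun j _ =>
    Submodule.smul_mem _ _ (mul_mem_homog (coord_mem m q i) (coord_mem m q j))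

theorem normSq_pow_mem (m : ℕ) (q : ℝ) (l : ℕ) : normSq m q ^ l ∈ homog m q (2 * l) := by
  induction l with
  | zero => simpa using one_mem_homog m q
  | succ l ih => rw [pow_succ, mul_add, mul_one]; exact mul_mem_homog ih (normSq_mem m q)

/-! ### Partial derivatives on noncommutative polynomials -/

/-- The action of left multiplication by `x^j` on pairs `(f, (∂^i f)_i)` that is prescribed by
`∂^i x^j = C^{ij} + c B^{ij}_{kl} x^k ∂^l`. -/
def leibnizStep (m : ℕ) (q : ℝ) (c : ℂ) (B : Matrix (Fin m × Fin m) (Fin m × Fin m) ℂ)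
    (j : Fin m) : Module.End ℂ (Words m × (Fin m → Words m)) where
  toFun p := (FreeAlgebra.ι ℂ j * p.1, fun i => metric m q i j • p.1 +
    c • ∑ k, ∑ l, B (i, j) (k, l) • (FreeAlgebra.ι ℂ k * p.2 l))
  map_add' p p' := by
    ext i
    · simp [mul_add]
    · simp only [Prod.fst_add, Prod.snd_add, Pi.add_apply, mul_add, smul_add,
        Finset.sum_add_distrib]
      abel
  map_smul' a p := by
    ext i
    · simp
    · simp only [Prod.smul_fst, Prod.smul_snd, Pi.smul_apply, mul_smul_comm, RingHom.id_apply,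
        smul_add, Finset.smul_sum, smul_comm a]

/-- The linear operators `∂^i` on noncommutative polynomials that are determined by `∂^i 1 = 0` and
`∂^i (x^j f) = C^{ij} f + c B^{ij}_{kl} x^k ∂^l f`. -/
def wordsPartial (m : ℕ) (q : ℝ) (c : ℂ) (B : Matrix (Fin m × Fin m) (Fin m × Fin m) ℂ)
    (i : Fin m) (f : Words m) : Words m :=
  (FreeAlgebra.lift ℂ (leibnizStep m q c B) f (1, 0)).2 i

section
variable {m : ℕ} (q : ℝ) (c : ℂ) (B : Matrix (Fin m × Fin m) (Fin m × Fin m) ℂ)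

theorem lift_leibnizStep_fst (f : Words m) (p : Words m × (Fin m → Words m)) :
    (FreeAlgebra.lift ℂ (leibnizStep m q c B) f p).1 = f * p.1 := by
  induction f using FreeAlgebra.induction generalizing p with
  | grade0 a => simp [Algebra.algebraMap_eq_smul_one]
  | grade1 j => simp [leibnizStep]
  | mul f g hf hg => rw [map_mul, Module.End.mul_apply, hf, hg, mul_assoc]
  | add f g hf hg => rw [map_add, LinearMap.add_apply, Prod.fst_add, hf, hg, add_mul]

theorem wordsPartial_one (i : Fin m) : wordsPartial m q c B i 1 = 0 := by
  simp [wordsPartial]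

theorem wordsPartial_add (i : Fin m) (f g : Words m) :
    wordsPartial m q c B i (f + g) = wordsPartial m q c B i f + wordsPartial m q c B i g := by
  simp [wordsPartial]

theorem wordsPartial_smul (i : Fin m) (a : ℂ) (f : Words m) :
    wordsPartial m q c B i (a • f) = a • wordsPartial m q c B i f := by
  simp [wordsPartial]

theorem wordsPartial_ι_mul (i j : Fin m) (f : Words m) :
    wordsPartial m q c B i (FreeAlgebra.ι ℂ j * f) = metric m q i j • f +
      c • ∑ k, ∑ l, B (i, j) (k, l) • (FreeAlgebra.ι ℂ k * wordsPartial m q c B l f) := by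
  have h := lift_leibnizStep_fst q c B f (1, 0)
  simp only [mul_one] at h
  simp only [wordsPartial, map_mul, Module.End.mul_apply, FreeAlgebra.lift_ι_apply]
  conv_lhs => simp only [leibnizStep, LinearMap.coe_mk, AddHom.coe_mk]
  rw [h]

theorem wordsPartial_mem (n : ℕ) : ∀ (i : Fin m) (f : Words m), f ∈ wordsHomog m (n + 1) →
    wordsPartial m q c B i f ∈ wordsHomog m n := by
  induction n with
  | zero =>
    intro i f hf
    unfold wordsHomog at *
    rw [zero_add, pow_one] at hf
    rw [pow_zero]
    induction hf using Submodule.span_induction with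
    | mem f hf =>
      obtain ⟨j, rfl⟩ := hf
      rw [← mul_one (FreeAlgebra.ι ℂ j), wordsPartial_ι_mul]
      simp only [wordsPartial_one, mul_zero, smul_zero, Finset.sum_const_zero, add_zero]
      exact Submodule.smul_mem _ _ (Submodule.one_le.mp le_rfl)
    | zero => simp [wordsPartial]
    | add f g _ _ hf hg => rw [wordsPartial_add]; exact Submodule.add_mem _ hf hg
    | smul a f _ hf => rw [wordsPartial_smul]; exact Submodule.smul_mem _ _ hf
  | succ n ih =>
    intro i f hf
    unfold wordsHomog at hf ih ⊢
    rw [pow_succ'] at hf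
    induction hf using Submodule.mul_induction_on' with
    | mem_mul_mem g hg f hf =>
      induction hg using Submodule.span_induction with
      | mem g hg =>
        obtain ⟨j, rfl⟩ := hg
        rw [wordsPartial_ι_mul]
        refine Submodule.add_mem _ (Submodule.smul_mem _ _ hf) (Submodule.smul_mem _ _
          (Submodule.sum_mem _ fun k _ => Submodule.sum_mem _ fun l _ =>
            Submodule.smul_mem _ _ ?_))
        rw [pow_succ']
        exact Submodule.mul_mem_mul (Submodule.subset_span ⟨k, rfl⟩) (ih l f hf)
      | zero => simp [wordsPartial]
      | add g g' _ _ h h' => rw [add_mul, wordsPartial_add]; exact Submodule.add_mem _ h h'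
      | smul a g _ h => rw [smul_mul_assoc, wordsPartial_smul]; exact Submodule.smul_mem _ _ h
    | add f _ g _ hf hg => rw [wordsPartial_add]; exact Submodule.add_mem _ hf hg

end

/-! ### Formal power series on quantum Euclidean space -/

/-- The algebra `O_q` of formal power series in the noncommuting variables modulo the commutation
relations. An element is a sequence of homogeneous polynomials, one in each degree `n`; it is
stored as a power series over the polynomials whose `n`-th coefficient is homogeneous of
degree `n`. -/
def QSeries (m : ℕ) (q : ℝ) : Subalgebra ℂ (PowerSeries (QPoly m q)) where
  carrier := {f | ∀ n, PowerSeries.coeff n f ∈ homog m q n}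
  mul_mem' {f g} hf hg n := by
    rw [PowerSeries.coeff_mul]
    refine Submodule.sum_mem _ fun p hp => ?_
    rw [← Finset.HasAntidiagonal.mem_antidiagonal.mp hp]
    exact mul_mem_homog (hf _) (hg _)
  add_mem' {f g} hf hg n := by
    rw [map_add]
    exact Submodule.add_mem _ (hf n) (hg n)
  algebraMap_mem' a n := by
    rw [Algebra.algebraMap_eq_smul_one, PowerSeries.coeff_smul, PowerSeries.coeff_one]
    split_ifs with h
    · subst h
      exact Submodule.smul_mem _ _ (one_mem_homog m q)
    · simp

section
variable {m : ℕ} {q : ℝ}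

/-- The homogeneous component of degree `n`. -/
def component (n : ℕ) (f : QSeries m q) : homog m q n :=
  ⟨PowerSeries.coeff n (f : PowerSeries (QPoly m q)), f.2 n⟩

/-- The series with prescribed homogeneous components. -/
def ofComponents (f : ∀ n, homog m q n) : QSeries m q :=
  ⟨PowerSeries.mk fun n => (f n : QPoly m q), fun n => by
    rw [PowerSeries.coeff_mk]; exact (f n).2⟩

/-- A homogeneous polynomial of degree `k`, viewed in `O_q`. -/
def ofHomog (k : ℕ) (S : homog m q k) : QSeries m q :=
  ofComponents fun n => if h : k = n then ⟨(S : QPoly m q), h ▸ S.2⟩ else 0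

/-- The coordinate `x^j`, viewed in `O_q`. -/
def seriesCoord (j : Fin m) : QSeries m q := ofHomog 1 ⟨coord m q j, coord_mem m q j⟩

/-- The radial element `f(𝐱²)` of `O_q`, where `s` is the Taylor series of `f` at the origin. -/
def radial (s : PowerSeries ℂ) : QSeries m q :=
  ofComponents fun n => if h : Even n then
    ⟨PowerSeries.coeff (n / 2) s • normSq m q ^ (n / 2), Submodule.smul_mem _ _ (by
      have := normSq_pow_mem m q (n / 2)
      rwa [Nat.two_mul_div_two_of_even h] at this)⟩
    else 0

/-- A homogeneous noncommutative polynomial representing a homogeneous polynomial. -/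
def representative (n : ℕ) (f : homog m q n) : Words m :=
  Classical.choose (Submodule.mem_map.mp ((homog_eq_map m q n).le f.2))

theorem representative_mem (n : ℕ) (f : homog m q n) :
    representative n f ∈ wordsHomog m n :=
  (Classical.choose_spec (Submodule.mem_map.mp ((homog_eq_map m q n).le f.2))).1

theorem toQPoly_representative (n : ℕ) (f : homog m q n) :
    toQPoly m q (representative n f) = f :=
  (Classical.choose_spec (Submodule.mem_map.mp ((homog_eq_map m q n).le f.2))).2

/-- The operator induced on `O_q`, degree by degree, by `wordsPartial`. -/
def seriesPartial (c : ℂ) (B : Matrix (Fin m × Fin m) (Fin m × Fin m) ℂ) (i : Fin m)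
    (f : QSeries m q) : QSeries m q :=
  ofComponents fun n =>
    ⟨toQPoly m q (wordsPartial m q c B i (representative (n + 1) (component (n + 1) f))), by
      rw [homog_eq_map]
      exact Submodule.mem_map_of_mem
        (wordsPartial_mem q c B n i _ (representative_mem (n + 1) _))⟩

/-- The partial derivatives `∂^i`, with `∂^i x^j = C^{ij} + q (R̂⁻¹)^{ij}_{kl} x^k ∂^l`. -/
def partialD (i : Fin m) (f : QSeries m q) : QSeries m q :=
  seriesPartial (q : ℂ) (braidMatrix m q)⁻¹ i f

/-- The partial derivatives of the second calculus, obtained by the replacement of `q` and `R̂` by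
`q⁻¹` and `R̂⁻¹`, that is `∂̄^i x^j = C^{ij} + q⁻¹ R̂^{ij}_{kl} x^k ∂̄^l`. -/
def partialBar (i : Fin m) (f : QSeries m q) : QSeries m q :=
  seriesPartial (q : ℂ)⁻¹ (braidMatrix m q) i f

/-- The Laplace operator `Δ = ∂^i C_{ij} ∂^j`. -/
def laplacian (f : QSeries m q) : QSeries m q :=
  ∑ i, ∑ j, metric m q i j • partialD i (partialD j f)

/-- The power `Λ^u` of the dilatation operator, determined by `Λ^u x^i = q^{2u} x^i Λ^u` and
`Λ^u 1 = 1`: it acts on degree `n` as `q^{2 u n}`. -/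
def dilatation (u : ℝ) (f : QSeries m q) : QSeries m q :=
  ofComponents fun n => ((q ^ (2 * u * (n : ℝ)) : ℝ) : ℂ) • component n f

/-- The spherical harmonics of degree `k`: homogeneous polynomials annihilated by `Δ`. -/
def sphericalHarmonics (m : ℕ) (q : ℝ) (k : ℕ) : Set (homog m q k) :=
  {S | laplacian (ofHomog k S) = 0}

end

/-! ### The excited states of the harmonic oscillator -/

section
variable (m : ℕ) (q : ℝ)

/-- The raising operator `a_n^{j+} = b_n (x^j - q^{2 - n - m/2} ∂^j) Λ^{-1/4}`. -/
def raising (b : ℕ → ℂ) (n : ℕ) (j : Fin m) (f : QSeries m q) : QSeries m q :=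
  b n • (seriesCoord j * dilatation (-1 / 4) f -
    ((q ^ (2 - (n : ℝ) - (m : ℝ) / 2) : ℝ) : ℂ) • partialD j (dilatation (-1 / 4) f))

/-- The raising operator `ā_n^{j+} = b̄_n (x^j - q^{n - 2 - m/2} ∂̄^j) Λ^{1/4}`. -/
def raisingBar (bbar : ℕ → ℂ) (n : ℕ) (j : Fin m) (f : QSeries m q) : QSeries m q :=
  bbar n • (seriesCoord j * dilatation (1 / 4) f -
    ((q ^ ((n : ℝ) - 2 - (m : ℝ) / 2) : ℝ) : ℂ) • partialBar j (dilatation (1 / 4) f))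

/-- The functions `ψ_n^{i_n ⋯ i_1} = a_n^{i_n +} ⋯ a_1^{i_1 +} ψ_0`, indexed by the list
`[i_n, …, i_1]`, with `ψ_0 = e_{q²}(-𝐱² / (q^{m/2} μ))`. -/
def excited (b : ℕ → ℂ) : List (Fin m) → QSeries m q
  | [] => radial (qExpSmallSeries (q ^ 2) (-(1 / (q ^ ((m : ℝ) / 2) * mu m q))))
  | i :: w => raising m q b (w.length + 1) i (excited b w)

/-- The functions `ψ̄_n^{i_n ⋯ i_1} = ā_n^{i_n +} ⋯ ā_1^{i_1 +} ψ̄_0`, indexed by the list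
`[i_n, …, i_1]`, with `ψ̄_0 = E_{q²}(-q^{m/2} q² 𝐱² / μ)`. -/
def excitedBar (bbar : ℕ → ℂ) : List (Fin m) → QSeries m q
  | [] => radial (qExpBigSeries (q ^ 2) (-(q ^ ((m : ℝ) / 2) * q ^ 2 / mu m q)))
  | i :: w => raisingBar m q bbar (w.length + 1) i (excitedBar bbar w)

/-- The linear relations that hold both between the `ψ_n^{i_n ⋯ i_1}` and between the
`ψ̄_n^{i_n ⋯ i_1}`. -/
def stateRelations (b bbar : ℕ → ℂ) : Submodule ℂ (List (Fin m) →₀ ℂ) :=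
  LinearMap.ker (Finsupp.linearCombination ℂ (excited m q b)) ⊓
    LinearMap.ker (Finsupp.linearCombination ℂ (excitedBar m q bbar))

/-- The abstract space `𝕍` of linear combinations of abstract elements `Ψ_n^{i_n ⋯ i_1}`. -/
abbrev StateSpace (b bbar : ℕ → ℂ) : Type :=
  (List (Fin m) →₀ ℂ) ⧸ stateRelations m q b bbar

/-- The abstract excited state `Ψ_n^{i_n ⋯ i_1}`, for the list `[i_n, …, i_1]`. -/
def state (b bbar : ℕ → ℂ) (w : List (Fin m)) : StateSpace m q b bbar :=
  (stateRelations m q b bbar).mkQ (Finsupp.single w 1)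

/-- The representation `Π`, with `Π(Ψ_n^{i_n ⋯ i_1}) = ψ_n^{i_n ⋯ i_1}`. -/
def rep (b bbar : ℕ → ℂ) : StateSpace m q b bbar →ₗ[ℂ] QSeries m q :=
  (stateRelations m q b bbar).liftQ (Finsupp.linearCombination ℂ (excited m q b)) inf_le_left

/-- The representation `Π̄`, with `Π̄(Ψ_n^{i_n ⋯ i_1}) = ψ̄_n^{i_n ⋯ i_1}`. -/
def repBar (b bbar : ℕ → ℂ) : StateSpace m q b bbar →ₗ[ℂ] QSeries m q :=
  (stateRelations m q b bbar).liftQ (Finsupp.linearCombination ℂ (excitedBar m q bbar))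
    inf_le_right

/-! ### The second Fourier transform -/

/-- The functions `ψ(u) = p(u) e_{q²}(-a q² u / μ)` of `u = r²`, with `p` a polynomial. -/
def gaussianFun (a : ℝ) (p : ℂ[X]) (u : ℝ) : ℂ :=
  p.eval (u : ℂ) * ((qExpSmall (q ^ 2) (-(a * q ^ 2 * u / mu m q)) : ℝ) : ℂ)

/-- The space `V_a = 𝒫 ⊗ e_{q²}(-a q² 𝐲² / μ)` inside `O_q`. -/
def gaussianSpace (a : ℝ) : Submodule ℂ (QSeries m q) :=
  Submodule.span ℂ {f | ∃ (k : ℕ) (P : homog m q k),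
    f = ofHomog k P * radial (qExpSmallSeries (q ^ 2) (-(a * q ^ 2 / mu m q)))}

/-- The space `V_[α] = ⋃_j V_{q^{-2j} α}`; the union is increasing, hence equal to the sum. -/
def gaussianClass (α : ℝ) : Submodule ℂ (QSeries m q) :=
  ⨆ j : ℕ, gaussianSpace m q ((q ^ (2 * j))⁻¹ * α)

/-- The graph of the second Fourier transform on
`V_[α] = ⋃_j V_a`, `a = q^{-2j} α`, `V_a = 𝒫 ⊗ e_{q²}(-a q² 𝐲² / μ)`. It is spanned by the pairs
`(S_k ψ(𝐲²), (±i)^k c⁻¹ S_k F_{m/2 + k - 1}[ψ](𝐱²))` with `S_k` a spherical harmonic of degree `k`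
and `S_k ψ(𝐲²) ∈ V_a`; the sign is `ε`. -/
def fourierGraphOn (ε : ℤˣ) (γ α : ℝ) : Submodule ℂ (QSeries m q × QSeries m q) :=
  Submodule.span ℂ {z | ∃ (j k : ℕ) (S : homog m q k) (p : ℂ[X]) (s t : PowerSeries ℂ),
    S ∈ sphericalHarmonics m q k ∧
    HasTaylorAtOrigin (gaussianFun m q ((q ^ (2 * j))⁻¹ * α) p) s ∧
    HasTaylorAtOrigin (radialTransform m q γ ((m : ℝ) / 2 + (k : ℝ) - 1)
      (gaussianFun m q ((q ^ (2 * j))⁻¹ * α) p)) t ∧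
    z = (ofHomog k S * radial s,
      ((((ε : ℤ) : ℂ) * Complex.I) ^ k / fourierConst m q ((q ^ (2 * j))⁻¹ * α) γ) •
        (ofHomog k S * radial t))}

/-- The graph of the second Fourier transform on `V_[q^{-m/2}] ⊕ V_[q^{1-m/2}]`, the sum of the
two transforms on the summands. -/
def fourierGraph (ε : ℤˣ) (γ : ℝ) : Submodule ℂ (QSeries m q × QSeries m q) :=
  fourierGraphOn m q ε γ (q ^ (-((m : ℝ) / 2))) ⊔
    fourierGraphOn m q ε γ (q ^ (1 - (m : ℝ) / 2))

/-- The domain of the second Fourier transform: the first projection of its graph. -/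
def fourierDomain (ε : ℤˣ) (γ : ℝ) : Submodule ℂ (QSeries m q) :=
  (fourierGraph m q ε γ).map (LinearMap.fst ℂ (QSeries m q) (QSeries m q))

open Classical in
/-- The second Fourier transform on `V_[q^{-m/2}] ⊕ V_[q^{1-m/2}]` (with value `0` elsewhere). -/
def fourierTwo (ε : ℤˣ) (γ : ℝ) (f : QSeries m q) : QSeries m q :=
  if h : ∃ g, (f, g) ∈ fourierGraph m q ε γ then h.choose else 0

/-- The Fourier transform `𝔽^± = q^{-m²/4} Π̄⁻¹ ∘ F^± ∘ Π` on `𝕍`; the sign is `ε`. -/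
def oscillatorFourier (b bbar : ℕ → ℂ) (ε : ℤˣ) (γ : ℝ) (u : StateSpace m q b bbar) :
    StateSpace m q b bbar :=
  ((q ^ (-((m : ℝ) ^ 2 / 4)) : ℝ) : ℂ) •
    Function.invFun (repBar m q b bbar) (fourierTwo m q ε γ (rep m q b bbar u))

end

end QuantumEuclidean

end

open QuantumEuclidean

/-! The second Fourier transform is handled as a relation: `oscGraph` is the span of the pairs
(function, image). Write η = ±i and H = q^{m/2}. The heart of the proof is covariance: if (f, g)
lies in the graph, then so do (x^j Λ^{-1/4} f, -(η/H) ∂̄^j Λ^{1/4} g) and (∂^j Λ^{-1/4} f, -ηH x^j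
Λ^{1/4} g) (`oscGraph_coord`, `oscGraph_deriv`). A raising operator on the left therefore becomes η
times the barred raising operator on the right, exactly with the normalization b̄_n = q^{2-n} b_n.
The transform sends ψ_0 to q^{m²/4} ψ̄_0 (`fourierSeries_ground`), so induction sends each state ψ_w
to q^{m²/4} η^{|w|} ψ̄_w (`excited_mem_oscGraph`).

For covariance it is enough to treat S u^l times a Gaussian, with S harmonic of degree k. The
product x^j S is a harmonic T of degree k + 1 plus a multiple of r² ∂^j S, so each statement splits
into two scalar relations between Taylor coefficients of transforms: four contiguity relations in
all. These coefficients are explicit (`besselCoeff_mul_moment`), because the Jackson moments of the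
Gaussian obey a first-order recursion (`qMoment_mul`), which cancels the q-Gamma functions and every
trace of γ. The commutation rules of coordinates, derivatives, r² and Δ rest on relations between
the braid matrix and the metric, proved by induction from m to m + 2 (`BraidExtension.braidSystem`).

The transform is single-valued and injective because both properties can be tested on radial parts.
Gaussians whose parameters differ by q² are related by the functional equation of the q-exponential,
compatibly with the transform, while neighbours whose parameters differ by q are independent over
the polynomials, before and after transforming (`gaussSeries_independent`,
`fourierPoly_independent`).

Finally, Π and Π̄ are injective as soon as the ψ_w and the ψ̄_w satisfy the same linear relations.
The transform only turns ∑ c_w ψ_w = 0 into ∑ c_w η^{|w|} ψ̄_w = 0. The factor η^{|w|} is removed by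
the Hamiltonian Δ - r², whose eigenvalue on ψ_w determines |w| (`hamiltonian_excited`,
`energy_injective`): relations among the ψ_w split by length (`lengthScale_excited`, `ker_excited`).
-/

noncomputable section

namespace QuantumEuclidean

/-! ### Braid systems with an invariant metric -/

section Tensors
variable {ι : Type} [Fintype ι] {M : Type} [AddCommGroup M] [Module ℂ M]

/-- The action of a matrix on a pair of tensor indices. -/
def tact (R : ι → ι → ι → ι → ℂ) (S : ι → ι → M) (i j : ι) : M := ∑ a, ∑ b, R i j a b • S a b

/-- The contraction of a pair of tensor indices. -/
def tcap (C : ι → ι → ℂ) (S : ι → ι → M) : M := ∑ a, ∑ b, C a b • S a b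

variable (R : ι → ι → ι → ι → ℂ) (C : ι → ι → ℂ)

theorem tact_add (S T : ι → ι → M) (i j : ι) :
    tact R (fun a b => S a b + T a b) i j = tact R S i j + tact R T i j := by
  simp [tact, Finset.sum_add_distrib]

theorem tact_sub (S T : ι → ι → M) (i j : ι) :
    tact R (fun a b => S a b - T a b) i j = tact R S i j - tact R T i j := by
  simp [tact, smul_sub]

theorem tact_smul (c : ℂ) (S : ι → ι → M) (i j : ι) :
    tact R (fun a b => c • S a b) i j = c • tact R S i j := by
  simp [tact, Finset.smul_sum, smul_comm c]

theorem tact_zero (i j : ι) : tact R (fun _ _ => (0 : M)) i j = 0 := by simp [tact]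

theorem tcap_add (S T : ι → ι → M) :
    tcap C (fun a b => S a b + T a b) = tcap C S + tcap C T := by
  simp [tcap, Finset.sum_add_distrib]

theorem tcap_sub (S T : ι → ι → M) :
    tcap C (fun a b => S a b - T a b) = tcap C S - tcap C T := by
  simp [tcap, smul_sub]

theorem tcap_smul (c : ℂ) (S : ι → ι → M) :
    tcap C (fun a b => c • S a b) = c • tcap C S := by
  simp [tcap, Finset.smul_sum, smul_comm c]

theorem tcap_zero : tcap C (fun _ _ => (0 : M)) = 0 := by simp [tcap]

/-- The relations between the braid matrix, its eigenvalues and the invariant metric that hold for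
quantum orthogonal groups, written as identities between tensors with coefficients in an arbitrary
vector space. -/
structure BraidSystem (q κ : ℂ) : Prop where
  quad : ∀ (M : Type) [AddCommGroup M] [Module ℂ M] (S : ι → ι → M) (i j : ι),
    tact R (fun a b => tact R S a b) i j = S i j + (q - q⁻¹) • tact R S i j -
      ((q - q⁻¹) * (q * κ ^ 2)) • C i j • tcap C S
  cap_act : ∀ (M : Type) [AddCommGroup M] [Module ℂ M] (S : ι → ι → M),
    tcap C (fun a b => tact R S a b) = (q * κ ^ 2) • tcap C S
  act_cup : ∀ (M : Type) [AddCommGroup M] [Module ℂ M] (v : M) (i j : ι),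
    tact R (fun a b => C a b • v) i j = (q * κ ^ 2) • C i j • v
  cap_cup₁ : ∀ (M : Type) [AddCommGroup M] [Module ℂ M] (v : ι → M) (i : ι),
    tcap C (fun j k => C i j • v k) = v i
  cap_cup₂ : ∀ (M : Type) [AddCommGroup M] [Module ℂ M] (v : ι → M) (i : ι),
    tcap C (fun j k => C k i • v j) = v i
  loop : (q - q⁻¹) * tcap C C = q - q⁻¹ + (q * κ ^ 2)⁻¹ - q * κ ^ 2
  cup_cross₁ : ∀ (M : Type) [AddCommGroup M] [Module ℂ M] (v : ι → M) (i j k : ι),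
    tact R (fun a b => tact R (fun c d => C a c • v d) b k) i j = C j k • v i
  cup_cross₂ : ∀ (M : Type) [AddCommGroup M] [Module ℂ M] (v : ι → M) (i j k : ι),
    tact R (fun b c => tact R (fun a d => C d c • v a) i b) j k = C i j • v k
  cap_cross₁ : ∀ (M : Type) [AddCommGroup M] [Module ℂ M] (T : ι → ι → ι → M) (i : ι),
    tcap C (fun j k => tact R (fun a b => tact R (fun c d => T a c d) b k) i j) =
      tcap C (fun a b => T a b i)
  cap_cross₂ : ∀ (M : Type) [AddCommGroup M] [Module ℂ M] (T : ι → ι → ι → M) (k : ι),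
    tcap C (fun i j => tact R (fun b c => tact R (fun a d => T a d c) i b) j k) =
      tcap C (fun a b => T k a b)
  braid : ∀ (M : Type) [AddCommGroup M] [Module ℂ M] (T : ι → ι → ι → M) (i j k : ι),
    tact R (fun a b => tact R (fun c d => tact R (fun e f => T e f d) a c) b k) i j =
      tact R (fun b c => tact R (fun a d => tact R (fun e f => T a e f) d c) i b) j k

/-- The braid matrix `R'` and the metric `C'` on the index set `J` extend `R` and `C` by a smallest
index `bot` and a largest index `top`. -/
structure BraidExtension {J : Type} [Fintype J] (q κ : ℂ) (bot top : J) (mid : ι → J)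
    (R' : J → J → J → J → ℂ) (C' : J → J → ℂ) : Prop where
  cases : ∀ j, j = bot ∨ j = top ∨ ∃ x, j = mid x
  cbt : C' bot top = κ
  ctb : C' top bot = κ⁻¹
  cbb : C' bot bot = 0
  ctt : C' top top = 0
  cbm : ∀ x, C' bot (mid x) = 0
  cmb : ∀ x, C' (mid x) bot = 0
  ctm : ∀ x, C' top (mid x) = 0
  cmt : ∀ x, C' (mid x) top = 0
  cmm : ∀ x y, C' (mid x) (mid y) = C x y
  cap : ∀ (M : Type) [AddCommGroup M] [Module ℂ M] (S : J → J → M),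
    tcap C' S = κ • S bot top + κ⁻¹ • S top bot + tcap C (fun a b => S (mid a) (mid b))
  bb : ∀ (M : Type) [AddCommGroup M] [Module ℂ M] (S : J → J → M),
    tact R' S bot bot = q • S bot bot
  tt : ∀ (M : Type) [AddCommGroup M] [Module ℂ M] (S : J → J → M),
    tact R' S top top = q • S top top
  bm : ∀ (M : Type) [AddCommGroup M] [Module ℂ M] (S : J → J → M) (x : ι),
    tact R' S bot (mid x) = S (mid x) bot + (q - q⁻¹) • S bot (mid x)
  mb : ∀ (M : Type) [AddCommGroup M] [Module ℂ M] (S : J → J → M) (x : ι),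
    tact R' S (mid x) bot = S bot (mid x)
  mt : ∀ (M : Type) [AddCommGroup M] [Module ℂ M] (S : J → J → M) (x : ι),
    tact R' S (mid x) top = S top (mid x) + (q - q⁻¹) • S (mid x) top
  tm : ∀ (M : Type) [AddCommGroup M] [Module ℂ M] (S : J → J → M) (x : ι),
    tact R' S top (mid x) = S (mid x) top
  bt : ∀ (M : Type) [AddCommGroup M] [Module ℂ M] (S : J → J → M),
    tact R' S bot top = q⁻¹ • S top bot + ((q - q⁻¹) * (1 - κ ^ 2)) • S bot top -
      ((q - q⁻¹) * κ) • tcap C (fun a b => S (mid a) (mid b))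
  tb : ∀ (M : Type) [AddCommGroup M] [Module ℂ M] (S : J → J → M),
    tact R' S top bot = q⁻¹ • S bot top
  mm : ∀ (M : Type) [AddCommGroup M] [Module ℂ M] (S : J → J → M) (x y : ι),
    tact R' S (mid x) (mid y) = tact R (fun a b => S (mid a) (mid b)) x y -
      ((q - q⁻¹) * κ) • C x y • S bot top

variable {R C}

theorem BraidExtension.forall_index {J : Type} [Fintype J] {q κ : ℂ} {bot top : J} {mid : ι → J}
    {R' : J → J → J → J → ℂ} {C' : J → J → ℂ} (h : BraidExtension R C q κ bot top mid R' C')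
    {p : J → Prop} (hb : p bot) (ht : p top) (hm : ∀ x, p (mid x)) (j : J) : p j := by
  rcases h.cases j with rfl | rfl | ⟨x, rfl⟩
  exacts [hb, ht, hm x]

end Tensors

section Tensors
variable {ι : Type} [Fintype ι] {M : Type} [AddCommGroup M] [Module ℂ M]
  {R : ι → ι → ι → ι → ℂ} {C : ι → ι → ℂ} {q κ : ℂ}

theorem tcap_cup (v : M) : tcap C (fun a b => C a b • v) = tcap C C • v := by
  simp [tcap, Finset.sum_smul, mul_smul]

/-- Dividing `loop` by q - q⁻¹ is possible since q² ≠ 1; in this solved form it serves as a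
rewriting rule in the extension step. -/
theorem BraidSystem.loop_eq (h : BraidSystem R C q κ) (hq : q ≠ 0) (hκ : κ ≠ 0)
    (hq2 : q ^ 2 - 1 ≠ 0) :
    tcap C C = 1 + (1 - q ^ 2 * κ ^ 4) / (κ ^ 2 * (q ^ 2 - 1)) := by
  have hl := h.loop
  field_simp at hl ⊢
  linear_combination hl

/-- The action of the inverse braid matrix, expressed through the skein relation. -/
theorem BraidSystem.act_inv (h : BraidSystem R C q κ) (S : ι → ι → M) (i j : ι) :
    tact R (fun a b => tact R S a b - (q - q⁻¹) • S a b + (q - q⁻¹) • C a b • tcap C S) i j =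
      S i j := by
  rw [tact_add, tact_sub, h.quad, tact_smul, tact_smul, h.act_cup]
  module

/-- By `cap_cross₁` a strand may be pulled through two crossings under a cap. Feeding in a tensor on
which the inverse braid matrix has already acted removes one of the crossings; writing that inverse
by the skein relation `act_inv` moves the remaining crossing to the other side of the cap. -/
theorem BraidSystem.cap_skein (h : BraidSystem R C q κ) (T : ι → ι → ι → M) (i : ι) :
    tcap C (fun j k => tact R (fun a b => T a b k) i j) =
      tcap C (fun a b => tact R (fun c d => T a c d) b i) -
        (q - q⁻¹) • tcap C (fun a b => T a b i) + (q - q⁻¹) • tcap C (fun a b => T i a b) := by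
  have := h.cap_cross₁ M (fun a b c => tact R (fun c d => T a c d) b c - (q - q⁻¹) • T a b c +
    (q - q⁻¹) • C b c • tcap C (fun c d => T a c d)) i
  simp only [h.act_inv] at this
  rw [this, tcap_add, tcap_sub, tcap_smul, tcap_smul, h.cap_cup₂]

/-- A kink in a strand is a scalar. The skein relation trades it for the opposite kink, where the
braid matrix acts on a cup, and a closed loop whose value is `loop`. -/
theorem BraidSystem.cap_act_cup (h : BraidSystem R C q κ) (v : ι → M) (i : ι) :
    tcap C (fun a b => tact R (fun c d => C a c • v d) b i) = (q * κ ^ 2)⁻¹ • v i := by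
  have h1 := h.cap_skein (fun a b c => C a b • v c) i
  simp only [h.act_cup, tcap_smul, h.cap_cup₁, tcap_cup] at h1
  rw [smul_smul, h.loop] at h1
  have h2 : tcap C (fun a b => tact R (fun c d => C a c • v d) b i) = (q * κ ^ 2) • v i +
      (q - q⁻¹ + (q * κ ^ 2)⁻¹ - q * κ ^ 2) • v i - (q - q⁻¹) • v i := by
    rw [h1]
    module
  rw [h2]
  module

/-- The move dual to `cap_skein`: one more crossing is applied to `cup_cross₂` and reduced with
`quad`. -/
theorem BraidSystem.cup_skein (h : BraidSystem R C q κ) (v : ι → M) (i j k : ι) :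
    tact R (fun a d => C d k • v a) i j = tact R (fun b c => C i b • v c) j k -
      (q - q⁻¹) • C i j • v k + (q - q⁻¹) • C j k • v i := by
  have h1 := h.quad M (fun b c => tact R (fun a d => C d c • v a) i b) j k
  have h2 := h.cap_act M (fun b c => tact R (fun a d => C d c • v a) i b)
  simp only [h.cup_cross₂, h.cap_cup₁] at h1 h2
  rw [h1, mul_smul, smul_comm (q * κ ^ 2), ← h2]
  module

end Tensors

/-! ### Passing from an index set to the one with a new smallest and a new largest index -/

section Extension
variable {ι J : Type} [Fintype ι] [Fintype J] {q κ : ℂ} {bot top : J} {mid : ι → J}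
  {R : ι → ι → ι → ι → ℂ} {C : ι → ι → ℂ} {R' : J → J → J → J → ℂ} {C' : J → J → ℂ}

set_option linter.unusedSimpArgs false

/-- Every index is the smallest, the largest or an old one. In each case the rules of the extension
rewrite both sides as tensors over the old indices, where the old relations act as rewriting rules,
and a rational identity in `q` and `κ` remains. Coefficients in an arbitrary vector space are what
allows an old relation to be applied to some of the indices while the others are carried along. The
other relations of the extended system are checked in the same way. -/
theorem BraidExtension.quad (h : BraidExtension R C q κ bot top mid R' C')
    (hR : BraidSystem R C q κ) (hq : q ≠ 0) (hκ : κ ≠ 0) (hq2 : q ^ 2 - 1 ≠ 0)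
    (M : Type) [AddCommGroup M] [Module ℂ M] (S : J → J → M) (i j : J) :
    tact R' (fun a b => tact R' S a b) i j = S i j + (q - q⁻¹) • tact R' S i j -
      ((q - q⁻¹) * (q * (κ * q⁻¹) ^ 2)) • C' i j • tcap C' S := by
  induction i using h.forall_index <;>
  induction j using h.forall_index <;>
    simp only [h.cbt, h.ctb, h.cbb, h.ctt, h.cbm, h.cmb, h.ctm, h.cmt, h.cmm, h.cap, h.bb, h.tt,
      h.bm, h.mb, h.mt, h.tm, h.bt, h.tb, h.mm, tact_add, tact_sub, tact_smul, tact_zero,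
      tcap_add, tcap_sub, tcap_smul, tcap_zero, hR.quad, hR.cap_act, hR.act_cup, tcap_cup,
      hR.loop_eq hq hκ hq2, hR.cap_cup₁, hR.cap_cup₂, hR.cup_cross₁, hR.cup_cross₂,
      hR.cap_cross₁, hR.cap_cross₂, hR.braid, hR.cap_skein, hR.cup_skein, hR.cap_act_cup,
      smul_zero, zero_smul, add_zero, zero_add, sub_zero, zero_sub]
  all_goals (match_scalars <;> field_simp <;> ring1)

theorem BraidExtension.cap_act (h : BraidExtension R C q κ bot top mid R' C')
    (hR : BraidSystem R C q κ) (hq : q ≠ 0) (hκ : κ ≠ 0) (hq2 : q ^ 2 - 1 ≠ 0)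
    (M : Type) [AddCommGroup M] [Module ℂ M] (S : J → J → M) :
    tcap C' (fun a b => tact R' S a b) = (q * (κ * q⁻¹) ^ 2) • tcap C' S := by
  simp only [h.cbt, h.ctb, h.cbb, h.ctt, h.cbm, h.cmb, h.ctm, h.cmt, h.cmm, h.cap, h.bb, h.tt,
      h.bm, h.mb, h.mt, h.tm, h.bt, h.tb, h.mm, tact_add, tact_sub, tact_smul, tact_zero,
      tcap_add, tcap_sub, tcap_smul, tcap_zero, hR.quad, hR.cap_act, hR.act_cup, tcap_cup,
      hR.loop_eq hq hκ hq2, hR.cap_cup₁, hR.cap_cup₂, hR.cup_cross₁, hR.cup_cross₂,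
      hR.cap_cross₁, hR.cap_cross₂, hR.braid, hR.cap_skein, hR.cup_skein, hR.cap_act_cup,
      smul_zero, zero_smul, add_zero, zero_add, sub_zero, zero_sub]
  all_goals (match_scalars <;> field_simp <;> ring1)

theorem BraidExtension.act_cup (h : BraidExtension R C q κ bot top mid R' C')
    (hR : BraidSystem R C q κ) (hq : q ≠ 0) (hκ : κ ≠ 0) (hq2 : q ^ 2 - 1 ≠ 0)
    (M : Type) [AddCommGroup M] [Module ℂ M] (v : M) (i j : J) :
    tact R' (fun a b => C' a b • v) i j = (q * (κ * q⁻¹) ^ 2) • C' i j • v := by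
  induction i using h.forall_index <;>
  induction j using h.forall_index <;>
    simp only [h.cbt, h.ctb, h.cbb, h.ctt, h.cbm, h.cmb, h.ctm, h.cmt, h.cmm, h.cap, h.bb, h.tt,
      h.bm, h.mb, h.mt, h.tm, h.bt, h.tb, h.mm, tact_add, tact_sub, tact_smul, tact_zero,
      tcap_add, tcap_sub, tcap_smul, tcap_zero, hR.quad, hR.cap_act, hR.act_cup, tcap_cup,
      hR.loop_eq hq hκ hq2, hR.cap_cup₁, hR.cap_cup₂, hR.cup_cross₁, hR.cup_cross₂,
      hR.cap_cross₁, hR.cap_cross₂, hR.braid, hR.cap_skein, hR.cup_skein, hR.cap_act_cup,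
      smul_zero, zero_smul, add_zero, zero_add, sub_zero, zero_sub]
  all_goals (match_scalars <;> field_simp <;> ring1)

theorem BraidExtension.cap_cup₁ (h : BraidExtension R C q κ bot top mid R' C')
    (hR : BraidSystem R C q κ) (hκ : κ ≠ 0)
    (M : Type) [AddCommGroup M] [Module ℂ M] (v : J → M) (i : J) :
    tcap C' (fun j k => C' i j • v k) = v i := by
  induction i using h.forall_index <;>
    simp only [h.cbt, h.ctb, h.cbb, h.ctt, h.cbm, h.cmb, h.ctm, h.cmt, h.cmm, h.cap, h.bb, h.tt,
      h.bm, h.mb, h.mt, h.tm, h.bt, h.tb, h.mm, tact_add, tact_sub, tact_smul, tact_zero,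
      tcap_add, tcap_sub, tcap_smul, tcap_zero, hR.quad, hR.cap_act, hR.act_cup, tcap_cup,
      hR.cap_cup₁, hR.cap_cup₂, hR.cup_cross₁, hR.cup_cross₂,
      hR.cap_cross₁, hR.cap_cross₂, hR.braid, hR.cap_skein, hR.cup_skein, hR.cap_act_cup,
      smul_zero, zero_smul, add_zero, zero_add, sub_zero, zero_sub]
  all_goals (match_scalars; field_simp)

theorem BraidExtension.cap_cup₂ (h : BraidExtension R C q κ bot top mid R' C')
    (hR : BraidSystem R C q κ) (hκ : κ ≠ 0)
    (M : Type) [AddCommGroup M] [Module ℂ M] (v : J → M) (i : J) :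
    tcap C' (fun j k => C' k i • v j) = v i := by
  induction i using h.forall_index <;>
    simp only [h.cbt, h.ctb, h.cbb, h.ctt, h.cbm, h.cmb, h.ctm, h.cmt, h.cmm, h.cap, h.bb, h.tt,
      h.bm, h.mb, h.mt, h.tm, h.bt, h.tb, h.mm, tact_add, tact_sub, tact_smul, tact_zero,
      tcap_add, tcap_sub, tcap_smul, tcap_zero, hR.quad, hR.cap_act, hR.act_cup, tcap_cup,
      hR.cap_cup₁, hR.cap_cup₂, hR.cup_cross₁, hR.cup_cross₂,
      hR.cap_cross₁, hR.cap_cross₂, hR.braid, hR.cap_skein, hR.cup_skein, hR.cap_act_cup,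
      smul_zero, zero_smul, add_zero, zero_add, sub_zero, zero_sub]
  all_goals (match_scalars; field_simp)

theorem BraidExtension.cup_cross₁ (h : BraidExtension R C q κ bot top mid R' C')
    (hR : BraidSystem R C q κ) (hq : q ≠ 0) (hκ : κ ≠ 0) (hq2 : q ^ 2 - 1 ≠ 0)
    (M : Type) [AddCommGroup M] [Module ℂ M] (v : J → M) (i j k : J) :
    tact R' (fun a b => tact R' (fun c d => C' a c • v d) b k) i j = C' j k • v i := by
  induction i using h.forall_index <;>
  induction j using h.forall_index <;>
  induction k using h.forall_index <;>
    simp only [h.cbt, h.ctb, h.cbb, h.ctt, h.cbm, h.cmb, h.ctm, h.cmt, h.cmm, h.cap, h.bb, h.tt,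
      h.bm, h.mb, h.mt, h.tm, h.bt, h.tb, h.mm, tact_add, tact_sub, tact_smul, tact_zero,
      tcap_add, tcap_sub, tcap_smul, tcap_zero, hR.quad, hR.cap_act, hR.act_cup, tcap_cup,
      hR.loop_eq hq hκ hq2, hR.cap_cup₁, hR.cap_cup₂, hR.cup_cross₁, hR.cup_cross₂,
      hR.cap_cross₁, hR.cap_cross₂, hR.braid, hR.cap_skein, hR.cup_skein, hR.cap_act_cup,
      smul_zero, zero_smul, add_zero, zero_add, sub_zero, zero_sub]
  all_goals (match_scalars <;> field_simp <;> ring1)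

theorem BraidExtension.cup_cross₂ (h : BraidExtension R C q κ bot top mid R' C')
    (hR : BraidSystem R C q κ) (hq : q ≠ 0) (hκ : κ ≠ 0) (hq2 : q ^ 2 - 1 ≠ 0)
    (M : Type) [AddCommGroup M] [Module ℂ M] (v : J → M) (i j k : J) :
    tact R' (fun b c => tact R' (fun a d => C' d c • v a) i b) j k = C' i j • v k := by
  induction i using h.forall_index <;>
  induction j using h.forall_index <;>
  induction k using h.forall_index <;>
    simp only [h.cbt, h.ctb, h.cbb, h.ctt, h.cbm, h.cmb, h.ctm, h.cmt, h.cmm, h.cap, h.bb, h.tt,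
      h.bm, h.mb, h.mt, h.tm, h.bt, h.tb, h.mm, tact_add, tact_sub, tact_smul, tact_zero,
      tcap_add, tcap_sub, tcap_smul, tcap_zero, hR.quad, hR.cap_act, hR.act_cup, tcap_cup,
      hR.loop_eq hq hκ hq2, hR.cap_cup₁, hR.cap_cup₂, hR.cup_cross₁, hR.cup_cross₂,
      hR.cap_cross₁, hR.cap_cross₂, hR.braid, hR.cap_skein, hR.cup_skein, hR.cap_act_cup,
      smul_zero, zero_smul, add_zero, zero_add, sub_zero, zero_sub]
  all_goals (match_scalars <;> field_simp <;> ring1)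

theorem BraidExtension.cap_cross₁ (h : BraidExtension R C q κ bot top mid R' C')
    (hR : BraidSystem R C q κ) (hq : q ≠ 0) (hκ : κ ≠ 0) (hq2 : q ^ 2 - 1 ≠ 0)
    (M : Type) [AddCommGroup M] [Module ℂ M] (T : J → J → J → M) (i : J) :
    tcap C' (fun j k => tact R' (fun a b => tact R' (fun c d => T a c d) b k) i j) =
      tcap C' (fun a b => T a b i) := by
  induction i using h.forall_index <;>
    simp only [h.cbt, h.ctb, h.cbb, h.ctt, h.cbm, h.cmb, h.ctm, h.cmt, h.cmm, h.cap, h.bb, h.tt,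
      h.bm, h.mb, h.mt, h.tm, h.bt, h.tb, h.mm, tact_add, tact_sub, tact_smul, tact_zero,
      tcap_add, tcap_sub, tcap_smul, tcap_zero, hR.quad, hR.cap_act, hR.act_cup, tcap_cup,
      hR.loop_eq hq hκ hq2, hR.cap_cup₁, hR.cap_cup₂, hR.cup_cross₁, hR.cup_cross₂,
      hR.cap_cross₁, hR.cap_cross₂, hR.braid, hR.cap_skein, hR.cup_skein, hR.cap_act_cup,
      smul_zero, zero_smul, add_zero, zero_add, sub_zero, zero_sub]
  all_goals (match_scalars <;> field_simp <;> ring1)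

theorem BraidExtension.cap_cross₂ (h : BraidExtension R C q κ bot top mid R' C')
    (hR : BraidSystem R C q κ) (hq : q ≠ 0) (hκ : κ ≠ 0) (hq2 : q ^ 2 - 1 ≠ 0)
    (M : Type) [AddCommGroup M] [Module ℂ M] (T : J → J → J → M) (k : J) :
    tcap C' (fun i j => tact R' (fun b c => tact R' (fun a d => T a d c) i b) j k) =
      tcap C' (fun a b => T k a b) := by
  induction k using h.forall_index <;>
    simp only [h.cbt, h.ctb, h.cbb, h.ctt, h.cbm, h.cmb, h.ctm, h.cmt, h.cmm, h.cap, h.bb, h.tt,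
      h.bm, h.mb, h.mt, h.tm, h.bt, h.tb, h.mm, tact_add, tact_sub, tact_smul, tact_zero,
      tcap_add, tcap_sub, tcap_smul, tcap_zero, hR.quad, hR.cap_act, hR.act_cup, tcap_cup,
      hR.loop_eq hq hκ hq2, hR.cap_cup₁, hR.cap_cup₂, hR.cup_cross₁, hR.cup_cross₂,
      hR.cap_cross₁, hR.cap_cross₂, hR.braid, hR.cap_skein, hR.cup_skein, hR.cap_act_cup,
      smul_zero, zero_smul, add_zero, zero_add, sub_zero, zero_sub]
  all_goals (match_scalars <;> field_simp <;> ring1)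

theorem BraidExtension.braid (h : BraidExtension R C q κ bot top mid R' C')
    (hR : BraidSystem R C q κ) (hq : q ≠ 0) (hκ : κ ≠ 0) (hq2 : q ^ 2 - 1 ≠ 0)
    (M : Type) [AddCommGroup M] [Module ℂ M] (T : J → J → J → M) (i j k : J) :
    tact R' (fun a b => tact R' (fun c d => tact R' (fun e f => T e f d) a c) b k) i j =
      tact R' (fun b c => tact R' (fun a d => tact R' (fun e f => T a e f) d c) i b) j k := by
  induction i using h.forall_index <;>
  induction j using h.forall_index <;>
  induction k using h.forall_index <;>
    simp only [h.cbt, h.ctb, h.cbb, h.ctt, h.cbm, h.cmb, h.ctm, h.cmt, h.cmm, h.cap, h.bb, h.tt,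
      h.bm, h.mb, h.mt, h.tm, h.bt, h.tb, h.mm, tact_add, tact_sub, tact_smul, tact_zero,
      tcap_add, tcap_sub, tcap_smul, tcap_zero, hR.quad, hR.cap_act, hR.act_cup, tcap_cup,
      hR.loop_eq hq hκ hq2, hR.cap_cup₁, hR.cap_cup₂, hR.cup_cross₁, hR.cup_cross₂,
      hR.cap_cross₁, hR.cap_cross₂, hR.braid, hR.cap_skein, hR.cup_skein, hR.cap_act_cup,
      smul_zero, zero_smul, add_zero, zero_add, sub_zero, zero_sub]
  all_goals (match_scalars <;> field_simp <;> ring1)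

/-- The induction step in `m`: two new indices multiply κ = q^{-m/2} by q⁻¹. -/
theorem BraidExtension.braidSystem (h : BraidExtension R C q κ bot top mid R' C')
    (hR : BraidSystem R C q κ) (hq : q ≠ 0) (hκ : κ ≠ 0) (hq2 : q ^ 2 - 1 ≠ 0) :
    BraidSystem R' C' q (κ * q⁻¹) where
  quad := h.quad hR hq hκ hq2
  cap_act := h.cap_act hR hq hκ hq2
  act_cup := h.act_cup hR hq hκ hq2
  cap_cup₁ := h.cap_cup₁ hR hκ
  cap_cup₂ := h.cap_cup₂ hR hκ
  loop := by
    rw [h.cap, h.cbt, h.ctb]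
    simp only [h.cmm]
    rw [hR.loop_eq hq hκ hq2]
    simp only [smul_eq_mul]
    field_simp
    ring
  cup_cross₁ := h.cup_cross₁ hR hq hκ hq2
  cup_cross₂ := h.cup_cross₂ hR hq hκ hq2
  cap_cross₁ := h.cap_cross₁ hR hq hκ hq2
  cap_cross₂ := h.cap_cross₂ hR hq hκ hq2
  braid := h.braid hR hq hκ hq2

end Extension

/-! ### The braid matrix of `O_q(m)` is a braid system -/

section Concrete
variable {m : ℕ} {q : ℝ}

/-- The braid matrix with separated indices. -/
def braidCoeff (m : ℕ) (q : ℝ) (i j k l : Fin m) : ℂ := braidMatrix m q (i, j) (k, l)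

/-- The constant `q ^ (-m/2)`. -/
def kappa (m : ℕ) (q : ℝ) : ℂ := ((q ^ (-((m : ℝ) / 2)) : ℝ) : ℂ)

theorem tact_braidCoeff {M : Type} [AddCommGroup M] [Module ℂ M] (S : Fin m → Fin m → M)
    (i j : Fin m) :
    tact (braidCoeff m q) S i j =
      (if i = j then (if i = i.rev then 1 else (q : ℂ)) else if j = i.rev then (q : ℂ)⁻¹ else 1) •
        S j i + (if i < j then ((q : ℂ) - (q : ℂ)⁻¹) • S i j else 0) -
      (if j = i.rev then ∑ l, if i < l then
        (((q : ℂ) - (q : ℂ)⁻¹) * ((q ^ (rho m l - rho m i) : ℝ) : ℂ)) • S l.rev l else 0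
        else 0) := by
  unfold tact braidCoeff braidMatrix
  simp only [Matrix.of_apply, add_smul, sub_smul, Finset.sum_add_distrib, Finset.sum_sub_distrib,
    ite_smul, zero_smul, Prod.mk.injEq]
  congr 1
  · congr 1
    · simp [ite_and]
    · by_cases h : i < j <;> simp [h, ite_and]
  · rw [Finset.sum_comm]
    by_cases h : j = i.rev <;> simp [h, ite_and]

theorem rho_rev (i : Fin m) : rho m i.rev = -rho m i := by
  unfold rho
  rcases lt_trichotomy i i.rev with h | h | h
  · have h1 : ¬ i.rev < i := not_lt.mpr h.le
    have h2 : ¬ i.rev = i := h.ne'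
    simp [h, h1, h2]
  · simp [← h]
  · have h1 : ¬ i < i.rev := not_lt.mpr h.le
    have h2 : ¬ i = i.rev := h.ne'
    simp [h, h1, h2]

/-- The index of `Fin (m + 2)` corresponding to an index of `Fin m`. -/
def midIndex (x : Fin m) : Fin (m + 2) := x.succ.castSucc

theorem rev_midIndex (x : Fin m) : (midIndex x).rev = midIndex x.rev := by
  apply Fin.ext
  simp only [midIndex, Fin.val_rev, Fin.val_castSucc, Fin.val_succ]
  omega

theorem midIndex_lt {x y : Fin m} : midIndex x < midIndex y ↔ x < y := by
  rw [midIndex, midIndex, Fin.castSucc_lt_castSucc_iff, Fin.succ_lt_succ_iff]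

theorem midIndex_inj {x y : Fin m} : midIndex x = midIndex y ↔ x = y := by
  simp [midIndex]

theorem rho_midIndex (x : Fin m) : rho (m + 2) (midIndex x) = rho m x := by
  unfold rho
  simp only [rev_midIndex, midIndex_lt, midIndex_inj]
  have h : ∀ y : Fin m, ((midIndex y : Fin (m + 2)) : ℕ) = y + 1 := fun y => by simp [midIndex]
  simp only [h]
  push_cast
  split_ifs <;> ring

theorem rho_zero_index : rho (m + 2) 0 = (m : ℝ) / 2 := by
  have : (0 : Fin (m + 2)) < Fin.rev 0 := by simp [Fin.lt_def]
  unfold rho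
  rw [if_pos this]
  push_cast
  simp
  ring

theorem rho_last_index : rho (m + 2) (Fin.last (m + 1)) = -((m : ℝ) / 2) := by
  rw [← Fin.rev_zero, rho_rev, rho_zero_index]

theorem sum_index {M : Type} [AddCommGroup M] (f : Fin (m + 2) → M) :
    ∑ i, f i = f 0 + ∑ x, f (midIndex x) + f (Fin.last (m + 1)) := by
  rw [Fin.sum_univ_castSucc, Fin.sum_univ_succ]
  rfl

theorem cases_index (j : Fin (m + 2)) :
    j = 0 ∨ j = Fin.last (m + 1) ∨ ∃ x : Fin m, j = midIndex x := by
  induction j using Fin.lastCases with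
  | last => simp
  | cast j =>
    induction j using Fin.cases with
    | zero => simp
    | succ x => exact Or.inr (Or.inr ⟨x, rfl⟩)

theorem rev_eq_iff_index {x y : Fin m} : y = x.rev ↔ x = y.rev := by
  constructor <;> rintro rfl <;> simp

theorem tcap_metric {M : Type} [AddCommGroup M] [Module ℂ M] (S : Fin m → Fin m → M) :
    tcap (metric m q) S = ∑ x, ((q ^ rho m x : ℝ) : ℂ) • S x.rev x := by
  rw [tcap, Finset.sum_comm]
  refine Finset.sum_congr rfl fun x _ => ?_
  have h : ∀ y, x = y.rev ↔ y = x.rev := fun y => rev_eq_iff_index.symm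
  simp only [metric, h, ite_smul, zero_smul, Finset.sum_ite_eq', Finset.mem_univ, if_true,
    rho_rev, neg_neg]

/-- The inner indices keep their values of ρ, so the inner blocks of braid matrix and metric are
those of `O_q(m)`. The pair (0, last) is coupled to inner pairs only through the third summand of
the braid matrix, where q^{ρ_l - ρ_i} splits off a factor κ because ρ = ± m/2 at the outer indices.
-/
theorem braidExtension (m : ℕ) (hq : 0 < q) :
    BraidExtension (braidCoeff m q) (metric m q) q (kappa m q) (0 : Fin (m + 2))
      (Fin.last (m + 1)) midIndex (braidCoeff (m + 2) q) (metric (m + 2) q) := by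
  have z1 : ∀ x : Fin m, (0 : Fin (m + 2)) < midIndex x := fun x => by simp [midIndex, Fin.lt_def]
  have z2 : ∀ x : Fin m, midIndex x < Fin.last (m + 1) := fun x => by simp [midIndex, Fin.lt_def]
  have z3 : (0 : Fin (m + 2)) < Fin.last (m + 1) := by simp [Fin.lt_def]
  have n1 := fun x : Fin m => (z1 x).ne
  have n2 := fun x : Fin m => (z2 x).ne
  have n1' := fun x : Fin m => (z1 x).ne'
  have n2' := fun x : Fin m => (z2 x).ne'
  have l1 := fun x : Fin m => (z1 x).not_gt
  have l2 := fun x : Fin m => (z2 x).not_gt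
  have hinv : ∀ a : ℝ, ((q ^ (-a) : ℝ) : ℂ) = ((q ^ a : ℝ) : ℂ)⁻¹ := fun a => by
    rw [Real.rpow_neg hq.le]; push_cast; rfl
  have hmet : ∀ x y : Fin m, metric (m + 2) q (midIndex x) (midIndex y) = metric m q x y := by
    intro x y
    simp [metric, rev_midIndex, midIndex_inj, rho_midIndex]
  refine
    { cases := cases_index
      cbt := by simp [metric, rho_zero_index, kappa]
      ctb := by simp [metric, rho_last_index, kappa, hinv]
      cbb := by simp [metric, z3.ne]
      ctt := by simp [metric, z3.ne']
      cbm := fun x => by simp [metric, n2]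
      cmb := fun x => by simp [metric, rev_midIndex, n1]
      ctm := fun x => by simp [metric, n1']
      cmt := fun x => by simp [metric, rev_midIndex, n2']
      cmm := hmet
      cap := ?_, bb := ?_, tt := ?_, bm := ?_, mb := ?_, mt := ?_, tm := ?_, bt := ?_, tb := ?_,
      mm := ?_ }
  · intro M _ _ S
    simp only [tcap, sum_index]
    simp [metric, rev_midIndex, midIndex_inj, rho_midIndex, n1, n2, n1', n2', z3.ne, z3.ne',
      rho_zero_index, rho_last_index, kappa, hinv]
    abel
  · intro M _ _ S
    rw [tact_braidCoeff]
    simp [z3.ne]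
  · intro M _ _ S
    rw [tact_braidCoeff]
    simp [z3.ne']
  · intro M _ _ S x
    rw [tact_braidCoeff]
    simp [z1, n1, n2]
  · intro M _ _ S x
    rw [tact_braidCoeff]
    simp [l1, n1', n1, rev_midIndex]
  · intro M _ _ S x
    rw [tact_braidCoeff]
    simp [z2, n2, n2', rev_midIndex]
  · intro M _ _ S x
    rw [tact_braidCoeff]
    simp [l2, n1', n2']
  · intro M _ _ S
    rw [tact_braidCoeff, tcap_metric]
    simp only [sum_index, z3.ne, if_false, Fin.rev_zero, if_true, z3, lt_irrefl, z1, rev_midIndex,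
      rho_zero_index, rho_last_index, rho_midIndex, kappa, Finset.smul_sum, Fin.rev_last]
    have h1 : ∀ x : Fin m, ((q ^ (rho m x - m / 2) : ℝ) : ℂ) =
        ((q ^ (-((m : ℝ) / 2)) : ℝ) : ℂ) * ((q ^ rho m x : ℝ) : ℂ) := fun x => by
      rw [← Complex.ofReal_mul, ← Real.rpow_add hq]
      ring_nf
    have h2 : ((q ^ (-((m : ℝ) / 2) - m / 2) : ℝ) : ℂ) = ((q ^ (-((m : ℝ) / 2)) : ℝ) : ℂ) ^ 2 := by
      rw [pow_two, ← Complex.ofReal_mul, ← Real.rpow_add hq]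
      ring_nf
    simp only [h1, h2, zero_add, mul_smul, ← Finset.smul_sum]
    module
  · intro M _ _ S
    rw [tact_braidCoeff]
    simp [z3.ne', z3.not_gt, (Fin.le_last _).not_gt]
  · intro M _ _ S x y
    rw [tact_braidCoeff, tact_braidCoeff]
    simp only [sum_index, midIndex_inj, midIndex_lt, rev_midIndex, z2, l1, if_false, if_true,
      zero_add, Fin.rev_last, rho_last_index, rho_midIndex]
    by_cases h : y = x.rev
    · have h1 : (q ^ (-((m : ℝ) / 2) - rho m x) : ℝ) = (q ^ (-((m : ℝ) / 2)) : ℝ) *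
          (q ^ (-rho m x) : ℝ) := by
        rw [← Real.rpow_add hq]
        ring_nf
      simp only [h, if_true, metric, kappa, h1, Complex.ofReal_mul, mul_smul]
      module
    · simp [h, metric]

/-- Induction in steps of two. For `m = 0` there are no indices; for `m = 1` braid matrix and metric
are the scalar 1, consistent because q κ² = 1. -/
theorem braidSystem (m : ℕ) (hq : 0 < q) (hq1 : q < 1) :
    BraidSystem (braidCoeff m q) (metric m q) q (kappa m q) := by
  induction m using Nat.twoStepInduction with
  | zero => constructor <;> simp [tact, tcap, kappa]
  | one =>
    have hr : rho 1 0 = 0 := by simp [rho]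
    have hc : metric 1 q 0 0 = 1 := by simp [metric, hr]
    have hB : braidCoeff 1 q 0 0 0 0 = 1 := by simp [braidCoeff, braidMatrix]
    have hqc : (q : ℂ) ≠ 0 := by exact_mod_cast hq.ne'
    have hk : (q : ℂ) * kappa 1 q ^ 2 = 1 := by
      rw [kappa, ← Complex.ofReal_pow, ← Real.rpow_natCast, ← Real.rpow_mul hq.le]
      norm_num [Real.rpow_neg_one, hqc]
    constructor <;> simp [tact, tcap, hk, hc, hB, Fin.forall_fin_one]
  | more m ih _ =>
    have hqc : (q : ℂ) ≠ 0 := by exact_mod_cast hq.ne'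
    have := (braidExtension m hq).braidSystem ih hqc (by simp [kappa, (Real.rpow_pos_of_pos hq _).ne'])
      (by
        have : q ^ 2 - 1 ≠ 0 := by nlinarith
        exact_mod_cast this)
    convert this using 1
    simp only [kappa]
    rw [← Complex.ofReal_inv, ← Complex.ofReal_mul, ← Real.rpow_neg_one, ← Real.rpow_add hq]
    congr 2
    push_cast
    ring

end Concrete

/-! ### The inverse braid system -/

section Inverse
variable {ι : Type} [Fintype ι] [DecidableEq ι] {M : Type} [AddCommGroup M] [Module ℂ M]
  {R : ι → ι → ι → ι → ℂ} {C : ι → ι → ℂ} {q κ : ℂ}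

variable (R C q) in
/-- The inverse braid matrix, expressed through the skein relation. -/
def invCoeff (i j k l : ι) : ℂ :=
  R i j k l - (q - q⁻¹) * ((if i = k ∧ j = l then 1 else 0) - C i j * C k l)

theorem tact_invCoeff (S : ι → ι → M) (i j : ι) :
    tact (invCoeff R C q) S i j =
      tact R S i j - (q - q⁻¹) • S i j + (q - q⁻¹) • C i j • tcap C S := by
  simp only [tact, tcap, invCoeff, sub_smul, mul_smul, Finset.sum_sub_distrib, ite_smul, one_smul,
    zero_smul, ite_and, Finset.sum_ite_eq, Finset.mem_univ, if_true,
    ← Finset.smul_sum, Finset.sum_ite_irrel, Finset.sum_const_zero]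
  module

theorem BraidSystem.act_invCoeff (h : BraidSystem R C q κ) (S : ι → ι → M) (i j : ι) :
    tact R (fun a b => tact (invCoeff R C q) S a b) i j = S i j := by
  simp only [tact_invCoeff, h.act_inv]

theorem BraidSystem.invCoeff_act (h : BraidSystem R C q κ) (S : ι → ι → M) (i j : ι) :
    tact (invCoeff R C q) (fun a b => tact R S a b) i j = S i j := by
  rw [tact_invCoeff, h.quad, h.cap_act]
  module

/-- Inverting the braid matrix exchanges q with q⁻¹ and κ with κ⁻¹, so whatever is proved for one
differential calculus holds for the other. Each crossing relation of the inverse comes from the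
mirror relation of the original, applied to a tensor on which the inverse has already acted. -/
theorem BraidSystem.inverse (h : BraidSystem R C q κ) (hq : q ≠ 0) (hκ : κ ≠ 0) :
    BraidSystem (invCoeff R C q) C q⁻¹ κ⁻¹ := by
  have hcap : ∀ (M : Type) [AddCommGroup M] [Module ℂ M] (S : ι → ι → M),
      tcap C (fun a b => tact (invCoeff R C q) S a b) = (q⁻¹ * κ⁻¹ ^ 2) • tcap C S := by
    intro M _ _ S
    have := h.cap_act M (fun a b => tact (invCoeff R C q) S a b)
    simp only [h.act_invCoeff] at this
    rw [this, smul_smul]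
    match_scalars
    field_simp
  have hcup : ∀ (M : Type) [AddCommGroup M] [Module ℂ M] (v : M) (i j : ι),
      tact (invCoeff R C q) (fun a b => C a b • v) i j = (q⁻¹ * κ⁻¹ ^ 2) • C i j • v := by
    intro M _ _ v i j
    have := h.invCoeff_act (fun a b => C a b • v) i j
    simp only [h.act_cup, tact_smul] at this
    rw [← this, smul_smul]
    match_scalars
    field_simp
  constructor
  · intro M _ _ S i j
    rw [tact_invCoeff, hcap, h.act_invCoeff]
    rw [inv_inv]
    module
  · exact hcap
  · exact hcup
  · exact h.cap_cup₁
  · exact h.cap_cup₂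
  · have := h.loop
    field_simp at this ⊢
    linear_combination -this
  · intro M _ _ v i j k
    obtain ⟨W, hW⟩ : ∃ W : ι → ι → ι → M, ∀ i j k, W i j k =
      tact R (fun b c => tact R (fun a d => C d c • v a) i b) j k := ⟨_, fun _ _ _ => rfl⟩
    have hW' : ∀ i j k, C i j • v k = W i j k := fun i j k => by rw [hW, h.cup_cross₂]
    calc _ = tact (invCoeff R C q) (fun a b => tact (invCoeff R C q) (fun c d => W a c d) b k) i j :=
          by simp only [hW']
      _ = _ := by simp only [hW, h.invCoeff_act]
  · intro M _ _ v i j k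
    obtain ⟨W, hW⟩ : ∃ W : ι → ι → ι → M, ∀ i j k, W i j k =
      tact R (fun a b => tact R (fun c d => C a c • v d) b k) i j := ⟨_, fun _ _ _ => rfl⟩
    have hW' : ∀ i j k, C j k • v i = W i j k := fun i j k => by rw [hW, h.cup_cross₁]
    calc _ = tact (invCoeff R C q) (fun b c => tact (invCoeff R C q) (fun a d => W a d c) i b) j k :=
          by simp only [hW']
      _ = _ := by simp only [hW, h.invCoeff_act]
  · intro M _ _ T i
    have := h.cap_cross₂ M (fun a b k => tact (invCoeff R C q)
      (fun a b => tact (invCoeff R C q) (fun c d => T a c d) b k) a b) i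
    simp only [h.act_invCoeff] at this
    exact this.symm
  · intro M _ _ T k
    have := h.cap_cross₁ M (fun i b c => tact (invCoeff R C q)
      (fun b c => tact (invCoeff R C q) (fun a d => T a d c) i b) b c) k
    simp only [h.act_invCoeff] at this
    exact this.symm
  · intro M _ _ T i j k
    -- With the left side named `U`, the braid relation of `R` recovers `T` from `U` by crossings in
    -- the other order, and these cancel against the right side.
    obtain ⟨U, hU⟩ : ∃ U : ι → ι → ι → M, ∀ i j k, U i j k = tact (invCoeff R C q) (fun a b =>
      tact (invCoeff R C q) (fun c d => tact (invCoeff R C q) (fun e f => T e f d) a c) b k) i j :=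
      ⟨_, fun _ _ _ => rfl⟩
    have hT : ∀ i j k, T i j k =
        tact R (fun b c => tact R (fun a d => tact R (fun e f => U a e f) d c) i b) j k := by
      intro i j k
      rw [← h.braid]
      simp only [hU, h.act_invCoeff]
    rw [← hU]
    simp only [hT, h.invCoeff_act]

end Inverse

/-! ### Quantum differential calculus over a braid system -/

section Calculus
variable {ι : Type} [Fintype ι] {M N : Type} [AddCommGroup M] [Module ℂ M]
  [AddCommGroup N] [Module ℂ N]
  {B : ι → ι → ι → ι → ℂ} {C : ι → ι → ℂ} {s κ : ℂ}

theorem map_tact (L : M →ₗ[ℂ] N) (S : ι → ι → M) (i j : ι) :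
    L (tact B S i j) = tact B (fun a b => L (S a b)) i j := by
  simp [tact]

theorem map_tcap (L : M →ₗ[ℂ] N) (S : ι → ι → M) :
    L (tcap C S) = tcap C (fun a b => L (S a b)) := by
  simp [tcap]

/-- The coefficient of the metric in the symmetry relation. -/
def cupCoeff (C : ι → ι → ℂ) (s κ : ℂ) : ℂ := (s * κ ^ 2 - s) / tcap C C

/-- A multiple of the antisymmetric projection. -/
def anti (B : ι → ι → ι → ι → ℂ) (C : ι → ι → ℂ) (s κ : ℂ) (S : ι → ι → M) (i j : ι) : M :=
  s • S i j - tact B S i j + cupCoeff C s κ • C i j • tcap C S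

theorem anti_add (S T : ι → ι → M) (i j : ι) :
    anti B C s κ (fun a b => S a b + T a b) i j = anti B C s κ S i j + anti B C s κ T i j := by
  simp only [anti, tact_add, tcap_add]
  module

theorem anti_smul (c : ℂ) (S : ι → ι → M) (i j : ι) :
    anti B C s κ (fun a b => c • S a b) i j = c • anti B C s κ S i j := by
  simp only [anti, tact_smul, tcap_smul]
  module

theorem map_anti (L : M →ₗ[ℂ] N) (S : ι → ι → M) (i j : ι) :
    L (anti B C s κ S i j) = anti B C s κ (fun a b => L (S a b)) i j := by
  simp only [anti, map_add, map_sub, map_smul, map_tact, map_tcap]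

/-- `anti` combines the identity, the braid matrix and a cap followed by a cup. Each of the three
slides along a strand that crosses both of its indices, by `braid`, `cap_cross₁` and `cup_cross₁`.
-/
theorem BraidSystem.anti_cross₁ (h : BraidSystem B C s κ) (T : ι → ι → ι → M) (i j k : ι) :
    anti B C s κ (fun j k => tact B (fun a b => tact B (fun c d => T a c d) b k) i j) j k =
      tact B (fun a b => tact B (fun c d => anti B C s κ (fun e f => T e f d) a c) b k) i j := by
  simp only [anti, tact_add, tact_sub, tact_smul, h.braid, h.cap_cross₁, h.cup_cross₁]

theorem BraidSystem.anti_cross₂ (h : BraidSystem B C s κ) (T : ι → ι → ι → M) (i j k : ι) :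
    anti B C s κ (fun i j => tact B (fun b c => tact B (fun a d => T a d c) i b) j k) i j =
      tact B (fun b c => tact B (fun a d => anti B C s κ (fun e f => T a e f) d c) i b) j k := by
  simp only [anti, tact_add, tact_sub, tact_smul, ← h.braid, h.cap_cross₂, h.cup_cross₂]

/-- On the antisymmetric part the braid matrix has eigenvalue -s⁻¹, so 1 + s⁻¹R⁻¹ vanishes there,
and `anti` kills everything else. This is the compatibility of the Leibniz rule with the commutation
relations. -/
theorem BraidSystem.anti_act (h : BraidSystem B C s κ) (hs : s ≠ 0) (hκ : κ ≠ 0)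
    (hδ : tcap C C ≠ 0) (S : ι → ι → M) (i j : ι) :
    anti B C s κ (fun a b => S a b + s⁻¹ • (tact B S a b - (s - s⁻¹) • S a b +
      (s - s⁻¹) • C a b • tcap C S)) i j = 0 := by
  have hl := h.loop
  have hl' : ∀ v : M, (s - s⁻¹) • tcap C C • v =
      (s - s⁻¹ + (s * κ ^ 2)⁻¹ - s * κ ^ 2) • v := fun v => by rw [smul_smul, hl]
  simp only [anti, tact_add, tcap_add, tact_smul, tcap_smul, h.quad, h.cap_act, h.act_cup, tact_sub,
    tcap_sub, tcap_cup]
  generalize tact B S i j = Y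
  generalize tcap C S = Z
  generalize S i j = W
  match_scalars
  · field_simp
    ring
  · field_simp
    ring
  · unfold cupCoeff
    field_simp at hl ⊢
    linear_combination C i j * hl

/-- Operators `X i` (coordinates) and `D i` (derivatives) that satisfy the commutation relations
of the coordinates and the deformed Leibniz rule. -/
structure QCalculus (B : ι → ι → ι → ι → ℂ) (C : ι → ι → ℂ) (s κ : ℂ)
    (X D : ι → N →ₗ[ℂ] N) : Prop where
  leib : ∀ i j f, D i (X j f) = C i j • f + s⁻¹ • tact B (fun k l => X k (D l f)) i j
  comm : ∀ i j f, anti B C s κ (fun k l => X k (X l f)) i j = 0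

variable {X D : ι → N →ₗ[ℂ] N}

/-- The quadratic invariant of a family of operators. -/
def invariantSq (C : ι → ι → ℂ) (X : ι → N →ₗ[ℂ] N) : N →ₗ[ℂ] N :=
  ∑ i, ∑ j, C i j • (X i ∘ₗ X j)

theorem invariantSq_apply (f : N) : invariantSq C X f = tcap C (fun i j => X i (X j f)) := by
  simp [invariantSq, tcap]

/-- The operator `x^i C_{ij} ∂^j`. -/
def euler (C : ι → ι → ℂ) (X D : ι → N →ₗ[ℂ] N) : N →ₗ[ℂ] N :=
  ∑ i, ∑ j, C i j • (X i ∘ₗ D j)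

theorem euler_apply (f : N) : euler C X D f = tcap C (fun i j => X i (D j f)) := by
  simp [euler, tcap]

theorem act_of_comm (hX : ∀ i j f, anti B C s κ (fun k l => X k (X l f)) i j = 0) (i j : ι)
    (f : N) : tact B (fun k l => X k (X l f)) i j =
      s • X i (X j f) + cupCoeff C s κ • C i j • invariantSq C X f := by
  have := hX i j f
  rw [anti, ← invariantSq_apply] at this
  rw [← sub_eq_zero, ← neg_eq_zero, ← this]
  abel

theorem BraidSystem.cap_act_cup' (h : BraidSystem B C s κ) (v : ι → M) (i : ι) :
    tcap C (fun j k => tact B (fun a b => C b k • v a) i j) = (s * κ ^ 2)⁻¹ • v i := by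
  rw [h.cap_skein (fun a b k => C b k • v a)]
  simp only [tcap_smul, tcap_cup, h.act_cup, h.cap_cup₂]
  rw [smul_smul, h.loop]
  module

/-- A form of `loop`. The two sides are the factors met in `invariantSq_comm` when the invariant is
moved past a coordinate; their equality makes the invariant central instead of merely q-commuting.
-/
theorem BraidSystem.cupCoeff_eq (h : BraidSystem B C s κ) (hs : s ≠ 0) (hκ : κ ≠ 0)
    (hδ : tcap C C ≠ 0) :
    1 - s * cupCoeff C s κ = s ^ 2 + (s * κ ^ 2)⁻¹ * cupCoeff C s κ := by
  have hl := h.loop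
  unfold cupCoeff
  field_simp at hl ⊢
  linear_combination (-1) * hl

/-- The strand is pulled under the cap with `cap_cross₁`, and each crossing is evaluated on a pair
of coordinates by `act_of_comm`. Only the symmetry relations of the family `X` are used, so the
result also applies to the derivatives and their Laplacian. -/
theorem invariantSq_comm (h : BraidSystem B C s κ) (hs : s ≠ 0) (hκ : κ ≠ 0)
    (hδ : tcap C C ≠ 0) (hne : 1 - s * cupCoeff C s κ ≠ 0)
    (hX : ∀ i j f, anti B C s κ (fun k l => X k (X l f)) i j = 0) (i : ι) (f : N) :
    invariantSq C X (X i f) = X i (invariantSq C X f) := by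
  have h1 := h.cap_cross₁ N (fun a b c => X a (X b (X c f))) i
  simp only [← map_tact, act_of_comm hX, map_add, map_smul, tact_add, tact_smul, tcap_add,
    tcap_smul, h.cap_act_cup', h.cap_cup₁] at h1
  simp only [← map_tcap, ← invariantSq_apply] at h1
  have h2 : (1 - s * cupCoeff C s κ) • invariantSq C X (X i f) =
      (1 - s * cupCoeff C s κ) • X i (invariantSq C X f) := by
    conv_rhs => rw [h.cupCoeff_eq hs hκ hδ]
    rw [sub_smul, one_smul]
    nth_rewrite 1 [← h1]
    module
  exact smul_right_injective N hne h2

namespace QCalculus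

theorem invariantSq_comm_X (hc : QCalculus B C s κ X D) (h : BraidSystem B C s κ) (hs : s ≠ 0)
    (hκ : κ ≠ 0) (hδ : tcap C C ≠ 0) (hne : 1 - s * cupCoeff C s κ ≠ 0) (i : ι) (f : N) :
    invariantSq C X (X i f) = X i (invariantSq C X f) :=
  invariantSq_comm h hs hκ hδ hne hc.comm i f

/-- The derivative of the squared norm. -/
theorem D_invariantSq (hc : QCalculus B C s κ X D) (h : BraidSystem B C s κ) (i : ι) (f : N) :
    D i (invariantSq C X f) =
      (1 + s⁻¹ * (s * κ ^ 2)⁻¹) • X i f + (s⁻¹ ^ 2) • invariantSq C X (D i f) := by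
  rw [invariantSq_apply, map_tcap]
  simp only [hc.leib, map_add, map_smul, map_tact, tact_add, tact_smul, tcap_add, tcap_smul,
    h.cap_cup₁, h.cap_act_cup', smul_add]
  rw [h.cap_cross₁ N (fun a b c => X a (X b (D c f))), ← invariantSq_apply]
  module

/-- The commutation relation of the Laplacian and the coordinates. -/
theorem laplacian_X (hc : QCalculus B C s κ X D) (h : BraidSystem B C s κ) (k : ι) (f : N) :
    invariantSq C D (X k f) =
      (1 + s⁻¹ * (s * κ ^ 2)⁻¹) • D k f + (s⁻¹ ^ 2) • X k (invariantSq C D f) := by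
  rw [invariantSq_apply]
  simp only [hc.leib, map_add, map_smul, map_tact, tact_add, tact_smul, tcap_add, tcap_smul,
    h.cap_cup₂, h.cap_act_cup, smul_add, h.cap_cross₂]
  simp only [← map_tcap, ← invariantSq_apply]
  module

/-- The commutation relation of the Euler operator and the coordinates. -/
theorem euler_X (hc : QCalculus B C s κ X D) (h : BraidSystem B C s κ) (hs : s ≠ 0) (k : ι) (f : N) :
    euler C X D (X k f) = X k f + (s⁻¹ ^ 2) • X k (euler C X D f) +
      (s⁻¹ * (cupCoeff C s κ + (s - s⁻¹))) • invariantSq C X (D k f) := by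
  rw [euler_apply]
  simp only [hc.leib, map_add, map_smul, map_tact, tcap_add, tcap_smul, h.cap_cup₂]
  -- The crossing involves a coordinate and a derivative; the skein relation moves it onto the two
  -- coordinates, where `act_of_comm` evaluates it.
  have h1 := h.cap_skein (fun a b c => X a (X b (D c f))) k
  simp only [act_of_comm hc.comm, tcap_add, tcap_smul, h.cap_cup₁] at h1
  simp only [← map_tcap, ← euler_apply] at h1
  have h2 : euler C X X (D k f) = invariantSq C X (D k f) := rfl
  rw [h2, ← sub_eq_zero, ← neg_eq_zero] at h1
  rw [← sub_eq_zero, ← smul_zero (s⁻¹), ← h1]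
  match_scalars <;> field_simp <;> ring

end QCalculus

end Calculus

/-! ### Identities proved by induction along a cyclic vector, and the link between the two calculi
-/

section Cyclic
variable {ι : Type} [Fintype ι] {M N : Type} [AddCommGroup M] [Module ℂ M]
  [AddCommGroup N] [Module ℂ N]
  {B : ι → ι → ι → ι → ℂ} {C : ι → ι → ℂ} {s κ : ℂ} {X D D' : ι → N →ₗ[ℂ] N} {v : N}

/-- The vector `v` is cyclic for the operators `X i`. -/
def IsCyclicVector (X : ι → N →ₗ[ℂ] N) (v : N) : Prop :=
  ∀ W : Submodule ℂ N, v ∈ W → (∀ j, ∀ f ∈ W, X j f ∈ W) → ∀ f, f ∈ W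

theorem cupCoeff_inv (h : BraidSystem B C s κ) (hs : s ≠ 0) (hκ : κ ≠ 0)
    (hδ : tcap C C ≠ 0) : cupCoeff C s⁻¹ κ⁻¹ = cupCoeff C s κ + (s - s⁻¹) := by
  have hl := h.loop
  unfold cupCoeff
  field_simp at hl ⊢
  linear_combination (-1) * hl

/-- By the skein relation the two expressions differ only in the cup-cap term, and `cupCoeff_inv`
absorbs the difference. Hence both calculi live on the same algebra of coordinates. -/
theorem anti_inv [DecidableEq ι] (h : BraidSystem B C s κ) (hs : s ≠ 0) (hκ : κ ≠ 0)
    (hδ : tcap C C ≠ 0) (S : ι → ι → M) (i j : ι) :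
    anti (invCoeff B C s) C s⁻¹ κ⁻¹ S i j = anti B C s κ S i j := by
  rw [anti, anti, tact_invCoeff, cupCoeff_inv h hs hκ hδ]
  module

namespace QCalculus

/-- The derivatives satisfy the same commutation relations as the coordinates. -/
theorem D_comm (hc : QCalculus B C s κ X D) (h : BraidSystem B C s κ) (hs : s ≠ 0)
    (hκ : κ ≠ 0) (hδ : tcap C C ≠ 0) (hv : IsCyclicVector X v) (hD : ∀ i, D i v = 0)
    (i j : ι) (f : N) : anti B C s κ (fun k l => D k (D l f)) i j = 0 := by
  let W : Submodule ℂ N :=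
    { carrier := {f | ∀ i j, anti B C s κ (fun k l => D k (D l f)) i j = 0}
      add_mem' := fun {f g} hf hg i j => by simp only [map_add, anti_add, hf i j, hg i j, add_zero]
      zero_mem' := fun i j => by simp [anti, tact, tcap]
      smul_mem' := fun c f hf i j => by simp only [map_smul, anti_smul, hf i j, smul_zero] }
  refine hv W (fun i j => by simp [hD, anti, tact, tcap]) (fun k f hf i j => ?_) f i j
  -- A double derivative of x^k f consists of 1 + s⁻¹R⁻¹ applied to first derivatives, which
  -- `anti_act` kills, and a term in which x^k has crossed both derivatives, where the induction
  -- hypothesis for `f` applies.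
  have h1 : ∀ i j, D i (D j (X k f)) =
      (C j k • D i f + s⁻¹ • (tact B (fun a b => C b k • D a f) i j -
        (s - s⁻¹) • C j k • D i f + (s - s⁻¹) • C i j • tcap C (fun a b => C b k • D a f))) +
      (s⁻¹ ^ 2) • tact B (fun b c => tact B (fun a d => X a (D d (D c f))) i b) j k := by
    intro i j
    rw [hc.leib, map_add, map_smul, map_smul, map_tact]
    simp only [hc.leib, tact_add, tact_smul]
    rw [h.cup_skein, h.cap_cup₂]
    module
  simp only [h1, anti_add _ (fun i j => (s⁻¹ ^ 2) • _), anti_smul]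
  rw [h.anti_act hs hκ hδ, h.anti_cross₂]
  have h2 : ∀ a d c, anti B C s κ (fun e f' => X a (D e (D f' f))) d c = 0 := fun a d c => by
    rw [← map_anti, hf, map_zero]
  simp [h2, tact]

theorem laplacian_D (hc : QCalculus B C s κ X D) (h : BraidSystem B C s κ) (hs : s ≠ 0)
    (hκ : κ ≠ 0) (hδ : tcap C C ≠ 0) (hne : 1 - s * cupCoeff C s κ ≠ 0)
    (hv : IsCyclicVector X v) (hD : ∀ i, D i v = 0) (i : ι) (f : N) :
    invariantSq C D (D i f) = D i (invariantSq C D f) :=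
  invariantSq_comm h hs hκ hδ hne (hc.D_comm h hs hκ hδ hv hD) i f

end QCalculus

/-- The operator `q^{2n}` in degree `n`, expressed through coordinates and derivatives. -/
def scaling (C : ι → ι → ℂ) (s κ : ℂ) (X D : ι → N →ₗ[ℂ] N) : N →ₗ[ℂ] N :=
  LinearMap.id + (s⁻¹ ^ 2 - 1) • euler C X D -
    ((s⁻¹ ^ 2 - 1) * (s⁻¹ * (cupCoeff C s κ + (s - s⁻¹))) / (1 + s⁻¹ * (s * κ ^ 2)⁻¹)) •
      (invariantSq C X ∘ₗ invariantSq C D)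

/-- The Euler operator passes a coordinate only up to r² times a derivative. Passing the Laplacian
by the coordinate produces the same derivative, and the last coefficient in `scaling` is the one
that makes the two cancel. -/
theorem scaling_X (hc : QCalculus B C s κ X D) (h : BraidSystem B C s κ) (hs : s ≠ 0)
    (hκ : κ ≠ 0) (hδ : tcap C C ≠ 0) (hne : 1 - s * cupCoeff C s κ ≠ 0)
    (hμ : 1 + s⁻¹ * (s * κ ^ 2)⁻¹ ≠ 0) (j : ι) (f : N) :
    scaling C s κ X D (X j f) = (s⁻¹ ^ 2) • X j (scaling C s κ X D f) := by
  simp only [scaling, LinearMap.add_apply, LinearMap.sub_apply, LinearMap.smul_apply,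
    LinearMap.id_apply, LinearMap.comp_apply, hc.euler_X h hs, hc.laplacian_X h, map_add, map_smul,
    map_sub, hc.invariantSq_comm_X h hs hκ hδ hne]
  generalize 1 + s⁻¹ * (s * κ ^ 2)⁻¹ = μ at *
  match_scalars <;> field_simp <;> ring

/-- Up to the dilatation, the second family of derivatives equals the first one plus a term that
vanishes on harmonic polynomials. Both sides kill the cyclic vector and obey the same recursion
under multiplication by a coordinate. -/
theorem scaling_derivative [DecidableEq ι] (hc' : QCalculus B C s κ X D')
    (hc : QCalculus (invCoeff B C s) C s⁻¹ κ⁻¹ X D) (h : BraidSystem B C s κ) (hs : s ≠ 0)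
    (hκ : κ ≠ 0) (hδ : tcap C C ≠ 0) (hne : 1 - s⁻¹ * cupCoeff C s⁻¹ κ⁻¹ ≠ 0)
    (hμ : 1 + s⁻¹⁻¹ * (s⁻¹ * κ⁻¹ ^ 2)⁻¹ ≠ 0) (hv : IsCyclicVector X v) (hD : ∀ i, D i v = 0)
    (hD' : ∀ i, D' i v = 0) (i : ι) (f : N) :
    scaling C s⁻¹ κ⁻¹ X D (D' i f) = D i f +
      ((s ^ 2 - 1) / (1 + s⁻¹⁻¹ * (s⁻¹ * κ⁻¹ ^ 2)⁻¹)) • X i (invariantSq C D f) := by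
  have hs' := inv_ne_zero hs
  have hκ' := inv_ne_zero hκ
  have h' := h.inverse hs hκ
  let W : Submodule ℂ N :=
    { carrier := {f | ∀ i, scaling C s⁻¹ κ⁻¹ X D (D' i f) = D i f +
        ((s ^ 2 - 1) / (1 + s⁻¹⁻¹ * (s⁻¹ * κ⁻¹ ^ 2)⁻¹)) • X i (invariantSq C D f)}
      add_mem' := fun {f g} hf hg i => by
        simp only [map_add, hf i, hg i, smul_add]
        abel
      zero_mem' := fun i => by simp
      smul_mem' := fun c f hf i => by
        simp only [map_smul, hf i]
        module }
  refine hv W (fun i => by simp [hD, hD', invariantSq_apply, tcap]) (fun j f hf i => ?_) f i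
  rw [hc'.leib, map_add, map_smul, map_smul, map_tact]
  simp only [scaling_X hc h' hs' hκ' hδ hne hμ]
  have hf' : ∀ l, scaling C s⁻¹ κ⁻¹ X D (D' l f) = D l f +
    ((s ^ 2 - 1) / (1 + s⁻¹⁻¹ * (s⁻¹ * κ⁻¹ ^ 2)⁻¹)) • X l (invariantSq C D f) := hf
  simp only [hf', map_add, map_smul, tact_add, tact_smul, act_of_comm hc'.comm, hc.leib,
    hc.laplacian_X h', tact_invCoeff, ← euler_apply]
  rw [scaling]
  simp only [LinearMap.add_apply, LinearMap.sub_apply, LinearMap.smul_apply,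
    LinearMap.id_apply, LinearMap.comp_apply]
  rw [cupCoeff_inv h hs hκ hδ]
  generalize 1 + s⁻¹⁻¹ * (s⁻¹ * κ⁻¹ ^ 2)⁻¹ = μ at *
  match_scalars <;> field_simp <;> ring

end Cyclic

/-! ### The differential calculus on quantum Euclidean space -/

/-- Differentiating x^k x^l f yields 1 + s⁻¹R⁻¹ on terms with one coordinate, killed by `anti_act`,
and a term in which the pair of coordinates has crossed the derivative, killed by the commutation
relations themselves. So the Leibniz rule descends to the quotient algebra. -/
theorem leibniz_anti {ι : Type} [Fintype ι] {N : Type} [AddCommGroup N] [Module ℂ N]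
    {B : ι → ι → ι → ι → ℂ} {C : ι → ι → ℂ} {s κ : ℂ} {X : ι → N →ₗ[ℂ] N}
    (h : BraidSystem B C s κ) (hs : s ≠ 0) (hκ : κ ≠ 0) (hδ : tcap C C ≠ 0)
    (hX : ∀ i j f, anti B C s κ (fun k l => X k (X l f)) i j = 0) (f : N) (g : ι → N)
    (a i j : ι) :
    anti B C s κ (fun k l => C a k • X l f + s⁻¹ • tact B (fun d b => X d (C b l • f +
      s⁻¹ • tact B (fun e c => X e (g c)) b l)) a k) i j = 0 := by
  have h1 : ∀ k l, C a k • X l f + s⁻¹ • tact B (fun d b => X d (C b l • f +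
      s⁻¹ • tact B (fun e c => X e (g c)) b l)) a k =
      (C a k • X l f + s⁻¹ • (tact B (fun b d => C a b • X d f) k l -
        (s - s⁻¹) • C a k • X l f + (s - s⁻¹) • C k l • tcap C (fun b d => C a b • X d f))) +
      (s⁻¹ ^ 2) • tact B (fun d b => tact B (fun e c => X d (X e (g c))) b l) a k := by
    intro k l
    simp only [map_add, map_smul, map_tact, tact_add, tact_smul]
    rw [h.cup_skein (fun d => X d f), h.cap_cup₁]
    module
  simp only [h1, anti_add _ (fun k l => (s⁻¹ ^ 2) • _), anti_smul]
  rw [h.anti_act hs hκ hδ, h.anti_cross₁]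
  simp [hX, tact]

section OnPolynomials
variable {m : ℕ} {q : ℝ}

/-- Left multiplication by a coordinate. -/
def mulCoord (m : ℕ) (q : ℝ) (j : Fin m) : QPoly m q →ₗ[ℂ] QPoly m q :=
  LinearMap.mulLeft ℂ (coord m q j)

theorem mulCoord_apply (j : Fin m) (f : QPoly m q) : mulCoord m q j f = coord m q j * f := rfl

theorem invariantSq_mulCoord (f : QPoly m q) :
    invariantSq (metric m q) (mulCoord m q) f = normSq m q * f := by
  simp [invariantSq, normSq, Finset.sum_mul, mulCoord_apply, mul_assoc]

theorem isCyclicVector_one : IsCyclicVector (mulCoord m q) 1 := by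
  intro W h1 hW f
  obtain ⟨w, rfl⟩ := RingQuot.mkAlgHom_surjective ℂ (Commutation m q) f
  suffices ∀ g ∈ W, toQPoly m q w * g ∈ W by
    have h := this 1 h1
    rw [mul_one] at h
    exact h
  induction w using FreeAlgebra.induction with
  | grade0 a =>
    intro g hg
    simpa [Algebra.algebraMap_eq_smul_one] using W.smul_mem a hg
  | grade1 j => exact fun g hg => hW j g hg
  | mul a b ha hb =>
    intro g hg
    rw [map_mul, mul_assoc]
    exact ha _ (hb _ hg)
  | add a b ha hb =>
    intro g hg
    rw [map_add, add_mul]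
    exact W.add_mem (ha g hg) (hb g hg)

theorem kappa_sq (hq : 0 < q) : (q : ℂ) * kappa m q ^ 2 = ((q ^ (1 - (m : ℝ)) : ℝ) : ℂ) := by
  rw [kappa, ← Complex.ofReal_pow, ← Complex.ofReal_mul, ← Real.rpow_natCast, ← Real.rpow_mul hq.le]
  nth_rewrite 1 [← Real.rpow_one q]
  rw [← Real.rpow_add hq]
  congr 2
  push_cast
  ring

theorem sum_antisymProj (hq : 0 < q) {M : Type} [AddCommGroup M] [Module ℂ M]
    (S : Fin m → Fin m → M) (i j : Fin m) :
    ∑ k, ∑ l, antisymProj m q (i, j) (k, l) • S k l =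
      ((q : ℂ) + (q : ℂ)⁻¹)⁻¹ • anti (braidCoeff m q) (metric m q) q (kappa m q) S i j := by
  have h1 : ∀ k l, antisymProj m q (i, j) (k, l) = ((q : ℂ) + (q : ℂ)⁻¹)⁻¹ *
      ((q : ℂ) * (if i = k ∧ j = l then 1 else 0) - braidCoeff m q i j k l +
        cupCoeff (metric m q) q (kappa m q) * metric m q i j * metric m q k l) := by
    intro k l
    simp only [antisymProj, Matrix.smul_apply, Matrix.add_apply, Matrix.sub_apply, smul_eq_mul,
      Matrix.one_apply, Prod.mk.injEq, singletProj, Matrix.of_apply, braidCoeff, cupCoeff,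
      kappa_sq hq, tcap]
    ring
  simp only [h1, anti, tact, tcap, mul_smul, add_smul, sub_smul, Finset.sum_add_distrib,
    Finset.sum_sub_distrib, ite_smul, one_smul, zero_smul, ite_and, Finset.sum_ite_eq,
    Finset.mem_univ, if_true, ← Finset.smul_sum, Finset.sum_ite_irrel, Finset.sum_const_zero]

theorem anti_mulCoord (hq : 0 < q) (i j : Fin m) (f : QPoly m q) :
    anti (braidCoeff m q) (metric m q) q (kappa m q)
      (fun k l => mulCoord m q k (mulCoord m q l f)) i j = 0 := by
  have hne : ((q : ℂ) + (q : ℂ)⁻¹)⁻¹ ≠ 0 := by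
    have : q + q⁻¹ ≠ 0 := by positivity
    exact inv_ne_zero (by exact_mod_cast this)
  have h := RingQuot.mkAlgHom_rel ℂ (Commutation.rel (m := m) (q := q) i j)
  have h2 : (∑ k, ∑ l, antisymProj m q (i, j) (k, l) • (coord m q k * coord m q l)) * f = 0 := by
    have : ∑ k, ∑ l, antisymProj m q (i, j) (k, l) • (coord m q k * coord m q l) = 0 := by
      simp only [map_sum, map_smul, map_mul, map_zero] at h
      exact h
    rw [this, zero_mul]
  simp only [Finset.sum_mul, smul_mul_assoc, mul_assoc] at h2
  rw [sum_antisymProj hq (fun k l => coord m q k * (coord m q l * f))] at h2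
  exact (smul_eq_zero.mp h2).resolve_left hne

/-- The action of left multiplication by `x^j` on pairs `(f, (∂^i f)_i)` of polynomials on quantum
Euclidean space. -/
def leibnizQuot (m : ℕ) (q : ℝ) (c : ℂ) (B : Matrix (Fin m × Fin m) (Fin m × Fin m) ℂ)
    (j : Fin m) : Module.End ℂ (QPoly m q × (Fin m → QPoly m q)) where
  toFun p := (coord m q j * p.1, fun i => metric m q i j • p.1 +
    c • tact (fun i j k l => B (i, j) (k, l)) (fun k l => mulCoord m q k (p.2 l)) i j)
  map_add' p p' := by
    ext i
    · simp [mul_add]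
    · simp only [Prod.fst_add, Prod.snd_add, Pi.add_apply, map_add, tact_add, smul_add]
      abel
  map_smul' a p := by
    ext i
    · simp
    · simp only [Prod.smul_fst, Prod.smul_snd, Pi.smul_apply, map_smul, tact_smul, RingHom.id_apply,
        smul_add, smul_comm a]

section Existence
variable {c s κ : ℂ} {B : Matrix (Fin m × Fin m) (Fin m × Fin m) ℂ}

/-- A defining relation acts as zero on pairs of a polynomial and its gradient: on the first entry
by the relation itself, on the others by `leibniz_anti`. The hypothesis `hanti` covers both calculi,
whose antisymmetrizers coincide. -/
theorem leibnizQuot_rel (hq : 0 < q)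
    (h : BraidSystem (fun i j k l => B (i, j) (k, l)) (metric m q) s κ) (hs : s ≠ 0) (hκ : κ ≠ 0)
    (hδ : tcap (metric m q) (metric m q) ≠ 0) (hc : c = s⁻¹)
    (hanti : ∀ (M : Type) [AddCommGroup M] [Module ℂ M] (S : Fin m → Fin m → M) (i j : Fin m),
      anti (fun i j k l => B (i, j) (k, l)) (metric m q) s κ S i j =
        anti (braidCoeff m q) (metric m q) q (kappa m q) S i j) ⦃x y : Words m⦄
    (hxy : Commutation m q x y) :
    FreeAlgebra.lift ℂ (leibnizQuot m q c B) x = FreeAlgebra.lift ℂ (leibnizQuot m q c B) y := by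
  obtain ⟨i, j⟩ := hxy
  rw [map_zero]
  simp only [map_sum, map_smul, map_mul, FreeAlgebra.lift_ι_apply]
  have hX : ∀ i j f, anti (fun i j k l => B (i, j) (k, l)) (metric m q) s κ
      (fun k l => mulCoord m q k (mulCoord m q l f)) i j = 0 := fun i j f => by
    rw [hanti, anti_mulCoord hq]
  refine LinearMap.ext fun p => ?_
  simp only [LinearMap.sum_apply, LinearMap.smul_apply, Module.End.mul_apply, LinearMap.zero_apply]
  rw [sum_antisymProj hq (fun k l => leibnizQuot m q c B k (leibnizQuot m q c B l p)), ← hanti]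
  convert smul_zero _
  refine Prod.ext ?_ (funext fun a => ?_)
  · exact (map_anti (LinearMap.fst ℂ (QPoly m q) (Fin m → QPoly m q))
      (fun k l => leibnizQuot m q c B k (leibnizQuot m q c B l p)) i j).trans (hX i j p.1)
  · refine (map_anti ((LinearMap.proj a).comp (LinearMap.snd ℂ (QPoly m q)
      (Fin m → QPoly m q)))
      (fun k l => leibnizQuot m q c B k (leibnizQuot m q c B l p)) i j).trans ?_
    subst hc
    exact leibniz_anti h hs hκ hδ hX p.1 p.2 a i j

variable (c B) in
/-- The representation of polynomials on pairs `(f, (∂^i f)_i)`. -/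
def leibnizLift (H : ∀ ⦃x y : Words m⦄, Commutation m q x y →
    FreeAlgebra.lift ℂ (leibnizQuot m q c B) x = FreeAlgebra.lift ℂ (leibnizQuot m q c B) y) :
    QPoly m q →ₐ[ℂ] Module.End ℂ (QPoly m q × (Fin m → QPoly m q)) :=
  RingQuot.liftAlgHom ℂ ⟨FreeAlgebra.lift ℂ (leibnizQuot m q c B), H⟩

variable (m q c B) in
/-- The partial derivative induced on polynomials by `wordsPartial`. -/
def HasQuotient (D : Fin m → QPoly m q →ₗ[ℂ] QPoly m q) : Prop :=
  ∀ i w, toQPoly m q (wordsPartial m q c B i w) = D i (toQPoly m q w)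

theorem exists_hasQuotient (H : ∀ ⦃x y : Words m⦄, Commutation m q x y →
    FreeAlgebra.lift ℂ (leibnizQuot m q c B) x = FreeAlgebra.lift ℂ (leibnizQuot m q c B) y) :
    ∃ D, HasQuotient m q c B D := by
  refine ⟨fun i => (LinearMap.proj i).comp ((LinearMap.snd ℂ (QPoly m q)
    (Fin m → QPoly m q)).comp (((leibnizLift c B H).toLinearMap).flip (1, 0))), fun i w => ?_⟩
  have hl : ∀ w, leibnizLift c B H (toQPoly m q w) = FreeAlgebra.lift ℂ (leibnizQuot m q c B) w :=
    fun w => RingQuot.liftAlgHom_mkAlgHom_apply _ _ _ _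
  let φ : (Words m × (Fin m → Words m)) → QPoly m q × (Fin m → QPoly m q) :=
    fun p => (toQPoly m q p.1, fun i => toQPoly m q (p.2 i))
  have key : ∀ p, φ (FreeAlgebra.lift ℂ (leibnizStep m q c B) w p) =
      FreeAlgebra.lift ℂ (leibnizQuot m q c B) w (φ p) := by
    induction w using FreeAlgebra.induction with
    | grade0 a => intro p; simp [φ, Algebra.algebraMap_eq_smul_one]; rfl
    | grade1 j =>
      intro p
      simp only [FreeAlgebra.lift_ι_apply]
      refine Prod.ext ?_ (funext fun i => ?_)
      · simp [φ, leibnizStep, leibnizQuot, coord]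
      · simp [φ, leibnizStep, leibnizQuot, coord, tact, mulCoord_apply]
    | mul a b ha hb =>
      intro p
      rw [map_mul, map_mul, Module.End.mul_apply, Module.End.mul_apply, ha, hb]
    | add a b ha hb =>
      intro p
      rw [map_add, map_add, LinearMap.add_apply, LinearMap.add_apply, ← ha, ← hb]
      refine Prod.ext ?_ (funext fun i => ?_) <;> simp [φ]
  have := key (1, 0)
  have h2 := congrFun (congrArg Prod.snd this) i
  simp only [wordsPartial]
  refine h2.trans ?_
  simp [hl, φ]
  rfl

theorem HasQuotient.leib {D : Fin m → QPoly m q →ₗ[ℂ] QPoly m q} (hD : HasQuotient m q c B D)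
    (i j : Fin m) (f : QPoly m q) :
    D i (mulCoord m q j f) = metric m q i j • f +
      c • tact (fun i j k l => B (i, j) (k, l)) (fun k l => mulCoord m q k (D l f)) i j := by
  obtain ⟨w, rfl⟩ := RingQuot.mkAlgHom_surjective ℂ (Commutation m q) f
  have h1 := hD i (FreeAlgebra.ι ℂ j * w)
  rw [wordsPartial_ι_mul, map_mul] at h1
  refine h1.symm.trans ?_
  simp only [map_add, map_smul, map_sum, map_mul, hD _ w]
  rfl

theorem HasQuotient.one {D : Fin m → QPoly m q →ₗ[ℂ] QPoly m q} (hD : HasQuotient m q c B D)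
    (i : Fin m) : D i 1 = 0 := by
  have := hD i 1
  rw [wordsPartial_one, map_zero, map_one] at this
  exact this.symm

/-- Since the derivative descends to the quotient, the representative chosen in `seriesPartial` does
not matter, and the operator is linear. -/
theorem HasQuotient.coeff_seriesPartial {D : Fin m → QPoly m q →ₗ[ℂ] QPoly m q}
    (hD : HasQuotient m q c B D) (i : Fin m) (f : QSeries m q) (n : ℕ) :
    PowerSeries.coeff n (seriesPartial c B i f : PowerSeries (QPoly m q)) =
      D i (PowerSeries.coeff (n + 1) (f : PowerSeries (QPoly m q))) := by
  simp only [seriesPartial, ofComponents, PowerSeries.coeff_mk]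
  rw [hD, toQPoly_representative]
  rfl

end Existence

end OnPolynomials

/-! ### The two calculi on quantum Euclidean space: constants and commutation rules -/

section Facts
variable {m : ℕ} {q : ℝ}

theorem kappa_sq' (hq : 0 < q) : kappa m q ^ 2 = ((q : ℂ) ^ m)⁻¹ := by
  rw [kappa, ← Complex.ofReal_pow, ← Real.rpow_natCast, ← Real.rpow_mul hq.le,
    ← Complex.ofReal_pow, ← Complex.ofReal_inv, ← Real.rpow_natCast, ← Real.rpow_neg hq.le]
  congr 2
  push_cast
  ring

theorem kappa_ne_zero (hq : 0 < q) : kappa m q ≠ 0 := by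
  simp [kappa, (Real.rpow_pos_of_pos hq _).ne']

theorem mu_eq (hq : 0 < q) : mu m q = 1 + q ^ 2 * (q ^ m)⁻¹ := by
  rw [mu, Real.rpow_sub hq, Real.rpow_natCast, div_eq_mul_inv]
  norm_num

theorem mu_pos (hq : 0 < q) : 0 < mu m q := by
  rw [mu_eq hq]
  positivity

theorem mu_ne_zero (hq : 0 < q) : ((mu m q : ℝ) : ℂ) ≠ 0 := by
  exact_mod_cast (mu_pos hq).ne'

theorem metric_loop_real : ∃ d : ℝ, tcap (metric m q) (metric m q) = d ∧ (1 ≤ m → 0 < q → 0 < d) := by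
  refine ⟨∑ x, q ^ rho m x * q ^ rho m x, ?_, fun hm hq => ?_⟩
  · rw [tcap_metric]
    push_cast
    refine Finset.sum_congr rfl fun x _ => ?_
    simp [metric, rho_rev]
  · have : Nonempty (Fin m) := ⟨⟨0, hm⟩⟩
    exact Finset.sum_pos (fun x _ => by positivity) Finset.univ_nonempty

theorem metric_loop_ne_zero (hm : 1 ≤ m) (hq : 0 < q) :
    tcap (metric m q) (metric m q) ≠ 0 := by
  obtain ⟨d, h, hd⟩ := metric_loop_real (m := m) (q := q)
  rw [h]
  exact_mod_cast (hd hm hq).ne'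

theorem ofReal_sq_sub_one_ne_zero (hq : 0 < q) (hq1 : q < 1) : (q : ℂ) ^ 2 - 1 ≠ 0 := by
  have : q ^ 2 - 1 ≠ 0 := by nlinarith
  exact_mod_cast this

theorem qNumber_half (hq : 0 < q) :
    ((qNumber (q ^ 2) ((m : ℝ) / 2) : ℝ) : ℂ) = ((q : ℂ) ^ m - 1) / ((q : ℂ) ^ 2 - 1) := by
  rw [qNumber, ← Real.rpow_natCast q 2, ← Real.rpow_mul hq.le]
  have : ((2 : ℕ) : ℝ) * ((m : ℝ) / 2) = m := by push_cast; ring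
  rw [this, Real.rpow_natCast, Real.rpow_natCast]
  push_cast
  rfl

theorem metric_loop_eq (hq : 0 < q) (hq1 : q < 1) : tcap (metric m q) (metric m q) =
    ((mu m q * qNumber (q ^ 2) ((m : ℝ) / 2) : ℝ) : ℂ) := by
  have hqc : (q : ℂ) ≠ 0 := by exact_mod_cast hq.ne'
  rw [(braidSystem m hq hq1).loop_eq hqc (kappa_ne_zero hq) (ofReal_sq_sub_one_ne_zero hq hq1),
    Complex.ofReal_mul, qNumber_half hq, mu_eq hq]
  have : kappa m q ^ 4 = (((q : ℂ) ^ m)⁻¹) ^ 2 := by rw [← kappa_sq' hq]; ring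
  rw [this, kappa_sq' hq]
  have := ofReal_sq_sub_one_ne_zero hq hq1
  push_cast
  field_simp
  ring

/-- Ties the matrix inverse used to define ∂ to the inverse given by the skein relation; for square
matrices a right inverse suffices. -/
theorem inv_braidMatrix (hq : 0 < q) (hq1 : q < 1) :
    (fun i j k l => (braidMatrix m q)⁻¹ (i, j) (k, l)) =
      invCoeff (braidCoeff m q) (metric m q) (q : ℂ) := by
  have hB := braidSystem m hq hq1
  have h : braidMatrix m q * Matrix.of (fun a b => invCoeff (braidCoeff m q) (metric m q) (q : ℂ)
      a.1 a.2 b.1 b.2) = 1 := by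
    ext ⟨i, j⟩ ⟨k, l⟩
    have h1 := hB.act_invCoeff (fun a b => if a = k ∧ b = l then (1 : ℂ) else 0) i j
    have h2 : ∀ (B : Fin m → Fin m → Fin m → Fin m → ℂ) i j,
        tact B (fun a b => if a = k ∧ b = l then (1 : ℂ) else 0) i j = B i j k l := by
      intro B i j
      simp [tact, ite_and]
    simp only [h2] at h1
    rw [Matrix.mul_apply, Fintype.sum_prod_type, Matrix.one_apply]
    simpa [tact, braidCoeff] using h1
  rw [Matrix.inv_eq_right_inv h]
  rfl

/-- The partial derivatives `D` and `D'` on polynomials that correspond to `∂` and `∂̄`. -/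
structure PolyCalculus (m : ℕ) (q : ℝ) (D D' : Fin m → QPoly m q →ₗ[ℂ] QPoly m q) : Prop where
  left : HasQuotient m q (q : ℂ) (braidMatrix m q)⁻¹ D
  right : HasQuotient m q (q : ℂ)⁻¹ (braidMatrix m q) D'

theorem exists_polyCalculus (hm : 1 ≤ m) (hq : 0 < q) (hq1 : q < 1) :
    ∃ D D', PolyCalculus m q D D' := by
  have hqc : (q : ℂ) ≠ 0 := by exact_mod_cast hq.ne'
  have hB := braidSystem m hq hq1
  have hκ := kappa_ne_zero (m := m) hq
  have hδ := metric_loop_ne_zero hm hq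
  have hi := inv_braidMatrix (m := m) hq hq1
  obtain ⟨D, hD⟩ := exists_hasQuotient (m := m) (q := q) (leibnizQuot_rel (c := (q : ℂ))
    (B := (braidMatrix m q)⁻¹) hq (by rw [hi]; exact hB.inverse hqc hκ)
    (inv_ne_zero hqc) (inv_ne_zero hκ) hδ (inv_inv _).symm
    (fun M _ _ S i j => by rw [hi]; exact anti_inv hB hqc hκ hδ S i j))
  obtain ⟨D', hD'⟩ := exists_hasQuotient (m := m) (q := q) (leibnizQuot_rel (c := (q : ℂ)⁻¹)
    (B := braidMatrix m q) hq hB hqc hκ hδ rfl (fun M _ _ S i j => rfl))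
  exact ⟨D, D', hD, hD'⟩

namespace PolyCalculus
variable {D D' : Fin m → QPoly m q →ₗ[ℂ] QPoly m q}

theorem calculus (h : PolyCalculus m q D D') (hm : 1 ≤ m) (hq : 0 < q) (hq1 : q < 1) :
    QCalculus (invCoeff (braidCoeff m q) (metric m q) (q : ℂ)) (metric m q) (q : ℂ)⁻¹
      (kappa m q)⁻¹ (mulCoord m q) D where
  leib i j f := by
    rw [h.left.leib, inv_braidMatrix hq hq1, inv_inv]
  comm i j f := by
    rw [anti_inv (braidSystem m hq hq1) (by exact_mod_cast hq.ne') (kappa_ne_zero hq)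
      (metric_loop_ne_zero hm hq), anti_mulCoord hq]

theorem calculus' (h : PolyCalculus m q D D') (hq : 0 < q) :
    QCalculus (braidCoeff m q) (metric m q) (q : ℂ) (kappa m q) (mulCoord m q) D' where
  leib := h.right.leib
  comm := anti_mulCoord hq

theorem mu_coeff (hq : 0 < q) : 1 + (q : ℂ)⁻¹⁻¹ * ((q : ℂ)⁻¹ * (kappa m q)⁻¹ ^ 2)⁻¹ =
    ((mu m q : ℝ) : ℂ) := by
  rw [mu_eq hq, inv_pow, kappa_sq' hq]
  push_cast
  field_simp

/-- For s = q⁻¹ the cup coefficient is q⁻¹(q^m - 1) divided by a positive loop value. It is not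
positive, so the expression is at least 1. -/
theorem symmetry_ne_zero (hm : 1 ≤ m) (hq : 0 < q) (hq1 : q < 1) :
    1 - (q : ℂ)⁻¹ * cupCoeff (metric m q) (q : ℂ)⁻¹ (kappa m q)⁻¹ ≠ 0 := by
  obtain ⟨d, h, hd⟩ := metric_loop_real (m := m) (q := q)
  have hd := hd hm hq
  rw [cupCoeff, h, inv_pow, kappa_sq' hq, inv_inv]
  have h1 : q ^ m ≤ 1 := pow_le_one₀ hq.le hq1.le
  have h2 : 0 ≤ q⁻¹ - q⁻¹ * q ^ m := by
    rw [← mul_one_sub]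
    exact mul_nonneg (inv_nonneg.mpr hq.le) (by linarith)
  have h3 : 0 < 1 - q⁻¹ * ((q⁻¹ * q ^ m - q⁻¹) / d) := by
    have : 0 ≤ q⁻¹ * ((q⁻¹ - q⁻¹ * q ^ m) / d) := by positivity
    have h4 : q⁻¹ * ((q⁻¹ * q ^ m - q⁻¹) / d) = -(q⁻¹ * ((q⁻¹ - q⁻¹ * q ^ m) / d)) := by ring
    rw [h4]
    linarith
  exact_mod_cast h3.ne'

variable (h : PolyCalculus m q D D')
include h

theorem D_normSq (hm : 1 ≤ m) (hq : 0 < q) (hq1 : q < 1) (i : Fin m) (f : QPoly m q) :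
    D i (normSq m q * f) = ((mu m q : ℝ) : ℂ) • (coord m q i * f) +
      ((q : ℂ) ^ 2) • (normSq m q * D i f) := by
  have := (h.calculus hm hq hq1).D_invariantSq ((braidSystem m hq hq1).inverse
    (by exact_mod_cast hq.ne') (kappa_ne_zero hq)) i f
  rwa [mu_coeff hq, invariantSq_mulCoord, invariantSq_mulCoord, inv_inv] at this

theorem D'_normSq (hq : 0 < q) (hq1 : q < 1) (i : Fin m) (f : QPoly m q) :
    D' i (normSq m q * f) = ((mu m q : ℝ) * (q : ℂ) ^ m * ((q : ℂ) ^ 2)⁻¹) • (coord m q i * f) +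
      ((q : ℂ) ^ 2)⁻¹ • (normSq m q * D' i f) := by
  have := (h.calculus' hq).D_invariantSq (braidSystem m hq hq1) i f
  rw [invariantSq_mulCoord, invariantSq_mulCoord, kappa_sq' hq] at this
  rw [this, mu_eq hq]
  have hqc : (q : ℂ) ≠ 0 := by exact_mod_cast hq.ne'
  rw [mulCoord_apply]
  congr 2
  · push_cast
    field_simp
    ring
  · rw [inv_pow]

theorem normSq_coord (hm : 1 ≤ m) (hq : 0 < q) (hq1 : q < 1) (i : Fin m) (f : QPoly m q) :
    normSq m q * (coord m q i * f) = coord m q i * (normSq m q * f) := by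
  have hqc : (q : ℂ) ≠ 0 := by exact_mod_cast hq.ne'
  have := (h.calculus hm hq hq1).invariantSq_comm_X ((braidSystem m hq hq1).inverse
    hqc (kappa_ne_zero hq)) (inv_ne_zero hqc) (inv_ne_zero (kappa_ne_zero hq))
    (metric_loop_ne_zero hm hq) (symmetry_ne_zero hm hq hq1) i f
  rwa [invariantSq_mulCoord, invariantSq_mulCoord] at this

theorem laplacian_coord (hm : 1 ≤ m) (hq : 0 < q) (hq1 : q < 1) (i : Fin m) (f : QPoly m q) :
    invariantSq (metric m q) D (coord m q i * f) = ((mu m q : ℝ) : ℂ) • D i f +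
      ((q : ℂ) ^ 2) • (coord m q i * invariantSq (metric m q) D f) := by
  have := (h.calculus hm hq hq1).laplacian_X ((braidSystem m hq hq1).inverse
    (by exact_mod_cast hq.ne') (kappa_ne_zero hq)) i f
  rwa [mu_coeff hq, inv_inv] at this

theorem laplacian_D (hm : 1 ≤ m) (hq : 0 < q) (hq1 : q < 1) (i : Fin m) (f : QPoly m q) :
    invariantSq (metric m q) D (D i f) = D i (invariantSq (metric m q) D f) := by
  have hqc : (q : ℂ) ≠ 0 := by exact_mod_cast hq.ne'
  exact (h.calculus hm hq hq1).laplacian_D ((braidSystem m hq hq1).inverse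
    hqc (kappa_ne_zero hq)) (inv_ne_zero hqc) (inv_ne_zero (kappa_ne_zero hq))
    (metric_loop_ne_zero hm hq) (symmetry_ne_zero hm hq hq1) isCyclicVector_one
    h.left.one i f

theorem D_homog (n : ℕ) {f : QPoly m q} (hf : f ∈ homog m q (n + 1)) (i : Fin m) :
    D i f ∈ homog m q n := by
  rw [homog_eq_map] at hf ⊢
  obtain ⟨w, hw, rfl⟩ := hf
  exact ⟨_, wordsPartial_mem q (q : ℂ) (braidMatrix m q)⁻¹ n i w hw, h.left i w⟩

theorem D'_homog (n : ℕ) {f : QPoly m q} (hf : f ∈ homog m q (n + 1)) (i : Fin m) :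
    D' i f ∈ homog m q n := by
  rw [homog_eq_map] at hf ⊢
  obtain ⟨w, hw, rfl⟩ := hf
  exact ⟨_, wordsPartial_mem q (q : ℂ)⁻¹ (braidMatrix m q) n i w hw, h.right i w⟩

theorem D_homog_zero {f : QPoly m q} (hf : f ∈ homog m q 0) (i : Fin m) : D i f = 0 := by
  unfold homog at hf
  rw [pow_zero, Submodule.mem_one] at hf
  obtain ⟨c, rfl⟩ := hf
  rw [Algebra.algebraMap_eq_smul_one, map_smul, h.left.one, smul_zero]

theorem D'_homog_zero {f : QPoly m q} (hf : f ∈ homog m q 0) (i : Fin m) : D' i f = 0 := by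
  unfold homog at hf
  rw [pow_zero, Submodule.mem_one] at hf
  obtain ⟨c, rfl⟩ := hf
  rw [Algebra.algebraMap_eq_smul_one, map_smul, h.right.one, smul_zero]

/-- Constants are fixed, and by `scaling_X` each coordinate contributes a factor q². -/
theorem scaling_homog (hm : 1 ≤ m) (hq : 0 < q) (hq1 : q < 1) (n : ℕ) {f : QPoly m q}
    (hf : f ∈ homog m q n) :
    scaling (metric m q) (q : ℂ)⁻¹ (kappa m q)⁻¹ (mulCoord m q) D f = ((q : ℂ) ^ (2 * n)) • f := by
  have hqc : (q : ℂ) ≠ 0 := by exact_mod_cast hq.ne'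
  induction n generalizing f with
  | zero =>
    have h1 : ∀ i, D i f = 0 := h.D_homog_zero hf
    simp [scaling, euler_apply, invariantSq_apply, h1, tcap]
  | succ n ih =>
    unfold homog at hf ih
    rw [pow_succ'] at hf
    induction hf using Submodule.mul_induction_on' with
    | mem_mul_mem g hg f hf =>
      induction hg using Submodule.span_induction with
      | mem g hg =>
        obtain ⟨j, rfl⟩ := hg
        have := scaling_X (h.calculus hm hq hq1) ((braidSystem m hq hq1).inverse
          hqc (kappa_ne_zero hq)) (inv_ne_zero hqc) (inv_ne_zero (kappa_ne_zero hq))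
          (metric_loop_ne_zero hm hq) (symmetry_ne_zero hm hq hq1)
          (by rw [mu_coeff hq]; exact mu_ne_zero hq) j f
        rw [← mulCoord_apply, this, ih hf, map_smul, smul_smul, inv_inv]
        ring_nf
      | zero => simp
      | add g g' _ _ h h' => rw [add_mul, map_add, h, h', smul_add]
      | smul a g _ h => rw [smul_mul_assoc, map_smul, h, smul_comm]
    | add f _ g _ hf hg => rw [map_add, hf, hg, smul_add]

/-- When Δf = 0 the correction term of `scaling` drops out, and `scaling_homog` can be solved for
the Euler operator. -/
theorem euler_harmonic (hm : 1 ≤ m) (hq : 0 < q) (hq1 : q < 1) (n : ℕ) {f : QPoly m q}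
    (hf : f ∈ homog m q n) (hΔ : invariantSq (metric m q) D f = 0) :
    euler (metric m q) (mulCoord m q) D f =
      (((q : ℂ) ^ (2 * n) - 1) / ((q : ℂ) ^ 2 - 1)) • f := by
  have := h.scaling_homog hm hq hq1 n hf
  simp only [scaling, LinearMap.add_apply, LinearMap.sub_apply, LinearMap.smul_apply,
    LinearMap.id_apply, LinearMap.comp_apply, hΔ, map_zero, smul_zero, sub_zero, inv_inv] at this
  have h1 : ((q : ℂ) ^ 2 - 1) • euler (metric m q) (mulCoord m q) D f =
      ((q : ℂ) ^ (2 * n) - 1) • f := by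
    rw [sub_smul _ _ f, ← this]
    module
  rw [div_eq_inv_mul, mul_smul, ← h1, inv_smul_smul₀ (ofReal_sq_sub_one_ne_zero hq hq1)]

/-- `scaling_derivative` without its Laplacian term. Because of it a single family of harmonic
polynomials ∂^j S serves both calculi. -/
theorem D'_harmonic (hm : 1 ≤ m) (hq : 0 < q) (hq1 : q < 1) (n : ℕ) {f : QPoly m q}
    (hf : f ∈ homog m q (n + 1)) (hΔ : invariantSq (metric m q) D f = 0) (i : Fin m) :
    D' i f = ((q : ℂ) ^ (2 * n))⁻¹ • D i f := by
  have hqc : (q : ℂ) ≠ 0 := by exact_mod_cast hq.ne'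
  have := scaling_derivative (h.calculus' hq) (h.calculus hm hq hq1) (braidSystem m hq hq1)
    hqc (kappa_ne_zero hq) (metric_loop_ne_zero hm hq) (symmetry_ne_zero hm hq hq1)
    (by rw [mu_coeff hq]; exact mu_ne_zero hq) isCyclicVector_one h.left.one h.right.one i f
  rw [hΔ, map_zero, smul_zero, add_zero,
    h.scaling_homog hm hq hq1 n (h.D'_homog n hf i)] at this
  rw [← this, inv_smul_smul₀ (pow_ne_zero _ hqc)]

end PolyCalculus
end Facts

/-! ### Harmonic decomposition -/

section Harmonic
variable {m : ℕ} {q : ℝ}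

/-- The `q²`-number of a natural number, as a complex number. -/
def qInt (q : ℝ) (l : ℕ) : ℂ := ((q : ℂ) ^ (2 * l) - 1) / ((q : ℂ) ^ 2 - 1)

/-- The `q²`-number of `m / 2 + n`, as a complex number. -/
def qHalfInt (m : ℕ) (q : ℝ) (n : ℕ) : ℂ := ((q : ℂ) ^ (m + 2 * n) - 1) / ((q : ℂ) ^ 2 - 1)

/-- The constant `μ` as a complex number. -/
def muC (m : ℕ) (q : ℝ) : ℂ := ((mu m q : ℝ) : ℂ)

theorem qInt_zero : qInt q 0 = 0 := by simp [qInt]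

theorem ofReal_pow_sub_one_ne_zero (hq : 0 < q) (hq1 : q < 1) {n : ℕ} (hn : n ≠ 0) :
    (q : ℂ) ^ n - 1 ≠ 0 := by
  have : q ^ n - 1 ≠ 0 := (sub_neg.mpr (pow_lt_one₀ hq.le hq1 hn)).ne
  exact_mod_cast this

theorem qInt_succ_ne_zero (hq : 0 < q) (hq1 : q < 1) (l : ℕ) : qInt q (l + 1) ≠ 0 :=
  div_ne_zero (ofReal_pow_sub_one_ne_zero hq hq1 (by omega)) (ofReal_sq_sub_one_ne_zero hq hq1)

theorem qHalfInt_ne_zero (hm : 1 ≤ m) (hq : 0 < q) (hq1 : q < 1) (n : ℕ) : qHalfInt m q n ≠ 0 :=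
  div_ne_zero (ofReal_pow_sub_one_ne_zero hq hq1 (by omega)) (ofReal_sq_sub_one_ne_zero hq hq1)

theorem muC_ne_zero (hq : 0 < q) : muC m q ≠ 0 := mu_ne_zero hq

/-- The Laplace operator on polynomials. -/
def lap (D : Fin m → QPoly m q →ₗ[ℂ] QPoly m q) : QPoly m q →ₗ[ℂ] QPoly m q :=
  invariantSq (metric m q) D

/-- Harmonic homogeneous polynomials. -/
def harmonics (D : Fin m → QPoly m q →ₗ[ℂ] QPoly m q) (k : ℕ) : Submodule ℂ (QPoly m q) :=
  homog m q k ⊓ LinearMap.ker (lap D)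

theorem mem_harmonics {D : Fin m → QPoly m q →ₗ[ℂ] QPoly m q} {k : ℕ} {S : QPoly m q} :
    S ∈ harmonics D k ↔ S ∈ homog m q k ∧ lap D S = 0 := Iff.rfl

namespace PolyCalculus
variable {D D' : Fin m → QPoly m q →ₗ[ℂ] QPoly m q}
variable (h : PolyCalculus m q D D') (hm : 1 ≤ m) (hq : 0 < q) (hq1 : q < 1)
include h hm hq hq1

theorem normSq_pow_coord (l : ℕ) (i : Fin m) (f : QPoly m q) :
    normSq m q ^ l * (coord m q i * f) = coord m q i * (normSq m q ^ l * f) := by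
  induction l with
  | zero => simp
  | succ l ih => rw [pow_succ', mul_assoc, ih, h.normSq_coord hm hq hq1, mul_assoc]

theorem D_normSq_pow (l : ℕ) (i : Fin m) (f : QPoly m q) :
    D i (normSq m q ^ l * f) = ((q : ℂ) ^ (2 * l)) • (normSq m q ^ l * D i f) +
      (muC m q * qInt q l) • (normSq m q ^ (l - 1) * (coord m q i * f)) := by
  induction l with
  | zero => simp [qInt_zero]
  | succ l ih =>
    have hne := ofReal_sq_sub_one_ne_zero hq hq1
    rw [pow_succ', mul_assoc, h.D_normSq hm hq hq1, ih, ← h.normSq_pow_coord hm hq hq1,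
      add_tsub_cancel_right, ← muC, mul_assoc (normSq m q) _ (D i f), mul_add, mul_smul_comm,
      mul_smul_comm]
    -- For l = 0 the exponent l - 1 is truncated; the factor `qInt q 0 = 0` makes this harmless.
    have h1 : qInt q l • (normSq m q * (normSq m q ^ (l - 1) * (coord m q i * f))) =
        qInt q l • (normSq m q ^ l * (coord m q i * f)) := by
      cases l with
      | zero => simp [qInt_zero]
      | succ l => rw [add_tsub_cancel_right, pow_succ', mul_assoc]
    rw [mul_smul (muC m q), h1]
    match_scalars
    · unfold qInt
      field_simp
      ring
    · ring

theorem D'_normSq_pow (l : ℕ) (i : Fin m) (f : QPoly m q) :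
    D' i (normSq m q ^ l * f) = ((q : ℂ) ^ (2 * l))⁻¹ • (normSq m q ^ l * D' i f) +
      (muC m q * (q : ℂ) ^ m * ((q : ℂ) ^ (2 * l))⁻¹ * qInt q l) •
        (normSq m q ^ (l - 1) * (coord m q i * f)) := by
  induction l with
  | zero => simp [qInt_zero]
  | succ l ih =>
    have hne := ofReal_sq_sub_one_ne_zero hq hq1
    have hqc : (q : ℂ) ≠ 0 := by exact_mod_cast hq.ne'
    rw [pow_succ', mul_assoc, h.D'_normSq hq hq1, ih, ← h.normSq_pow_coord hm hq hq1,
      add_tsub_cancel_right, ← muC, mul_assoc (normSq m q) _ (D' i f), mul_add, mul_smul_comm,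
      mul_smul_comm]
    have h1 : qInt q l • (normSq m q * (normSq m q ^ (l - 1) * (coord m q i * f))) =
        qInt q l • (normSq m q ^ l * (coord m q i * f)) := by
      cases l with
      | zero => simp [qInt_zero]
      | succ l => rw [add_tsub_cancel_right, pow_succ', mul_assoc]
    rw [mul_smul _ (qInt q l), h1]
    match_scalars
    · unfold qInt
      field_simp
      ring
    · field_simp
      ring

theorem cap_D_coord (f : QPoly m q) :
    tcap (metric m q) (fun i j => D i (coord m q j * f)) =
      (muC m q * qHalfInt m q 0) • f +
        ((q : ℂ) ^ m) • euler (metric m q) (mulCoord m q) D f := by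
  have hqc : (q : ℂ) ≠ 0 := by exact_mod_cast hq.ne'
  have h1 : ∀ i j, D i (coord m q j * f) = _ := fun i j => (h.calculus hm hq hq1).leib i j f
  simp only [h1, tcap_add, tcap_smul, tcap_cup,
    ((braidSystem m hq hq1).inverse hqc (kappa_ne_zero hq)).cap_act, ← euler_apply]
  rw [metric_loop_eq hq hq1, Complex.ofReal_mul, qNumber_half hq, inv_pow, kappa_sq' hq, smul_smul]
  congr 2
  field_simp

/-- After both derivatives have passed the power of r², what remains of S is ΔS = 0 and Euler terms,
which are scalars by `euler_harmonic`. The factor never vanishes for 0 < q < 1, and the harmonic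
decomposition rests on this. -/
theorem lap_normSq_pow (k l : ℕ) {S : QPoly m q} (hS : S ∈ harmonics D k) :
    lap D (normSq m q ^ (l + 1) * S) =
      (muC m q ^ 2 * qInt q (l + 1) * qHalfInt m q (k + l)) • (normSq m q ^ l * S) := by
  obtain ⟨hS, hΔ⟩ := mem_harmonics.mp hS
  have hne := ofReal_sq_sub_one_ne_zero hq hq1
  have hqc : (q : ℂ) ≠ 0 := by exact_mod_cast hq.ne'
  have hE := h.euler_harmonic hm hq hq1 k hS hΔ
  have hN : ∀ j : ℕ, ∀ T : Fin m → Fin m → QPoly m q,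
      tcap (metric m q) (fun a b => normSq m q ^ j * T a b) =
        normSq m q ^ j * tcap (metric m q) T := fun j T => by
    simp [tcap, Finset.mul_sum]
  have h1 : tcap (metric m q) (fun i j => D i (D j S)) = 0 := by
    rw [← invariantSq_apply]; exact hΔ
  have h2 : tcap (metric m q) (fun i j => coord m q i * D j S) =
      euler (metric m q) (mulCoord m q) D S := by rw [euler_apply]; rfl
  have h3 : tcap (metric m q) (fun i j => coord m q i * (coord m q j * S)) = normSq m q * S := by
    rw [← invariantSq_mulCoord, invariantSq_apply]; rfl
  have h4 : qInt q l • (normSq m q ^ (l - 1) * (normSq m q * S)) =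
      qInt q l • (normSq m q ^ l * S) := by
    cases l with
    | zero => simp [qInt_zero]
    | succ l => rw [add_tsub_cancel_right, pow_succ, mul_assoc]
  rw [lap, invariantSq_apply]
  simp only [h.D_normSq_pow hm hq hq1, map_add, map_smul, tcap_add, tcap_smul, hN, h1, h2, h3,
    h.cap_D_coord hm hq hq1, hE, add_tsub_cancel_right, mul_zero, smul_zero, zero_add, mul_add,
    smul_add, mul_smul_comm, mul_smul _ (qInt q l), h4]
  match_scalars
  unfold qHalfInt qInt
  field_simp
  have hμ' : muC m q = 1 + (q : ℂ) ^ 2 * ((q : ℂ) ^ m)⁻¹ := by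
    rw [muC, mu_eq hq]
    push_cast
    rfl
  rw [hμ']
  field_simp
  ring

end PolyCalculus
end Harmonic

/-! ### Existence and uniqueness of the expansion into powers of r² times harmonic polynomials -/

section Decomposition
variable {m : ℕ} {q : ℝ} {D D' : Fin m → QPoly m q →ₗ[ℂ] QPoly m q}

/-- The span of the products of a positive power of the squared norm with a harmonic polynomial, of
total degree `n`. -/
def radialMultiples (D : Fin m → QPoly m q →ₗ[ℂ] QPoly m q) (n : ℕ) : Submodule ℂ (QPoly m q) :=
  Submodule.span ℂ {f | ∃ k l S, S ∈ harmonics D k ∧ k + 2 * (l + 1) = n ∧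
    f = normSq m q ^ (l + 1) * S}

theorem lap_homog_le_one (h : PolyCalculus m q D D') {n : ℕ} (hn : n < 2) {f : QPoly m q}
    (hf : f ∈ homog m q n) : lap D f = 0 := by
  rw [lap, invariantSq_apply]
  have : ∀ i j, D i (D j f) = 0 := fun i j => by
    match n, hn, hf with
    | 0, _, hf => rw [h.D_homog_zero hf, map_zero]
    | 1, _, hf => exact h.D_homog_zero (h.D_homog 0 hf j) i
  simp [this, tcap]

theorem lap_homog (h : PolyCalculus m q D D') (n : ℕ) {f : QPoly m q}
    (hf : f ∈ homog m q (n + 2)) : lap D f ∈ homog m q n := by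
  rw [lap, invariantSq_apply, tcap]
  exact Submodule.sum_mem _ fun i _ => Submodule.sum_mem _ fun j _ =>
    Submodule.smul_mem _ _ (h.D_homog n (h.D_homog (n + 1) hf j) i)

theorem radialMultiples_repr (n : ℕ) {f : QPoly m q} (hf : f ∈ radialMultiples D n) :
    ∃ (L : ℕ) (k : ℕ → ℕ) (S : ℕ → QPoly m q), (∀ l, S l ∈ harmonics D (k l)) ∧
      f = ∑ l ∈ Finset.range L, normSq m q ^ (l + 1) * S l := by
  suffices ∃ (S : ℕ → QPoly m q), (∀ l, S l ∈ harmonics D (n - 2 * (l + 1))) ∧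
      f = ∑ l ∈ Finset.range n, normSq m q ^ (l + 1) * S l by
    obtain ⟨S, hS, hf⟩ := this
    exact ⟨n, _, S, hS, hf⟩
  unfold radialMultiples at hf
  induction hf using Submodule.span_induction with
  | mem f hf =>
    obtain ⟨k, l, S, hS, hkl, rfl⟩ := hf
    refine ⟨fun j => if j = l then S else 0, fun j => ?_, ?_⟩
    · by_cases hj : j = l
      · subst hj
        simpa [show n - 2 * (j + 1) = k by omega] using hS
      · simp [hj]
    · rw [Finset.sum_eq_single l]
      · simp
      · intro j _ hj
        simp [hj]
      · intro hl
        exact absurd (Finset.mem_range.mpr (by omega)) hl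
  | zero => exact ⟨fun _ => 0, fun _ => Submodule.zero_mem _, by simp⟩
  | add f g _ _ hf hg =>
    obtain ⟨S, hS, rfl⟩ := hf
    obtain ⟨T, hT, rfl⟩ := hg
    exact ⟨fun l => S l + T l, fun l => Submodule.add_mem _ (hS l) (hT l), by
      simp [mul_add, Finset.sum_add_distrib]⟩
  | smul c f _ hf =>
    obtain ⟨S, hS, rfl⟩ := hf
    exact ⟨fun l => c • S l, fun l => Submodule.smul_mem _ _ (hS l), by simp [Finset.smul_sum]⟩

namespace PolyCalculus
variable (h : PolyCalculus m q D D') (hm : 1 ≤ m) (hq : 0 < q) (hq1 : q < 1)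
include h hm hq hq1

/-- By induction Δf is a combination of terms r^{2l} S with S harmonic, and by `lap_normSq_pow` each
of them is the Laplacian of a multiple of r^{2l+2} S. Subtracting these multiples from f leaves a
harmonic polynomial. -/
theorem homog_le (n : ℕ) : homog m q n ≤ harmonics D n ⊔ radialMultiples D n := by
  induction n using Nat.strong_induction_on with
  | _ n ih =>
    intro f hf
    rcases Nat.lt_or_ge n 2 with hn | hn
    · exact Submodule.mem_sup_left ⟨hf, lap_homog_le_one h hn hf⟩
    obtain ⟨n, rfl⟩ := Nat.exists_eq_add_of_le' hn
    have hs : ∀ g ∈ harmonics D n ⊔ radialMultiples D n,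
        ∃ f' ∈ radialMultiples D (n + 2), lap D f' = g ∧ f' ∈ homog m q (n + 2) := by
      have hgen : ∀ k l, k + 2 * l = n → ∀ S ∈ harmonics D k,
          ∃ f' ∈ radialMultiples D (n + 2), lap D f' = normSq m q ^ l * S ∧
            f' ∈ homog m q (n + 2) := by
        intro k l hkl S hS
        have hne : muC m q ^ 2 * qInt q (l + 1) * qHalfInt m q (k + l) ≠ 0 :=
          mul_ne_zero (mul_ne_zero (pow_ne_zero _ (muC_ne_zero hq)) (qInt_succ_ne_zero hq hq1 l))
            (qHalfInt_ne_zero hm hq hq1 _)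
        refine ⟨(muC m q ^ 2 * qInt q (l + 1) * qHalfInt m q (k + l))⁻¹ •
          (normSq m q ^ (l + 1) * S), Submodule.smul_mem _ _ (Submodule.subset_span
          ⟨k, l, S, hS, by omega, rfl⟩), ?_, Submodule.smul_mem _ _ ?_⟩
        · rw [map_smul, h.lap_normSq_pow hm hq hq1 k l hS, inv_smul_smul₀ hne]
        · have := mul_mem_homog (normSq_pow_mem m q (l + 1)) hS.1
          rwa [show 2 * (l + 1) + k = n + 2 by omega] at this
      intro g hg
      obtain ⟨S, hS, g, hgr, rfl⟩ := Submodule.mem_sup.mp hg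
      obtain ⟨f1, hf1, hf1', hf1''⟩ := hgen n 0 (by omega) S hS
      clear hg
      suffices ∃ f' ∈ radialMultiples D (n + 2), lap D f' = g ∧ f' ∈ homog m q (n + 2) by
        obtain ⟨f2, hf2, hf2', hf2''⟩ := this
        exact ⟨f1 + f2, Submodule.add_mem _ hf1 hf2, by rw [map_add, hf1', hf2']; simp,
          Submodule.add_mem _ hf1'' hf2''⟩
      unfold radialMultiples at hgr
      induction hgr using Submodule.span_induction with
      | mem g hg =>
        obtain ⟨k, l, S, hS, hkl, rfl⟩ := hg
        exact hgen k (l + 1) hkl S hS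
      | zero => exact ⟨0, Submodule.zero_mem _, map_zero _, Submodule.zero_mem _⟩
      | add g g' _ _ ha hb =>
        obtain ⟨a, ha, ha', ha''⟩ := ha
        obtain ⟨b, hb, hb', hb''⟩ := hb
        exact ⟨a + b, Submodule.add_mem _ ha hb, by rw [map_add, ha', hb'],
          Submodule.add_mem _ ha'' hb''⟩
      | smul c g _ ha =>
        obtain ⟨a, ha, ha', ha''⟩ := ha
        exact ⟨c • a, Submodule.smul_mem _ c ha, by rw [map_smul, ha'],
          Submodule.smul_mem _ c ha''⟩
    obtain ⟨f', hf', hf'', hf3⟩ := hs _ (ih n (by omega) (lap_homog h n hf))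
    rw [← sub_add_cancel f f']
    exact Submodule.add_mem_sup ⟨Submodule.sub_mem _ hf hf3, by
      show lap D (f - f') = 0
      rw [map_sub, hf'', sub_self]⟩ hf'

/-- The constant is chosen before `S`: it depends on the degree only, as needed for the linear
coefficient maps of `exists_harmonicCoeff`. -/
theorem lap_pow_normSq_pow (k i j : ℕ) : ∃ c : ℂ, c ≠ 0 ∧ ∀ S ∈ harmonics D k,
    ((lap D : Module.End ℂ (QPoly m q)) ^ i) (normSq m q ^ (i + j) * S) =
      c • (normSq m q ^ j * S) := by
  induction i with
  | zero => exact ⟨1, one_ne_zero, by simp⟩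
  | succ i ih =>
    obtain ⟨c, hc, hc'⟩ := ih
    refine ⟨(muC m q ^ 2 * qInt q (i + j + 1) * qHalfInt m q (k + (i + j))) * c,
      mul_ne_zero (mul_ne_zero (mul_ne_zero (pow_ne_zero _ (muC_ne_zero hq))
        (qInt_succ_ne_zero hq hq1 _)) (qHalfInt_ne_zero hm hq hq1 _)) hc, fun S hS => ?_⟩
    rw [pow_succ, Module.End.mul_apply, show i + 1 + j = i + j + 1 by ring,
      h.lap_normSq_pow hm hq hq1 k (i + j) hS, map_smul, hc' S hS, smul_smul]

theorem lap_pow_eq_zero (k i l : ℕ) (hl : l < i) {S : QPoly m q} (hS : S ∈ harmonics D k) :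
    ((lap D : Module.End ℂ (QPoly m q)) ^ i) (normSq m q ^ l * S) = 0 := by
  obtain ⟨t, rfl⟩ := Nat.exists_eq_add_of_lt hl
  obtain ⟨c, -, hc⟩ := h.lap_pow_normSq_pow hm hq hq1 k l 0
  specialize hc S hS
  rw [show l + t + 1 = (t + 1) + l by ring, pow_add, Module.End.mul_apply]
  rw [add_zero, pow_zero, one_mul] at hc
  rw [hc, map_smul, pow_succ, Module.End.mul_apply, hS.2, map_zero, smul_zero]

/-- The highest power of Δ that does not kill the top term kills all the others and isolates the top
coefficient. The degrees `k l` are arbitrary. -/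
theorem harmonic_sum_eq_zero (L : ℕ) (k : ℕ → ℕ) (S : ℕ → QPoly m q)
    (hS : ∀ l, S l ∈ harmonics D (k l)) (h0 : ∑ l ∈ Finset.range L, normSq m q ^ l * S l = 0) :
    ∀ l < L, S l = 0 := by
  induction L with
  | zero => intro l hl; omega
  | succ L ih =>
    have hL : S L = 0 := by
      have h1 := congrArg ((lap D : Module.End ℂ (QPoly m q)) ^ L) h0
      rw [Finset.sum_range_succ, map_add, map_sum, map_zero, Finset.sum_eq_zero, zero_add] at h1
      · obtain ⟨c, hc, hc'⟩ := h.lap_pow_normSq_pow hm hq hq1 (k L) L 0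
        specialize hc' _ (hS L)
        rw [add_zero, pow_zero, one_mul] at hc'
        rw [hc'] at h1
        exact (smul_eq_zero.mp h1).resolve_left hc
      · intro l hl
        exact h.lap_pow_eq_zero hm hq hq1 (k l) L l (Finset.mem_range.mp hl) (hS l)
    rw [Finset.sum_range_succ, hL, mul_zero, add_zero] at h0
    intro l hl
    rcases Nat.lt_succ_iff_lt_or_eq.mp hl with hl | rfl
    · exact ih h0 l hl
    · exact hL

theorem disjoint_harmonics (n : ℕ) : Disjoint (harmonics D n) (radialMultiples D n) := by
  rw [Submodule.disjoint_def]
  intro f hf hf'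
  obtain ⟨L, k, S, hS, hfS⟩ := radialMultiples_repr n hf'
  have h1 := h.harmonic_sum_eq_zero hm hq hq1 (L + 1) (fun l => l.casesOn n k)
    (fun l => l.casesOn (-f) S) (fun l => by
      cases l with
      | zero => exact Submodule.neg_mem _ hf
      | succ l => exact hS l) (by
      rw [Finset.sum_range_succ']
      simp [hfS])
  simpa using h1 0 (by omega)

theorem exists_harmonicProj (n : ℕ) : ∃ φ : QPoly m q →ₗ[ℂ] QPoly m q,
    (∀ S ∈ harmonics D n, φ S = S) ∧ ∀ f ∈ radialMultiples D n, φ f = 0 := by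
  obtain ⟨W, hW, hc⟩ := (h.disjoint_harmonics hm hq hq1 n).exists_isCompl
  refine ⟨W.subtype.comp (Submodule.projectionOnto W _ hc), fun S hS => ?_, fun f hf => ?_⟩
  · exact congrArg Subtype.val (Submodule.projectionOnto_apply_left hc ⟨S, hW hS⟩)
  · simpa using hf

/-- The coefficients of the harmonic decomposition depend linearly on the polynomial. -/
theorem exists_harmonicCoeff (k i : ℕ) : ∃ P : QPoly m q →ₗ[ℂ] QPoly m q,
    (∀ S ∈ harmonics D k, P (normSq m q ^ i * S) = S) ∧
    ∀ k' l S, S ∈ harmonics D k' → k' + 2 * l = k + 2 * i → l ≠ i →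
      P (normSq m q ^ l * S) = 0 := by
  obtain ⟨φ, hφ, hφ'⟩ := h.exists_harmonicProj hm hq hq1 k
  obtain ⟨c, hc, hc'⟩ := h.lap_pow_normSq_pow hm hq hq1 k i 0
  -- Δ^i kills the terms with l < i. On those with l > i it leaves a positive power of r² times a
  -- harmonic polynomial, which the projection `φ` removes.
  refine ⟨c⁻¹ • (φ ∘ₗ ((lap D : Module.End ℂ (QPoly m q)) ^ i)), fun S hS => ?_,
    fun k' l S hS hkl hl => ?_⟩
  · have := hc' S hS
    rw [add_zero, pow_zero, one_mul] at this
    rw [LinearMap.smul_apply, LinearMap.comp_apply, this, map_smul, hφ S hS,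
      inv_smul_smul₀ hc]
  · rw [LinearMap.smul_apply, LinearMap.comp_apply]
    rcases Nat.lt_or_gt_of_ne hl with hl | hl
    · rw [h.lap_pow_eq_zero hm hq hq1 k' i l hl hS, map_zero, smul_zero]
    · obtain ⟨t, rfl⟩ := Nat.exists_eq_add_of_lt hl
      obtain ⟨d, -, hd⟩ := h.lap_pow_normSq_pow hm hq hq1 k' i (t + 1)
      rw [add_assoc, hd S hS, map_smul, hφ' _ (Submodule.subset_span
        ⟨k', t, S, hS, by omega, rfl⟩), smul_zero, smul_zero]

end PolyCalculus
end Decomposition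

/-! ### Products of a homogeneous polynomial with a radial series -/

section Sphere
variable {m : ℕ} {q : ℝ}

/-- The series `∑_i s_i 𝐱^{2i} S`, where `S` is regarded as a polynomial of degree `k`. -/
def sphere (m : ℕ) (q : ℝ) (k : ℕ) :
    QPoly m q →ₗ[ℂ] PowerSeries ℂ →ₗ[ℂ] PowerSeries (QPoly m q) :=
  LinearMap.mk₂ ℂ (fun S s => PowerSeries.mk fun n => if k ≤ n ∧ Even (n - k) then
      PowerSeries.coeff ((n - k) / 2) s • (normSq m q ^ ((n - k) / 2) * S) else 0)
    (fun S S' s => by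
      ext n
      simp only [PowerSeries.coeff_mk, map_add]
      split_ifs <;> simp [mul_add])
    (fun c S s => by
      ext n
      simp only [PowerSeries.coeff_mk, PowerSeries.coeff_smul]
      split_ifs <;> simp [smul_comm c])
    (fun S s s' => by
      ext n
      simp only [PowerSeries.coeff_mk, map_add]
      split_ifs <;> simp [add_smul])
    (fun c S s => by
      ext n
      simp only [PowerSeries.coeff_mk, PowerSeries.coeff_smul]
      split_ifs <;> simp [mul_smul])

theorem coeff_sphere (k n : ℕ) (S : QPoly m q) (s : PowerSeries ℂ) :
    PowerSeries.coeff n (sphere m q k S s) = if k ≤ n ∧ Even (n - k) then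
      PowerSeries.coeff ((n - k) / 2) s • (normSq m q ^ ((n - k) / 2) * S) else 0 := by
  rw [sphere, LinearMap.mk₂_apply, PowerSeries.coeff_mk]

theorem coeff_sphere_add (k i : ℕ) (S : QPoly m q) (s : PowerSeries ℂ) :
    PowerSeries.coeff (k + 2 * i) (sphere m q k S s) =
      PowerSeries.coeff i s • (normSq m q ^ i * S) := by
  rw [coeff_sphere, if_pos ⟨by omega, by simp⟩]
  simp

theorem coeff_sphere_eq_zero {k n : ℕ} (hn : ∀ i, n ≠ k + 2 * i) (S : QPoly m q)
    (s : PowerSeries ℂ) : PowerSeries.coeff n (sphere m q k S s) = 0 := by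
  rw [coeff_sphere, if_neg]
  rintro ⟨h1, i, hi⟩
  exact hn i (by omega)

/-- Multiplication by a coordinate, on series. -/
def coordOp (m : ℕ) (q : ℝ) (j : Fin m) : Module.End ℂ (PowerSeries (QPoly m q)) where
  toFun f := PowerSeries.mk fun n => if n = 0 then 0 else coord m q j * PowerSeries.coeff (n - 1) f
  map_add' f g := by
    ext n
    simp only [PowerSeries.coeff_mk, map_add]
    split_ifs <;> simp [mul_add]
  map_smul' c f := by
    ext n
    simp only [PowerSeries.coeff_mk, PowerSeries.coeff_smul]
    split_ifs <;> simp

/-- A linear map lowering the degree by one, on series. -/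
def derivOp (d : QPoly m q →ₗ[ℂ] QPoly m q) : Module.End ℂ (PowerSeries (QPoly m q)) where
  toFun f := PowerSeries.mk fun n => d (PowerSeries.coeff (n + 1) f)
  map_add' f g := by ext n; simp
  map_smul' c f := by ext n; simp

/-- The dilatation acting on degree `n` as `r ^ n`. -/
def dilOp (m : ℕ) (q : ℝ) (r : ℂ) : Module.End ℂ (PowerSeries (QPoly m q)) where
  toFun f := PowerSeries.mk fun n => r ^ n • PowerSeries.coeff n f
  map_add' f g := by ext n; simp
  map_smul' c f := by ext n; simp [smul_comm c]

@[simp] theorem coeff_coordOp_zero (j : Fin m) (f : PowerSeries (QPoly m q)) :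
    PowerSeries.coeff 0 (coordOp m q j f) = 0 := by simp [coordOp]

@[simp] theorem coeff_coordOp_succ (n : ℕ) (j : Fin m) (f : PowerSeries (QPoly m q)) :
    PowerSeries.coeff (n + 1) (coordOp m q j f) = coord m q j * PowerSeries.coeff n f := by
  simp [coordOp]

@[simp] theorem coeff_derivOp (n : ℕ) (d : QPoly m q →ₗ[ℂ] QPoly m q)
    (f : PowerSeries (QPoly m q)) :
    PowerSeries.coeff n (derivOp d f) = d (PowerSeries.coeff (n + 1) f) := by
  simp [derivOp]

@[simp] theorem coeff_dilOp (n : ℕ) (r : ℂ) (f : PowerSeries (QPoly m q)) :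
    PowerSeries.coeff n (dilOp m q r f) = r ^ n • PowerSeries.coeff n f := by
  simp [dilOp]

/-- The `q²`-derivative of a series. -/
def qDeriv (q : ℝ) (s : PowerSeries ℂ) : PowerSeries ℂ :=
  PowerSeries.mk fun i => qInt q (i + 1) * PowerSeries.coeff (i + 1) s

/-- The `q⁻²`-derivative of a series. -/
def qDerivBar (q : ℝ) (s : PowerSeries ℂ) : PowerSeries ℂ :=
  PowerSeries.mk fun i => ((q : ℂ) ^ (2 * (i + 1)))⁻¹ * qInt q (i + 1) *
    PowerSeries.coeff (i + 1) s

theorem dilOp_sphere (r : ℂ) (k : ℕ) (S : QPoly m q) (s : PowerSeries ℂ) :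
    dilOp m q r (sphere m q k S s) = r ^ k • sphere m q k S (PowerSeries.rescale (r ^ 2) s) := by
  ext n
  by_cases hn : ∃ i, n = k + 2 * i
  · obtain ⟨i, rfl⟩ := hn
    rw [coeff_dilOp, PowerSeries.coeff_smul, coeff_sphere_add, coeff_sphere_add,
      PowerSeries.coeff_rescale, smul_smul, smul_smul, pow_add, pow_mul, mul_assoc]
  · push Not at hn
    rw [coeff_dilOp, PowerSeries.coeff_smul, coeff_sphere_eq_zero hn, coeff_sphere_eq_zero hn,
      smul_zero, smul_zero]

theorem sphere_normSq_mul (k : ℕ) (S : QPoly m q) (s : PowerSeries ℂ) :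
    sphere m q (k + 2) (normSq m q * S) s = sphere m q k S (PowerSeries.X * s) := by
  ext n
  by_cases hn : ∃ i, n = k + 2 * i
  · obtain ⟨i, rfl⟩ := hn
    rcases i with _ | i
    · rw [coeff_sphere_eq_zero (by intro i; omega), coeff_sphere_add]
      simp
    · rw [coeff_sphere_add, show k + 2 * (i + 1) = k + 2 + 2 * i by ring, coeff_sphere_add,
        PowerSeries.coeff_succ_X_mul, pow_succ, mul_assoc]
  · push Not at hn
    rw [coeff_sphere_eq_zero hn, coeff_sphere_eq_zero]
    intro i hi
    exact hn (i + 1) (by omega)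

namespace PolyCalculus
variable {D D' : Fin m → QPoly m q →ₗ[ℂ] QPoly m q}
variable (h : PolyCalculus m q D D') (hm : 1 ≤ m) (hq : 0 < q) (hq1 : q < 1)
include h hm hq hq1

theorem coordOp_sphere (j : Fin m) (k : ℕ) (S : QPoly m q) (s : PowerSeries ℂ) :
    coordOp m q j (sphere m q k S s) = sphere m q (k + 1) (coord m q j * S) s := by
  ext n
  rcases n with _ | n
  · rw [coeff_coordOp_zero, coeff_sphere_eq_zero (by intro i; omega)]
  by_cases hn : ∃ i, n = k + 2 * i
  · obtain ⟨i, rfl⟩ := hn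
    rw [coeff_coordOp_succ, show k + 2 * i + 1 = k + 1 + 2 * i by ring, coeff_sphere_add,
      coeff_sphere_add, mul_smul_comm, h.normSq_pow_coord hm hq hq1]
  · push Not at hn
    rw [coeff_coordOp_succ, coeff_sphere_eq_zero hn, mul_zero, coeff_sphere_eq_zero]
    intro i hi
    exact hn i (by omega)

theorem normSq_mul_comm (f : QPoly m q) : normSq m q * f = f * normSq m q := by
  obtain ⟨w, rfl⟩ : ∃ w, toQPoly m q w = f := RingQuot.mkAlgHom_surjective ℂ _ f
  induction w using FreeAlgebra.induction with
  | grade0 a => rw [AlgHom.commutes, Algebra.commutes]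
  | grade1 j =>
    have := h.normSq_coord hm hq hq1 j 1
    rwa [mul_one, mul_one] at this
  | mul f g hf hg => rw [map_mul, ← mul_assoc, hf, mul_assoc, hg, mul_assoc]
  | add f g hf hg => rw [map_add, mul_add, hf, hg, add_mul]

/-- Moving ∂ past r^{2i} gives q^{2i}, hence the rescaling by q²; differentiating r^{2i} gives the
q²-derivative. For k = 0 the truncated degree k - 1 does no harm because ∂^j S = 0. -/
theorem derivOp_sphere (j : Fin m) (k : ℕ) {S : QPoly m q} (hS : S ∈ homog m q k)
    (s : PowerSeries ℂ) : derivOp (D j) (sphere m q k S s) =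
      sphere m q (k - 1) (D j S) (PowerSeries.rescale ((q : ℂ) ^ 2) s) +
        muC m q • sphere m q (k + 1) (coord m q j * S) (qDeriv q s) := by
  ext n
  rw [coeff_derivOp, map_add, PowerSeries.coeff_smul]
  by_cases hn : ∃ i, n + 1 = k + 2 * i
  · obtain ⟨i, hi⟩ := hn
    rw [hi, coeff_sphere_add, map_smul, h.D_normSq_pow hm hq hq1, smul_add]
    congr 1
    · rcases k with _ | k
      · rw [h.D_homog_zero hS]
        simp
      · obtain rfl : n = k + 2 * i := by omega
        rw [add_tsub_cancel_right, coeff_sphere_add, PowerSeries.coeff_rescale, smul_smul, pow_mul,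
          mul_comm]
    · rcases i with _ | i
      · rw [qInt_zero, coeff_sphere_eq_zero]
        · simp
        · intro i; omega
      · obtain rfl : n = k + 1 + 2 * i := by omega
        rw [coeff_sphere_add, qDeriv, PowerSeries.coeff_mk, smul_smul, smul_smul,
          add_tsub_cancel_right]
        congr 1
        ring
  · push Not at hn
    rw [coeff_sphere_eq_zero hn, map_zero, coeff_sphere_eq_zero (k := k + 1), smul_zero, add_zero]
    · rcases k with _ | k
      · rw [h.D_homog_zero hS]
        simp
      · rw [coeff_sphere_eq_zero]
        intro i hi
        exact hn i (by omega)
    · intro i hi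
      exact hn (i + 1) (by omega)

/-- Here `S` has to be harmonic and not merely homogeneous: `D'_harmonic` is used to write ∂̄^j S as
a multiple of ∂^j S. -/
theorem derivOp_bar_sphere (j : Fin m) (k : ℕ) {S : QPoly m q} (hS : S ∈ harmonics D k)
    (s : PowerSeries ℂ) : derivOp (D' j) (sphere m q k S s) =
      ((q : ℂ) ^ (2 * (k - 1)))⁻¹ •
        sphere m q (k - 1) (D j S) (PowerSeries.rescale ((q : ℂ) ^ 2)⁻¹ s) +
        (muC m q * (q : ℂ) ^ m) • sphere m q (k + 1) (coord m q j * S) (qDerivBar q s) := by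
  ext n
  rw [coeff_derivOp, map_add, PowerSeries.coeff_smul, PowerSeries.coeff_smul]
  by_cases hn : ∃ i, n + 1 = k + 2 * i
  · obtain ⟨i, hi⟩ := hn
    rw [hi, coeff_sphere_add, map_smul, h.D'_normSq_pow hm hq hq1, smul_add]
    congr 1
    · rcases k with _ | k
      · rw [h.D_homog_zero hS.1, h.D'_homog_zero hS.1]
        simp
      · obtain rfl : n = k + 2 * i := by omega
        rw [add_tsub_cancel_right, coeff_sphere_add, PowerSeries.coeff_rescale,
          h.D'_harmonic hm hq hq1 k hS.1 hS.2, smul_smul, mul_smul_comm, smul_smul, smul_smul,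
          inv_pow, pow_mul (q : ℂ) 2 i]
        congr 1
        ring
    · rcases i with _ | i
      · rw [qInt_zero, coeff_sphere_eq_zero]
        · simp
        · intro i; omega
      · obtain rfl : n = k + 1 + 2 * i := by omega
        rw [coeff_sphere_add, qDerivBar, PowerSeries.coeff_mk, smul_smul, smul_smul,
          add_tsub_cancel_right]
        congr 1
        ring
  · push Not at hn
    rw [coeff_sphere_eq_zero hn, map_zero, coeff_sphere_eq_zero (k := k + 1), smul_zero, add_zero]
    · rcases k with _ | k
      · rw [h.D_homog_zero hS.1]
        simp
      · rw [coeff_sphere_eq_zero, smul_zero]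
        intro i hi
        exact hn i (by omega)
    · intro i hi
      exact hn (i + 1) (by omega)

end PolyCalculus
end Sphere

/-! ### Transfer between elements of O_q and plain power series over the polynomials -/

section Bridge
variable {m : ℕ} {q : ℝ}

theorem coe_dilatation (u : ℝ) (f : QSeries m q) (hq : 0 < q) :
    (dilatation u f : PowerSeries (QPoly m q)) =
      dilOp m q (((q ^ (2 * u) : ℝ) : ℂ)) (f : PowerSeries (QPoly m q)) := by
  ext n
  rw [coeff_dilOp, dilatation, ofComponents]
  simp only [PowerSeries.coeff_mk, component, Submodule.coe_smul]
  rw [Real.rpow_mul hq.le, Real.rpow_natCast, Complex.ofReal_pow]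

theorem coe_seriesCoord_mul (j : Fin m) (f : QSeries m q) :
    ((seriesCoord j * f : QSeries m q) : PowerSeries (QPoly m q)) =
      coordOp m q j (f : PowerSeries (QPoly m q)) := by
  have hc : ∀ n, PowerSeries.coeff n ((seriesCoord j : QSeries m q) : PowerSeries (QPoly m q)) =
      if n = 1 then coord m q j else 0 := fun n => by
    simp only [seriesCoord, ofHomog, ofComponents, PowerSeries.coeff_mk]
    by_cases hn : 1 = n
    · subst hn; simp
    · rw [dif_neg hn, if_neg (Ne.symm hn)]; rfl
  ext n
  rw [MulMemClass.coe_mul, PowerSeries.coeff_mul]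
  rcases n with _ | n
  · simp [hc]
  · rw [Finset.sum_eq_single (1, n)]
    · simp [hc]
    · rintro ⟨a, b⟩ hab hne
      have : a ≠ 1 := by
        rintro rfl
        rw [Finset.HasAntidiagonal.mem_antidiagonal] at hab
        exact hne (by simp; omega)
      simp [hc, this]
    · intro hn
      exact absurd (Finset.HasAntidiagonal.mem_antidiagonal.mpr (add_comm 1 n)) hn

theorem coeff_radial (s : PowerSeries ℂ) (n : ℕ) :
    PowerSeries.coeff n ((radial s : QSeries m q) : PowerSeries (QPoly m q)) =
      if Even n then PowerSeries.coeff (n / 2) s • normSq m q ^ (n / 2) else 0 := by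
  simp only [radial, ofComponents, PowerSeries.coeff_mk]
  split_ifs <;> rfl

theorem coeff_ofHomog (k n : ℕ) (S : homog m q k) :
    PowerSeries.coeff n (ofHomog k S : PowerSeries (QPoly m q)) =
      if n = k then (S : QPoly m q) else 0 := by
  simp only [ofHomog, ofComponents, PowerSeries.coeff_mk]
  by_cases hn : k = n
  · subst hn; simp
  · rw [dif_neg hn, if_neg (Ne.symm hn)]; rfl

theorem coe_radial (s : PowerSeries ℂ) :
    ((radial s : QSeries m q) : PowerSeries (QPoly m q)) = sphere m q 0 1 s := by
  ext n
  rw [coeff_radial, coeff_sphere]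
  simp

namespace PolyCalculus
variable {D D' : Fin m → QPoly m q →ₗ[ℂ] QPoly m q}
variable (h : PolyCalculus m q D D')
include h

theorem coe_partialD (i : Fin m) (f : QSeries m q) :
    (partialD i f : PowerSeries (QPoly m q)) = derivOp (D i) (f : PowerSeries (QPoly m q)) := by
  ext n
  rw [coeff_derivOp, partialD, h.left.coeff_seriesPartial]

theorem coe_partialBar (i : Fin m) (f : QSeries m q) :
    (partialBar i f : PowerSeries (QPoly m q)) = derivOp (D' i) (f : PowerSeries (QPoly m q)) := by
  ext n
  rw [coeff_derivOp, partialBar, h.right.coeff_seriesPartial]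

theorem mem_sphericalHarmonics (k : ℕ) (S : homog m q k) :
    S ∈ sphericalHarmonics m q k ↔ (S : QPoly m q) ∈ harmonics D k := by
  have hc : ∀ n, PowerSeries.coeff n (laplacian (ofHomog k S) : PowerSeries (QPoly m q)) =
      lap D (PowerSeries.coeff (n + 2) (ofHomog k S : PowerSeries (QPoly m q))) := fun n => by
    rw [laplacian, lap, invariantSq_apply, tcap]
    simp only [AddSubmonoidClass.coe_finsetSum, map_sum]
    refine Finset.sum_congr rfl fun i _ => Finset.sum_congr rfl fun j _ => ?_
    rw [SetLike.val_smul, PowerSeries.coeff_smul, h.coe_partialD, h.coe_partialD, coeff_derivOp,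
      coeff_derivOp]
  have hiff : S ∈ sphericalHarmonics m q k ↔
      ∀ n, lap D (PowerSeries.coeff (n + 2) (ofHomog k S : PowerSeries (QPoly m q))) = 0 := by
    rw [sphericalHarmonics, Set.mem_ofPred_eq, ← Subtype.coe_inj, PowerSeries.ext_iff]
    simp only [hc]
    rfl
  rw [hiff, mem_harmonics]
  constructor
  · intro hS
    refine ⟨S.2, ?_⟩
    rcases Nat.lt_or_ge k 2 with hk | hk
    · exact lap_homog_le_one h hk S.2
    · obtain ⟨n, rfl⟩ := Nat.exists_eq_add_of_le' hk
      have := hS n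
      rwa [coeff_ofHomog, if_pos rfl] at this
  · rintro ⟨-, hS⟩ n
    rw [coeff_ofHomog]
    split_ifs with hn
    · exact hS
    · exact map_zero _

variable (hm : 1 ≤ m) (hq : 0 < q) (hq1 : q < 1)
include hm hq hq1

theorem normSq_pow_comm (l : ℕ) (f : QPoly m q) : normSq m q ^ l * f = f * normSq m q ^ l :=
  (show Commute (normSq m q) f from h.normSq_mul_comm hm hq hq1 f).pow_left l

theorem coe_ofHomog_mul_radial (k : ℕ) (S : homog m q k) (s : PowerSeries ℂ) :
    ((ofHomog k S * radial s : QSeries m q) : PowerSeries (QPoly m q)) =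
      sphere m q k (S : QPoly m q) s := by
  ext n
  rw [MulMemClass.coe_mul, PowerSeries.coeff_mul, coeff_sphere]
  by_cases hn : k ≤ n
  · rw [Finset.sum_eq_single (k, n - k)]
    · rw [coeff_ofHomog, coeff_radial, if_pos rfl]
      simp only [hn, true_and]
      split_ifs
      · rw [mul_smul_comm, h.normSq_pow_comm hm hq hq1]
      · rw [mul_zero]
    · rintro ⟨a, b⟩ hab hne
      rw [Finset.HasAntidiagonal.mem_antidiagonal] at hab
      rw [coeff_ofHomog, if_neg, zero_mul]
      rintro rfl
      exact hne (by simp at hab ⊢; omega)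
    · intro hn'
      exact absurd (Finset.HasAntidiagonal.mem_antidiagonal.mpr (Nat.add_sub_of_le hn)) hn'
  · rw [if_neg (fun h' => hn h'.1)]
    refine Finset.sum_eq_zero ?_
    rintro ⟨a, b⟩ hab
    rw [Finset.HasAntidiagonal.mem_antidiagonal] at hab
    rw [coeff_ofHomog, if_neg (by simp at hab ⊢; omega), zero_mul]

theorem D_mem_harmonics (k : ℕ) {S : QPoly m q} (hS : S ∈ harmonics D k) (j : Fin m) :
    D j S ∈ harmonics D (k - 1) := by
  rcases k with _ | k
  · rw [h.D_homog_zero hS.1]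
    exact Submodule.zero_mem _
  · refine ⟨h.D_homog k hS.1 j, ?_⟩
    have := h.laplacian_D hm hq hq1 j S
    show lap D (D j S) = 0
    rw [lap, this, ← lap, hS.2, map_zero]

/-- The decomposition of the product of a coordinate and a harmonic polynomial. -/
theorem exists_coord_mul (k : ℕ) {S : QPoly m q} (hS : S ∈ harmonics D k) (j : Fin m) :
    ∃ T ∈ harmonics D (k + 1), ∀ s, sphere m q (k + 1) (coord m q j * S) s =
      sphere m q (k + 1) T s + (muC m q * qHalfInt m q (k - 1))⁻¹ •
        sphere m q (k - 1) (D j S) (PowerSeries.X * s) := by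
  have hmem : coord m q j * S ∈ homog m q (k + 1) := by
    rw [add_comm]
    exact mul_mem_homog (coord_mem m q j) hS.1
  rcases k with _ | k
  · refine ⟨coord m q j * S, ⟨hmem, lap_homog_le_one h (by norm_num) hmem⟩, fun s => ?_⟩
    rw [h.D_homog_zero hS.1]
    simp
  · have hD := h.D_mem_harmonics hm hq hq1 _ hS j
    rw [add_tsub_cancel_right] at hD ⊢
    have hne := muC_ne_zero (m := m) hq
    have hne' := qHalfInt_ne_zero hm hq hq1 k
    have hsq := ofReal_sq_sub_one_ne_zero hq hq1
    -- The coefficient makes Δ(x^j S) = μ ∂^j S cancel against Δ(r² ∂^j S) = μ² [m/2 + k] ∂^j S,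
    -- where [·] is the q²-number; here `S` has degree k + 1.
    refine ⟨coord m q j * S - (muC m q * qHalfInt m q k)⁻¹ • (normSq m q * D j S),
      ⟨Submodule.sub_mem _ hmem (Submodule.smul_mem _ _ ?_), ?_⟩, fun s => ?_⟩
    · have := mul_mem_homog (normSq_mem m q) hD.1
      rwa [show 2 + k = k + 1 + 1 by ring] at this
    · show lap D _ = 0
      have h1 := h.lap_normSq_pow hm hq hq1 k 0 hD
      have h2 := h.laplacian_coord hm hq hq1 j S
      rw [← lap, hS.2, mul_zero, smul_zero, add_zero, ← muC] at h2
      rw [zero_add, pow_one, pow_zero, one_mul, add_zero] at h1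
      have hc : (muC m q * qHalfInt m q k)⁻¹ * (muC m q ^ 2 * qInt q 1 * qHalfInt m q k) =
          muC m q := by
        rw [qInt, mul_one, div_self hsq]
        field_simp
      rw [map_sub, map_smul, h1, h2, smul_smul, hc, sub_self]
    · rw [← sphere_normSq_mul, map_sub, map_smul, LinearMap.sub_apply, LinearMap.smul_apply,
        sub_add_cancel]

end PolyCalculus
end Bridge

/-! ### The `q`-exponentials -/

section Exponential
variable {p : ℝ} (hp : 0 < p) (hp1 : p < 1)

theorem qNumber_natCast (hp1 : p < 1) (n : ℕ) : qNumber p n = ∑ k ∈ Finset.range n, p ^ k := by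
  rw [qNumber, Real.rpow_natCast, geom_sum_eq hp1.ne]

theorem qNumber_succ (hp1 : p < 1) (n : ℕ) : qNumber p ((n : ℝ) + 1) * (1 - p) = 1 - p ^ (n + 1) := by
  have : p - 1 ≠ 0 := by linarith
  have h := Real.rpow_natCast p (n + 1)
  push_cast at h
  rw [qNumber, h]
  field_simp
  ring

include hp hp1 in
theorem one_le_qNumber_succ (n : ℕ) : 1 ≤ qNumber p ((n : ℝ) + 1) := by
  have h1 := qNumber_natCast hp1 (n + 1)
  push_cast at h1
  rw [h1, Finset.sum_range_succ', pow_zero]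
  have : 0 ≤ ∑ k ∈ Finset.range n, p ^ (k + 1) := Finset.sum_nonneg fun k _ => by positivity
  linarith

theorem qFactorial_succ (n : ℕ) : qFactorial p (n + 1) = qFactorial p n * qNumber p ((n : ℝ) + 1) :=
  Finset.prod_range_succ _ _

theorem qFactorial_zero : qFactorial p 0 = 1 := Finset.prod_range_zero _

include hp hp1 in
theorem one_le_qFactorial (n : ℕ) : 1 ≤ qFactorial p n := by
  induction n with
  | zero => rw [qFactorial_zero]
  | succ n ih =>
    rw [qFactorial_succ]
    exact one_le_mul_of_one_le_of_one_le ih (one_le_qNumber_succ hp hp1 n)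

include hp hp1 in
theorem qFactorial_pos (n : ℕ) : 0 < qFactorial p n :=
  zero_lt_one.trans_le (one_le_qFactorial hp hp1 n)

include hp hp1 in
theorem summable_pow_choose_mul (x : ℝ) : Summable fun j : ℕ => p ^ (j.choose 2) * x ^ j := by
  rcases eq_or_ne x 0 with rfl | hx
  · exact summable_of_ne_finset_zero (s := {0}) fun j hj => by
      simp [show j ≠ 0 by simpa using hj]
  refine summable_of_ratio_test_tendsto_lt_one (l := 0) zero_lt_one
    (Filter.Eventually.of_forall fun j => by positivity) ?_
  have h1 : Filter.Tendsto (fun j : ℕ => p ^ j * |x|) Filter.atTop (nhds (0 * |x|)) :=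
    (tendsto_pow_atTop_nhds_zero_of_lt_one hp.le hp1).mul_const _
  rw [zero_mul] at h1
  refine h1.congr fun j => ?_
  rw [Nat.choose_succ_succ' j 1, Nat.choose_one_right, ← norm_div, pow_add, pow_succ x]
  have h2 : p ^ j * p ^ j.choose (1 + 1) * (x ^ j * x) / (p ^ j.choose 2 * x ^ j) = p ^ j * x := by
    field_simp
  rw [h2, norm_mul, Real.norm_eq_abs, Real.norm_eq_abs, abs_of_pos (pow_pos hp j)]

include hp hp1 in
theorem summable_qExpBig (t : ℝ) :
    Summable fun j : ℕ => p ^ (j.choose 2) * t ^ j / qFactorial p j := by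
  refine Summable.of_norm_bounded (summable_pow_choose_mul hp hp1 |t|) fun j => ?_
  rw [norm_div, norm_mul, norm_pow, norm_pow, Real.norm_eq_abs, Real.norm_eq_abs, abs_of_pos hp,
    Real.norm_eq_abs, abs_of_pos (qFactorial_pos hp hp1 j)]
  exact div_le_self (by positivity) (one_le_qFactorial hp hp1 j)

-- In E(t) - E(pt) the j-th term carries 1 - p^j, which cancels the last factor of [j]_p! and shifts
-- the series by one.
include hp hp1 in
theorem qExpBig_eq (t : ℝ) : qExpBig p t = (1 + (1 - p) * t) * qExpBig p (p * t) := by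
  have h1 := summable_qExpBig hp hp1 t
  have h2 := summable_qExpBig hp hp1 (p * t)
  have h3 : qExpBig p t - qExpBig p (p * t) = (1 - p) * t * qExpBig p (p * t) := by
    unfold qExpBig
    rw [← h1.tsum_sub h2, ← tsum_mul_left, (h1.sub h2).tsum_eq_zero_add]
    simp only [pow_zero, sub_self, zero_add]
    refine tsum_congr fun j => ?_
    have hf := (qFactorial_pos hp hp1 j).ne'
    have hn : qNumber p ((j : ℝ) + 1) ≠ 0 :=
      (zero_lt_one.trans_le (one_le_qNumber_succ hp hp1 j)).ne'
    have hs := qNumber_succ hp1 j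
    rw [qFactorial_succ, Nat.choose_succ_succ' j 1, Nat.choose_one_right]
    field_simp
    simp only [mul_pow, pow_add, pow_one] at hs ⊢
    linear_combination (-p ^ j * p ^ (j.choose 2) * t * t ^ j) * hs
  linarith

include hp hp1 in
theorem one_le_qExpBig {t : ℝ} (ht : 0 ≤ t) : 1 ≤ qExpBig p t := by
  have := (summable_qExpBig hp hp1 t).le_tsum 0 fun j _ => by
    have := qFactorial_pos hp hp1 j
    positivity
  simpa [qFactorial_zero, qExpBig] using this

include hp hp1 in
theorem le_qExpBig {t : ℝ} (ht : 0 ≤ t) (j : ℕ) :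
    p ^ (j.choose 2) * t ^ j / qFactorial p j ≤ qExpBig p t :=
  (summable_qExpBig hp hp1 t).le_tsum j fun j _ => by
    have := qFactorial_pos hp hp1 j
    positivity

theorem qExpSmall_neg (u : ℝ) : qExpSmall p (-u) = (qExpBig p u)⁻¹ := by
  rw [qExpSmall, neg_neg, one_div]

include hp hp1 in
theorem qExpSmall_neg_pos {u : ℝ} (hu : 0 ≤ u) : 0 < qExpSmall p (-u) := by
  rw [qExpSmall_neg]
  exact inv_pos.mpr (zero_lt_one.trans_le (one_le_qExpBig hp hp1 hu))

include hp hp1 in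
theorem qExpSmall_neg_le_one {u : ℝ} (hu : 0 ≤ u) : qExpSmall p (-u) ≤ 1 := by
  rw [qExpSmall_neg]
  exact inv_le_one_of_one_le₀ (one_le_qExpBig hp hp1 hu)

-- The discrete counterpart of the differential equation of the exponential; the recursion for the
-- moments of the Gaussian comes from it.
include hp hp1 in
theorem qExpSmall_neg_mul {u : ℝ} (hu : 0 ≤ u) :
    qExpSmall p (-(p * u)) = (1 + (1 - p) * u) * qExpSmall p (-u) := by
  have h1 := one_le_qExpBig hp hp1 hu
  have h2 := one_le_qExpBig hp hp1 (mul_nonneg hp.le hu)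
  have h3 : 0 < 1 + (1 - p) * u := by
    have : 0 ≤ (1 - p) * u := mul_nonneg (by linarith) hu
    linarith
  rw [qExpSmall_neg, qExpSmall_neg, qExpBig_eq hp hp1 u, mul_inv, mul_inv_cancel_left₀ h3.ne']

/-! #### Formal identities -/

theorem coeff_qExpSmallSeries (a : ℝ) (n : ℕ) :
    PowerSeries.coeff n (qExpSmallSeries p a) = ((a ^ n / qFactorial p n : ℝ) : ℂ) :=
  PowerSeries.coeff_mk _ _

theorem coeff_qExpBigSeries (a : ℝ) (n : ℕ) : PowerSeries.coeff n (qExpBigSeries p a) =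
    ((p ^ (n.choose 2) * a ^ n / qFactorial p n : ℝ) : ℂ) :=
  PowerSeries.coeff_mk _ _

theorem rescale_qExpSmallSeries (r a : ℝ) :
    PowerSeries.rescale (r : ℂ) (qExpSmallSeries p a) = qExpSmallSeries p (r * a) := by
  ext n
  rw [PowerSeries.coeff_rescale, coeff_qExpSmallSeries, coeff_qExpSmallSeries]
  push_cast
  ring

theorem rescale_qExpBigSeries (r a : ℝ) :
    PowerSeries.rescale (r : ℂ) (qExpBigSeries p a) = qExpBigSeries p (r * a) := by
  ext n
  rw [PowerSeries.coeff_rescale, coeff_qExpBigSeries, coeff_qExpBigSeries]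
  push_cast
  ring

include hp hp1 in
theorem qExpSmallSeries_mul (a : ℝ) : qExpSmallSeries p (p * a) =
    (1 - PowerSeries.C (((1 - p) * a : ℝ) : ℂ) * PowerSeries.X) * qExpSmallSeries p a := by
  ext n
  rw [sub_mul, one_mul, map_sub, mul_assoc, PowerSeries.coeff_C_mul]
  rcases n with _ | n
  · simp [coeff_qExpSmallSeries, qFactorial_zero]
  · rw [PowerSeries.coeff_succ_X_mul]
    simp only [coeff_qExpSmallSeries]
    norm_cast
    have hf := (qFactorial_pos hp hp1 n).ne'
    have hn : qNumber p ((n : ℝ) + 1) ≠ 0 :=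
      (zero_lt_one.trans_le (one_le_qNumber_succ hp hp1 n)).ne'
    have hs := qNumber_succ hp1 n
    rw [qFactorial_succ]
    field_simp
    simp only [mul_pow, pow_add, pow_one] at hs ⊢
    linear_combination (a * a ^ n) * hs

include hp hp1 in
theorem qExpBigSeries_mul (a : ℝ) : qExpBigSeries p a =
    (1 + PowerSeries.C (((1 - p) * a : ℝ) : ℂ) * PowerSeries.X) * qExpBigSeries p (p * a) := by
  ext n
  rw [add_mul, one_mul, map_add, mul_assoc, PowerSeries.coeff_C_mul]
  rcases n with _ | n
  · simp [coeff_qExpBigSeries, qFactorial_zero]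
  · rw [PowerSeries.coeff_succ_X_mul]
    simp only [coeff_qExpBigSeries]
    norm_cast
    have hf := (qFactorial_pos hp hp1 n).ne'
    have hn : qNumber p ((n : ℝ) + 1) ≠ 0 :=
      (zero_lt_one.trans_le (one_le_qNumber_succ hp hp1 n)).ne'
    have hs := qNumber_succ hp1 n
    rw [qFactorial_succ, Nat.choose_succ_succ' n 1, Nat.choose_one_right]
    field_simp
    simp only [mul_pow, pow_add, pow_one] at hs ⊢
    linear_combination (-p ^ n * p ^ (n.choose 2) * a * a ^ n) * hs

-- The functional equations of the two factors contribute the same linear polynomial `L`, so the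
-- product is unchanged when its variable is scaled by p, and only the constant coefficient
-- survives.
include hp hp1 in
theorem qExpSmallSeries_mul_qExpBigSeries (a : ℝ) :
    qExpSmallSeries p (-a) * qExpBigSeries p a = 1 := by
  set F := qExpSmallSeries p (-a) * qExpBigSeries p a with hF
  set L : PowerSeries ℂ := 1 + PowerSeries.C (((1 - p) * a : ℝ) : ℂ) * PowerSeries.X with hL
  have h1 := qExpSmallSeries_mul hp hp1 (-a)
  have h2 := qExpBigSeries_mul hp hp1 a
  have hL0 : L ≠ 0 := fun h0 => by
    have := congrArg (PowerSeries.coeff 0) h0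
    simp [hL] at this
  have h3 : L * PowerSeries.rescale (p : ℂ) F = L * F := by
    rw [hF, map_mul, rescale_qExpSmallSeries, rescale_qExpBigSeries, h1]
    conv_rhs => rw [h2]
    rw [hL]
    push_cast
    simp only [mul_neg, map_neg]
    ring
  have h4 := mul_left_cancel₀ hL0 h3
  ext n
  rcases n with _ | n
  · simp [hF, PowerSeries.coeff_mul, coeff_qExpSmallSeries, coeff_qExpBigSeries, qFactorial_zero]
  · have h5 := congrArg (PowerSeries.coeff (n + 1)) h4
    rw [PowerSeries.coeff_rescale] at h5
    have h6 : ((p : ℂ) ^ (n + 1) - 1) * PowerSeries.coeff (n + 1) F = 0 := by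
      linear_combination h5
    rw [(mul_eq_zero.mp h6).resolve_left (ofReal_pow_sub_one_ne_zero hp hp1 (by omega))]
    simp [PowerSeries.coeff_one]

end Exponential

/-! ### Taylor series at the origin -/

section Taylor

theorem hasSum_of_eq {f g : ℕ → ℂ} {a : ℂ} (h : HasSum f a) (e : ∀ n, f n = g n) : HasSum g a :=
  (funext e : f = g) ▸ h

theorem HasTaylorAtOrigin.add {f g : ℝ → ℂ} {s t : PowerSeries ℂ} (hf : HasTaylorAtOrigin f s)
    (hg : HasTaylorAtOrigin g t) : HasTaylorAtOrigin (fun u => f u + g u) (s + t) := by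
  obtain ⟨δ, hδ, hf⟩ := hf
  obtain ⟨δ', hδ', hg⟩ := hg
  refine ⟨min δ δ', lt_min hδ hδ', fun u hu hu' => ?_⟩
  have := (hf u hu (hu'.trans_le (min_le_left _ _))).add (hg u hu (hu'.trans_le (min_le_right _ _)))
  simpa [add_mul] using this

theorem HasTaylorAtOrigin.const_mul {f : ℝ → ℂ} {s : PowerSeries ℂ} (hf : HasTaylorAtOrigin f s)
    (c : ℂ) : HasTaylorAtOrigin (fun u => c * f u) (c • s) := by
  obtain ⟨δ, hδ, hf⟩ := hf
  refine ⟨δ, hδ, fun u hu hu' => ?_⟩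
  simpa [mul_assoc] using (hf u hu hu').mul_left c

theorem HasTaylorAtOrigin.X_mul {f : ℝ → ℂ} {s : PowerSeries ℂ} (hf : HasTaylorAtOrigin f s) :
    HasTaylorAtOrigin (fun u => u * f u) (PowerSeries.X * s) := by
  obtain ⟨δ, hδ, hf⟩ := hf
  refine ⟨δ, hδ, fun u hu hu' => ?_⟩
  rw [← hasSum_nat_add_iff' 1]
  have h1 := (hf u hu hu').mul_left (u : ℂ)
  simp only [Finset.range_one, Finset.sum_singleton, PowerSeries.coeff_zero_X_mul, zero_mul,
    sub_zero, PowerSeries.coeff_succ_X_mul]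
  exact hasSum_of_eq h1 fun n => by ring

theorem HasTaylorAtOrigin.congr {f g : ℝ → ℂ} {s : PowerSeries ℂ} (hf : HasTaylorAtOrigin f s)
    (hfg : ∀ u, 0 < u → f u = g u) : HasTaylorAtOrigin g s := by
  obtain ⟨δ, hδ, hf⟩ := hf
  exact ⟨δ, hδ, fun u hu hu' => hfg u hu ▸ hf u hu hu'⟩

theorem hasTaylorAtOrigin_zero : HasTaylorAtOrigin (fun _ => 0) 0 :=
  ⟨1, one_pos, fun u _ _ => by simp⟩

theorem HasTaylorAtOrigin.finset_sum {ι : Type*} (t : Finset ι) {f : ι → ℝ → ℂ}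
    {s : ι → PowerSeries ℂ} (hf : ∀ i ∈ t, HasTaylorAtOrigin (f i) (s i)) :
    HasTaylorAtOrigin (fun u => ∑ i ∈ t, f i u) (∑ i ∈ t, s i) := by
  classical
  induction t using Finset.induction_on with
  | empty => simpa using hasTaylorAtOrigin_zero
  | insert i t hi ih =>
    simp only [Finset.sum_insert hi]
    exact (hf i (Finset.mem_insert_self i t)).add
      (ih fun j hj => hf j (Finset.mem_insert_of_mem hj))

theorem HasTaylorAtOrigin.X_pow_mul {f : ℝ → ℂ} {s : PowerSeries ℂ} (hf : HasTaylorAtOrigin f s)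
    (l : ℕ) : HasTaylorAtOrigin (fun u => (u : ℂ) ^ l * f u) (PowerSeries.X ^ l * s) := by
  induction l with
  | zero => simpa using hf
  | succ l ih =>
    rw [pow_succ', mul_assoc]
    exact ih.X_mul.congr fun u _ => by ring

theorem polynomial_coe_eq_sum (P : ℂ[X]) :
    (P : PowerSeries ℂ) = ∑ l ∈ P.support, P.coeff l • PowerSeries.X ^ l := by
  ext n
  rw [Polynomial.coeff_coe, map_sum]
  simp only [PowerSeries.coeff_smul, PowerSeries.coeff_X_pow, smul_eq_mul, mul_ite, mul_one,
    mul_zero, Finset.sum_ite_eq, Polynomial.mem_support_iff]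
  by_cases hn : P.coeff n = 0 <;> simp [hn]

theorem HasTaylorAtOrigin.polynomial_mul {f : ℝ → ℂ} {s : PowerSeries ℂ}
    (hf : HasTaylorAtOrigin f s) (P : ℂ[X]) :
    HasTaylorAtOrigin (fun u => P.eval (u : ℂ) * f u) ((P : PowerSeries ℂ) * s) := by
  rw [polynomial_coe_eq_sum, Finset.sum_mul]
  refine (HasTaylorAtOrigin.finset_sum P.support (f := fun l u => P.coeff l * ((u : ℂ) ^ l * f u))
    fun l _ => ?_).congr fun u _ => ?_
  · rw [smul_mul_assoc]
    exact (hf.X_pow_mul l).const_mul _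
  · rw [Polynomial.eval_eq_sum, Polynomial.sum, Finset.sum_mul]
    exact Finset.sum_congr rfl fun l _ => by ring

/-- An identity theorem that uses positive real points only. After division by the lowest power of
u, vanishing of the sum bounds the first coefficient by a constant times u, for all small u. -/
theorem HasTaylorAtOrigin.eq_zero {s : PowerSeries ℂ} (hs : HasTaylorAtOrigin (fun _ => 0) s) :
    s = 0 := by
  obtain ⟨δ, hδ, hs⟩ := hs
  by_contra hne
  set n := s.order.toNat with hn
  obtain ⟨t, ht⟩ : PowerSeries.X ^ n ∣ s := PowerSeries.X_pow_order_dvd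
  have ht0 : PowerSeries.coeff 0 t ≠ 0 := by
    have := PowerSeries.coeff_order hne
    rw [← hn, ht] at this
    simpa [PowerSeries.coeff_X_pow_mul'] using this
  have hsum : ∀ u : ℝ, 0 < u → u < δ → HasSum (fun i => PowerSeries.coeff i t * (u : ℂ) ^ i) 0 := by
    intro u hu hu'
    have h1 := hs u hu hu'
    rw [← hasSum_nat_add_iff' n, Finset.sum_eq_zero, sub_zero] at h1
    · have h2 := h1.mul_left ((u : ℂ) ^ n)⁻¹
      rw [mul_zero] at h2
      refine hasSum_of_eq h2 fun i => ?_
      have hu0 : (u : ℂ) ≠ 0 := by exact_mod_cast hu.ne'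
      rw [ht, PowerSeries.coeff_X_pow_mul, pow_add]
      field_simp
    · intro i hi
      rw [ht, PowerSeries.coeff_X_pow_mul', if_neg (by simpa using hi), zero_mul]
  have hδ2 : δ / 2 < δ := by linarith
  have hδ0 : 0 < δ / 2 := by linarith
  have hsm : Summable fun i => ‖PowerSeries.coeff (i + 1) t‖ * (δ / 2) ^ i := by
    have h1 := ((summable_nat_add_iff 1).mpr (hsum _ hδ0 hδ2).summable.norm).mul_left (δ / 2)⁻¹
    refine h1.congr fun i => ?_
    rw [norm_mul, norm_pow, Complex.norm_real, Real.norm_of_nonneg hδ0.le, pow_succ]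
    field_simp
  set C := ∑' i, ‖PowerSeries.coeff (i + 1) t‖ * (δ / 2) ^ i with hC
  have hC0 : 0 ≤ C := tsum_nonneg fun i => by positivity
  have hle : ∀ u : ℝ, 0 < u → u ≤ δ / 2 → ‖PowerSeries.coeff 0 t‖ ≤ u * C := by
    intro u hu hu'
    have h1 := hsum u hu (hu'.trans_lt hδ2)
    rw [← hasSum_nat_add_iff' 1] at h1
    have h2 : HasSum (fun i => (u : ℂ) * (PowerSeries.coeff (i + 1) t * (u : ℂ) ^ i))
        (-PowerSeries.coeff 0 t) := by
      have h2 := hasSum_of_eq h1 (g := fun i => (u : ℂ) * (PowerSeries.coeff (i + 1) t *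
        (u : ℂ) ^ i)) fun i => by ring
      simpa only [Finset.range_one, Finset.sum_singleton, pow_zero, mul_one, zero_sub] using h2
    rw [← norm_neg, ← h2.tsum_eq]
    refine tsum_of_norm_bounded (hsm.hasSum.mul_left u) fun i => ?_
    rw [norm_mul, norm_mul, norm_pow, Complex.norm_real, Real.norm_of_nonneg hu.le]
    gcongr
  have hpos : 0 < ‖PowerSeries.coeff 0 t‖ := norm_pos_iff.mpr ht0
  have h1 := hle (min (δ / 2) (‖PowerSeries.coeff 0 t‖ / (2 * (C + 1))))
    (lt_min hδ0 (by positivity)) (min_le_left _ _)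
  have h2 := h1.trans (mul_le_mul_of_nonneg_right (min_le_right _ _) hC0)
  rw [div_mul_eq_mul_div, le_div_iff₀ (by positivity)] at h2
  nlinarith

theorem HasTaylorAtOrigin.unique {f : ℝ → ℂ} {s t : PowerSeries ℂ} (hs : HasTaylorAtOrigin f s)
    (ht : HasTaylorAtOrigin f t) : s = t := by
  rw [← sub_eq_zero]
  refine HasTaylorAtOrigin.eq_zero ?_
  rw [sub_eq_add_neg, ← neg_one_smul ℂ t]
  exact (hs.add (ht.const_mul (-1))).congr fun u _ => by ring

theorem hasSum_coeff_mul {s t : PowerSeries ℂ} {z : ℂ}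
    (hs : Summable fun n => ‖PowerSeries.coeff n s * z ^ n‖)
    (ht : Summable fun n => ‖PowerSeries.coeff n t * z ^ n‖) :
    HasSum (fun n => PowerSeries.coeff n (s * t) * z ^ n)
      ((∑' n, PowerSeries.coeff n s * z ^ n) * ∑' n, PowerSeries.coeff n t * z ^ n) := by
  rw [tsum_mul_tsum_eq_tsum_sum_antidiagonal_of_summable_norm hs ht]
  have h1 := (summable_norm_sum_mul_antidiagonal_of_summable_norm hs ht).of_norm.hasSum
  refine hasSum_of_eq h1 fun n => ?_
  rw [PowerSeries.coeff_mul, Finset.sum_mul]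
  refine Finset.sum_congr rfl fun x hx => ?_
  rw [← Finset.HasAntidiagonal.mem_antidiagonal.mp hx, pow_add]
  ring

end Taylor

/-! ### The Taylor expansion of the Gaussian at the origin -/

section Gaussian
variable {p : ℝ} (hp : 0 < p) (hp1 : p < 1)
include hp hp1

/-- `qExpSmall` is the reciprocal of an entire function, so its expansion is found from the Cauchy
product of the two series, which is formally 1. On u < c⁻¹ the small series is dominated by a
geometric one. -/
theorem hasTaylorAtOrigin_qExpSmall {c : ℝ} (hc : 0 < c) :
    HasTaylorAtOrigin (fun u => ((qExpSmall p (-(c * u)) : ℝ) : ℂ)) (qExpSmallSeries p (-c)) := by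
  refine ⟨c⁻¹, inv_pos.mpr hc, fun u hu hu' => ?_⟩
  have hcu : c * u < 1 := by rwa [lt_inv_comm₀ hu hc, inv_eq_one_div, lt_div_iff₀ hu] at hu'
  have hcu0 : 0 < c * u := mul_pos hc hu
  have h1 : Summable fun n => ‖PowerSeries.coeff n (qExpSmallSeries p (-c)) * (u : ℂ) ^ n‖ := by
    refine Summable.of_nonneg_of_le (fun n => norm_nonneg _) (fun n => ?_)
      (summable_geometric_of_lt_one hcu0.le hcu)
    rw [coeff_qExpSmallSeries, ← Complex.ofReal_pow, ← Complex.ofReal_mul, Complex.norm_real,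
      norm_mul, norm_div, norm_pow, norm_pow, norm_neg, Real.norm_of_nonneg hc.le,
      Real.norm_of_nonneg hu.le, Real.norm_of_nonneg (qFactorial_pos hp hp1 n).le, mul_pow,
      div_mul_eq_mul_div]
    exact div_le_self (by positivity) (one_le_qFactorial hp hp1 n)
  have hbig := (summable_qExpBig hp hp1 (c * u))
  have heq : ∀ n, PowerSeries.coeff n (qExpBigSeries p c) * (u : ℂ) ^ n =
      ((p ^ (n.choose 2) * (c * u) ^ n / qFactorial p n : ℝ) : ℂ) := fun n => by
    rw [coeff_qExpBigSeries]
    push_cast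
    ring
  have h2 : Summable fun n => ‖PowerSeries.coeff n (qExpBigSeries p c) * (u : ℂ) ^ n‖ := by
    simp only [heq, Complex.norm_real]
    exact hbig.norm
  have h3 := (hasSum_coeff_mul h1 h2).unique (f := fun n => PowerSeries.coeff n
    (qExpSmallSeries p (-c) * qExpBigSeries p c) * (u : ℂ) ^ n) (by
      rw [qExpSmallSeries_mul_qExpBigSeries hp hp1]
      convert hasSum_ite_eq 0 (1 : ℂ) using 2 with n
      rw [PowerSeries.coeff_one]
      split_ifs with hn
      · subst hn; simp
      · simp)
  have h4 : ∑' n, PowerSeries.coeff n (qExpBigSeries p c) * (u : ℂ) ^ n =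
      ((qExpBig p (c * u) : ℝ) : ℂ) := by
    simp only [heq, qExpBig, Complex.ofReal_tsum]
  have hpos := zero_lt_one.trans_le (one_le_qExpBig hp hp1 hcu0.le)
  have h5 : ∑' n, PowerSeries.coeff n (qExpSmallSeries p (-c)) * (u : ℂ) ^ n =
      ((qExpSmall p (-(c * u)) : ℝ) : ℂ) := by
    rw [h4] at h3
    rw [qExpSmall_neg, Complex.ofReal_inv]
    exact eq_inv_of_mul_eq_one_left h3
  beta_reduce
  rw [← h5]
  exact h1.of_norm.hasSum

end Gaussian

theorem hasTaylorAtOrigin_gaussianFun {m : ℕ} {q : ℝ} (hq : 0 < q) (hq1 : q < 1) {a : ℝ}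
    (ha : 0 < a) (P : ℂ[X]) : HasTaylorAtOrigin (gaussianFun m q a P)
      ((P : PowerSeries ℂ) * qExpSmallSeries (q ^ 2) (-(a * q ^ 2 / mu m q))) := by
  have hc : 0 < a * q ^ 2 / mu m q := div_pos (by positivity) (mu_pos hq)
  refine ((hasTaylorAtOrigin_qExpSmall (pow_pos hq 2) (pow_lt_one₀ hq.le hq1 two_ne_zero)
    hc).polynomial_mul P).congr fun u _ => ?_
  rw [gaussianFun, show a * q ^ 2 * u / mu m q = a * q ^ 2 / mu m q * u by ring]

/-! ### Moments of the Gaussian and the `q`-Gamma function -/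

/-- The Jackson moments `∑_{n ∈ ℤ} x ^ n e_p(-p ^ n z)` of the Gaussian. -/
def qMoment (p z x : ℝ) : ℝ := ∑' n : ℤ, x ^ n * qExpSmall p (-(p ^ n * z))

section Moment
variable {p : ℝ} (hp : 0 < p) (hp1 : p < 1) {z : ℝ} (hz : 0 < z)
include hp hp1 hz

theorem qMoment_term_pos {x : ℝ} (hx : 0 < x) (n : ℤ) :
    0 < x ^ n * qExpSmall p (-(p ^ n * z)) :=
  mul_pos (zpow_pos hx n) (qExpSmall_neg_pos hp hp1 (by positivity))

theorem summable_qMoment {x : ℝ} (hx : 0 < x) (hx1 : x < 1) :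
    Summable fun n : ℤ => x ^ n * qExpSmall p (-(p ^ n * z)) := by
  refine Summable.of_nat_of_neg ?_ ?_
  · refine Summable.of_nonneg_of_le (fun n => (qMoment_term_pos hp hp1 hz hx n).le) (fun n => ?_)
      (summable_geometric_of_lt_one hx.le hx1)
    rw [zpow_natCast, zpow_natCast]
    exact mul_le_of_le_one_right (by positivity) (qExpSmall_neg_le_one hp hp1 (by positivity))
  -- For large arguments e_p(-t) is at most the reciprocal of a single term of E_p(t). The index `j`
  -- of this term is chosen so that t^{-j} outweighs the growth x^{-n}.
  · obtain ⟨j, hj⟩ := exists_pow_lt_of_lt_one hx hp1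
    have hlt : p ^ j / x < 1 := (div_lt_one hx).mpr hj
    refine Summable.of_nonneg_of_le (fun n => (qMoment_term_pos hp hp1 hz hx _).le) (fun n => ?_)
      ((summable_geometric_of_lt_one (by positivity) hlt).mul_left
        (qFactorial p j / (p ^ (j.choose 2) * z ^ j)))
    have h1 := le_qExpBig hp hp1 (t := p ^ (-(n : ℤ)) * z) (by positivity) j
    have hf := qFactorial_pos hp hp1 j
    rw [qExpSmall_neg]
    have h2 : (qExpBig p (p ^ (-(n : ℤ)) * z))⁻¹ ≤
        (p ^ (j.choose 2) * (p ^ (-(n : ℤ)) * z) ^ j / qFactorial p j)⁻¹ :=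
      inv_anti₀ (by positivity) h1
    refine (mul_le_mul_of_nonneg_left h2 (by positivity)).trans_eq ?_
    rw [zpow_neg, zpow_neg, zpow_natCast, zpow_natCast, div_pow, ← pow_mul, mul_comm j n, pow_mul,
      mul_pow, inv_pow]
    field_simp

theorem qMoment_pos {x : ℝ} (hx : 0 < x) (hx1 : x < 1) : 0 < qMoment p z x :=
  (summable_qMoment hp hp1 hz hx hx1).tsum_pos
    (fun n => (qMoment_term_pos hp hp1 hz hx n).le) 0 (qMoment_term_pos hp hp1 hz hx 0)

/-- A discrete integration by parts: the summation index is shifted by one and the functional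
equation of the Gaussian is inserted. -/
theorem qMoment_mul {x : ℝ} (hx : 0 < x) (hx1 : x < 1) :
    qMoment p z (p * x) = (x⁻¹ - 1) / ((1 - p) * z) * qMoment p z x := by
  have h1 := summable_qMoment hp hp1 hz hx hx1
  have h2 := summable_qMoment hp hp1 hz (mul_pos hp hx) (by nlinarith : p * x < 1)
  have h3 : ∑' n : ℤ, x ^ (n + 1) * qExpSmall p (-(p ^ (n + 1) * z)) = qMoment p z x :=
    (Equiv.addRight (1 : ℤ)).tsum_eq fun n => x ^ n * qExpSmall p (-(p ^ n * z))
  have h4 : ∑' n : ℤ, x ^ (n + 1) * qExpSmall p (-(p ^ (n + 1) * z)) =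
      x * (qMoment p z x + (1 - p) * z * qMoment p z (p * x)) := by
    unfold qMoment
    rw [← tsum_mul_left (a := (1 - p) * z), ← h1.tsum_add (h2.mul_left _), ← tsum_mul_left]
    refine tsum_congr fun n => ?_
    rw [zpow_add_one₀ hx.ne', zpow_add_one₀ hp.ne', mul_comm (p ^ n) p, mul_assoc p,
      qExpSmall_neg_mul hp hp1 (by positivity), mul_zpow]
    ring
  rw [h3] at h4
  have : (1 - p) * z ≠ 0 := mul_ne_zero (by linarith) hz.ne'
  rw [div_mul_eq_mul_div, eq_div_iff this]
  field_simp
  linear_combination -h4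

theorem qMoment_pow_mul {x : ℝ} (hx : 0 < x) (hx1 : x < 1) (n : ℕ) :
    qMoment p z (p ^ n * x) =
      (∏ t ∈ Finset.range n, ((p ^ t * x)⁻¹ - 1) / ((1 - p) * z)) * qMoment p z x := by
  induction n with
  | zero => simp
  | succ n ih =>
    have h1 : p ^ n * x < 1 := by
      have := pow_le_one₀ hp.le hp1.le (n := n)
      nlinarith
    rw [pow_succ', mul_assoc, qMoment_mul hp hp1 hz (by positivity) h1, ih,
      Finset.prod_range_succ]
    ring

end Moment

/-! ### Positivity and functional equation of the q-Gamma function -/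

section Gamma
variable {p : ℝ} (hp : 0 < p) (hp1 : p < 1)
include hp hp1

theorem summable_rpow_add (t : ℝ) : Summable fun k : ℕ => p ^ (t + (k : ℝ)) := by
  simp only [Real.rpow_add hp, Real.rpow_natCast]
  exact (summable_geometric_of_lt_one hp.le hp1).mul_left _

theorem one_sub_rpow_pos {t : ℝ} (ht : 0 < t) : 0 < 1 - p ^ t :=
  sub_pos.mpr (Real.rpow_lt_one hp.le hp1 ht)

theorem multipliable_one_sub_rpow (t : ℝ) : Multipliable fun k : ℕ => 1 - p ^ (t + (k : ℝ)) := by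
  simp only [sub_eq_add_neg]
  exact Real.multipliable_one_add_of_summable (summable_rpow_add hp hp1 t).neg

theorem tprod_one_sub_rpow_pos {t : ℝ} (ht : 0 < t) : 0 < ∏' k : ℕ, (1 - p ^ (t + (k : ℝ))) := by
  rw [← Real.rexp_tsum_eq_tprod (fun k => one_sub_rpow_pos hp hp1 (by positivity))]
  · exact Real.exp_pos _
  · simp only [sub_eq_add_neg]
    exact Real.summable_log_one_add_of_summable (summable_rpow_add hp hp1 t).neg

theorem qGamma_pos {t : ℝ} (ht : 0 < t) : 0 < qGamma p t := by
  have h1 := tprod_one_sub_rpow_pos hp hp1 one_pos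
  have h2 : ∏' k : ℕ, (1 - p ^ (k + 1)) = ∏' k : ℕ, (1 - p ^ (1 + (k : ℝ))) :=
    tprod_congr fun k => by
      rw [Real.rpow_add hp, Real.rpow_natCast, Real.rpow_one, pow_succ']
  rw [← h2] at h1
  exact mul_pos (div_pos h1 (tprod_one_sub_rpow_pos hp hp1 ht))
    (Real.rpow_pos_of_pos (by linarith) _)

theorem qGamma_add_one {t : ℝ} (ht : 0 < t) : qGamma p (t + 1) = qNumber p t * qGamma p t := by
  have h1 := tprod_one_sub_rpow_pos hp hp1 (by linarith : 0 < t + 1)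
  have h2 : ∏' k : ℕ, (1 - p ^ (t + (k : ℝ))) =
      (1 - p ^ t) * ∏' k : ℕ, (1 - p ^ (t + 1 + (k : ℝ))) := by
    have hm := multipliable_one_sub_rpow hp hp1 (t + 1)
    have he : (fun k : ℕ => 1 - p ^ (t + 1 + (k : ℝ))) =
        fun k : ℕ => 1 - p ^ (t + ((k + 1 : ℕ) : ℝ)) := funext fun k => by
      congr 2
      push_cast
      ring
    rw [he] at hm ⊢
    rw [tprod_eq_zero_mul' (f := fun k : ℕ => 1 - p ^ (t + (k : ℝ))) hm, Nat.cast_zero, add_zero]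
  have h3 := one_sub_rpow_pos hp hp1 ht
  have h4 : 1 - p ≠ 0 := by linarith
  have h5 : p - 1 ≠ 0 := by linarith
  rw [qGamma, qGamma, h2, qNumber, show 1 - t = 1 - (t + 1) + 1 by ring,
    Real.rpow_add_one h4, ← neg_sub (1 : ℝ) (p ^ t), ← neg_sub 1 p, neg_div_neg_eq]
  field_simp

theorem qGamma_add_natCast {t : ℝ} (ht : 0 < t) (n : ℕ) :
    qGamma p (t + n) = (∏ k ∈ Finset.range n, qNumber p (t + k)) * qGamma p t := by
  induction n with
  | zero => simp
  | succ n ih =>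
    rw [Nat.cast_succ, ← add_assoc, qGamma_add_one hp hp1 (by positivity), ih,
      Finset.prod_range_succ]
    ring

end Gamma

/-! ### The radial transform of a monomial times a Gaussian -/

/-- The parameter `a = q ^ (1 - N - m / 2)` of the Gaussians on which the oscillator lives. -/
def gaussianParam (m : ℕ) (q : ℝ) (N : ℕ) : ℝ := q ^ (1 - (N : ℝ) - (m : ℝ) / 2)

/-- The Taylor coefficients of the normalized radial transform of `u ^ l e_{q²}(-a q² u / μ)`. -/
def fourierCoeff (m : ℕ) (q : ℝ) (N k l i : ℕ) : ℝ :=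
  (-1) ^ i * q ^ ((i : ℝ) ^ 2 + i - (3 - (N : ℝ) - (m : ℝ) / 2) * ((m : ℝ) / 2 + k + i + l)) *
    (mu m q ^ l / mu m q ^ i) / qFactorial (q ^ 2) i *
    ∏ t ∈ Finset.range l, ((q ^ (m + 2 * (k + i + t)))⁻¹ - 1) / (1 - q ^ 2)

section Transform
variable {m : ℕ} {q γ : ℝ} (hm : 1 ≤ m) (hq : 0 < q) (hq1 : q < 1) (hγ : 0 < γ)

theorem pow_eq_exp {x : ℝ} (hx : 0 < x) (n : ℕ) : x ^ n = Real.exp (n * Real.log x) := by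
  rw [← Real.rpow_natCast, Real.rpow_def_of_pos hx, mul_comm]

theorem prod_pow_add_two_mul (m j : ℕ) (hq : 0 < q) : ∏ t ∈ Finset.range j, q ^ (m + 2 * t) =
    q ^ ((j : ℝ) * (m + j - 1)) := by
  induction j with
  | zero => simp
  | succ j ih =>
    rw [Finset.prod_range_succ, ih, ← Real.rpow_natCast, ← Real.rpow_add hq]
    congr 1
    push_cast
    ring

theorem qNumber_sq_half (hq : 0 < q) (t : ℕ) :
    qNumber (q ^ 2) ((m : ℝ) / 2 + t) = (1 - q ^ (m + 2 * t)) / (1 - q ^ 2) := by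
  have h1 : (q ^ 2) ^ ((m : ℝ) / 2 + t) = q ^ (m + 2 * t) := by
    rw [← Real.rpow_natCast q 2, ← Real.rpow_mul hq.le, ← Real.rpow_natCast q (m + 2 * t)]
    congr 1
    push_cast
    ring
  rw [qNumber, h1, ← neg_sub, ← neg_sub (1 : ℝ) (q ^ 2), neg_div_neg_eq]

/-- The real number `z` at which the Gaussian moments are taken. -/
def momentPoint (m : ℕ) (q γ a : ℝ) : ℝ := a * q ^ 2 * γ ^ 2 / mu m q

/-- The real value of the normalization constant of the transform. -/
def fourierConstReal (m : ℕ) (q γ a : ℝ) : ℝ :=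
  q ^ (((m : ℝ) / 2 - 1) * ((m : ℝ) / 2)) / qGamma (q ^ 2) ((m : ℝ) / 2) *
    ((1 - q ^ 2) * momentPoint m q γ a ^ ((m : ℝ) / 2) *
      qMoment (q ^ 2) (momentPoint m q γ a) (q ^ m))

include hq hγ in
theorem momentPoint_pos {a : ℝ} (ha : 0 < a) : 0 < momentPoint m q γ a :=
  div_pos (by positivity) (mu_pos hq)

include hq hγ in
theorem fourierConst_eq {a : ℝ} (ha : 0 < a) :
    fourierConst m q a γ = ((fourierConstReal m q γ a : ℝ) : ℂ) := by
  have hz := momentPoint_pos (m := m) hq hγ ha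
  rw [fourierConst, fourierConstReal, jacksonIntegral,
    show a * q ^ 2 * γ ^ 2 / mu m q = momentPoint m q γ a from rfl]
  rw [Complex.ofReal_mul, qMoment]
  simp only [← Complex.ofReal_mul, ← Complex.ofReal_tsum]
  congr 1
  congr 1
  simp only [← tsum_mul_left]
  refine tsum_congr fun n => ?_
  have hx : 0 < q ^ n := zpow_pos hq n
  have h1 : ((q ^ 2) ^ n : ℝ) = (q ^ n) ^ 2 := by rw [← zpow_natCast, zpow_comm, zpow_natCast]
  have h2 : ((q ^ m) ^ n : ℝ) = (q ^ n) ^ m := by rw [← zpow_natCast, zpow_comm, zpow_natCast]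
  have h3 : ((q ^ n) ^ 2 * momentPoint m q γ a) ^ ((m : ℝ) / 2 - 1) * (q ^ n) ^ 2 *
      momentPoint m q γ a = momentPoint m q γ a ^ ((m : ℝ) / 2) * (q ^ n) ^ m := by
    rw [mul_assoc, Real.rpow_sub_one (by positivity), div_mul_cancel₀ _ (by positivity),
      Real.mul_rpow (by positivity) hz.le, ← Real.rpow_natCast _ 2, ← Real.rpow_mul hx.le,
      ← Real.rpow_natCast _ m, mul_comm]
    congr 2
    push_cast
    ring
  rw [h2, ← h1] at *
  linear_combination (1 - q ^ 2) * (qExpSmall (q ^ 2) (-((q ^ 2) ^ n * momentPoint m q γ a))) * h3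

include hm hq hq1 hγ in
theorem fourierConstReal_pos {a : ℝ} (ha : 0 < a) : 0 < fourierConstReal m q γ a := by
  have hp1 : q ^ 2 < 1 := pow_lt_one₀ hq.le hq1 two_ne_zero
  have hz := momentPoint_pos (m := m) hq hγ ha
  have h1 := qGamma_pos (pow_pos hq 2) hp1 (t := (m : ℝ) / 2) (by positivity)
  have h2 := qMoment_pos (pow_pos hq 2) hp1 hz (pow_pos hq m) (pow_lt_one₀ hq.le hq1 (by omega))
  have h3 : 0 < 1 - q ^ 2 := by linarith
  unfold fourierConstReal
  positivity

/-- The coefficients of the Bessel function. -/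
def besselCoeff (q ν : ℝ) (i : ℕ) : ℝ :=
  q ^ (2 * (i : ℝ) * ((i : ℝ) + ν)) * (-1) ^ i /
    (qFactorial (q ^ 2) i * qGamma (q ^ 2) ((i : ℝ) + ν + 1))

-- By `qMoment_pow_mul` each moment is an explicit multiple of the moment at q^m, which is also the
-- one in the normalization constant. Of the k + i + l factors, the first k + i cancel the q-Gamma
-- function of the Bessel coefficient down to that of m/2, and the last l stay in `fourierCoeff`.
-- The powers of γ cancel against those in the moment point, so the normalized transform is
-- independent of γ.
include hm hq hq1 hγ in
theorem besselCoeff_mul_moment (N k l i : ℕ) :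
    (1 + q) / mu m q * ((1 - q) * γ) * (q ^ (((m : ℝ) / 2 + k - 1) ^ 2) *
      (q / mu m q) ^ ((m : ℝ) / 2 + k - 1)) *
      (besselCoeff q ((m : ℝ) / 2 + k - 1) i * (q / mu m q) ^ (2 * i) *
        γ ^ (2 * i + 2 * l + (m + 2 * k - 1)) *
        qMoment (q ^ 2) (momentPoint m q γ (gaussianParam m q N)) (q ^ (m + 2 * (k + i + l)))) =
    fourierConstReal m q γ (gaussianParam m q N) * fourierCoeff m q N k l i := by
  have ha : 0 < gaussianParam m q N := Real.rpow_pos_of_pos hq _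
  have hp : 0 < q ^ 2 := pow_pos hq 2
  have hp1 : q ^ 2 < 1 := pow_lt_one₀ hq.le hq1 two_ne_zero
  have hμ := mu_pos (m := m) hq
  have hp' : (1 - q ^ 2) ≠ 0 := by linarith
  set z := momentPoint m q γ (gaussianParam m q N) with hzdef
  have hz : 0 < z := momentPoint_pos hq hγ ha
  have hΓ := qGamma_pos hp hp1 (t := (m : ℝ) / 2) (by positivity)
  have h1 := qMoment_pow_mul hp hp1 hz (pow_pos hq m) (pow_lt_one₀ hq.le hq1 (by omega))
    (k + i + l)
  have hpt : ∀ t, (q ^ 2) ^ t * q ^ m = q ^ (m + 2 * t) := fun t => by ring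
  simp only [hpt] at h1
  rw [h1, Finset.prod_range_add]
  have h2 := qGamma_add_natCast hp hp1 (t := (m : ℝ) / 2) (by positivity) (k + i)
  have h3 : (i : ℝ) + ((m : ℝ) / 2 + k - 1) + 1 = (m : ℝ) / 2 + ((k + i : ℕ) : ℝ) := by
    push_cast; ring
  set G := ∏ t ∈ Finset.range (k + i), qNumber (q ^ 2) ((m : ℝ) / 2 + t) with hG
  have hGpos : 0 < G := Finset.prod_pos fun t _ => by
    rw [qNumber_sq_half hq]
    exact div_pos (sub_pos.mpr (pow_lt_one₀ hq.le hq1 (by omega))) (by linarith)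
  have h4 : ∏ t ∈ Finset.range (k + i), ((q ^ (m + 2 * t))⁻¹ - 1) / ((1 - q ^ 2) * z) =
      G * (q ^ (((k + i : ℕ) : ℝ) * (m + ((k + i : ℕ) : ℝ) - 1)))⁻¹ * (z ^ (k + i))⁻¹ := by
    rw [hG, ← prod_pow_add_two_mul m (k + i) hq, ← Finset.prod_inv_distrib,
      ← Finset.prod_mul_distrib]
    conv_rhs => rw [← Finset.card_range (k + i), ← Finset.prod_const, ← Finset.prod_inv_distrib,
      Finset.card_range, ← Finset.prod_mul_distrib]
    refine Finset.prod_congr rfl fun t _ => ?_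
    rw [qNumber_sq_half hq]
    field_simp
  have h5 : ∏ t ∈ Finset.range l, ((q ^ (m + 2 * (k + i + t)))⁻¹ - 1) / ((1 - q ^ 2) * z) =
      (∏ t ∈ Finset.range l, ((q ^ (m + 2 * (k + i + t)))⁻¹ - 1) / (1 - q ^ 2)) *
        (z ^ l)⁻¹ := by
    conv_rhs => rw [← Finset.card_range l, ← Finset.prod_const, ← Finset.prod_inv_distrib,
      Finset.card_range, ← Finset.prod_mul_distrib]
    refine Finset.prod_congr rfl fun t _ => ?_
    field_simp
  rw [h4, h5, besselCoeff, h3, h2, fourierConstReal, ← hzdef, fourierCoeff]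
  set M := qMoment (q ^ 2) z (q ^ m)
  set P := ∏ t ∈ Finset.range l, ((q ^ (m + 2 * (k + i + t)))⁻¹ - 1) / (1 - q ^ 2)
  have hf := qFactorial_pos hp hp1 i
  have hlz : Real.log z = (3 - N - (m : ℝ) / 2) * Real.log q + 2 * Real.log γ -
      Real.log (mu m q) := by
    rw [hzdef, momentPoint, gaussianParam, Real.log_div (by positivity) hμ.ne',
      Real.log_mul (by positivity) (by positivity), Real.log_mul (by positivity) (by positivity),
      Real.log_rpow hq, Real.log_pow, Real.log_pow]
    push_cast
    ring
  -- Only powers of q, γ and μ are left; the identity is checked on their logarithms.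
  have key : (γ / mu m q) * (q ^ (((m : ℝ) / 2 + k - 1) ^ 2) *
      (q / mu m q) ^ ((m : ℝ) / 2 + k - 1)) * (q ^ (2 * (i : ℝ) * ((i : ℝ) +
        ((m : ℝ) / 2 + k - 1))) * (q / mu m q) ^ (2 * i) *
        γ ^ (2 * i + 2 * l + (m + 2 * k - 1)) *
      ((q ^ (((k + i : ℕ) : ℝ) * (m + ((k + i : ℕ) : ℝ) - 1)))⁻¹ * (z ^ (k + i))⁻¹ * (z ^ l)⁻¹)) =
      q ^ (((m : ℝ) / 2 - 1) * ((m : ℝ) / 2)) * z ^ ((m : ℝ) / 2) *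
      (q ^ ((i : ℝ) ^ 2 + i - (3 - (N : ℝ) - (m : ℝ) / 2) * ((m : ℝ) / 2 + k + i + l)) *
      (mu m q ^ l / mu m q ^ i)) := by
    have hn : ((2 * i + 2 * l + (m + 2 * k - 1) : ℕ) : ℝ) = 2 * i + 2 * l + m + 2 * k - 1 := by
      rw [Nat.cast_add, Nat.cast_sub (by omega)]
      push_cast
      ring
    have hγ1 : γ / mu m q = Real.exp (Real.log γ - Real.log (mu m q)) := by
      rw [Real.exp_sub, Real.exp_log hγ, Real.exp_log hμ]
    simp only [pow_eq_exp hγ, pow_eq_exp hz, pow_eq_exp hμ, pow_eq_exp (div_pos hq hμ),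
      Real.rpow_def_of_pos hq, Real.rpow_def_of_pos hz, Real.rpow_def_of_pos (div_pos hq hμ),
      Real.log_div hq.ne' hμ.ne', hlz, ← Real.exp_neg, ← Real.exp_sub, hγ1, ← Real.exp_add, hn]
    congr 1
    push_cast
    ring
  have hq2 : (1 + q) * (1 - q) = 1 - q ^ 2 := by ring
  calc _ = (1 + q) * (1 - q) * ((γ / mu m q) * (q ^ (((m : ℝ) / 2 + k - 1) ^ 2) *
      (q / mu m q) ^ ((m : ℝ) / 2 + k - 1)) * (q ^ (2 * (i : ℝ) * ((i : ℝ) +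
        ((m : ℝ) / 2 + k - 1))) * (q / mu m q) ^ (2 * i) *
        γ ^ (2 * i + 2 * l + (m + 2 * k - 1)) *
      ((q ^ (((k + i : ℕ) : ℝ) * (m + ((k + i : ℕ) : ℝ) - 1)))⁻¹ * (z ^ (k + i))⁻¹ * (z ^ l)⁻¹))) *
      ((-1) ^ i / qFactorial (q ^ 2) i / qGamma (q ^ 2) ((m : ℝ) / 2) * M * P) := by
        field_simp
    _ = _ := by
        rw [key, hq2]
        field_simp

end Transform

section Transform
variable {m : ℕ} {q γ : ℝ} (hm : 1 ≤ m) (hq : 0 < q) (hq1 : q < 1) (hγ : 0 < γ)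

/-- The Taylor series of the normalized radial transform of `u ^ l e_{q²}(-a q² u / μ)`. -/
def fourierSeries (m : ℕ) (q : ℝ) (N k l : ℕ) : PowerSeries ℂ :=
  PowerSeries.mk fun i => ((fourierCoeff m q N k l i : ℝ) : ℂ)

-- The factor q^{i² + i} decays faster than any geometric sequence, while the product grows at most
-- like q^{-2li}. The series therefore converges for every u > 0.
include hq hq1 in
theorem summable_fourierCoeff (N k l : ℕ) {u : ℝ} (hu : 0 < u) :
    Summable fun i => |fourierCoeff m q N k l i * u ^ i| := by
  have hp : 0 < q ^ 2 := pow_pos hq 2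
  have hp1 : q ^ 2 < 1 := pow_lt_one₀ hq.le hq1 two_ne_zero
  have hμ := mu_pos (m := m) hq
  have h1p : 0 < 1 - q ^ 2 := by linarith
  set c : ℝ := 3 - (N : ℝ) - (m : ℝ) / 2 with hc
  refine Summable.of_nonneg_of_le (fun i => abs_nonneg _) (fun i => ?_)
    ((summable_pow_choose_mul hp hp1 (q ^ 2 * q ^ (-c) * (mu m q)⁻¹ * u * ((q ^ 2) ^ l)⁻¹)).mul_left
      (q ^ (-c * ((m : ℝ) / 2 + k)) * q ^ (-c * l) * mu m q ^ l * ((q ^ (m + 2 * (k + l)))⁻¹ / (1 - q ^ 2)) ^ l))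
  have hprod : |∏ t ∈ Finset.range l, ((q ^ (m + 2 * (k + i + t)))⁻¹ - 1) / (1 - q ^ 2)| ≤
      ((q ^ (m + 2 * (k + l)))⁻¹ / (1 - q ^ 2)) ^ l * (((q ^ 2) ^ l)⁻¹) ^ i := by
    rw [Finset.abs_prod]
    have h1 : ((q ^ (m + 2 * (k + l)))⁻¹ / (1 - q ^ 2)) ^ l * (((q ^ 2) ^ l)⁻¹) ^ i =
        ∏ t ∈ Finset.range l, ((q ^ (m + 2 * (k + l)))⁻¹ / (1 - q ^ 2) * ((q ^ 2) ^ i)⁻¹) := by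
      rw [Finset.prod_const, Finset.card_range, mul_pow, inv_pow, inv_pow, ← pow_mul _ i l,
        ← pow_mul _ l i, mul_comm i l]
    rw [h1]
    refine Finset.prod_le_prod (fun t _ => abs_nonneg _) fun t ht => ?_
    have h2 : 1 ≤ (q ^ (m + 2 * (k + i + t)))⁻¹ :=
      (one_le_inv₀ (by positivity)).mpr (pow_le_one₀ hq.le hq1.le)
    rw [abs_of_nonneg (div_nonneg (by linarith) h1p.le), div_mul_eq_mul_div]
    refine div_le_div_of_nonneg_right ?_ h1p.le
    have h3 : (q ^ (m + 2 * (k + i + t)))⁻¹ ≤ (q ^ (m + 2 * (k + l)))⁻¹ * ((q ^ 2) ^ i)⁻¹ := by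
      rw [← mul_inv, ← pow_mul, ← pow_add]
      refine inv_anti₀ (by positivity) (pow_le_pow_of_le_one hq.le hq1.le ?_)
      have := Finset.mem_range.mp ht
      omega
    linarith
  have hexp : q ^ ((i : ℝ) ^ 2 + i - c * ((m : ℝ) / 2 + k + i + l)) =
      q ^ (-c * ((m : ℝ) / 2 + k)) * ((q ^ 2) ^ (i.choose 2) * (q ^ 2 * q ^ (-c)) ^ i) * q ^ (-c * l) := by
    have hch : ((i.choose 2 : ℕ) : ℝ) = i * (i - 1) / 2 := Nat.cast_choose_two ℝ i
    simp only [← pow_mul, mul_pow]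
    rw [← Real.rpow_natCast q (2 * i.choose 2), ← Real.rpow_natCast q (2 * i),
      ← Real.rpow_natCast (q ^ (-c)) i, ← Real.rpow_mul hq.le, ← Real.rpow_add hq,
      ← Real.rpow_add hq, ← Real.rpow_add hq, ← Real.rpow_add hq]
    refine congrArg _ ?_
    push_cast
    rw [hch]
    ring
  have hf := one_le_qFactorial hp hp1 i
  rw [fourierCoeff, ← hc, abs_mul, abs_mul, abs_div, abs_mul, abs_mul, abs_pow, abs_neg, abs_one,
    one_pow, one_mul, abs_of_pos (Real.rpow_pos_of_pos hq _), abs_of_pos (pow_pos hu i),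
    abs_of_pos (show 0 < mu m q ^ l / mu m q ^ i by positivity),
    abs_of_pos (qFactorial_pos hp hp1 i)]
  have h1 : q ^ ((i : ℝ) ^ 2 + i - c * ((m : ℝ) / 2 + k + i + l)) * (mu m q ^ l / mu m q ^ i) /
      qFactorial (q ^ 2) i ≤
      q ^ ((i : ℝ) ^ 2 + i - c * ((m : ℝ) / 2 + k + i + l)) * (mu m q ^ l / mu m q ^ i) :=
    div_le_self (by positivity) hf
  refine (mul_le_mul_of_nonneg_right (mul_le_mul h1 hprod (abs_nonneg _) (by positivity))
    (pow_pos hu i).le).trans_eq ?_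
  rw [hexp]
  simp only [mul_pow, inv_pow]
  field_simp

-- The Bessel series and the Jackson sum are interchanged. Since the Gaussian moments are positive,
-- summing absolute values over the lattice gives the absolute values of the final coefficients, so
-- `summable_fourierCoeff` yields absolute summability of the double family. The second conclusion
-- is what later permits splitting a polynomial into monomials under the Jackson sum.
include hm hq hq1 hγ in
theorem radialTransform_monomial (N k l : ℕ) {u : ℝ} (hu : 0 < u) :
    HasSum (fun i => ((fourierConstReal m q γ (gaussianParam m q N) *
        fourierCoeff m q N k l i * u ^ i : ℝ) : ℂ))
      (radialTransform m q γ ((m : ℝ) / 2 + k - 1) (gaussianFun m q (gaussianParam m q N)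
        (Polynomial.X ^ l)) u) ∧
    Summable fun n : ℤ => (((besselTwo q ((m : ℝ) / 2 + k - 1) (q * ((1 + q) / mu m q) *
      (Real.sqrt u * (q ^ n * γ))) / (Real.sqrt u * (q ^ n * γ)) ^ ((m : ℝ) / 2 + k - 1) *
      (q ^ n * γ) ^ (2 * ((m : ℝ) / 2 + k - 1) + 1) : ℝ) : ℂ) *
        gaussianFun m q (gaussianParam m q N) (Polynomial.X ^ l) ((q ^ n * γ) ^ 2)) *
        ((q ^ n : ℝ) : ℂ) := by
  have ha : 0 < gaussianParam m q N := Real.rpow_pos_of_pos hq _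
  have hp : 0 < q ^ 2 := pow_pos hq 2
  have hp1 : q ^ 2 < 1 := pow_lt_one₀ hq.le hq1 two_ne_zero
  have hμ := mu_pos (m := m) hq
  set a := gaussianParam m q N with hadef
  set ν := (m : ℝ) / 2 + k - 1 with hν
  set z := momentPoint m q γ a with hzdef
  have hz : 0 < z := momentPoint_pos hq hγ ha
  set K := (1 + q) / mu m q * ((1 - q) * γ) * (q ^ (ν ^ 2) * (q / mu m q) ^ ν) with hK
  have hK0 : 0 < K := by
    have : 0 < 1 - q := by linarith
    positivity
  set B : ℕ → ℝ := fun i => besselCoeff q ν i * (q / mu m q) ^ (2 * i) *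
        γ ^ (2 * i + 2 * l + (m + 2 * k - 1)) with hB
  set x : ℕ → ℝ := fun i => q ^ (m + 2 * (k + i + l)) with hx
  have hx0 : ∀ i, 0 < x i := fun i => pow_pos hq _
  have hx1 : ∀ i, x i < 1 := fun i => pow_lt_one₀ hq.le hq1 (by omega)
  have hBM : ∀ i, K * (B i * qMoment (q ^ 2) z (x i)) =
      fourierConstReal m q γ a * fourierCoeff m q N k l i := fun i => by
    have := besselCoeff_mul_moment hm hq hq1 hγ N k l i
    rw [← this]
  clear_value K
  set W : ℕ → ℤ → ℝ := fun i n => B i * u ^ i * (x i ^ n * qExpSmall (q ^ 2) (-((q ^ 2) ^ n * z)))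
    with hW
  have hWi : ∀ i, HasSum (W i) (B i * u ^ i * qMoment (q ^ 2) z (x i)) := fun i =>
    (summable_qMoment hp hp1 hz (hx0 i) (hx1 i)).hasSum.mul_left _
  have hWn : ∀ i, HasSum (fun n => |W i n|) (|B i| * u ^ i * qMoment (q ^ 2) z (x i)) := fun i => by
    have h1 := (summable_qMoment hp hp1 hz (hx0 i) (hx1 i)).hasSum.mul_left (|B i| * u ^ i)
    have h2 : (fun n => |W i n|) = fun n =>
        |B i| * u ^ i * (x i ^ n * qExpSmall (q ^ 2) (-((q ^ 2) ^ n * z))) := funext fun n => by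
      rw [hW, abs_mul, abs_mul, abs_of_pos (pow_pos hu i),
        abs_of_pos (qMoment_term_pos hp hp1 hz (hx0 i) n)]
    rw [h2]
    exact h1
  have hWs : Summable (Function.uncurry W) := by
    refine Summable.of_norm ?_
    refine (summable_prod_of_nonneg fun y => norm_nonneg _).mpr ⟨fun i => (hWn i).summable, ?_⟩
    have h1 := (summable_fourierCoeff (m := m) hq hq1 N k l hu).mul_left
      (|fourierConstReal m q γ a| / K)
    refine h1.congr fun i => ?_
    show _ = ∑' n, |W i n|
    rw [(hWn i).tsum_eq]
    have h2 := congrArg abs (hBM i)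
    rw [abs_mul K, abs_mul (B i), abs_of_pos hK0,
      abs_of_pos (qMoment_pos hp hp1 hz (hx0 i) (hx1 i)), abs_mul (fourierConstReal m q γ a)] at h2
    rw [abs_mul, abs_of_pos (pow_pos hu i), div_mul_eq_mul_div, div_eq_iff hK0.ne']
    linear_combination (-u ^ i) * h2
  have hterm : ∀ n : ℤ, (((besselTwo q ν (q * ((1 + q) / mu m q) *
      (Real.sqrt u * (q ^ n * γ))) / (Real.sqrt u * (q ^ n * γ)) ^ ν *
      (q ^ n * γ) ^ (2 * ν + 1) : ℝ) : ℂ) *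
        gaussianFun m q a (Polynomial.X ^ l) ((q ^ n * γ) ^ 2)) * ((q ^ n : ℝ) : ℂ) =
      (((q ^ (ν ^ 2) * (q / mu m q) ^ ν) * ∑' i, W i n : ℝ) : ℂ) := by
    intro n
    have hy : 0 < q ^ n := zpow_pos hq n
    set y := q ^ n with hydef
    have hT : 0 < y * γ := mul_pos hy hγ
    have hr : 0 < Real.sqrt u * (y * γ) := mul_pos (Real.sqrt_pos.mpr hu) hT
    have h1 : q * ((1 + q) / mu m q) * (Real.sqrt u * (y * γ)) / (1 + q) =
        q / mu m q * (Real.sqrt u * (y * γ)) := by field_simp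
    have h2 : (q ^ 2) ^ n = y ^ 2 := by rw [hydef, ← zpow_natCast, zpow_comm, zpow_natCast]
    have h3 : ∀ i, x i ^ n = y ^ (m + 2 * (k + i + l)) := fun i => by
      rw [hydef, hx]
      rw [← zpow_natCast, zpow_comm, zpow_natCast]
    have h4 : (y * γ) ^ (2 * ν + 1) = (y * γ) ^ (m + 2 * k - 1) := by
      rw [← Real.rpow_natCast, Nat.cast_sub (by omega)]
      congr 1
      push_cast
      rw [hν]
      ring
    have h5 : a * q ^ 2 * (y * γ) ^ 2 / mu m q = y ^ 2 * z := by
      rw [hzdef, momentPoint]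
      ring
    rw [gaussianFun, Polynomial.eval_pow, Polynomial.eval_X, besselTwo, h1, h4, h5,
      Real.mul_rpow (by positivity) hr.le]
    simp only [← Complex.ofReal_pow, ← Complex.ofReal_mul]
    rw [Complex.ofReal_inj]
    have h6 : 0 < (Real.sqrt u * (y * γ)) ^ ν := Real.rpow_pos_of_pos hr _
    rw [show ∀ S : ℝ, q ^ ν ^ 2 * ((q / mu m q) ^ ν * (Real.sqrt u * (y * γ)) ^ ν) * S /
        (Real.sqrt u * (y * γ)) ^ ν * (y * γ) ^ (m + 2 * k - 1) *
        (((y * γ) ^ 2) ^ l * qExpSmall (q ^ 2) (-(y ^ 2 * z))) * y =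
        q ^ ν ^ 2 * (q / mu m q) ^ ν * (S * ((y * γ) ^ (m + 2 * k - 1) *
        (((y * γ) ^ 2) ^ l * qExpSmall (q ^ 2) (-(y ^ 2 * z))) * y)) from fun S => by
          field_simp, ← tsum_mul_right]
    congr 1
    refine tsum_congr fun i => ?_
    have h7 : (y * γ) ^ (m + 2 * k - 1) * ((y * γ) ^ 2) ^ l * y * ((y * γ) ^ 2) ^ i =
        γ ^ (2 * i + 2 * l + (m + 2 * k - 1)) * y ^ (m + 2 * (k + i + l)) := by
      obtain ⟨m', rfl⟩ := Nat.exists_eq_add_of_le' hm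
      rw [show m' + 1 + 2 * k - 1 = m' + 2 * k by omega]
      ring
    have h8 : (q / mu m q * (Real.sqrt u * (y * γ))) ^ (2 * i) =
        (q / mu m q) ^ (2 * i) * (u ^ i * ((y * γ) ^ 2) ^ i) := by
      rw [mul_pow, mul_pow, pow_mul (Real.sqrt u), Real.sq_sqrt hu.le, pow_mul (y * γ)]
    rw [hW]
    simp only []
    rw [h2, h3, hB, h8]
    simp only [besselCoeff]
    linear_combination (q ^ (2 * (i : ℝ) * ((i : ℝ) + ν)) * (-1) ^ i /
      (qFactorial (q ^ 2) i * qGamma (q ^ 2) ((i : ℝ) + ν + 1)) * (q / mu m q) ^ (2 * i) * u ^ i *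
        qExpSmall (q ^ 2) (-(y ^ 2 * z))) * h7
  have hsw := hWs.prod_symm
  constructor
  · have h1 : radialTransform m q γ ν (gaussianFun m q a (Polynomial.X ^ l)) u =
        ((K * ∑' i, ∑' n, W i n : ℝ) : ℂ) := by
      rw [radialTransform, hankelTwo, jacksonIntegral]
      simp only [hterm]
      rw [← Complex.ofReal_tsum, tsum_mul_left, hWs.tsum_comm, ← Complex.ofReal_mul,
        ← Complex.ofReal_mul, hK]
      congr 1
      ring
    rw [h1]
    refine Complex.hasSum_ofReal.mpr ?_
    have h2 := (hWs.prod.hasSum).mul_left K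
    have h3 : (fun i => K * ∑' n, W i n) = fun i => fourierConstReal m q γ a *
        fourierCoeff m q N k l i * u ^ i := funext fun i => by
      rw [(hWi i).tsum_eq]
      linear_combination u ^ i * hBM i
    rw [← h3]
    exact h2
  · simp only [hterm]
    exact Complex.summable_ofReal.mpr (hsw.prod.mul_left _)

end Transform

theorem gaussianFun_eq_sum (m : ℕ) (q a : ℝ) (P : ℂ[X]) (v : ℝ) :
    gaussianFun m q a P v = ∑ l ∈ P.support, P.coeff l * gaussianFun m q a (Polynomial.X ^ l) v := by
  simp only [gaussianFun]
  rw [Polynomial.eval_eq_sum, Polynomial.sum, Finset.sum_mul]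
  refine Finset.sum_congr rfl fun l _ => ?_
  rw [Polynomial.eval_pow, Polynomial.eval_X, mul_assoc]

theorem hasTaylorAtOrigin_radialTransform {m : ℕ} {q γ : ℝ} (hm : 1 ≤ m) (hq : 0 < q)
    (hq1 : q < 1) (hγ : 0 < γ) (N k : ℕ) (P : ℂ[X]) :
    HasTaylorAtOrigin (radialTransform m q γ ((m : ℝ) / 2 + k - 1)
      (gaussianFun m q (gaussianParam m q N) P))
      (∑ l ∈ P.support, P.coeff l •
        (fourierConst m q (gaussianParam m q N) γ • fourierSeries m q N k l)) := by
  have ha : 0 < gaussianParam m q N := Real.rpow_pos_of_pos hq _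
  refine (HasTaylorAtOrigin.finset_sum P.support (f := fun l u => P.coeff l *
    radialTransform m q γ ((m : ℝ) / 2 + k - 1)
      (gaussianFun m q (gaussianParam m q N) (Polynomial.X ^ l)) u) fun l _ => ?_).congr
      fun u hu => ?_
  · refine HasTaylorAtOrigin.const_mul ⟨1, one_pos, fun u hu _ => ?_⟩ _
    refine hasSum_of_eq (radialTransform_monomial hm hq hq1 hγ N k l hu).1 fun i => ?_
    rw [fourierConst_eq hq hγ ha, fourierSeries, PowerSeries.coeff_smul, PowerSeries.coeff_mk]
    push_cast
    ring
  · simp only [radialTransform, hankelTwo, jacksonIntegral]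
    simp only [gaussianFun_eq_sum m q _ P, Finset.mul_sum, Finset.sum_mul]
    rw [Summable.tsum_finsetSum]
    · rw [Finset.mul_sum, Finset.mul_sum]
      refine Finset.sum_congr rfl fun l _ => ?_
      rw [mul_left_comm, mul_left_comm (P.coeff l), ← tsum_mul_left]
      congr 2
      refine tsum_congr fun n => ?_
      ring
    · intro l _
      refine ((radialTransform_monomial hm hq hq1 hγ N k l hu).2.mul_left (P.coeff l)).congr
        fun n => ?_
      ring

/-! ### Contiguity relations of the transform coefficients -/

section Contiguity
variable {m : ℕ} {q s H : ℝ}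

/-- The power of `q` in the transform coefficients. -/
def fourierPow (m : ℕ) (q : ℝ) (N k l i : ℕ) : ℝ :=
  q ^ ((i : ℝ) ^ 2 + i - (3 - (N : ℝ) - (m : ℝ) / 2) * ((m : ℝ) / 2 + k + i + l))

/-- The product in the transform coefficients. -/
def fourierProd (m : ℕ) (q : ℝ) (n l : ℕ) : ℝ :=
  ∏ t ∈ Finset.range l, ((q ^ (m + 2 * (n + t)))⁻¹ - 1) / (1 - q ^ 2)

theorem fourierCoeff_eq (N k l i : ℕ) : fourierCoeff m q N k l i =
    (-1) ^ i * fourierPow m q N k l i * (mu m q ^ l / mu m q ^ i) / qFactorial (q ^ 2) i *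
      fourierProd m q (k + i) l := rfl

theorem fourierProd_zero (n : ℕ) : fourierProd m q n 0 = 1 := Finset.prod_range_zero _

theorem fourierProd_succ (n l : ℕ) : fourierProd m q n (l + 1) =
    fourierProd m q n l * (((q ^ (m + 2 * (n + l)))⁻¹ - 1) / (1 - q ^ 2)) :=
  Finset.prod_range_succ _ _

theorem fourierProd_succ' (n l : ℕ) : fourierProd m q n (l + 1) =
    fourierProd m q (n + 1) l * (((q ^ (m + 2 * n))⁻¹ - 1) / (1 - q ^ 2)) := by
  rw [fourierProd, Finset.prod_range_succ']
  congr 1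
  exact Finset.prod_congr rfl fun t _ => by rw [show n + (t + 1) = n + 1 + t by ring]

variable (hq : 0 < q)
include hq

theorem gaussianParam_pos (N : ℕ) : 0 < gaussianParam m q N := Real.rpow_pos_of_pos hq _

theorem gaussianParam_succ (N : ℕ) : gaussianParam m q (N + 1) = gaussianParam m q N * q⁻¹ := by
  rw [gaussianParam, gaussianParam, ← Real.rpow_neg_one, ← Real.rpow_add hq]
  congr 1
  push_cast
  ring

theorem fourierPow_N (hH : H = q ^ ((m : ℝ) / 2)) (N k l i : ℕ) :
    fourierPow m q (N + 1) k l i = fourierPow m q N k l i * (H * q ^ (k + i + l)) := by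
  rw [fourierPow, fourierPow, hH, ← Real.rpow_natCast q (k + i + l), ← Real.rpow_add hq, ← Real.rpow_add hq]
  congr 1
  push_cast
  ring

theorem fourierPow_shift (N : ℕ) {x y : ℝ} (hxy : y = x - (3 - (N : ℝ) - (m : ℝ) / 2)) :
    q ^ y = q ^ x * (gaussianParam m q N * q ^ 2)⁻¹ := by
  rw [gaussianParam, ← Real.rpow_natCast, ← Real.rpow_add hq, ← Real.rpow_neg hq.le,
    ← Real.rpow_add hq, hxy]
  congr 1
  push_cast
  ring

theorem fourierPow_k (N k l i : ℕ) :
    fourierPow m q N (k + 1) l i = fourierPow m q N k l i * (gaussianParam m q N * q ^ 2)⁻¹ :=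
  fourierPow_shift hq N (by push_cast; ring)

theorem fourierPow_l (N k l i : ℕ) :
    fourierPow m q N k (l + 1) i = fourierPow m q N k l i * (gaussianParam m q N * q ^ 2)⁻¹ :=
  fourierPow_shift hq N (by push_cast; ring)

theorem fourierPow_i (N k l i : ℕ) : fourierPow m q N k l (i + 1) =
    fourierPow m q N k l i * q ^ (2 * i + 2) * (gaussianParam m q N * q ^ 2)⁻¹ := by
  rw [fourierPow, fourierPow, ← Real.rpow_natCast q (2 * i + 2), ← Real.rpow_add hq]
  exact fourierPow_shift hq N (by push_cast; ring)

theorem qFactorial_sq_succ (hq1 : q < 1) (i : ℕ) : qFactorial (q ^ 2) (i + 1) =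
    qFactorial (q ^ 2) i * ((1 - q ^ (2 * (i + 1))) / (1 - q ^ 2)) := by
  have hp1 : q ^ 2 < 1 := pow_lt_one₀ hq.le hq1 two_ne_zero
  have := qNumber_succ hp1 i
  rw [← pow_mul] at this
  rw [qFactorial_succ, eq_div_of_mul_eq (by linarith) this]

variable (hq1 : q < 1) (hs : 0 < s) (hsq : s ^ 2 = q) (hH : H = q ^ ((m : ℝ) / 2))
include hq1 hs hsq hH

/-- The component of `oscGraph_coord` along the harmonic T of degree k + 1 in x^j S. -/
theorem fourierCoeff_raise (N k l i : ℕ) :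
    (s ^ k)⁻¹ * (q ^ l)⁻¹ * fourierCoeff m q (N + 1) (k + 1) l i =
      -(H⁻¹ * s ^ k * (mu m q * q ^ m)) * ((q ^ (2 * (i + 1)))⁻¹ *
        ((q ^ (2 * (i + 1)) - 1) / (q ^ 2 - 1)) * (q ^ (i + 1) * fourierCoeff m q N k l (i + 1))) := by
  have hp1 : q ^ 2 < 1 := pow_lt_one₀ hq.le hq1 two_ne_zero
  have hH0 : 0 < H := hH ▸ Real.rpow_pos_of_pos hq _
  have hHm : q ^ m = H ^ 2 := by
    rw [hH, ← Real.rpow_natCast _ 2, ← Real.rpow_mul hq.le, ← Real.rpow_natCast]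
    congr 1; push_cast; ring
  have hk : q ^ k = (s ^ k) ^ 2 := by rw [← hsq]; ring
  have hf := qFactorial_pos (pow_pos hq 2) hp1 i
  have ha := gaussianParam_pos (m := m) hq N
  have hμ := mu_pos (m := m) hq
  have hn : q ^ (2 * (i + 1)) < 1 := pow_lt_one₀ hq.le hq1 (by omega)
  have hn' : 1 - q ^ (2 * (i + 1)) ≠ 0 := by linarith
  have hp' : 1 - q ^ 2 ≠ 0 := by linarith
  rw [fourierCoeff_eq, fourierCoeff_eq, fourierPow_k hq, fourierPow_N hq hH, fourierPow_i hq,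
    gaussianParam_succ hq, qFactorial_sq_succ hq hq1, show k + 1 + i = k + (i + 1) by ring, hHm,
    ← neg_sub 1 (q ^ (2 * (i + 1))), ← neg_sub 1 (q ^ 2), neg_div_neg_eq]
  set n := 1 - q ^ (2 * (i + 1))
  set d := 1 - q ^ 2
  simp only [pow_add, hk]
  have hs0 : (s ^ k) ≠ 0 := by positivity
  generalize s ^ k = S at *
  field_simp
  ring

/-- The component of `oscGraph_coord` along ∂^j S, with `k` the degree of ∂^j S. On the left the
factor r² in the decomposition of x^j S raises l by one; on the right it accompanies the second
term. -/
theorem fourierCoeff_raise_lower (hm : 1 ≤ m) (N k l i : ℕ) :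
    (s ^ (k + 1))⁻¹ * (q ^ l)⁻¹ * ((mu m q * ((q ^ (m + 2 * k) - 1) / (q ^ 2 - 1)))⁻¹ *
      fourierCoeff m q (N + 1) k (l + 1) i) =
    H⁻¹ * s ^ (k + 1) * ((q ^ (2 * k))⁻¹ * ((q ^ i)⁻¹ * fourierCoeff m q N (k + 1) l i) +
      mu m q * q ^ m * ((mu m q * ((q ^ (m + 2 * k) - 1) / (q ^ 2 - 1)))⁻¹ *
        ((q ^ (2 * i))⁻¹ * ((q ^ (2 * i) - 1) / (q ^ 2 - 1)) *
          (q ^ i * fourierCoeff m q N (k + 1) l i)))) := by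
  have hp1 : q ^ 2 < 1 := pow_lt_one₀ hq.le hq1 two_ne_zero
  have hH0 : 0 < H := hH ▸ Real.rpow_pos_of_pos hq _
  have hHm : q ^ m = H ^ 2 := by
    rw [hH, ← Real.rpow_natCast _ 2, ← Real.rpow_mul hq.le, ← Real.rpow_natCast]
    congr 1; push_cast; ring
  have hk : q ^ k = (s ^ k) ^ 2 := by rw [← hsq]; ring
  have hf := qFactorial_pos (pow_pos hq 2) hp1 i
  have ha := gaussianParam_pos (m := m) hq N
  have hμ := mu_pos (m := m) hq
  have hn0 : 1 - q ^ (m + 2 * k) ≠ 0 := by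
    have : q ^ (m + 2 * k) < 1 := pow_lt_one₀ hq.le hq1 (by omega)
    linarith
  have hp' : 1 - q ^ 2 ≠ 0 := by linarith
  rw [fourierCoeff_eq, fourierCoeff_eq, fourierPow_k hq, fourierPow_N hq hH, fourierPow_l hq,
    fourierProd_succ', show k + 1 + i = k + i + 1 by ring,
    ← neg_sub 1 (q ^ (m + 2 * k)), ← neg_sub 1 (q ^ 2), neg_div_neg_eq]
  -- The q-numbers in the denominators become atoms while denominators are cleared; only `n` has to
  -- be expanded again at the end.
  obtain ⟨n, hn⟩ : ∃ n, n = 1 - q ^ (m + 2 * k) := ⟨_, rfl⟩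
  obtain ⟨d, hd⟩ : ∃ d, d = 1 - q ^ 2 := ⟨_, rfl⟩
  rw [← hn] at hn0 ⊢
  rw [← hd] at hp' ⊢
  have hn2 : n = 1 - H ^ 2 * (s ^ k) ^ 4 := by rw [hn, pow_add, pow_mul', hk, hHm]; ring
  simp only [pow_add, mul_add, pow_mul', hk, hHm, pow_one]
  have hs0 : (s ^ k) ≠ 0 := by positivity
  generalize s ^ k = S at *
  field_simp
  rw [hn2, hsq]
  ring

/-- The component of `oscGraph_deriv` along T. For l = 0 the truncated index l - 1 is multiplied by
zero. -/
theorem fourierCoeff_lower (N k l i : ℕ) :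
    (s ^ k)⁻¹ * (q ^ l)⁻¹ * (mu m q * ((q ^ (2 * l) - 1) / (q ^ 2 - 1)) *
      fourierCoeff m q (N + 1) (k + 1) (l - 1) i -
        q ^ (2 * l) * (gaussianParam m q (N + 1) * q ^ 2) * fourierCoeff m q (N + 1) (k + 1) l i) =
    -(H * s ^ k) * (q ^ i * fourierCoeff m q N k l i) := by
  have hp1 : q ^ 2 < 1 := pow_lt_one₀ hq.le hq1 two_ne_zero
  have hH0 : 0 < H := hH ▸ Real.rpow_pos_of_pos hq _
  have hHm : q ^ m = H ^ 2 := by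
    rw [hH, ← Real.rpow_natCast _ 2, ← Real.rpow_mul hq.le, ← Real.rpow_natCast]
    congr 1; push_cast; ring
  have hk : q ^ k = (s ^ k) ^ 2 := by rw [← hsq]; ring
  have hf := qFactorial_pos (pow_pos hq 2) hp1 i
  have ha := gaussianParam_pos (m := m) hq N
  have hμ := mu_pos (m := m) hq
  have hp' : 1 - q ^ 2 ≠ 0 := by linarith
  have hs0 : (s ^ k) ≠ 0 := by positivity
  rcases l with _ | l
  · simp only [fourierCoeff_eq, fourierProd_zero, fourierPow_k hq, fourierPow_N hq hH,
      gaussianParam_succ hq]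
    simp only [pow_add, hk, pow_zero, mul_zero, sub_self, zero_div, zero_mul]
    generalize s ^ k = S at *
    field_simp
    ring
  · rw [add_tsub_cancel_right]
    simp only [fourierCoeff_eq, fourierPow_k hq, fourierPow_N hq hH, fourierPow_l hq,
      gaussianParam_succ hq]
    rw [fourierProd_succ' (k + i), show k + 1 + i = k + i + 1 by ring, fourierProd_succ (k + i + 1),
      ← neg_sub 1 (q ^ (2 * (l + 1))), ← neg_sub 1 (q ^ 2), neg_div_neg_eq]
    obtain ⟨d, hd⟩ : ∃ d, d = 1 - q ^ 2 := ⟨_, rfl⟩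
    rw [← hd] at hp' ⊢
    simp only [pow_add, mul_add, pow_mul', hk, hHm, pow_one]
    generalize s ^ k = S at *
    field_simp
    ring

/-- The component of `oscGraph_deriv` along ∂^j S, with `k` the degree of ∂^j S. The right side
comes from a series multiplied by r², hence the shift to i - 1 and the exception i = 0. -/
theorem fourierCoeff_lower_raise (hm : 1 ≤ m) (N k l i : ℕ) :
    (s ^ (k + 1))⁻¹ * (q ^ l)⁻¹ * (q ^ (2 * l) * (fourierCoeff m q (N + 1) k l i +
      (1 - q ^ 2) * (gaussianParam m q (N + 1) * q ^ 2 / mu m q) *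
        fourierCoeff m q (N + 1) k (l + 1) i) +
      mu m q * (mu m q * ((q ^ (m + 2 * k) - 1) / (q ^ 2 - 1)))⁻¹ *
        ((q ^ (2 * l) - 1) / (q ^ 2 - 1) * fourierCoeff m q (N + 1) k l i -
          q ^ (2 * l) * (gaussianParam m q (N + 1) * q ^ 2 / mu m q) *
            fourierCoeff m q (N + 1) k (l + 1) i)) =
    H * s ^ (k + 1) * ((mu m q * ((q ^ (m + 2 * k) - 1) / (q ^ 2 - 1)))⁻¹ *
      if i = 0 then 0 else q ^ (i - 1) * fourierCoeff m q N (k + 1) l (i - 1)) := by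
  have hp1 : q ^ 2 < 1 := pow_lt_one₀ hq.le hq1 two_ne_zero
  have hH0 : 0 < H := hH ▸ Real.rpow_pos_of_pos hq _
  have hHm : q ^ m = H ^ 2 := by
    rw [hH, ← Real.rpow_natCast _ 2, ← Real.rpow_mul hq.le, ← Real.rpow_natCast]
    congr 1; push_cast; ring
  have hk : q ^ k = (s ^ k) ^ 2 := by rw [← hsq]; ring
  have ha := gaussianParam_pos (m := m) hq N
  have hμ := mu_pos (m := m) hq
  have hn0 : 1 - q ^ (m + 2 * k) ≠ 0 := by
    have : q ^ (m + 2 * k) < 1 := pow_lt_one₀ hq.le hq1 (by omega)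
    linarith
  have hp' : 1 - q ^ 2 ≠ 0 := by linarith
  have hs0 : (s ^ k) ≠ 0 := by positivity
  obtain ⟨n, hn⟩ : ∃ n, n = 1 - q ^ (m + 2 * k) := ⟨_, rfl⟩
  obtain ⟨d, hd⟩ : ∃ d, d = 1 - q ^ 2 := ⟨_, rfl⟩
  have hn2 : n = 1 - H ^ 2 * (s ^ k) ^ 4 := by rw [hn, pow_add, pow_mul', hk, hHm]; ring
  rw [← neg_sub 1 (q ^ (m + 2 * k)), ← neg_sub 1 (q ^ 2), neg_div_neg_eq]
  rw [← hn] at hn0 ⊢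
  rcases i with _ | i
  · have hf := qFactorial_pos (pow_pos hq 2) hp1 0
    simp only [fourierCoeff_eq, fourierPow_k hq, fourierPow_N hq hH, fourierPow_l hq,
      gaussianParam_succ hq, fourierProd_succ, if_true]
    rw [← hd] at hp' ⊢
    simp only [pow_add, mul_add, pow_mul', hk, hHm, pow_one, add_zero]
    generalize s ^ k = S at *
    field_simp
    rw [hn2]
    ring
  · have hf := qFactorial_pos (pow_pos hq 2) hp1 i
    have hi : 1 - q ^ (2 * (i + 1)) ≠ 0 := by
      have : q ^ (2 * (i + 1)) < 1 := pow_lt_one₀ hq.le hq1 (by omega)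
      linarith
    rw [if_neg (Nat.succ_ne_zero i), add_tsub_cancel_right]
    simp only [fourierCoeff_eq, fourierPow_k hq, fourierPow_N hq hH, fourierPow_l hq,
      gaussianParam_succ hq, fourierProd_succ, fourierPow_i hq, qFactorial_sq_succ hq hq1,
      show k + 1 + i = k + (i + 1) by ring]
    rw [← hd] at hp' ⊢
    obtain ⟨e, he⟩ : ∃ e, e = 1 - q ^ (2 * (i + 1)) := ⟨_, rfl⟩
    have he2 : e = 1 - q ^ 2 * (q ^ i) ^ 2 := by rw [he]; ring
    rw [← he] at hi ⊢
    simp only [pow_add, mul_add, pow_mul', hk, hHm, pow_one]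
    generalize s ^ k = S at *
    field_simp
    rw [hn2, he2, hsq]
    ring

end Contiguity

/-! ### The contiguity relations as identities between power series -/

section Series
variable {m : ℕ} {q s H : ℝ}

/-- The Taylor series of the Gaussian `e_{q²}(-a q² u / μ)` with `a = q ^ (1 - N - m / 2)`. -/
def gaussSeries (m : ℕ) (q : ℝ) (N : ℕ) : PowerSeries ℂ :=
  qExpSmallSeries (q ^ 2) (-(gaussianParam m q N * q ^ 2 / mu m q))

/-- The coefficient `a q² / μ` of the Gaussian. -/
def gaussCoeff (m : ℕ) (q : ℝ) (N : ℕ) : ℂ := ((gaussianParam m q N * q ^ 2 / mu m q : ℝ) : ℂ)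

theorem X_mul_qDeriv (hq : 0 < q) (hq1 : q < 1) (f : PowerSeries ℂ) :
    ((q : ℂ) ^ 2 - 1) • (PowerSeries.X * qDeriv q f) = PowerSeries.rescale ((q : ℂ) ^ 2) f - f := by
  have hne := ofReal_sq_sub_one_ne_zero hq hq1
  ext i
  rw [PowerSeries.coeff_smul, map_sub, PowerSeries.coeff_rescale]
  rcases i with _ | i
  · simp
  · rw [PowerSeries.coeff_succ_X_mul, qDeriv, PowerSeries.coeff_mk, qInt]
    simp only [smul_eq_mul]
    field_simp
    ring

theorem rescale_X_pow_mul (r : ℂ) (l : ℕ) (f : PowerSeries ℂ) :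
    PowerSeries.rescale r (PowerSeries.X ^ l * f) =
      r ^ l • (PowerSeries.X ^ l * PowerSeries.rescale r f) := by
  ext i
  simp only [PowerSeries.coeff_rescale, PowerSeries.coeff_smul, PowerSeries.coeff_X_pow_mul',
    smul_eq_mul]
  split_ifs with h
  · rw [← mul_assoc, ← pow_add, Nat.add_sub_of_le h]
  · simp

variable (hq : 0 < q) (hq1 : q < 1)
include hq

/-- Scaling u = r² by q⁻¹ is the effect of Λ^{-1/4} on a radial series. It moves N to N + 1, so the
raising operators alternate between the two Gaussian classes of the domain. -/
theorem rescale_gaussSeries (N : ℕ) :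
    PowerSeries.rescale (q : ℂ)⁻¹ (gaussSeries m q N) = gaussSeries m q (N + 1) := by
  rw [gaussSeries, ← Complex.ofReal_inv, rescale_qExpSmallSeries, gaussSeries,
    gaussianParam_succ hq]
  congr 1
  ring

include hq1

theorem rescale_sq_gaussSeries (N : ℕ) :
    PowerSeries.rescale ((q : ℂ) ^ 2) (gaussSeries m q N) = gaussSeries m q N +
      ((1 - (q : ℂ) ^ 2) * gaussCoeff m q N) • (PowerSeries.X * gaussSeries m q N) := by
  rw [gaussSeries, ← Complex.ofReal_pow, rescale_qExpSmallSeries,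
    qExpSmallSeries_mul (pow_pos hq 2) (pow_lt_one₀ hq.le hq1 two_ne_zero), gaussCoeff, sub_mul,
    one_mul, mul_assoc, ← PowerSeries.smul_eq_C_mul]
  push_cast
  rw [mul_neg, neg_smul, sub_neg_eq_add]

theorem rescale_sq_X_pow_mul_gaussSeries (N l : ℕ) :
    PowerSeries.rescale ((q : ℂ) ^ 2) (PowerSeries.X ^ l * gaussSeries m q N) =
      (q : ℂ) ^ (2 * l) • (PowerSeries.X ^ l * gaussSeries m q N +
        ((1 - (q : ℂ) ^ 2) * gaussCoeff m q N) • (PowerSeries.X ^ (l + 1) * gaussSeries m q N)) := by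
  rw [rescale_X_pow_mul, rescale_sq_gaussSeries hq hq1, mul_add, mul_smul_comm, pow_mul,
    ← mul_assoc, pow_succ (PowerSeries.X : PowerSeries ℂ) l]

theorem X_mul_qDeriv_gaussSeries (N l : ℕ) :
    PowerSeries.X * qDeriv q (PowerSeries.X ^ l * gaussSeries m q N) =
      qInt q l • (PowerSeries.X ^ l * gaussSeries m q N) -
        ((q : ℂ) ^ (2 * l) * gaussCoeff m q N) • (PowerSeries.X ^ (l + 1) * gaussSeries m q N) := by
  have hne := ofReal_sq_sub_one_ne_zero hq hq1
  have h1 := X_mul_qDeriv hq hq1 (PowerSeries.X ^ l * gaussSeries m q N)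
  rw [rescale_sq_X_pow_mul_gaussSeries hq hq1] at h1
  rw [← smul_right_inj hne, h1, qInt]
  match_scalars
  · field_simp
  · ring

theorem qDeriv_gaussSeries (N l : ℕ) :
    qDeriv q (PowerSeries.X ^ l * gaussSeries m q N) =
      qInt q l • (PowerSeries.X ^ (l - 1) * gaussSeries m q N) -
        ((q : ℂ) ^ (2 * l) * gaussCoeff m q N) • (PowerSeries.X ^ l * gaussSeries m q N) := by
  refine mul_left_cancel₀ PowerSeries.X_ne_zero ?_
  rw [X_mul_qDeriv_gaussSeries hq hq1, mul_sub, mul_smul_comm, mul_smul_comm, ← mul_assoc,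
    ← pow_succ', ← mul_assoc, ← pow_succ']
  rcases l with _ | l
  · simp [qInt_zero]
  · simp

variable (hs : 0 < s) (hsq : s ^ 2 = q) (hH : H = q ^ ((m : ℝ) / 2))
include hs hsq hH

theorem fourierSeries_raise (N k l : ℕ) :
    (((s : ℂ) ^ k)⁻¹ * ((q : ℂ) ^ l)⁻¹) • fourierSeries m q (N + 1) (k + 1) l =
      (-((H : ℂ)⁻¹ * (s : ℂ) ^ k * (muC m q * (q : ℂ) ^ m))) •
        qDerivBar q (PowerSeries.rescale (q : ℂ) (fourierSeries m q N k l)) := by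
  ext i
  have h1 := congrArg Complex.ofReal (fourierCoeff_raise (m := m) hq hq1 hs hsq hH N k l i)
  simp only [PowerSeries.coeff_smul, qDerivBar, PowerSeries.coeff_mk, PowerSeries.coeff_rescale,
    fourierSeries, smul_eq_mul, qInt, muC]
  push_cast at h1
  linear_combination h1

theorem fourierSeries_raise_lower (hm : 1 ≤ m) (N k l : ℕ) :
    (((s : ℂ) ^ (k + 1))⁻¹ * ((q : ℂ) ^ l)⁻¹ * (muC m q * qHalfInt m q k)⁻¹) •
      fourierSeries m q (N + 1) k (l + 1) = ((H : ℂ)⁻¹ * (s : ℂ) ^ (k + 1)) •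
        (((q : ℂ) ^ (2 * k))⁻¹ • PowerSeries.rescale ((q : ℂ) ^ 2)⁻¹
          (PowerSeries.rescale (q : ℂ) (fourierSeries m q N (k + 1) l)) +
        (muC m q * (q : ℂ) ^ m * (muC m q * qHalfInt m q k)⁻¹) • (PowerSeries.X *
          qDerivBar q (PowerSeries.rescale (q : ℂ) (fourierSeries m q N (k + 1) l)))) := by
  have hqc : (q : ℂ) ≠ 0 := by exact_mod_cast hq.ne'
  ext i
  have h1 := congrArg Complex.ofReal
    (fourierCoeff_raise_lower (m := m) hq hq1 hs hsq hH hm N k l i)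
  push_cast at h1
  have h2 : PowerSeries.coeff i (PowerSeries.X *
      qDerivBar q (PowerSeries.rescale (q : ℂ) (fourierSeries m q N (k + 1) l))) =
      ((q : ℂ) ^ (2 * i))⁻¹ * (((q : ℂ) ^ (2 * i) - 1) / ((q : ℂ) ^ 2 - 1)) *
        ((q : ℂ) ^ i * (fourierCoeff m q N (k + 1) l i : ℝ)) := by
    rcases i with _ | i
    · simp
    · rw [PowerSeries.coeff_succ_X_mul]
      simp [qDerivBar, fourierSeries, PowerSeries.coeff_rescale, qInt]
  have h3 : (((q : ℂ) ^ 2)⁻¹) ^ i * ((q : ℂ) ^ i) = ((q : ℂ) ^ i)⁻¹ := by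
    rw [inv_pow, ← pow_mul, mul_comm 2 i, pow_mul]
    field_simp
  simp only [PowerSeries.coeff_smul, map_add, h2, smul_eq_mul, PowerSeries.coeff_rescale]
  simp only [fourierSeries, PowerSeries.coeff_mk, qHalfInt, muC]
  rw [← mul_assoc (_ ^ i), h3]
  linear_combination h1

theorem fourierSeries_lower (N k l : ℕ) :
    (((s : ℂ) ^ k)⁻¹ * ((q : ℂ) ^ l)⁻¹ * muC m q) • (qInt q l •
      fourierSeries m q (N + 1) (k + 1) (l - 1) - ((q : ℂ) ^ (2 * l) * gaussCoeff m q (N + 1)) •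
        fourierSeries m q (N + 1) (k + 1) l) =
      (-((H : ℂ) * (s : ℂ) ^ k)) • PowerSeries.rescale (q : ℂ) (fourierSeries m q N k l) := by
  ext i
  have hμ := muC_ne_zero (m := m) hq
  have h1 := congrArg Complex.ofReal (fourierCoeff_lower (m := m) hq hq1 hs hsq hH N k l i)
  push_cast at h1
  have h2 : muC m q * gaussCoeff m q (N + 1) = (gaussianParam m q (N + 1) : ℝ) * (q : ℂ) ^ 2 := by
    rw [gaussCoeff]
    push_cast
    rw [← muC]
    field_simp
  simp only [PowerSeries.coeff_smul, map_sub, PowerSeries.coeff_mk, PowerSeries.coeff_rescale,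
    fourierSeries, smul_eq_mul, qInt]
  rw [← h2, ← muC] at h1
  linear_combination h1

theorem fourierSeries_lower_raise (hm : 1 ≤ m) (N k l : ℕ) :
    (((s : ℂ) ^ (k + 1))⁻¹ * ((q : ℂ) ^ l)⁻¹) • ((q : ℂ) ^ (2 * l) •
      (fourierSeries m q (N + 1) k l + ((1 - (q : ℂ) ^ 2) * gaussCoeff m q (N + 1)) •
        fourierSeries m q (N + 1) k (l + 1)) +
      (muC m q * (muC m q * qHalfInt m q k)⁻¹) • (qInt q l • fourierSeries m q (N + 1) k l -
        ((q : ℂ) ^ (2 * l) * gaussCoeff m q (N + 1)) • fourierSeries m q (N + 1) k (l + 1))) =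
      ((H : ℂ) * (s : ℂ) ^ (k + 1) * (muC m q * qHalfInt m q k)⁻¹) •
        (PowerSeries.X * PowerSeries.rescale (q : ℂ) (fourierSeries m q N (k + 1) l)) := by
  ext i
  have h1 := congrArg Complex.ofReal
    (fourierCoeff_lower_raise (m := m) hq hq1 hs hsq hH hm N k l i)
  push_cast at h1
  have h2 : PowerSeries.coeff i (PowerSeries.X *
      PowerSeries.rescale (q : ℂ) (fourierSeries m q N (k + 1) l)) =
      if i = 0 then 0 else (q : ℂ) ^ (i - 1) * (fourierCoeff m q N (k + 1) l (i - 1) : ℝ) := by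
    rcases i with _ | i
    · simp
    · rw [PowerSeries.coeff_succ_X_mul]
      simp [fourierSeries, PowerSeries.coeff_rescale]
  simp only [PowerSeries.coeff_smul, map_add, map_sub, h2, smul_eq_mul]
  simp only [fourierSeries, PowerSeries.coeff_mk, qHalfInt, muC, qInt, gaussCoeff]
  rw [apply_ite Complex.ofReal] at h1
  push_cast at h1 ⊢
  linear_combination h1

end Series

/-! ### The graph of the transform and its covariance -/

section Graph
variable {m : ℕ} {q s H : ℝ} {η : ℂ} {D D' : Fin m → QPoly m q →ₗ[ℂ] QPoly m q}

/-- The graph of the Fourier transform, inside pairs of power series. -/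
def oscGraph (D : Fin m → QPoly m q →ₗ[ℂ] QPoly m q) (η : ℂ) :
    Submodule ℂ (PowerSeries (QPoly m q) × PowerSeries (QPoly m q)) :=
  Submodule.span ℂ {z | ∃ (N k l : ℕ) (S : QPoly m q), S ∈ harmonics D k ∧
    z = (sphere m q k S (PowerSeries.X ^ l * gaussSeries m q N),
      η ^ k • sphere m q k S (fourierSeries m q N k l))}

theorem mem_oscGraph {k : ℕ} {S : QPoly m q} (hS : S ∈ harmonics D k) (N l : ℕ) :
    (sphere m q k S (PowerSeries.X ^ l * gaussSeries m q N),
      η ^ k • sphere m q k S (fourierSeries m q N k l)) ∈ oscGraph D η :=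
  Submodule.subset_span ⟨N, k, l, S, hS, rfl⟩

theorem oscGraph_map_mem {A B : Module.End ℂ (PowerSeries (QPoly m q))}
    (hgen : ∀ (N k l : ℕ) (S : QPoly m q), S ∈ harmonics D k →
      (A (sphere m q k S (PowerSeries.X ^ l * gaussSeries m q N)),
        B (η ^ k • sphere m q k S (fourierSeries m q N k l))) ∈ oscGraph D η)
    {z : PowerSeries (QPoly m q) × PowerSeries (QPoly m q)} (hz : z ∈ oscGraph D η) :
    (A z.1, B z.2) ∈ oscGraph D η := by
  have h1 : oscGraph D η ≤ (oscGraph D η).comap (A.prodMap B) := by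
    conv_lhs => unfold oscGraph
    rw [Submodule.span_le]
    rintro _ ⟨N, k, l, S, hS, rfl⟩
    exact hgen N k l S hS
  exact h1 hz

namespace PolyCalculus
variable (h : PolyCalculus m q D D') (hm : 1 ≤ m) (hq : 0 < q) (hq1 : q < 1)
  (hs : 0 < s) (hsq : s ^ 2 = q) (hH : H = q ^ ((m : ℝ) / 2)) (hη : η ^ 2 = -1)

section
include hsq

theorem dilOp_sphere_fourier (N k l : ℕ) (S : QPoly m q) :
    dilOp m q (s : ℂ) (sphere m q k S (fourierSeries m q N k l)) =
      (s : ℂ) ^ k • sphere m q k S (PowerSeries.rescale (q : ℂ) (fourierSeries m q N k l)) := by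
  have h1 : (s : ℂ) ^ 2 = (q : ℂ) := by rw [← Complex.ofReal_pow, hsq]
  rw [dilOp_sphere, h1]

include hq

theorem dilOp_inv_sphere_gauss (N k l : ℕ) (S : QPoly m q) :
    dilOp m q (s : ℂ)⁻¹ (sphere m q k S (PowerSeries.X ^ l * gaussSeries m q N)) =
      (((s : ℂ) ^ k)⁻¹ * ((q : ℂ) ^ l)⁻¹) •
        sphere m q k S (PowerSeries.X ^ l * gaussSeries m q (N + 1)) := by
  have h1 : ((s : ℂ)⁻¹) ^ 2 = (q : ℂ)⁻¹ := by rw [inv_pow, ← Complex.ofReal_pow, hsq]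
  rw [dilOp_sphere, h1, rescale_X_pow_mul, rescale_gaussSeries hq, map_smul, smul_smul, inv_pow,
    inv_pow]

end

include h hm hq hq1 hs hsq hH hη

/-- Both entries are expanded along T and ∂^j S by `exists_coord_mul`, and the two raising relations
match the components. The degrees k + 1 and k - 1 differ by two, so their powers of η differ by the
sign η² = -1, which is the sign the relations require. -/
theorem oscGraph_coord (j : Fin m)
    {z : PowerSeries (QPoly m q) × PowerSeries (QPoly m q)} (hz : z ∈ oscGraph D η) :
    (coordOp m q j (dilOp m q (s : ℂ)⁻¹ z.1),
      (-(η * (H : ℂ)⁻¹)) • derivOp (D' j) (dilOp m q (s : ℂ) z.2)) ∈ oscGraph D η := by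
  refine oscGraph_map_mem (A := (coordOp m q j) ∘ₗ (dilOp m q (s : ℂ)⁻¹))
    (B := (-(η * (H : ℂ)⁻¹)) • ((derivOp (D' j)) ∘ₗ (dilOp m q (s : ℂ)))) ?_ hz
  intro N k l S hS
  obtain ⟨T, hT, hT'⟩ := h.exists_coord_mul hm hq hq1 k hS j
  have hgT := mem_oscGraph (η := η) hT (N + 1) l
  have hgD := mem_oscGraph (η := η) (h.D_mem_harmonics hm hq hq1 k hS j) (N + 1) (l + 1)
  have e1 := congrArg (sphere m q (k + 1) T) (fourierSeries_raise (m := m) hq hq1 hs hsq hH N k l)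
  rw [map_smul, map_smul] at e1
  have hH0 : (H : ℂ) ≠ 0 := by
    rw [hH]; exact_mod_cast (Real.rpow_pos_of_pos hq _).ne'
  convert Submodule.smul_mem _ ((((s : ℂ) ^ k)⁻¹ * ((q : ℂ) ^ l)⁻¹)) (Submodule.add_mem _ hgT
    (Submodule.smul_mem _ (muC m q * qHalfInt m q (k - 1))⁻¹ hgD)) using 1
  refine Prod.ext ?_ ?_
  · simp only [LinearMap.comp_apply, Prod.smul_fst, Prod.fst_add]
    rw [dilOp_inv_sphere_gauss hq hsq, map_smul, h.coordOp_sphere hm hq hq1, hT', ← mul_assoc,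
      ← pow_succ']
  · simp only [LinearMap.comp_apply, LinearMap.smul_apply, Prod.smul_snd, Prod.snd_add]
    rw [map_smul, map_smul, dilOp_sphere_fourier hsq, map_smul,
      h.derivOp_bar_sphere hm hq hq1 j k hS, hT']
    rcases k with _ | k
    · rw [h.D_homog_zero hS.1]
      simp only [map_zero, LinearMap.zero_apply, smul_zero, add_zero, zero_add]
      linear_combination (norm := module) (-η) • e1
    · have e2 := congrArg (sphere m q k (D j S))
        (fourierSeries_raise_lower (m := m) hq hq1 hs hsq hH hm N k l)
      simp only [map_smul, map_add] at e2
      simp only [add_tsub_cancel_right]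
      have e3 : -(η * (H : ℂ)⁻¹) * η ^ (k + 1) = (H : ℂ)⁻¹ * η ^ k := by
        linear_combination (-(H : ℂ)⁻¹ * η ^ k) * hη
      have e4 : η ^ (k + 1 + 1) = -η ^ k := by linear_combination η ^ k * hη
      rw [smul_smul (-(η * (H : ℂ)⁻¹)), e3, e4]
      linear_combination (norm := module) (η ^ k) • e1 - (η ^ k) • e2

/-- The mirror of `oscGraph_coord`: differentiation turns into multiplication, and the two lowering
relations match the components. -/
theorem oscGraph_deriv (j : Fin m)
    {z : PowerSeries (QPoly m q) × PowerSeries (QPoly m q)} (hz : z ∈ oscGraph D η) :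
    (derivOp (D j) (dilOp m q (s : ℂ)⁻¹ z.1),
      (-(η * (H : ℂ))) • coordOp m q j (dilOp m q (s : ℂ) z.2)) ∈ oscGraph D η := by
  refine oscGraph_map_mem (A := (derivOp (D j)) ∘ₗ (dilOp m q (s : ℂ)⁻¹))
    (B := (-(η * (H : ℂ))) • ((coordOp m q j) ∘ₗ (dilOp m q (s : ℂ)))) ?_ hz
  intro N k l S hS
  obtain ⟨T, hT, hT'⟩ := h.exists_coord_mul hm hq hq1 k hS j
  have hgT := fun l' => mem_oscGraph (η := η) hT (N + 1) l'
  have hgD := fun l' => mem_oscGraph (η := η) (h.D_mem_harmonics hm hq hq1 k hS j) (N + 1) l'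
  have e1 := congrArg (sphere m q (k + 1) T) (fourierSeries_lower (m := m) hq hq1 hs hsq hH N k l)
  simp only [map_smul, map_sub] at e1
  -- This combination of generators is read off from the first entry: `derivOp_sphere` applied to
  -- u^l times the Gaussian, with the rescaled series, the q²-derivative and u times the
  -- q²-derivative each written again in terms of u^{l-1}, u^l and u^{l+1} times the same Gaussian.
  convert Submodule.smul_mem _ ((((s : ℂ) ^ k)⁻¹ * ((q : ℂ) ^ l)⁻¹)) (Submodule.add_mem _
    (Submodule.add_mem _
      (Submodule.smul_mem _ ((q : ℂ) ^ (2 * l)) (Submodule.add_mem _ (hgD l)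
        (Submodule.smul_mem _ ((1 - (q : ℂ) ^ 2) * gaussCoeff m q (N + 1)) (hgD (l + 1)))))
      (Submodule.smul_mem _ (muC m q) (Submodule.sub_mem _
        (Submodule.smul_mem _ (qInt q l) (hgT (l - 1)))
        (Submodule.smul_mem _ ((q : ℂ) ^ (2 * l) * gaussCoeff m q (N + 1)) (hgT l)))))
    (Submodule.smul_mem _ (muC m q * (muC m q * qHalfInt m q (k - 1))⁻¹) (Submodule.sub_mem _
        (Submodule.smul_mem _ (qInt q l) (hgD l))
        (Submodule.smul_mem _ ((q : ℂ) ^ (2 * l) * gaussCoeff m q (N + 1)) (hgD (l + 1)))))) using 1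
  refine Prod.ext ?_ ?_
  · simp only [LinearMap.comp_apply, Prod.smul_fst, Prod.fst_add, Prod.fst_sub]
    rw [dilOp_inv_sphere_gauss hq hsq, map_smul, h.derivOp_sphere hm hq hq1 j k hS.1, hT',
      rescale_sq_X_pow_mul_gaussSeries hq hq1, X_mul_qDeriv_gaussSeries hq hq1,
      qDeriv_gaussSeries hq hq1]
    simp only [map_smul, map_add, map_sub]
    module
  · simp only [LinearMap.comp_apply, LinearMap.smul_apply, Prod.smul_snd, Prod.snd_add,
      Prod.snd_sub]
    rw [map_smul, map_smul, dilOp_sphere_fourier hsq, map_smul, h.coordOp_sphere hm hq hq1, hT']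
    rcases k with _ | k
    · rw [h.D_homog_zero hS.1]
      simp only [map_zero, LinearMap.zero_apply, smul_zero, add_zero, zero_add, sub_self]
      linear_combination (norm := module) (-η) • e1
    · have e2 := congrArg (sphere m q k (D j S))
        (fourierSeries_lower_raise (m := m) hq hq1 hs hsq hH hm N k l)
      simp only [map_smul, map_add, map_sub] at e2
      simp only [add_tsub_cancel_right]
      have e3 : -(η * (H : ℂ)) * η ^ (k + 1) = (H : ℂ) * η ^ k := by
        linear_combination (-(H : ℂ) * η ^ k) * hη
      have e4 : η ^ (k + 1 + 1) = -η ^ k := by linear_combination η ^ k * hη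
      rw [smul_smul (-(η * (H : ℂ))), e3, e4]
      linear_combination (norm := module) (η ^ k) • e1 - (η ^ k) • e2

end PolyCalculus
end Graph

/-! ### Identification of the graph of the transform with `oscGraph` -/

section Comparison
variable {m : ℕ} {q γ : ℝ}

/-- The inclusion of pairs of elements of `O_q` in pairs of power series. -/
def coePair (m : ℕ) (q : ℝ) :
    (QSeries m q × QSeries m q) →ₗ[ℂ] PowerSeries (QPoly m q) × PowerSeries (QPoly m q) :=
  (QSeries m q).val.toLinearMap.prodMap (QSeries m q).val.toLinearMap

theorem coePair_apply (z : QSeries m q × QSeries m q) :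
    coePair m q z = ((z.1 : PowerSeries (QPoly m q)), (z.2 : PowerSeries (QPoly m q))) := rfl

theorem coePair_injective : Function.Injective (coePair m q) := fun z w hzw => by
  rw [coePair_apply, coePair_apply, Prod.mk.injEq] at hzw
  exact Prod.ext (Subtype.ext hzw.1) (Subtype.ext hzw.2)

theorem gaussianParam_odd (hq : 0 < q) (j : ℕ) :
    (q ^ (2 * j))⁻¹ * q ^ (-((m : ℝ) / 2)) = gaussianParam m q (2 * j + 1) := by
  rw [gaussianParam, ← Real.rpow_natCast, ← Real.rpow_neg hq.le, ← Real.rpow_add hq]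
  congr 1
  push_cast
  ring

theorem gaussianParam_even (hq : 0 < q) (j : ℕ) :
    (q ^ (2 * j))⁻¹ * q ^ (1 - (m : ℝ) / 2) = gaussianParam m q (2 * j) := by
  rw [gaussianParam, ← Real.rpow_natCast, ← Real.rpow_neg hq.le, ← Real.rpow_add hq]
  congr 1
  push_cast
  ring

namespace PolyCalculus
variable {D D' : Fin m → QPoly m q →ₗ[ℂ] QPoly m q}
variable (h : PolyCalculus m q D D') (hm : 1 ≤ m) (hq : 0 < q) (hq1 : q < 1) (hγ : 0 < γ)
include h hm hq hq1 hγ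

/-- Taylor series are unique, so the two series in a generator must be the computed ones. The
normalization constant is positive, hence can be divided out, and `fourierSeries` remains. -/
theorem map_fourierGraphOn_le (ε : ℤˣ) {α : ℝ}
    (hα : ∀ j : ℕ, ∃ N, (q ^ (2 * j))⁻¹ * α = gaussianParam m q N) :
    (fourierGraphOn m q ε γ α).map (coePair m q) ≤ oscGraph D (((ε : ℤ) : ℂ) * Complex.I) := by
  rw [fourierGraphOn, Submodule.map_span_le]
  rintro _ ⟨j, k, S, P, s, t, hS, hs, ht, rfl⟩
  obtain ⟨N, hN⟩ := hα j
  rw [hN] at hs ht ⊢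
  have hs' := hs.unique (hasTaylorAtOrigin_gaussianFun hq hq1 (gaussianParam_pos hq N) P)
  have ht' := ht.unique (hasTaylorAtOrigin_radialTransform hm hq hq1 hγ N k P)
  have hc : fourierConst m q (gaussianParam m q N) γ ≠ 0 := by
    rw [fourierConst_eq hq hγ (gaussianParam_pos hq N)]
    exact_mod_cast (fourierConstReal_pos hm hq hq1 hγ (gaussianParam_pos hq N)).ne'
  have hS' := (h.mem_sphericalHarmonics k S).mp hS
  rw [coePair_apply]
  simp only [SetLike.val_smul]
  rw [h.coe_ofHomog_mul_radial hm hq hq1, h.coe_ofHomog_mul_radial hm hq hq1, hs', ht']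
  have := Submodule.sum_mem (oscGraph D (((ε : ℤ) : ℂ) * Complex.I)) (t := P.support)
    (f := fun l => P.coeff l • (sphere m q k (S : QPoly m q) (PowerSeries.X ^ l * gaussSeries m q N),
      (((ε : ℤ) : ℂ) * Complex.I) ^ k • sphere m q k (S : QPoly m q) (fourierSeries m q N k l)))
    fun l _ => Submodule.smul_mem _ _ (mem_oscGraph hS' N l)
  convert this using 1
  rw [← gaussSeries, polynomial_coe_eq_sum]
  simp only [Finset.sum_mul, map_sum, smul_mul_assoc, map_smul]
  refine Prod.ext ?_ ?_
  · simp only [Prod.fst_sum, Prod.smul_fst]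
  · simp only [Prod.snd_sum, Prod.smul_snd, Finset.smul_sum]
    refine Finset.sum_congr rfl fun l _ => ?_
    rw [smul_comm (P.coeff l), smul_smul, div_mul_cancel₀ _ hc, smul_comm]

theorem generator_mem_map (ε : ℤˣ) {α : ℝ} {j N : ℕ}
    (hN : (q ^ (2 * j))⁻¹ * α = gaussianParam m q N) {k l : ℕ} {S : QPoly m q}
    (hS : S ∈ harmonics D k) :
    (sphere m q k S (PowerSeries.X ^ l * gaussSeries m q N),
      (((ε : ℤ) : ℂ) * Complex.I) ^ k • sphere m q k S (fourierSeries m q N k l)) ∈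
      (fourierGraphOn m q ε γ α).map (coePair m q) := by
  have hc : fourierConst m q (gaussianParam m q N) γ ≠ 0 := by
    rw [fourierConst_eq hq hγ (gaussianParam_pos hq N)]
    exact_mod_cast (fourierConstReal_pos hm hq hq1 hγ (gaussianParam_pos hq N)).ne'
  refine ⟨_, Submodule.subset_span ⟨j, k, ⟨S, hS.1⟩, Polynomial.X ^ l, _, _,
    (h.mem_sphericalHarmonics k ⟨S, hS.1⟩).mpr hS,
    hN ▸ hasTaylorAtOrigin_gaussianFun hq hq1 (gaussianParam_pos hq N) _,
    hN ▸ hasTaylorAtOrigin_radialTransform hm hq hq1 hγ N k _, rfl⟩, ?_⟩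
  rw [coePair_apply]
  simp only [SetLike.val_smul]
  rw [h.coe_ofHomog_mul_radial hm hq hq1, h.coe_ofHomog_mul_radial hm hq hq1, hN,
    Polynomial.support_X_pow l, Finset.sum_singleton, Polynomial.coeff_X_pow_self,
    one_smul, Polynomial.coe_pow, Polynomial.coe_X, map_smul, smul_smul, div_mul_cancel₀ _ hc]
  rfl

/-- The parameters of the class of q^{-m/2} are those with N odd, and the parameters of the class of
q^{1-m/2} those with N even, so together they exhaust all N. -/
theorem map_fourierGraph (ε : ℤˣ) :
    (fourierGraph m q ε γ).map (coePair m q) = oscGraph D (((ε : ℤ) : ℂ) * Complex.I) := by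
  rw [fourierGraph, Submodule.map_sup]
  refine le_antisymm (sup_le ?_ ?_) ?_
  · exact h.map_fourierGraphOn_le hm hq hq1 hγ ε fun j => ⟨_, gaussianParam_odd hq j⟩
  · exact h.map_fourierGraphOn_le hm hq hq1 hγ ε fun j => ⟨_, gaussianParam_even hq j⟩
  · unfold oscGraph
    rw [Submodule.span_le]
    rintro _ ⟨N, k, l, S, hS, rfl⟩
    obtain ⟨j, rfl | rfl⟩ := Nat.even_or_odd' N
    · exact Submodule.mem_sup_right
        (h.generator_mem_map hm hq hq1 hγ ε (gaussianParam_even hq j) hS)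
    · exact Submodule.mem_sup_left
        (h.generator_mem_map hm hq hq1 hγ ε (gaussianParam_odd hq j) hS)

theorem mem_fourierGraph (ε : ℤˣ) (f g : QSeries m q) : (f, g) ∈ fourierGraph m q ε γ ↔
    ((f : PowerSeries (QPoly m q)), (g : PowerSeries (QPoly m q))) ∈
      oscGraph D (((ε : ℤ) : ℂ) * Complex.I) := by
  rw [← h.map_fourierGraph hm hq hq1 hγ ε]
  exact ⟨fun hz => ⟨_, hz, rfl⟩, fun ⟨_, hz, e⟩ => coePair_injective (a₂ := (f, g)) e ▸ hz⟩

end PolyCalculus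
end Comparison

/-! ### The radial part of the graph -/

section Radial
variable {m : ℕ} {q : ℝ} {η : ℂ}

/-- The transform of a polynomial times a Gaussian, on the level of Taylor series. -/
def fourierPoly (m : ℕ) (q : ℝ) (N k : ℕ) : ℂ[X] →ₗ[ℂ] PowerSeries ℂ :=
  Polynomial.lsum fun l => LinearMap.toSpanSingleton ℂ (PowerSeries ℂ) (fourierSeries m q N k l)

theorem fourierPoly_monomial (N k l : ℕ) (a : ℂ) :
    fourierPoly m q N k (Polynomial.monomial l a) = a • fourierSeries m q N k l := by
  rw [fourierPoly, Polynomial.lsum_apply, Polynomial.sum_monomial_index]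
  · rfl
  · exact map_zero _

theorem fourierPoly_X_pow (N k l : ℕ) :
    fourierPoly m q N k (Polynomial.X ^ l) = fourierSeries m q N k l := by
  rw [Polynomial.X_pow_eq_monomial, fourierPoly_monomial, one_smul]

theorem fourierPoly_apply (N k : ℕ) (P : ℂ[X]) : fourierPoly m q N k P =
    ∑ l ∈ P.support, P.coeff l • fourierSeries m q N k l := by
  rw [fourierPoly, Polynomial.lsum_apply]
  rfl

/-- The pair formed by a polynomial times a Gaussian and its transform. -/
def radialPair (m : ℕ) (q : ℝ) (η : ℂ) (N k : ℕ) : ℂ[X] →ₗ[ℂ] PowerSeries ℂ × PowerSeries ℂ :=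
  LinearMap.prod ((LinearMap.mulRight ℂ (gaussSeries m q N)) ∘ₗ
    (Polynomial.coeToPowerSeries.algHom ℂ).toLinearMap) (η ^ k • fourierPoly m q N k)

theorem radialPair_apply (N k : ℕ) (P : ℂ[X]) : radialPair m q η N k P =
    ((P : PowerSeries ℂ) * gaussSeries m q N, η ^ k • fourierPoly m q N k P) := by
  rw [radialPair, LinearMap.prod_apply]
  simp [Polynomial.coeToPowerSeries.algHom_apply]

/-- The radial part of the graph in degree `k`. -/
def radialGraph (m : ℕ) (q : ℝ) (η : ℂ) (k : ℕ) : Submodule ℂ (PowerSeries ℂ × PowerSeries ℂ) :=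
  ⨆ N, LinearMap.range (radialPair m q η N k)

theorem mem_radialGraph (N k l : ℕ) : (PowerSeries.X ^ l * gaussSeries m q N,
    η ^ k • fourierSeries m q N k l) ∈ radialGraph m q η k := by
  refine Submodule.mem_iSup_of_mem N ⟨Polynomial.X ^ l, ?_⟩
  rw [radialPair_apply, fourierPoly_X_pow, Polynomial.coe_pow, Polynomial.coe_X]

/-- The transformed counterpart of `gaussSeries_add_two`. Together they say that the transforms for
the parameters a and q^{-2}a agree on the smaller of the two spaces, as needed on their union. -/
theorem fourierSeries_add_two (hq : 0 < q) (hq1 : q < 1) (N k l : ℕ) :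
    fourierSeries m q N k l = fourierSeries m q (N + 2) k l +
      ((1 - (q : ℂ) ^ 2) * gaussCoeff m q (N + 2)) • fourierSeries m q (N + 2) k (l + 1) := by
  have hp1 : q ^ 2 < 1 := pow_lt_one₀ hq.le hq1 two_ne_zero
  have hp' : 1 - q ^ 2 ≠ 0 := by linarith
  have hμ := mu_pos (m := m) hq
  have ha := gaussianParam_pos (m := m) hq (N + 2)
  have hHm : q ^ m = (q ^ ((m : ℝ) / 2)) ^ 2 := by
    rw [← Real.rpow_natCast _ 2, ← Real.rpow_mul hq.le, ← Real.rpow_natCast]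
    congr 1; push_cast; ring
  have hH0 : 0 < q ^ ((m : ℝ) / 2) := Real.rpow_pos_of_pos hq _
  have key : ∀ i, fourierCoeff m q N k l i = fourierCoeff m q (N + 2) k l i +
      (1 - q ^ 2) * (gaussianParam m q (N + 2) * q ^ 2 / mu m q) *
        fourierCoeff m q (N + 2) k (l + 1) i := fun i => by
    have hf := qFactorial_pos (pow_pos hq 2) hp1 i
    simp only [fourierCoeff_eq, fourierPow_l hq, fourierProd_succ]
    rw [fourierPow_N hq rfl, fourierPow_N hq rfl, pow_add q m, hHm]
    field_simp
    ring
  ext i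
  have := congrArg Complex.ofReal (key i)
  push_cast at this
  simp only [fourierSeries, map_add, PowerSeries.coeff_smul, PowerSeries.coeff_mk, gaussCoeff,
    smul_eq_mul]
  push_cast
  exact this

theorem gaussSeries_add_two (hq : 0 < q) (hq1 : q < 1) (N : ℕ) :
    gaussSeries m q N = gaussSeries m q (N + 2) +
      ((1 - (q : ℂ) ^ 2) * gaussCoeff m q (N + 2)) • (PowerSeries.X * gaussSeries m q (N + 2)) := by
  have hqc : (q : ℂ) ≠ 0 := by exact_mod_cast hq.ne'
  rw [← rescale_sq_gaussSeries hq hq1, ← rescale_gaussSeries hq (N + 1), ← rescale_gaussSeries hq N]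
  ext i
  simp only [PowerSeries.coeff_rescale]
  rw [← mul_assoc, ← mul_assoc, ← mul_pow, ← mul_pow]
  field_simp
  simp

theorem radialPair_add_two (hq : 0 < q) (hq1 : q < 1) (N k : ℕ) (P : ℂ[X]) :
    radialPair m q η N k P = radialPair m q η (N + 2) k
      (P + Polynomial.C ((1 - (q : ℂ) ^ 2) * gaussCoeff m q (N + 2)) * (Polynomial.X * P)) := by
  rw [radialPair_apply, radialPair_apply]
  refine Prod.ext ?_ ?_
  · simp only [gaussSeries_add_two hq hq1 N, Polynomial.coe_add, Polynomial.coe_mul,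
      Polynomial.coe_C, Polynomial.coe_X, PowerSeries.smul_eq_C_mul]
    ring
  · refine congrArg (η ^ k • ·) ?_
    induction P using Polynomial.induction_on' with
    | add P Q hP hQ =>
      rw [map_add, hP, hQ, ← map_add]
      congr 1
      ring
    | monomial l a =>
      rw [Polynomial.X_mul_monomial, Polynomial.C_mul_monomial, map_add, fourierPoly_monomial,
        fourierPoly_monomial, fourierPoly_monomial, fourierSeries_add_two hq hq1 N]
      module

/-- The ranges increase when N grows by two, so finitely many of them can be collected in two
consecutive ones, one of each parity. -/
theorem exists_radialPair (hq : 0 < q) (hq1 : q < 1) (k : ℕ) {z : PowerSeries ℂ × PowerSeries ℂ}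
    (hz : z ∈ radialGraph m q η k) : ∃ (N : ℕ) (P Q : ℂ[X]),
      z = radialPair m q η N k P + radialPair m q η (N + 1) k Q := by
  set R : ℕ → Submodule ℂ (PowerSeries ℂ × PowerSeries ℂ) := fun j =>
    LinearMap.range (radialPair m q η (2 * j) k) ⊔
      LinearMap.range (radialPair m q η (2 * j + 1) k) with hR
  have hstep : ∀ N, LinearMap.range (radialPair m q η N k) ≤
      LinearMap.range (radialPair m q η (N + 2) k) := by
    rintro N _ ⟨P, rfl⟩
    exact ⟨_, (radialPair_add_two hq hq1 N k P).symm⟩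
  have hmono : Monotone R := monotone_nat_of_le_succ fun j => sup_le_sup (hstep _) (hstep _)
  have hle : radialGraph m q η k ≤ ⨆ j, R j := by
    refine iSup_le fun N => ?_
    obtain ⟨j, rfl | rfl⟩ := Nat.even_or_odd' N
    · exact le_sup_left.trans (le_iSup R j)
    · exact le_sup_right.trans (le_iSup R j)
  obtain ⟨j, hj⟩ := (Submodule.mem_iSup_of_directed R hmono.directed_le).mp (hle hz)
  obtain ⟨_, ⟨P, rfl⟩, _, ⟨Q, rfl⟩, rfl⟩ := Submodule.mem_sup.mp hj
  exact ⟨2 * j, P, Q, rfl⟩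

theorem gaussSeries_ne_zero (N : ℕ) : gaussSeries m q N ≠ 0 := fun h0 => by
  have := congrArg (PowerSeries.coeff 0) h0
  simp [gaussSeries, coeff_qExpSmallSeries, qFactorial_zero] at this

theorem gaussCoeff_ne_zero (hq : 0 < q) (N : ℕ) : gaussCoeff m q N ≠ 0 := by
  have := gaussianParam_pos (m := m) hq N
  have := mu_pos (m := m) hq
  rw [gaussCoeff, Complex.ofReal_ne_zero]
  positivity

theorem gaussCoeff_succ (hq : 0 < q) (N : ℕ) :
    gaussCoeff m q (N + 1) = gaussCoeff m q N * (q : ℂ)⁻¹ := by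
  rw [gaussCoeff, gaussCoeff, gaussianParam_succ hq, ← Complex.ofReal_inv, ← Complex.ofReal_mul]
  congr 1
  ring

/-- Gaussians of different parity are independent over the polynomials. -/
theorem gaussSeries_independent (hq : 0 < q) (hq1 : q < 1) (N : ℕ) (P Q : ℂ[X])
    (h0 : (P : PowerSeries ℂ) * gaussSeries m q N + (Q : PowerSeries ℂ) * gaussSeries m q (N + 1)
      = 0) : P = 0 ∧ Q = 0 := by
  have hg := gaussSeries_ne_zero (m := m) (q := q)
  by_cases hP : P = 0
  · subst hP
    rw [Polynomial.coe_zero, zero_mul, zero_add] at h0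
    exact ⟨rfl, Polynomial.coe_eq_zero_iff.mp ((mul_eq_zero.mp h0).resolve_right (hg _))⟩
  by_cases hQ : Q = 0
  · subst hQ
    rw [Polynomial.coe_zero, zero_mul, add_zero] at h0
    exact absurd (Polynomial.coe_eq_zero_iff.mp ((mul_eq_zero.mp h0).resolve_right (hg _))) hP
  exfalso
  have hqc : (q : ℂ) ≠ 0 := by exact_mod_cast hq.ne'
  have hsq := ofReal_sq_sub_one_ne_zero hq hq1
  have hsq' : 1 - (q : ℂ) ^ 2 ≠ 0 := fun h => hsq (by linear_combination -h)
  set L : ℕ → ℂ[X] := fun M => 1 + Polynomial.C ((1 - (q : ℂ) ^ 2) * gaussCoeff m q M) *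
    Polynomial.X with hL
  set r : ℂ[X] → ℂ[X] := fun P => P.comp (Polynomial.C ((q : ℂ) ^ 2) * Polynomial.X) with hr
  have hrc : ∀ P : ℂ[X], PowerSeries.rescale ((q : ℂ) ^ 2) (P : PowerSeries ℂ) =
      ((r P : ℂ[X]) : PowerSeries ℂ) := fun P => by
    ext n
    rw [PowerSeries.coeff_rescale, Polynomial.coeff_coe, Polynomial.coeff_coe, hr]
    simp only [Polynomial.comp_C_mul_X_coeff]
    ring
  have hgs : ∀ M, PowerSeries.rescale ((q : ℂ) ^ 2) (gaussSeries m q M) =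
      ((L M : ℂ[X]) : PowerSeries ℂ) * gaussSeries m q M := fun M => by
    rw [rescale_sq_gaussSeries hq hq1, hL]
    simp only [Polynomial.coe_add, Polynomial.coe_one, Polynomial.coe_mul, Polynomial.coe_C,
      Polynomial.coe_X, add_mul, one_mul, PowerSeries.smul_eq_C_mul, mul_assoc]
  -- Substituting q²u for u multiplies each Gaussian by its own linear factor `L`. Eliminating the
  -- Gaussians between this relation and `h0` leaves a polynomial identity whose leading
  -- coefficients give q^{2 deg P + 1} = q^{2 deg Q}, impossible by parity.
  have h1 := congrArg (PowerSeries.rescale ((q : ℂ) ^ 2)) h0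
  rw [map_add, map_mul, map_mul, hrc, hrc, hgs, hgs, map_zero] at h1
  have h2 : (((r P * L N * Q - r Q * L (N + 1) * P : ℂ[X]) : PowerSeries ℂ)) *
      gaussSeries m q N = 0 := by
    simp only [Polynomial.coe_sub, Polynomial.coe_mul]
    linear_combination (Q : PowerSeries ℂ) * h1 -
      ((r Q : ℂ[X]) : PowerSeries ℂ) * ((L (N + 1) : ℂ[X]) : PowerSeries ℂ) * h0
  have h3 : r P * L N * Q = r Q * L (N + 1) * P := sub_eq_zero.mp
    (Polynomial.coe_eq_zero_iff.mp ((mul_eq_zero.mp h2).resolve_right (hg _)))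
  have h4 := congrArg Polynomial.leadingCoeff h3
  have hrl : ∀ P : ℂ[X], (r P).leadingCoeff = P.leadingCoeff * ((q : ℂ) ^ 2) ^ P.natDegree :=
    fun P => by
      rw [hr]
      simp only []
      rw [Polynomial.leadingCoeff_comp (by
        rw [Polynomial.natDegree_C_mul_X _ (pow_ne_zero 2 hqc)]; exact one_ne_zero),
        Polynomial.leadingCoeff_C_mul_X]
  have hLl : ∀ M, (L M).leadingCoeff = (1 - (q : ℂ) ^ 2) * gaussCoeff m q M := fun M => by
    rw [hL]
    simp only []
    rw [Polynomial.leadingCoeff_add_of_degree_lt, Polynomial.leadingCoeff_C_mul_X]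
    rw [Polynomial.degree_C_mul_X (mul_ne_zero hsq' (gaussCoeff_ne_zero hq M)),
      Polynomial.degree_one]
    exact zero_lt_one
  simp only [Polynomial.leadingCoeff_mul, hrl, hLl, gaussCoeff_succ hq N] at h4
  have hPl := Polynomial.leadingCoeff_ne_zero.mpr hP
  have hQl := Polynomial.leadingCoeff_ne_zero.mpr hQ
  have hgc := gaussCoeff_ne_zero (m := m) hq N
  have h5 : (q : ℂ) ^ (2 * P.natDegree + 1) = (q : ℂ) ^ (2 * Q.natDegree) := by
    rw [pow_add, pow_mul, pow_mul, pow_one]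
    field_simp at h4
    linear_combination h4
  have h6 : q ^ (2 * P.natDegree + 1) = q ^ (2 * Q.natDegree) := by exact_mod_cast h5
  have h7 := (pow_right_injective₀ hq hq1.ne) h6
  omega

end Radial

/-! ### Independence of the two parities after the transform -/

section Independence
variable {m : ℕ} {q : ℝ} {η : ℂ}

theorem eq_zero_of_sum_degree {R : ℕ → ℂ[X]} (hR : ∀ l, (R l).degree = l) {P : ℂ[X]}
    (h0 : ∑ l ∈ P.support, P.coeff l • R l = 0) : P = 0 := by
  by_contra hP
  have h1 := congrArg (fun S => Polynomial.coeff S P.natDegree) h0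
  simp only [Polynomial.finsetSum_coeff, Polynomial.coeff_smul, Polynomial.coeff_zero,
    smul_eq_mul] at h1
  rw [Finset.sum_eq_single P.natDegree] at h1
  · rcases mul_eq_zero.mp h1 with h2 | h2
    · exact hP (Polynomial.leadingCoeff_eq_zero.mp h2)
    · have h3 : (R P.natDegree).natDegree = P.natDegree :=
        Polynomial.natDegree_eq_of_degree_eq_some (hR _)
      have h4 : (R P.natDegree).leadingCoeff = 0 := by rw [Polynomial.leadingCoeff, h3, h2]
      have h5 := hR P.natDegree
      rw [Polynomial.leadingCoeff_eq_zero.mp h4, Polynomial.degree_zero] at h5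
      exact absurd h5 (by simp)
  · intro l hl hne
    have hlt : l < P.natDegree :=
      lt_of_le_of_ne (Polynomial.le_natDegree_of_mem_supp l hl) hne
    rw [Polynomial.coeff_eq_zero_of_degree_lt (p := R l) (by rw [hR]; exact_mod_cast hlt),
      mul_zero]
  · intro hn
    rw [Polynomial.notMem_support_iff.mp hn, zero_mul]

theorem eq_zero_of_expand {A B : ℂ[X]}
    (h0 : Polynomial.X * Polynomial.expand ℂ 2 A + Polynomial.expand ℂ 2 B = 0) :
    A = 0 ∧ B = 0 := by
  constructor
  · ext n
    have := congrArg (fun S => Polynomial.coeff S (2 * n + 1)) h0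
    simp only [Polynomial.coeff_add, Polynomial.coeff_X_mul, Polynomial.coeff_zero] at this
    rw [mul_comm 2 n, Polynomial.coeff_expand_mul two_pos, Polynomial.coeff_expand two_pos,
      if_neg (by omega), add_zero] at this
    simpa using this
  · ext n
    have := congrArg (fun S => Polynomial.coeff S (n * 2)) h0
    simp only [Polynomial.coeff_add, Polynomial.coeff_zero] at this
    rw [Polynomial.coeff_expand_mul two_pos] at this
    rcases n with _ | n
    · simpa using this
    · rw [show (n + 1) * 2 = (2 * n + 1) + 1 by ring, Polynomial.coeff_X_mul,
        Polynomial.coeff_expand two_pos, if_neg (by omega), zero_add] at this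
      simpa using this

/-- The polynomials in `q ^ (-2 i)` that occur in the transform coefficients. -/
def coeffPoly (m : ℕ) (q : ℝ) (k l : ℕ) : ℂ[X] :=
  ∏ t ∈ Finset.range l, Polynomial.C ((1 - (q : ℂ) ^ 2)⁻¹) *
    (Polynomial.C (((q : ℂ) ^ (m + 2 * (k + t)))⁻¹) * Polynomial.X + Polynomial.C (-1))

theorem degree_coeffPoly (hq : 0 < q) (hq1 : q < 1) (k l : ℕ) :
    (coeffPoly m q k l).degree = l := by
  have hqc : (q : ℂ) ≠ 0 := by exact_mod_cast hq.ne'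
  have hsq := ofReal_sq_sub_one_ne_zero hq hq1
  have hsq' : 1 - (q : ℂ) ^ 2 ≠ 0 := fun h => hsq (by linear_combination -h)
  rw [coeffPoly, Polynomial.degree_prod]
  simp only [Polynomial.degree_mul, Polynomial.degree_C (inv_ne_zero hsq'),
    Polynomial.degree_linear (inv_ne_zero (pow_ne_zero _ hqc))]
  simp

theorem eval_coeffPoly (k l i : ℕ) :
    (coeffPoly m q k l).eval ((((q : ℂ) ^ i)⁻¹) ^ 2) = ((fourierProd m q (k + i) l : ℝ) : ℂ) := by
  rw [coeffPoly, Polynomial.eval_prod, fourierProd, Complex.ofReal_prod]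
  refine Finset.prod_congr rfl fun t _ => ?_
  simp only [Polynomial.eval_mul, Polynomial.eval_C, Polynomial.eval_add, Polynomial.eval_X]
  push_cast
  have h1 : ((q : ℂ) ^ (m + 2 * (k + i + t)))⁻¹ =
      ((q : ℂ) ^ (m + 2 * (k + t)))⁻¹ * (((q : ℂ) ^ i)⁻¹) ^ 2 := by
    rw [inv_pow, ← mul_inv]
    congr 1
    ring
  rw [h1, div_eq_inv_mul]
  ring

variable (hq : 0 < q) (hq1 : q < 1)
include hq

theorem fourierPow_eq (N k l i : ℕ) : fourierPow m q N k l i =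
    fourierPow m q N k 0 i * ((gaussianParam m q N * q ^ 2)⁻¹) ^ l := by
  induction l with
  | zero => simp
  | succ l ih => rw [fourierPow_l hq, ih, pow_succ _ l, mul_assoc]

include hq1

/-- Up to a common nonzero factor, the i-th coefficient is A(y²) + y⁻¹ B(y²) at y = q^{-i}, with
polynomials A and B made from P and Q; the extra q^i comes from passing from N to N + 1. So y A(y²)
+ B(y²) has infinitely many roots, and its odd and even parts vanish. The polynomials that make up A
and B have degree exactly l, hence P = Q = 0. -/
theorem fourierPoly_independent (N k : ℕ) (P Q : ℂ[X])
    (h0 : fourierPoly m q N k P + fourierPoly m q (N + 1) k Q = 0) : P = 0 ∧ Q = 0 := by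
  have hqc : (q : ℂ) ≠ 0 := by exact_mod_cast hq.ne'
  have hp1 : q ^ 2 < 1 := pow_lt_one₀ hq.le hq1 two_ne_zero
  have hμ := mu_pos (m := m) hq
  have ha := gaussianParam_pos (m := m) hq N
  have hH0 : 0 < q ^ ((m : ℝ) / 2) := Real.rpow_pos_of_pos hq _
  set α : ℕ → ℝ := fun l => mu m q ^ l * ((gaussianParam m q N * q ^ 2)⁻¹) ^ l with hα
  set β : ℕ → ℝ := fun l => α l * (q ^ ((m : ℝ) / 2) * q ^ (k + l)) with hβ
  have hα0 : ∀ l, α l ≠ 0 := fun l => by rw [hα]; positivity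
  have hβ0 : ∀ l, β l ≠ 0 := fun l => mul_ne_zero (hα0 l) (by positivity)
  set c : ℕ → ℝ := fun i => (-1) ^ i * fourierPow m q N k 0 i / mu m q ^ i /
    qFactorial (q ^ 2) i with hc
  have hc0 : ∀ i, c i ≠ 0 := fun i => by
    have := qFactorial_pos (pow_pos hq 2) hp1 i
    have : 0 < fourierPow m q N k 0 i := Real.rpow_pos_of_pos hq _
    rw [hc]
    positivity
  have hF : ∀ l i, fourierCoeff m q N k l i = c i * (α l * fourierProd m q (k + i) l) :=
    fun l i => by
      rw [fourierCoeff_eq, fourierPow_eq hq, hc, hα]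
      ring
  have hF' : ∀ l i, fourierCoeff m q (N + 1) k l i =
      c i * (q ^ i * (β l * fourierProd m q (k + i) l)) := fun l i => by
    rw [fourierCoeff_eq, fourierPow_N hq rfl, fourierPow_eq hq, hc, hβ, hα]
    ring
  set A : ℂ[X] := ∑ l ∈ P.support, P.coeff l • ((α l : ℂ) • coeffPoly m q k l) with hA
  set B : ℂ[X] := ∑ l ∈ Q.support, Q.coeff l • ((β l : ℂ) • coeffPoly m q k l) with hB
  have hroot : ∀ i, (Polynomial.X * Polynomial.expand ℂ 2 A + Polynomial.expand ℂ 2 B).eval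
      (((q : ℂ) ^ i)⁻¹) = 0 := fun i => by
    have h1 := congrArg (PowerSeries.coeff i) h0
    rw [map_add, fourierPoly_apply, fourierPoly_apply, map_sum, map_sum, map_zero] at h1
    simp only [PowerSeries.coeff_smul, fourierSeries, PowerSeries.coeff_mk, hF, hF',
      smul_eq_mul, Complex.ofReal_mul, Complex.ofReal_pow] at h1
    rw [Polynomial.eval_add, Polynomial.eval_mul, Polynomial.eval_X, Polynomial.expand_eval,
      Polynomial.expand_eval, hA, hB, Polynomial.eval_finsetSum, Polynomial.eval_finsetSum]
    simp only [Polynomial.eval_smul, smul_eq_mul, eval_coeffPoly]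
    have hci : (c i : ℂ) ≠ 0 := by exact_mod_cast hc0 i
    have hqi : (q : ℂ) ^ i ≠ 0 := pow_ne_zero _ hqc
    have h2 : (c i : ℂ) * (∑ l ∈ P.support, P.coeff l * (α l * (fourierProd m q (k + i) l : ℝ)) +
        (q : ℂ) ^ i * ∑ l ∈ Q.support, Q.coeff l * (β l * (fourierProd m q (k + i) l : ℝ))) =
        0 := by
      rw [← h1, mul_add, Finset.mul_sum, Finset.mul_sum, Finset.mul_sum]
      congr 1 <;> refine Finset.sum_congr rfl fun l _ => ?_
      · ring
      · ring
    have h3 := (mul_eq_zero.mp h2).resolve_left hci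
    field_simp
    simp only [mul_assoc] at h3 ⊢
    linear_combination h3
  have hzero : Polynomial.X * Polynomial.expand ℂ 2 A + Polynomial.expand ℂ 2 B = 0 := by
    refine Polynomial.eq_zero_of_infinite_isRoot _ ?_
    refine Set.infinite_of_injective_forall_mem (f := fun i : ℕ => ((q : ℂ) ^ i)⁻¹) ?_ hroot
    intro i j hij
    have h1 : q ^ i = q ^ j := by exact_mod_cast inv_injective hij
    exact pow_right_injective₀ hq hq1.ne h1
  obtain ⟨hA0, hB0⟩ := eq_zero_of_expand hzero
  have hdeg : ∀ (γ : ℕ → ℝ), (∀ l, γ l ≠ 0) → ∀ l,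
      ((γ l : ℂ) • coeffPoly m q k l).degree = l := fun γ hγ l => by
    rw [Polynomial.smul_eq_C_mul, Polynomial.degree_C_mul (by exact_mod_cast hγ l),
      degree_coeffPoly hq hq1]
  exact ⟨eq_zero_of_sum_degree (hdeg α hα0) hA0, eq_zero_of_sum_degree (hdeg β hβ0) hB0⟩

/-- Single-valuedness of the transform on the radial level; `radialGraph_snd` is its injectivity. -/
theorem radialGraph_fst (k : ℕ) {z : PowerSeries ℂ × PowerSeries ℂ}
    (hz : z ∈ radialGraph m q η k) (h0 : z.1 = 0) : z = 0 := by
  obtain ⟨N, P, Q, rfl⟩ := exists_radialPair hq hq1 k hz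
  rw [radialPair_apply, radialPair_apply] at h0
  obtain ⟨rfl, rfl⟩ := gaussSeries_independent hq hq1 N P Q h0
  simp

theorem radialGraph_snd (hη : η ≠ 0) (k : ℕ) {z : PowerSeries ℂ × PowerSeries ℂ}
    (hz : z ∈ radialGraph m q η k) (h0 : z.2 = 0) : z = 0 := by
  obtain ⟨N, P, Q, rfl⟩ := exists_radialPair hq hq1 k hz
  rw [radialPair_apply, radialPair_apply] at h0
  have h1 : η ^ k • (fourierPoly m q N k P + fourierPoly m q (N + 1) k Q) = 0 := by
    rw [smul_add]
    exact h0
  obtain ⟨rfl, rfl⟩ := fourierPoly_independent hq hq1 N k P Q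
    ((smul_eq_zero.mp h1).resolve_left (pow_ne_zero k hη))
  simp

end Independence

/-! ### Radial components -/

section Components
variable {m : ℕ} {q γ : ℝ} {η : ℂ} {D D' : Fin m → QPoly m q →ₗ[ℂ] QPoly m q}

theorem sphere_normSq_pow_mul (k l : ℕ) (S : QPoly m q) (s : PowerSeries ℂ) :
    sphere m q (k + 2 * l) (normSq m q ^ l * S) s = sphere m q k S (PowerSeries.X ^ l * s) := by
  induction l generalizing s with
  | zero => simp
  | succ l ih =>
    rw [pow_succ', mul_assoc, show k + 2 * (l + 1) = k + 2 * l + 2 by ring, sphere_normSq_mul, ih,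
      ← mul_assoc, ← pow_succ]

/-- The span of the products of harmonic polynomials with `X ^ l` times the `N`-th Gaussian. -/
def gaussSpan (D : Fin m → QPoly m q →ₗ[ℂ] QPoly m q) (N : ℕ) :
    Submodule ℂ (PowerSeries (QPoly m q)) :=
  Submodule.span ℂ {f | ∃ (k l : ℕ) (S : QPoly m q), S ∈ harmonics D k ∧
    f = sphere m q k S (PowerSeries.X ^ l * gaussSeries m q N)}

theorem oscGraph_map_fst : (oscGraph D η).map (LinearMap.fst ℂ _ _) = ⨆ N, gaussSpan D N := by
  refine le_antisymm ?_ (iSup_le fun N => ?_)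
  · unfold oscGraph
    rw [Submodule.map_span_le]
    rintro _ ⟨N, k, l, S, hS, rfl⟩
    exact Submodule.mem_iSup_of_mem N (Submodule.subset_span ⟨k, l, S, hS, rfl⟩)
  · unfold gaussSpan
    rw [Submodule.span_le]
    rintro _ ⟨k, l, S, hS, rfl⟩
    exact ⟨_, mem_oscGraph hS N l, rfl⟩

/-- The polynomial multiples of the `N`-th Gaussian. -/
def gaussMultiples (m : ℕ) (q : ℝ) (N : ℕ) : Submodule ℂ (PowerSeries ℂ) :=
  (LinearMap.range (radialPair m q 1 N 0)).map (LinearMap.fst ℂ _ _)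

theorem mem_gaussMultiples {N : ℕ} {s : PowerSeries ℂ} :
    s ∈ gaussMultiples m q N ↔ ∃ P : ℂ[X], (P : PowerSeries ℂ) * gaussSeries m q N = s := by
  constructor
  · rintro ⟨_, ⟨P, rfl⟩, rfl⟩
    exact ⟨P, by rw [radialPair_apply]; rfl⟩
  · rintro ⟨P, rfl⟩
    exact ⟨_, ⟨P, rfl⟩, by rw [radialPair_apply]; rfl⟩

theorem gaussMultiples_le (hq : 0 < q) (hq1 : q < 1) (N : ℕ) :
    gaussMultiples m q N ≤ gaussMultiples m q (N + 2) := by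
  rintro _ ⟨_, ⟨P, rfl⟩, rfl⟩
  exact ⟨_, ⟨_, (radialPair_add_two hq hq1 N 0 P).symm⟩, rfl⟩

/-- Both unions are increasing, so the series is a polynomial multiple of two neighbouring Gaussians
at once, against `gaussSeries_independent`. -/
theorem gaussMultiples_disjoint (hq : 0 < q) (hq1 : q < 1) {s : PowerSeries ℂ}
    (h0 : s ∈ ⨆ j : ℕ, gaussMultiples m q (2 * j)) (h1 : s ∈ ⨆ j : ℕ, gaussMultiples m q (2 * j + 1)) :
    s = 0 := by
  have hmono : ∀ r, Monotone fun j : ℕ => gaussMultiples m q (2 * j + r) := fun r =>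
    monotone_nat_of_le_succ fun j => by
      have := gaussMultiples_le (m := m) hq hq1 (2 * j + r)
      rwa [show 2 * j + r + 2 = 2 * (j + 1) + r by ring] at this
  obtain ⟨i, hi⟩ := (Submodule.mem_iSup_of_directed _ (hmono 0).directed_le).mp h0
  obtain ⟨j, hj⟩ := (Submodule.mem_iSup_of_directed _ (hmono 1).directed_le).mp h1
  obtain ⟨P, hP⟩ := mem_gaussMultiples.mp (hmono 0 (le_max_left i j) hi)
  obtain ⟨Q, hQ⟩ := mem_gaussMultiples.mp (hmono 1 (le_max_right i j) hj)
  obtain ⟨rfl, -⟩ := gaussSeries_independent (m := m) hq hq1 (2 * max i j) P (-Q) (by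
    rw [Polynomial.coe_neg, neg_mul, hQ, ← sub_eq_add_neg, sub_eq_zero]
    exact hP)
  rw [← hP, Polynomial.coe_zero, zero_mul]

namespace PolyCalculus
variable (h : PolyCalculus m q D D') (hm : 1 ≤ m) (hq : 0 < q) (hq1 : q < 1)
include h hm hq hq1

theorem homog_le_span (n : ℕ) : homog m q n ≤ Submodule.span ℂ {f | ∃ k l S, S ∈ harmonics D k ∧
    k + 2 * l = n ∧ f = normSq m q ^ l * S} := by
  refine (h.homog_le hm hq hq1 n).trans (sup_le (fun S hS => ?_) (Submodule.span_le.mpr ?_))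
  · exact Submodule.subset_span ⟨n, 0, S, hS, by simp, by simp⟩
  · rintro _ ⟨k, l, S, hS, hkl, rfl⟩
    exact Submodule.subset_span ⟨k, l + 1, S, hS, hkl, rfl⟩

/-- The coefficient of `normSq ^ i` in the harmonic decomposition in degree `k + 2 i`. -/
def harmonicCoeff (k i : ℕ) : QPoly m q →ₗ[ℂ] QPoly m q :=
  (h.exists_harmonicCoeff hm hq hq1 k i).choose

theorem harmonicCoeff_self (k i : ℕ) {S : QPoly m q} (hS : S ∈ harmonics D k) :
    h.harmonicCoeff hm hq hq1 k i (normSq m q ^ i * S) = S :=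
  (h.exists_harmonicCoeff hm hq hq1 k i).choose_spec.1 S hS

theorem harmonicCoeff_ne {k i k' l : ℕ} {S : QPoly m q} (hS : S ∈ harmonics D k')
    (hd : k' + 2 * l = k + 2 * i) (hl : l ≠ i) :
    h.harmonicCoeff hm hq hq1 k i (normSq m q ^ l * S) = 0 :=
  (h.exists_harmonicCoeff hm hq hq1 k i).choose_spec.2 k' l S hS hd hl

theorem sum_harmonicCoeff (n : ℕ) {f : QPoly m q} (hf : f ∈ homog m q n) :
    ∑ l ∈ Finset.range (n / 2 + 1),
      normSq m q ^ l * h.harmonicCoeff hm hq hq1 (n - 2 * l) l f = f := by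
  set Φ : QPoly m q →ₗ[ℂ] QPoly m q := ∑ l ∈ Finset.range (n / 2 + 1),
    LinearMap.mulLeft ℂ (normSq m q ^ l) ∘ₗ h.harmonicCoeff hm hq hq1 (n - 2 * l) l with hΦ
  suffices Submodule.span ℂ {f | ∃ k l S, S ∈ harmonics D k ∧ k + 2 * l = n ∧
      f = normSq m q ^ l * S} ≤ LinearMap.eqLocus Φ LinearMap.id by
    have := this (h.homog_le_span hm hq hq1 n hf)
    simpa [hΦ, LinearMap.sum_apply] using this
  rw [Submodule.span_le]
  rintro _ ⟨k, l, S, hS, rfl, rfl⟩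
  show Φ (normSq m q ^ l * S) = normSq m q ^ l * S
  simp only [hΦ, LinearMap.sum_apply, LinearMap.comp_apply, LinearMap.mulLeft_apply]
  rw [Finset.sum_eq_single l]
  · rw [show k + 2 * l - 2 * l = k by omega, h.harmonicCoeff_self hm hq hq1 k l hS]
  · intro i hi hne
    have hi' := Finset.mem_range.mp hi
    rw [h.harmonicCoeff_ne hm hq hq1 hS (by omega) hne.symm, mul_zero]
  · intro hl
    exact absurd (Finset.mem_range.mpr (by omega)) hl

/-- The radial function that multiplies the harmonic polynomials of degree `k` in a series, paired
with a functional. -/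
def radialPart (k : ℕ) (φ : QPoly m q →ₗ[ℂ] ℂ) : PowerSeries (QPoly m q) →ₗ[ℂ] PowerSeries ℂ where
  toFun f := PowerSeries.mk fun i =>
    φ (h.harmonicCoeff hm hq hq1 k i (PowerSeries.coeff (k + 2 * i) f))
  map_add' f g := by ext i; simp
  map_smul' c f := by ext i; simp

theorem radialPart_self (k : ℕ) (φ : QPoly m q →ₗ[ℂ] ℂ) {S : QPoly m q} (hS : S ∈ harmonics D k)
    (s : PowerSeries ℂ) : h.radialPart hm hq hq1 k φ (sphere m q k S s) = φ S • s := by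
  ext i
  simp only [radialPart, LinearMap.coe_mk, AddHom.coe_mk, PowerSeries.coeff_mk]
  rw [coeff_sphere_add, map_smul, h.harmonicCoeff_self hm hq hq1 k i hS, map_smul,
    PowerSeries.coeff_smul, smul_eq_mul, smul_eq_mul, mul_comm]

theorem radialPart_ne {k k' : ℕ} (hk : k' ≠ k) (φ : QPoly m q →ₗ[ℂ] ℂ) {S : QPoly m q}
    (hS : S ∈ harmonics D k') (s : PowerSeries ℂ) :
    h.radialPart hm hq hq1 k φ (sphere m q k' S s) = 0 := by
  ext i
  simp only [radialPart, LinearMap.coe_mk, AddHom.coe_mk, PowerSeries.coeff_mk, map_zero]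
  by_cases hl : ∃ l, k + 2 * i = k' + 2 * l
  · obtain ⟨l, hl⟩ := hl
    rw [hl, coeff_sphere_add, map_smul,
      h.harmonicCoeff_ne hm hq hq1 hS hl.symm (by omega), smul_zero, map_zero]
  · rw [coeff_sphere_eq_zero (fun l hl' => hl ⟨l, hl'⟩), map_zero, map_zero]

/-- Functionals separate the harmonic coefficients, and these determine each component. Membership
in O_q matters: the n-th coefficient has to be homogeneous of degree n for the harmonic
decomposition to apply. -/
theorem eq_zero_of_radialPart (f : QSeries m q)
    (h0 : ∀ k φ, h.radialPart hm hq hq1 k φ (f : PowerSeries (QPoly m q)) = 0) : f = 0 := by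
  refine Subtype.ext (PowerSeries.ext fun n => ?_)
  rw [← h.sum_harmonicCoeff hm hq hq1 n (f.2 n)]
  refine (Finset.sum_eq_zero fun l hl => ?_).trans (by simp)
  have hl' := Finset.mem_range.mp hl
  suffices h.harmonicCoeff hm hq hq1 (n - 2 * l) l
      (PowerSeries.coeff n (f : PowerSeries (QPoly m q))) = 0 by rw [this, mul_zero]
  refine (Module.forall_dual_apply_eq_zero_iff ℂ _).mp fun φ => ?_
  have := congrArg (PowerSeries.coeff l) (h0 (n - 2 * l) φ)
  simp only [radialPart, LinearMap.coe_mk, AddHom.coe_mk, PowerSeries.coeff_mk, map_zero] at this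
  rwa [show n - 2 * l + 2 * l = n by omega] at this

/-- On harmonics of degree k the transform acts through one map of radial series, so taking radial
parts in both entries respects the graph. Single-valuedness and injectivity thus become statements
on scalar series. -/
theorem radialPart_mem_radialGraph (k : ℕ) (φ : QPoly m q →ₗ[ℂ] ℂ)
    {z : PowerSeries (QPoly m q) × PowerSeries (QPoly m q)} (hz : z ∈ oscGraph D η) :
    (h.radialPart hm hq hq1 k φ z.1, h.radialPart hm hq hq1 k φ z.2) ∈ radialGraph m q η k := by
  have h1 : oscGraph D η ≤ (radialGraph m q η k).comap
      ((h.radialPart hm hq hq1 k φ).prodMap (h.radialPart hm hq hq1 k φ)) := by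
    conv_lhs => unfold oscGraph
    rw [Submodule.span_le]
    rintro _ ⟨N, k', l, S, hS, rfl⟩
    show (h.radialPart hm hq hq1 k φ (sphere m q k' S (PowerSeries.X ^ l * gaussSeries m q N)),
      h.radialPart hm hq hq1 k φ (η ^ k' • sphere m q k' S (fourierSeries m q N k' l))) ∈
        radialGraph m q η k
    rw [map_smul]
    by_cases hk : k' = k
    · subst hk
      rw [h.radialPart_self hm hq hq1 k' φ hS, h.radialPart_self hm hq hq1 k' φ hS, smul_comm]
      exact Submodule.smul_mem _ (φ S) (mem_radialGraph N k' l)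
    · rw [h.radialPart_ne hm hq hq1 hk φ hS, h.radialPart_ne hm hq hq1 hk φ hS, smul_zero]
      exact Submodule.zero_mem _
  exact h1 hz

theorem radialPart_mem_gaussMultiples (N k : ℕ) (φ : QPoly m q →ₗ[ℂ] ℂ)
    {f : PowerSeries (QPoly m q)} (hf : f ∈ gaussSpan D N) :
    h.radialPart hm hq hq1 k φ f ∈ gaussMultiples m q N := by
  have h1 : gaussSpan D N ≤ (gaussMultiples m q N).comap (h.radialPart hm hq hq1 k φ) := by
    conv_lhs => unfold gaussSpan
    rw [Submodule.span_le]
    rintro _ ⟨k', l, S, hS, rfl⟩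
    show h.radialPart hm hq hq1 k φ _ ∈ gaussMultiples m q N
    by_cases hk : k' = k
    · subst hk
      rw [h.radialPart_self hm hq hq1 k' φ hS]
      exact Submodule.smul_mem _ (φ S) (mem_gaussMultiples.mpr ⟨Polynomial.X ^ l, by simp⟩)
    · rw [h.radialPart_ne hm hq hq1 hk φ hS]
      exact Submodule.zero_mem _
  exact h1 hf

/-- Arbitrary polynomial factors reduce to harmonic ones: in the harmonic decomposition the powers
of r² move into the radial series. -/
theorem map_gaussianSpace (N : ℕ) :
    (gaussianSpace m q (gaussianParam m q N)).map (QSeries m q).val.toLinearMap =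
      gaussSpan D N := by
  refine le_antisymm ?_ ?_
  · rw [gaussianSpace, Submodule.map_span_le]
    rintro _ ⟨k, P, rfl⟩
    show ((ofHomog k P * radial (gaussSeries m q N) : QSeries m q) : PowerSeries (QPoly m q)) ∈ _
    rw [h.coe_ofHomog_mul_radial hm hq hq1]
    have h1 : Submodule.span ℂ {f | ∃ k' l S, S ∈ harmonics D k' ∧ k' + 2 * l = k ∧
        f = normSq m q ^ l * S} ≤ (gaussSpan D N).comap
          ((sphere m q k).flip (gaussSeries m q N)) := by
      rw [Submodule.span_le]
      rintro _ ⟨k', l, S, hS, rfl, rfl⟩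
      show sphere m q (k' + 2 * l) (normSq m q ^ l * S) (gaussSeries m q N) ∈ gaussSpan D N
      rw [sphere_normSq_pow_mul]
      exact Submodule.subset_span ⟨k', l, S, hS, rfl⟩
    exact h1 (h.homog_le_span hm hq hq1 k P.2)
  · unfold gaussSpan
    rw [Submodule.span_le]
    rintro _ ⟨k, l, S, hS, rfl⟩
    have hmem : normSq m q ^ l * S ∈ homog m q (k + 2 * l) := by
      rw [add_comm]
      exact mul_mem_homog (normSq_pow_mem m q l) hS.1
    refine ⟨_, Submodule.subset_span ⟨k + 2 * l, ⟨_, hmem⟩, rfl⟩, ?_⟩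
    show ((ofHomog _ _ * radial (gaussSeries m q N) : QSeries m q) : PowerSeries (QPoly m q)) = _
    rw [h.coe_ofHomog_mul_radial hm hq hq1, sphere_normSq_pow_mul]

theorem map_gaussianClass_odd :
    (gaussianClass m q (q ^ (-((m : ℝ) / 2)))).map (QSeries m q).val.toLinearMap =
      ⨆ j : ℕ, gaussSpan D (2 * j + 1) := by
  simp only [gaussianClass, Submodule.map_iSup, gaussianParam_odd hq,
    h.map_gaussianSpace hm hq hq1]

theorem map_gaussianClass_even :
    (gaussianClass m q (q ^ (1 - (m : ℝ) / 2))).map (QSeries m q).val.toLinearMap =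
      ⨆ j : ℕ, gaussSpan D (2 * j) := by
  simp only [gaussianClass, Submodule.map_iSup, gaussianParam_even hq,
    h.map_gaussianSpace hm hq hq1]

theorem radialPart_mem_iSup {ι : ℕ → ℕ} (k : ℕ) (φ : QPoly m q →ₗ[ℂ] ℂ)
    {f : PowerSeries (QPoly m q)} (hf : f ∈ ⨆ j, gaussSpan D (ι j)) :
    h.radialPart hm hq hq1 k φ f ∈ ⨆ j, gaussMultiples m q (ι j) := by
  have h1 : ⨆ j, gaussSpan D (ι j) ≤
      (⨆ j, gaussMultiples m q (ι j)).comap (h.radialPart hm hq hq1 k φ) :=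
    iSup_le fun j f hf => Submodule.mem_iSup_of_mem j
      (h.radialPart_mem_gaussMultiples hm hq hq1 (ι j) k φ hf)
  exact h1 hf

theorem disjoint_gaussianClass : Disjoint (gaussianClass m q (q ^ (-((m : ℝ) / 2))))
    (gaussianClass m q (q ^ (1 - (m : ℝ) / 2))) := by
  rw [Submodule.disjoint_def]
  intro f hf hf'
  refine h.eq_zero_of_radialPart hm hq hq1 f fun k φ => ?_
  refine gaussMultiples_disjoint (m := m) hq hq1 ?_ ?_
  · refine h.radialPart_mem_iSup hm hq hq1 (ι := fun j => 2 * j) k φ ?_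
    rw [← h.map_gaussianClass_even hm hq hq1]
    exact ⟨f, hf', rfl⟩
  · refine h.radialPart_mem_iSup hm hq hq1 (ι := fun j => 2 * j + 1) k φ ?_
    rw [← h.map_gaussianClass_odd hm hq hq1]
    exact ⟨f, hf, rfl⟩

include γ

theorem fourierDomain_eq (hγ : 0 < γ) (ε : ℤˣ) : fourierDomain m q ε γ =
    gaussianClass m q (q ^ (-((m : ℝ) / 2))) ⊔ gaussianClass m q (q ^ (1 - (m : ℝ) / 2)) := by
  have hinj : Function.Injective (QSeries m q).val.toLinearMap := Subtype.val_injective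
  refine Submodule.map_injective_of_injective hinj ?_
  rw [Submodule.map_sup, h.map_gaussianClass_odd hm hq hq1, h.map_gaussianClass_even hm hq hq1]
  have h1 : (fourierDomain m q ε γ).map (QSeries m q).val.toLinearMap =
      ((fourierGraph m q ε γ).map (coePair m q)).map (LinearMap.fst ℂ _ _) := by
    rw [fourierDomain, ← Submodule.map_comp, ← Submodule.map_comp]
    rfl
  rw [h1, h.map_fourierGraph hm hq hq1 hγ, oscGraph_map_fst]
  refine le_antisymm (iSup_le fun N => ?_) (sup_le ?_ ?_)
  · obtain ⟨j, rfl | rfl⟩ := Nat.even_or_odd' N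
    · exact le_sup_of_le_right (le_iSup (fun j => gaussSpan D (2 * j)) j)
    · exact le_sup_of_le_left (le_iSup (fun j => gaussSpan D (2 * j + 1)) j)
  · exact iSup_le fun j => le_iSup (gaussSpan D) _
  · exact iSup_le fun j => le_iSup (gaussSpan D) _

theorem fourierGraph_snd_eq_zero (hγ : 0 < γ) (ε : ℤˣ) {g : QSeries m q}
    (hg : ((0 : QSeries m q), g) ∈ fourierGraph m q ε γ) : g = 0 := by
  have hz := (h.mem_fourierGraph hm hq hq1 hγ ε 0 g).mp hg
  refine h.eq_zero_of_radialPart hm hq hq1 g fun k φ => ?_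
  have := radialGraph_fst hq hq1 k (h.radialPart_mem_radialGraph hm hq hq1 k φ hz) (by simp)
  exact congrArg Prod.snd this

theorem fourierGraph_fst_eq_zero (hγ : 0 < γ) (ε : ℤˣ) {f : QSeries m q}
    (hf : (f, (0 : QSeries m q)) ∈ fourierGraph m q ε γ) : f = 0 := by
  have hz := (h.mem_fourierGraph hm hq hq1 hγ ε f 0).mp hf
  refine h.eq_zero_of_radialPart hm hq hq1 f fun k φ => ?_
  have := radialGraph_snd hq hq1 (by simp) k (h.radialPart_mem_radialGraph hm hq hq1 k φ hz)
    (by simp)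
  exact congrArg Prod.fst this

end PolyCalculus
end Components

/-! ### The excited states in the graph of the transform -/

section Excited
variable {m : ℕ} {q : ℝ} {η : ℂ} {D D' : Fin m → QPoly m q →ₗ[ℂ] QPoly m q}

/-- By the two covariance rules x^j - c ∂^j turns into c η H (x^j - c⁻¹ H⁻² ∂̄^j). The scalar c⁻¹
H⁻² is the coefficient in the barred operator, and c H is the ratio of b̄ to b. -/
theorem smul_raise {M : Type*} [AddCommGroup M] [Module ℂ M] {c H : ℂ} (hc : c ≠ 0) (hH : H ≠ 0)
    (κ a η b : ℂ) (X Y : M) :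
    (κ * (a * η)) • (c * H * b) • (X - (c⁻¹ * H⁻¹ ^ 2) • Y) =
      b • (-(η * H⁻¹) • (κ * a) • Y - c • -(η * H) • (κ * a) • X) := by
  match_scalars <;> field_simp

theorem gaussianParam_three (hq : 0 < q) :
    gaussianParam m q 3 * q ^ 2 = (q ^ ((m : ℝ) / 2))⁻¹ := by
  rw [gaussianParam, ← Real.rpow_natCast, ← Real.rpow_neg hq.le, ← Real.rpow_add hq]
  congr 1
  push_cast
  ring

theorem excited_nil (hq : 0 < q) (b : ℕ → ℂ) :
    excited m q b [] = radial (gaussSeries m q 3) := by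
  rw [excited, gaussSeries, gaussianParam_three hq, ← one_div, div_div]

/-- The ground state is the Gaussian with N = 3, for which 3 - N - m/2 = -m/2. The exponent of q
then splits into m²/4, the binomial exponent of E and powers absorbed by its argument; the constant
q^{m²/4} is the one that the normalization of 𝔽 removes. -/
theorem fourierSeries_ground (hq : 0 < q) : fourierSeries m q 3 0 0 =
    ((q ^ ((m : ℝ) ^ 2 / 4) : ℝ) : ℂ) •
      qExpBigSeries (q ^ 2) (-(q ^ ((m : ℝ) / 2) * q ^ 2 / mu m q)) := by
  ext i
  rw [PowerSeries.coeff_smul, coeff_qExpBigSeries, fourierSeries, PowerSeries.coeff_mk,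
    fourierCoeff_eq, fourierProd_zero, fourierPow, smul_eq_mul, ← Complex.ofReal_mul]
  congr 1
  have h1 : (i : ℝ) ^ 2 + i - (3 - ((3 : ℕ) : ℝ) - (m : ℝ) / 2) *
      ((m : ℝ) / 2 + (0 : ℕ) + i + (0 : ℕ)) =
      (m : ℝ) ^ 2 / 4 + (m : ℝ) / 2 * i + ((i * (i - 1) + 2 * i : ℕ) : ℝ) := by
    rcases i with _ | i
    · push_cast; ring
    · push_cast [Nat.add_sub_cancel]; ring
  have h2 : i * (i - 1) = 2 * i.choose 2 := by
    rw [Nat.choose_two_right, Nat.mul_div_cancel' (Nat.even_mul_pred_self i).two_dvd]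
  rw [h1, h2, Real.rpow_add hq, Real.rpow_add hq, Real.rpow_mul hq.le, Real.rpow_natCast,
    Real.rpow_natCast, neg_pow (_ / _), div_pow, mul_pow, pow_add, pow_mul, pow_mul,
    ← pow_mul q 2 i, pow_zero]
  ring

namespace PolyCalculus
variable (h : PolyCalculus m q D D') (hm : 1 ≤ m) (hq : 0 < q) (hq1 : q < 1) (hη : η ^ 2 = -1)
include h hm hq hq1 hη

theorem excited_mem_oscGraph {b bbar : ℕ → ℂ}
    (hb : ∀ n : ℕ, 1 ≤ n → bbar n = ((q ^ (2 - (n : ℝ)) : ℝ) : ℂ) * b n) (w : List (Fin m)) :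
    ((excited m q b w : PowerSeries (QPoly m q)),
      (((q ^ ((m : ℝ) ^ 2 / 4) : ℝ) : ℂ) * η ^ w.length) •
        (excitedBar m q bbar w : PowerSeries (QPoly m q))) ∈ oscGraph D η := by
  induction w with
  | nil =>
    have h1 : (1 : QPoly m q) ∈ harmonics D 0 :=
      ⟨one_mem_homog m q, lap_homog_le_one h two_pos (one_mem_homog m q)⟩
    have := mem_oscGraph (η := η) h1 3 0
    rw [fourierSeries_ground hq] at this
    convert this using 2
    · rw [excited_nil hq, coe_radial, pow_zero, one_mul]
    · rw [excitedBar, coe_radial, map_smul]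
      simp
  | cons i w ih =>
    set s : ℝ := q ^ ((1 : ℝ) / 2) with hs
    have hs0 : 0 < s := Real.rpow_pos_of_pos hq _
    have hsq : s ^ 2 = q := by
      rw [hs, ← Real.rpow_natCast, ← Real.rpow_mul hq.le]
      norm_num
    set H : ℝ := q ^ ((m : ℝ) / 2) with hH
    have hH0 : (H : ℂ) ≠ 0 := by exact_mod_cast (Real.rpow_pos_of_pos hq _).ne'
    have hd1 : (((q ^ (2 * (-1 / 4 : ℝ)) : ℝ)) : ℂ) = (s : ℂ)⁻¹ := by
      rw [← Complex.ofReal_inv, hs, ← Real.rpow_neg hq.le]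
      norm_num
    have hd2 : (((q ^ (2 * (1 / 4 : ℝ)) : ℝ)) : ℂ) = (s : ℂ) := by
      rw [hs]
      norm_num
    have h1 := h.oscGraph_coord hm hq hq1 hs0 hsq hH hη i ih
    have h2 := h.oscGraph_deriv hm hq hq1 hs0 hsq hH hη i ih
    set n : ℕ := w.length + 1 with hn
    set c : ℝ := q ^ (2 - (n : ℝ) - (m : ℝ) / 2) with hc
    have h3 := Submodule.smul_mem _ (b n) (Submodule.sub_mem _ h1 (Submodule.smul_mem _ (c : ℂ) h2))
    have hc0 : (c : ℂ) ≠ 0 := by exact_mod_cast (Real.rpow_pos_of_pos hq _).ne'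
    have hcbar : ((q ^ ((n : ℝ) - 2 - (m : ℝ) / 2) : ℝ) : ℂ) = (c : ℂ)⁻¹ * ((H : ℂ)⁻¹) ^ 2 := by
      rw [← Complex.ofReal_inv, ← Complex.ofReal_inv, ← Complex.ofReal_pow, ← Complex.ofReal_mul,
        hc, hH, ← Real.rpow_neg hq.le, ← Real.rpow_neg hq.le, ← Real.rpow_natCast,
        ← Real.rpow_mul hq.le, ← Real.rpow_add hq]
      congr 2
      push_cast
      ring
    -- The prescribed ratio of b̄ and b enters here: q^{2-n} = c H.
    have hbc : bbar n = (c : ℂ) * (H : ℂ) * b n := by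
      rw [hb n (by omega), ← Complex.ofReal_mul, hc, hH, ← Real.rpow_add hq]
      congr 3
      ring
    convert h3 using 1
    refine Prod.ext ?_ ?_
    · simp only [excited, raising, SetLike.val_smul, AddSubgroupClass.coe_sub,
        coe_seriesCoord_mul, h.coe_partialD, coe_dilatation _ _ hq, hd1, Prod.smul_mk,
        Prod.mk_sub_mk]
      rfl
    · simp only [excitedBar, raisingBar, SetLike.val_smul, AddSubgroupClass.coe_sub,
        coe_seriesCoord_mul, h.coe_partialBar, coe_dilatation _ _ hq, hd2, Prod.smul_mk,
        Prod.mk_sub_mk, map_smul, List.length_cons]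
      rw [← hn, hcbar, hbc, hn, pow_succ]
      exact smul_raise hc0 hH0 _ _ _ _ _ _

end PolyCalculus
end Excited

/-! ### The Hamiltonian -/

section Hamiltonian
variable {m : ℕ} {q : ℝ} {D D' : Fin m → QPoly m q →ₗ[ℂ] QPoly m q}

/-- The Laplace operator on series. -/
def lapOp (D : Fin m → QPoly m q →ₗ[ℂ] QPoly m q) : Module.End ℂ (PowerSeries (QPoly m q)) where
  toFun f := PowerSeries.mk fun n => lap D (PowerSeries.coeff (n + 2) f)
  map_add' f g := by ext n; simp
  map_smul' c f := by ext n; simp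

/-- The multiplication of series by the squared norm. -/
def normOp (m : ℕ) (q : ℝ) : Module.End ℂ (PowerSeries (QPoly m q)) :=
  LinearMap.mulLeft ℂ (PowerSeries.X ^ 2 * PowerSeries.C (normSq m q))

theorem coeff_lapOp (n : ℕ) (f : PowerSeries (QPoly m q)) :
    PowerSeries.coeff n (lapOp D f) = lap D (PowerSeries.coeff (n + 2) f) := by
  simp [lapOp]

theorem coeff_normOp_add_two (n : ℕ) (f : PowerSeries (QPoly m q)) :
    PowerSeries.coeff (n + 2) (normOp m q f) = normSq m q * PowerSeries.coeff n f := by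
  rw [normOp, LinearMap.mulLeft_apply, mul_assoc, add_comm, PowerSeries.coeff_X_pow_mul',
    if_pos (by omega), Nat.add_sub_cancel_left, PowerSeries.coeff_C_mul]

theorem coeff_normOp_of_lt {n : ℕ} (hn : n < 2) (f : PowerSeries (QPoly m q)) :
    PowerSeries.coeff n (normOp m q f) = 0 := by
  rw [normOp, LinearMap.mulLeft_apply, mul_assoc, PowerSeries.coeff_X_pow_mul', if_neg (by omega)]

/-- The Hamiltonian `Δ - 𝐱²` of the harmonic oscillator. -/
def hamiltonian (D : Fin m → QPoly m q →ₗ[ℂ] QPoly m q) :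
    Module.End ℂ (PowerSeries (QPoly m q)) := lapOp D - normOp m q

theorem lapOp_dilOp (r : ℂ) (f : PowerSeries (QPoly m q)) :
    lapOp D (dilOp m q r f) = r ^ 2 • dilOp m q r (lapOp D f) := by
  ext n
  simp only [coeff_lapOp, coeff_dilOp, PowerSeries.coeff_smul, map_smul, smul_smul]
  rw [pow_add, mul_comm]

theorem normOp_dilOp {r : ℂ} (hr : r ≠ 0) (f : PowerSeries (QPoly m q)) :
    normOp m q (dilOp m q r f) = (r ^ 2)⁻¹ • dilOp m q r (normOp m q f) := by
  ext n
  rcases Nat.lt_or_ge n 2 with hn | hn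
  · simp [coeff_normOp_of_lt hn]
  · obtain ⟨n, rfl⟩ := Nat.exists_eq_add_of_le' hn
    simp only [coeff_normOp_add_two, coeff_dilOp, PowerSeries.coeff_smul, smul_smul,
      mul_smul_comm]
    congr 1
    field_simp
    ring

/-- The eigenvalues of the Hamiltonian. -/
def energy (m : ℕ) (q : ℝ) (n : ℕ) : ℝ :=
  mu m q * ((q ^ n * q ^ ((m : ℝ) / 2))⁻¹ - q ^ n * q ^ ((m : ℝ) / 2)) / (q ^ 2 - 1)

/-- The function x ↦ x⁻¹ - x is injective for x > 0, since equal values at x and y give (x - y)(1 +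
x y) = 0. -/
theorem energy_injective (hq : 0 < q) (hq1 : q < 1) : Function.Injective (energy m q) := by
  intro i j hij
  have hμ := mu_pos (m := m) hq
  have hH : 0 < q ^ ((m : ℝ) / 2) := Real.rpow_pos_of_pos hq _
  have hne : q ^ 2 - 1 ≠ 0 := (sub_neg.mpr (pow_lt_one₀ hq.le hq1 two_ne_zero)).ne
  have h1 := mul_left_cancel₀ hμ.ne' ((div_left_inj' hne).mp hij)
  have hx : 0 < q ^ i * q ^ ((m : ℝ) / 2) := by positivity
  have hy : 0 < q ^ j * q ^ ((m : ℝ) / 2) := by positivity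
  have h2 : q ^ i * q ^ ((m : ℝ) / 2) = q ^ j * q ^ ((m : ℝ) / 2) := by
    generalize q ^ i * q ^ ((m : ℝ) / 2) = x at *
    generalize q ^ j * q ^ ((m : ℝ) / 2) = y at *
    field_simp at h1
    have h3 : (x - y) * (1 + x * y) = 0 := by linear_combination -h1
    rcases mul_eq_zero.mp h3 with h4 | h4
    · exact sub_eq_zero.mp h4
    · nlinarith [mul_pos hx hy]
  exact pow_right_injective₀ hq hq1.ne (mul_right_cancel₀ hH.ne' h2)

theorem smul_energy {M : Type*} [AddCommGroup M] [Module ℂ M] {r t H : ℂ} (hr : r ≠ 0) (ht : t ≠ 0)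
    (hH : H ≠ 0) (hr1 : r ^ 2 - 1 ≠ 0) (ν : ℂ) (X Y X' Y' : M) :
    ν • Y + r ^ 2 • r⁻¹ • (X' + (ν * ((t * H)⁻¹ - t * H) / (r ^ 2 - 1)) • X) -
        (r * (t * H)⁻¹) • r⁻¹ • (Y' + (ν * ((t * H)⁻¹ - t * H) / (r ^ 2 - 1)) • Y) -
      (r⁻¹⁻¹ • X' - (r * (t * H)⁻¹) • (r ^ 2)⁻¹ • (r⁻¹⁻¹ • Y' - ν • X)) =
    (ν * ((t * r * H)⁻¹ - t * r * H) / (r ^ 2 - 1)) • (X - (r * (t * H)⁻¹) • Y) := by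
  match_scalars <;> field_simp <;> ring

namespace PolyCalculus
variable (h : PolyCalculus m q D D') (hm : 1 ≤ m) (hq : 0 < q) (hq1 : q < 1)
include h hm hq hq1

/-- The q²-derivative of the Gaussian is a multiple of the Gaussian, which gives a one-step
recursion of its coefficients. In each even degree the eigenvalue equation then reduces to a scalar
identity; in degree zero the r² term is absent. -/
theorem hamiltonian_ground : hamiltonian D (sphere m q 0 1 (gaussSeries m q 3)) =
    ((energy m q 0 : ℝ) : ℂ) • sphere m q 0 1 (gaussSeries m q 3) := by
  have h1 : (1 : QPoly m q) ∈ harmonics D 0 :=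
    ⟨one_mem_homog m q, lap_homog_le_one h two_pos (one_mem_homog m q)⟩
  set g : ℕ → ℂ := fun i => PowerSeries.coeff i (gaussSeries m q 3) with hg
  have hrec : ∀ i, qInt q (i + 1) * g (i + 1) = -(gaussCoeff m q 3 * g i) := fun i => by
    have := congrArg (PowerSeries.coeff i) (qDeriv_gaussSeries (m := m) hq hq1 3 0)
    simpa [qDeriv, qInt_zero] using this
  set H : ℂ := ((q ^ ((m : ℝ) / 2) : ℝ) : ℂ) with hH
  have hH0 : H ≠ 0 := Complex.ofReal_ne_zero.mpr (Real.rpow_pos_of_pos hq _).ne'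
  have hμ := muC_ne_zero (m := m) hq
  have hsq := ofReal_sq_sub_one_ne_zero hq hq1
  have hgc : gaussCoeff m q 3 = (muC m q * H)⁻¹ := by
    rw [gaussCoeff, gaussianParam_three hq, hH, muC]
    push_cast
    rw [mul_inv, div_eq_mul_inv, mul_comm]
  have hHm : H ^ 2 = (q : ℂ) ^ m := by
    rw [hH, ← Complex.ofReal_pow, ← Real.rpow_natCast, ← Real.rpow_mul hq.le, ← Complex.ofReal_pow]
    norm_num
  have hE : ((energy m q 0 : ℝ) : ℂ) = muC m q * (H⁻¹ - H) / ((q : ℂ) ^ 2 - 1) := by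
    simp [energy, hH, muC]
  have hlap : ∀ i, lap D (PowerSeries.coeff (0 + 2 * (i + 1)) (sphere m q 0 1 (gaussSeries m q 3)))
      = (-(muC m q * H⁻¹ * qHalfInt m q i * g i)) • normSq m q ^ i := fun i => by
    have := h.lap_normSq_pow hm hq hq1 0 i h1
    rw [coeff_sphere_add, map_smul, this, smul_smul, mul_one, zero_add]
    congr 1
    have := hrec i
    rw [hgc] at this
    change g (i + 1) * _ = _
    field_simp at this ⊢
    linear_combination (qHalfInt m q i) * this
  ext n
  rw [hamiltonian, LinearMap.sub_apply, map_sub, coeff_lapOp, PowerSeries.coeff_smul]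
  by_cases hn : ∃ i, n = 0 + 2 * i
  · obtain ⟨i, rfl⟩ := hn
    rw [show 0 + 2 * i + 2 = 0 + 2 * (i + 1) by ring, hlap, coeff_sphere_add, mul_one, smul_smul, hE]
    rcases i with _ | i
    · rw [coeff_normOp_of_lt (by omega), sub_zero]
      congr 1
      rw [qHalfInt, mul_zero, add_zero, ← hHm]
      field_simp
      ring
    · rw [show 0 + 2 * (i + 1) = 0 + 2 * i + 2 by ring, coeff_normOp_add_two, coeff_sphere_add,
        mul_one, mul_smul_comm, ← pow_succ']
      have hsub : ∀ a b : ℂ, a • normSq m q ^ (i + 1) - b • normSq m q ^ (i + 1) =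
          (a - b) • normSq m q ^ (i + 1) := fun a b => (sub_smul a b _).symm
      rw [hsub]
      congr 1
      have := hrec i
      rw [hgc, qInt] at this
      rw [qHalfInt, pow_add, ← hHm]
      change -(muC m q * H⁻¹ * _ * g (i + 1)) - g i = _ * g (i + 1)
      field_simp at this ⊢
      linear_combination (-H) * this
  · have hz : ∀ n', (∀ i, n' ≠ 0 + 2 * i) →
        PowerSeries.coeff n' (sphere m q 0 1 (gaussSeries m q 3)) = 0 := fun n' h' =>
      coeff_sphere_eq_zero h' _ _
    rw [hz n fun i hi => hn ⟨i, hi⟩, hz (n + 2) fun i hi => hn ⟨i - 1, by omega⟩, map_zero, smul_zero,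
      zero_sub, neg_eq_zero]
    rcases Nat.lt_or_ge n 2 with h2 | h2
    · exact coeff_normOp_of_lt h2 _
    · obtain ⟨n, rfl⟩ := Nat.exists_eq_add_of_le' h2
      rw [coeff_normOp_add_two, hz n fun i hi => hn ⟨i + 1, by omega⟩, mul_zero]

/-- Homogeneity is used in degree zero only: there the term with Δ applied to the degree-one
component of f must vanish. -/
theorem lapOp_coordOp (j : Fin m) {f : PowerSeries (QPoly m q)}
    (hf : ∀ n, PowerSeries.coeff n f ∈ homog m q n) : lapOp D (coordOp m q j f) =
      muC m q • derivOp (D j) f + (q : ℂ) ^ 2 • coordOp m q j (lapOp D f) := by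
  ext n
  rw [coeff_lapOp, coeff_coordOp_succ, map_add, PowerSeries.coeff_smul, PowerSeries.coeff_smul,
    coeff_derivOp]
  have := h.laplacian_coord hm hq hq1 j (PowerSeries.coeff (n + 1) f)
  rw [lap, this]
  rcases n with _ | n
  · have h2 := lap_homog_le_one h one_lt_two (hf 1)
    rw [lap] at h2
    rw [zero_add, h2, mul_zero, smul_zero, coeff_coordOp_zero, smul_zero]
    rfl
  · rw [coeff_coordOp_succ, coeff_lapOp]
    rfl

theorem lapOp_derivOp (j : Fin m) (f : PowerSeries (QPoly m q)) :
    lapOp D (derivOp (D j) f) = derivOp (D j) (lapOp D f) := by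
  ext n
  simp only [coeff_lapOp, coeff_derivOp]
  exact h.laplacian_D hm hq hq1 j _

theorem normOp_coordOp (j : Fin m) (f : PowerSeries (QPoly m q)) :
    normOp m q (coordOp m q j f) = coordOp m q j (normOp m q f) := by
  ext n
  match n with
  | 0 => simp [coeff_normOp_of_lt]
  | 1 => simp [coeff_normOp_of_lt]
  | 2 => rw [coeff_normOp_add_two 0, coeff_coordOp_succ, coeff_normOp_of_lt one_lt_two]; simp
  | n + 3 =>
    rw [coeff_normOp_add_two (n + 1), coeff_coordOp_succ, coeff_coordOp_succ, coeff_normOp_add_two,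
      h.normSq_coord hm hq hq1]

theorem derivOp_normOp (j : Fin m) {f : PowerSeries (QPoly m q)}
    (hf : ∀ n, PowerSeries.coeff n f ∈ homog m q n) : derivOp (D j) (normOp m q f) =
      muC m q • coordOp m q j f + (q : ℂ) ^ 2 • normOp m q (derivOp (D j) f) := by
  ext n
  rw [coeff_derivOp, map_add, PowerSeries.coeff_smul, PowerSeries.coeff_smul]
  match n with
  | 0 => simp [coeff_normOp_of_lt]
  | 1 =>
    rw [coeff_normOp_add_two 0, h.D_normSq hm hq hq1, h.D_homog_zero (hf 0),
      coeff_normOp_of_lt one_lt_two, coeff_coordOp_succ, mul_zero]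
    rfl
  | n + 2 =>
    rw [coeff_normOp_add_two (n + 1), h.D_normSq hm hq hq1, coeff_normOp_add_two, coeff_derivOp,
      coeff_coordOp_succ]
    rfl

/-- Commuting Δ and r² past x^j and ∂^j turns x^j into ∂^j and vice versa. The coefficient
q^{2-(n+1)-m/2} is the one for which x^j - c ∂^j followed by these commutators closes on itself,
shifting the energy from n to n + 1; the dilatation supplies the powers of q. -/
theorem hamiltonian_raise {s : ℝ} (hs : 0 < s) (hsq : s ^ 2 = q) (n : ℕ) (j : Fin m)
    {f : PowerSeries (QPoly m q)} (hh : ∀ n, PowerSeries.coeff n f ∈ homog m q n)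
    (hf : hamiltonian D f = ((energy m q n : ℝ) : ℂ) • f) :
    hamiltonian D (coordOp m q j (dilOp m q (s : ℂ)⁻¹ f) -
      ((q ^ (2 - ((n + 1 : ℕ) : ℝ) - (m : ℝ) / 2) : ℝ) : ℂ) •
        derivOp (D j) (dilOp m q (s : ℂ)⁻¹ f)) =
      ((energy m q (n + 1) : ℝ) : ℂ) • (coordOp m q j (dilOp m q (s : ℂ)⁻¹ f) -
      ((q ^ (2 - ((n + 1 : ℕ) : ℝ) - (m : ℝ) / 2) : ℝ) : ℂ) •
        derivOp (D j) (dilOp m q (s : ℂ)⁻¹ f)) := by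
  have hsc : (s : ℂ) ≠ 0 := by exact_mod_cast hs.ne'
  have hqc : (q : ℂ) ≠ 0 := by exact_mod_cast hq.ne'
  have hr : ((s : ℂ)⁻¹) ^ 2 = (q : ℂ)⁻¹ := by rw [inv_pow, ← Complex.ofReal_pow, hsq]
  have hhd : ∀ n, PowerSeries.coeff n (dilOp m q (s : ℂ)⁻¹ f) ∈ homog m q n := fun n => by
    rw [coeff_dilOp]
    exact Submodule.smul_mem _ _ (hh n)
  set H : ℂ := ((q ^ ((m : ℝ) / 2) : ℝ) : ℂ) with hH
  have hH0 : H ≠ 0 := Complex.ofReal_ne_zero.mpr (Real.rpow_pos_of_pos hq _).ne'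
  have hsq1 := ofReal_sq_sub_one_ne_zero hq hq1
  have hE : ∀ n, ((energy m q n : ℝ) : ℂ) =
      muC m q * (((q : ℂ) ^ n * H)⁻¹ - (q : ℂ) ^ n * H) / ((q : ℂ) ^ 2 - 1) := fun n => by
    simp [energy, hH, muC]
  have hc : ((q ^ (2 - ((n + 1 : ℕ) : ℝ) - (m : ℝ) / 2) : ℝ) : ℂ) = (q : ℂ) * ((q : ℂ) ^ n * H)⁻¹ := by
    rw [← Complex.ofReal_pow, hH, ← Complex.ofReal_mul, ← Complex.ofReal_inv, ← Complex.ofReal_mul]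
    congr 1
    rw [show 2 - ((n + 1 : ℕ) : ℝ) - (m : ℝ) / 2 = 1 - ((n : ℝ) + (m : ℝ) / 2) by push_cast; ring,
      Real.rpow_sub hq, Real.rpow_add hq, Real.rpow_one, Real.rpow_natCast, div_eq_mul_inv]
  have hL : lapOp D f = normOp m q f + ((energy m q n : ℝ) : ℂ) • f := by
    rw [← hf, hamiltonian, LinearMap.sub_apply, add_sub_cancel]
  -- Solving the commutation rule for r² ∂^j leaves only four vectors, coordinate or derivative
  -- applied to f or to r² f after dilatation, and then `smul_energy` is a scalar check.
  have hNd : normOp m q (derivOp (D j) (dilOp m q (s : ℂ)⁻¹ f)) =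
      ((q : ℂ) ^ 2)⁻¹ • (derivOp (D j) (normOp m q (dilOp m q (s : ℂ)⁻¹ f)) -
        muC m q • coordOp m q j (dilOp m q (s : ℂ)⁻¹ f)) := by
    rw [h.derivOp_normOp hm hq hq1 j hhd, add_sub_cancel_left, smul_smul,
      inv_mul_cancel₀ (pow_ne_zero 2 hqc), one_smul]
  rw [hamiltonian, LinearMap.sub_apply, map_sub, map_sub, map_smul, map_smul,
    h.lapOp_coordOp hm hq hq1 j hhd, h.lapOp_derivOp hm hq hq1, h.normOp_coordOp hm hq hq1, hNd,
    lapOp_dilOp, normOp_dilOp (inv_ne_zero hsc), hL, hr, hc, hE n, hE (n + 1)]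
  simp only [map_add, map_smul]
  generalize coordOp m q j (dilOp m q (s : ℂ)⁻¹ f) = X
  generalize derivOp (D j) (dilOp m q (s : ℂ)⁻¹ f) = Y
  generalize coordOp m q j (dilOp m q (s : ℂ)⁻¹ (normOp m q f)) = X'
  generalize derivOp (D j) (dilOp m q (s : ℂ)⁻¹ (normOp m q f)) = Y'
  have hn : (q : ℂ) ^ n ≠ 0 := pow_ne_zero n hqc
  rw [pow_succ (q : ℂ) n]
  exact smul_energy hqc hn hH0 hsq1 (muC m q) X Y X' Y'

end PolyCalculus
end Hamiltonian

/-! ### The Fourier transform of the oscillator -/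

/-- A relation survives any polynomial in the operator, which acts on each summand by a scalar.
Vanishing summands are not eigenvectors and are treated separately. -/
theorem sum_eval_eq_zero {M ι : Type*} [AddCommGroup M] [Module ℂ M] (A : Module.End ℂ M)
    {v : ι → M} {e : ι → ℂ} (hv : ∀ w, A (v w) = e w • v w) {c : ι →₀ ℂ}
    (h0 : Finsupp.linearCombination ℂ v c = 0) (P : ℂ[X]) :
    Finsupp.linearCombination ℂ (fun w => P.eval (e w) • v w) c = 0 := by
  have h1 : ∀ w, Polynomial.aeval A P (v w) = P.eval (e w) • v w := fun w => by
    by_cases hw : v w = 0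
    · simp [hw]
    · exact Module.End.aeval_apply_of_hasEigenvector ⟨Module.End.mem_eigenspace_iff.mpr (hv w), hw⟩
  have h2 := congrArg (Polynomial.aeval A P) h0
  rw [map_zero, Finsupp.linearCombination_apply, map_finsuppSum] at h2
  rw [Finsupp.linearCombination_apply, ← h2]
  refine Finsupp.sum_congr fun w _ => ?_
  rw [map_smul, h1]

/-- The rescaling of the state labelled by `w` by `d w.length`. -/
def lengthScale (m : ℕ) (d : ℕ → ℂ) : (List (Fin m) →₀ ℂ) →ₗ[ℂ] List (Fin m) →₀ ℂ :=
  Finsupp.linearCombination ℂ fun w => Finsupp.single w (d w.length)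

section
variable {m : ℕ} {q γ : ℝ} {D D' : Fin m → QPoly m q →ₗ[ℂ] QPoly m q} {b bbar : ℕ → ℂ}

theorem lengthScale_single (d : ℕ → ℂ) (w : List (Fin m)) (a : ℂ) :
    lengthScale m d (Finsupp.single w a) = Finsupp.single w (a * d w.length) := by
  rw [lengthScale, Finsupp.linearCombination_single, Finsupp.smul_single, smul_eq_mul]

theorem linearCombination_lengthScale {M : Type*} [AddCommMonoid M] [Module ℂ M]
    (v : List (Fin m) → M) (d : ℕ → ℂ) (c : List (Fin m) →₀ ℂ) :
    Finsupp.linearCombination ℂ v (lengthScale m d c) =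
      Finsupp.linearCombination ℂ (fun w => d w.length • v w) c := by
  induction c using Finsupp.induction_linear with
  | zero => simp
  | add c c' hc hc' => rw [map_add, map_add, hc, hc', map_add]
  | single w a =>
    rw [lengthScale_single, Finsupp.linearCombination_single, Finsupp.linearCombination_single,
      mul_smul]

theorem lengthScale_comp (d d' : ℕ → ℂ) (hd : ∀ n, d n * d' n = 1) (c : List (Fin m) →₀ ℂ) :
    lengthScale m d' (lengthScale m d c) = c := by
  induction c using Finsupp.induction_linear with
  | zero => simp
  | add c c' hc hc' => rw [map_add, map_add, hc, hc']
  | single w a => rw [lengthScale_single, lengthScale_single, mul_assoc, hd, mul_one]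

namespace PolyCalculus
variable (h : PolyCalculus m q D D') (hm : 1 ≤ m) (hq : 0 < q) (hq1 : q < 1)
include h hm hq hq1

theorem hamiltonian_excited (w : List (Fin m)) :
    hamiltonian D (excited m q b w : PowerSeries (QPoly m q)) =
      ((energy m q w.length : ℝ) : ℂ) • (excited m q b w : PowerSeries (QPoly m q)) := by
  induction w with
  | nil =>
    rw [excited_nil hq, coe_radial]
    exact h.hamiltonian_ground hm hq hq1
  | cons i w ih =>
    have hs0 : 0 < q ^ ((1 : ℝ) / 2) := Real.rpow_pos_of_pos hq _
    have hsq : (q ^ ((1 : ℝ) / 2)) ^ 2 = q := by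
      rw [← Real.rpow_natCast, ← Real.rpow_mul hq.le]
      norm_num
    have hd : (((q ^ (2 * (-1 / 4 : ℝ)) : ℝ)) : ℂ) = ((q ^ ((1 : ℝ) / 2) : ℝ) : ℂ)⁻¹ := by
      rw [← Complex.ofReal_inv, ← Real.rpow_neg hq.le]
      norm_num
    have := h.hamiltonian_raise hm hq hq1 hs0 hsq w.length i (excited m q b w).2 ih
    simp only [excited, raising, SetLike.val_smul, AddSubgroupClass.coe_sub,
        coe_seriesCoord_mul, h.coe_partialD, coe_dilatation _ _ hq, hd, List.length_cons]
    rw [map_smul, this, smul_comm]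

/-- Different lengths mean different energies, so a relation splits by length. Concretely, the
interpolation polynomial with value `d n` at the n-th energy, for the finitely many lengths that
occur, is evaluated at the Hamiltonian. -/
theorem lengthScale_excited (d : ℕ → ℂ) {c : List (Fin m) →₀ ℂ}
    (h0 : Finsupp.linearCombination ℂ (excited m q b) c = 0) :
    Finsupp.linearCombination ℂ (excited m q b) (lengthScale m d c) = 0 := by
  set s := c.support.image List.length with hs
  set v : ℕ → ℂ := fun n => ((energy m q n : ℝ) : ℂ) with hv
  have hinj : Set.InjOn v s := fun i _ j _ hij =>
    energy_injective hq hq1 (Complex.ofReal_injective hij)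
  set P := Lagrange.interpolate s v d with hP
  have hval : ∀ c : List (Fin m) →₀ ℂ, ∀ u : List (Fin m) → QSeries m q,
      ((Finsupp.linearCombination ℂ u c : QSeries m q) : PowerSeries (QPoly m q)) =
        Finsupp.linearCombination ℂ (fun w => (u w : PowerSeries (QPoly m q))) c := fun c u =>
    (Finsupp.apply_linearCombination ℂ (QSeries m q).val.toLinearMap u c)
  have h1 := sum_eval_eq_zero (hamiltonian D)
    (v := fun w => (excited m q b w : PowerSeries (QPoly m q)))
    (h.hamiltonian_excited hm hq hq1) (c := c) (by rw [← hval, h0]; rfl) P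
  refine Subtype.ext ?_
  rw [linearCombination_lengthScale, hval, ZeroMemClass.coe_zero, ← h1,
    Finsupp.linearCombination_apply, Finsupp.linearCombination_apply]
  refine Finsupp.sum_congr fun w hw => ?_
  have : P.eval (v w.length) = d w.length :=
    Lagrange.eval_interpolate_at_node d hinj (Finset.mem_image_of_mem _ hw)
  rw [← this]
  rfl

variable (hγ : 0 < γ) (ε : ℤˣ)
  (hb : ∀ n : ℕ, 1 ≤ n → bbar n = ((q ^ (2 - (n : ℝ)) : ℝ) : ℂ) * b n)
include hγ hb

theorem linearCombination_mem_fourierGraph (c : List (Fin m) →₀ ℂ) :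
    (Finsupp.linearCombination ℂ (excited m q b) c,
      ((q ^ ((m : ℝ) ^ 2 / 4) : ℝ) : ℂ) • Finsupp.linearCombination ℂ (excitedBar m q bbar)
        (lengthScale m (fun n => (((ε : ℤ) : ℂ) * Complex.I) ^ n) c)) ∈ fourierGraph m q ε γ := by
  induction c using Finsupp.induction_linear with
  | zero =>
    rw [map_zero, map_zero, map_zero, smul_zero]
    exact Submodule.zero_mem _
  | add c c' hc hc' =>
    rw [map_add, map_add, map_add, smul_add]
    exact Submodule.add_mem _ hc hc'
  | single w a =>
    have hη : (((ε : ℤ) : ℂ) * Complex.I) ^ 2 = -1 := by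
      rcases Int.units_eq_one_or ε with rfl | rfl <;> simp
    have h1 := h.excited_mem_oscGraph hm hq hq1 hη hb w
    have h2 : (excited m q b w, (((q ^ ((m : ℝ) ^ 2 / 4) : ℝ) : ℂ) *
        (((ε : ℤ) : ℂ) * Complex.I) ^ w.length) • excitedBar m q bbar w) ∈
        fourierGraph m q ε γ := (h.mem_fourierGraph hm hq hq1 hγ ε _ _).mpr h1
    have h3 := Submodule.smul_mem _ a h2
    rw [lengthScale_single, Finsupp.linearCombination_single, Finsupp.linearCombination_single,
      smul_smul]
    rw [Prod.smul_mk, smul_smul] at h3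
    convert h3 using 3
    ring

/-- The transform carries relations among the ψ_w to relations among the ψ̄_w with coefficients
multiplied by η^{|w|}, and back by its injectivity. `lengthScale_excited` undoes this factor on the
side of the ψ_w. -/
theorem ker_excited : LinearMap.ker (Finsupp.linearCombination ℂ (excited m q b)) =
    LinearMap.ker (Finsupp.linearCombination ℂ (excitedBar m q bbar)) := by
  set η : ℂ := (((1 : ℤˣ) : ℤ) : ℂ) * Complex.I with hη
  have hη0 : η ≠ 0 := by simp [hη]
  have hκ : ((q ^ ((m : ℝ) ^ 2 / 4) : ℝ) : ℂ) ≠ 0 :=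
    Complex.ofReal_ne_zero.mpr (Real.rpow_pos_of_pos hq _).ne'
  have hscale : ∀ c : List (Fin m) →₀ ℂ,
      lengthScale m (fun n => η ^ n) (lengthScale m (fun n => (η ^ n)⁻¹) c) = c :=
    lengthScale_comp _ _ fun n => inv_mul_cancel₀ (pow_ne_zero n hη0)
  ext c
  -- The coefficients are divided by η^{|w|} in advance, so that the second entry of the pair is a
  -- multiple of the combination with coefficients `c` itself.
  have hmem := h.linearCombination_mem_fourierGraph hm hq hq1 hγ 1 hb
    (lengthScale m (fun n => (η ^ n)⁻¹) c)
  rw [hscale] at hmem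
  rw [LinearMap.mem_ker, LinearMap.mem_ker]
  constructor
  · intro h0
    rw [h.lengthScale_excited hm hq hq1 _ h0] at hmem
    exact (smul_eq_zero.mp (h.fourierGraph_snd_eq_zero hm hq hq1 hγ 1 hmem)).resolve_left hκ
  · intro h0
    rw [h0, smul_zero] at hmem
    have := h.lengthScale_excited hm hq hq1 (fun n => η ^ n)
      (h.fourierGraph_fst_eq_zero hm hq hq1 hγ 1 hmem)
    rwa [hscale] at this

theorem rep_injective : Function.Injective (rep m q b bbar) := by
  refine (injective_iff_map_eq_zero _).mpr fun u hu => ?_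
  obtain ⟨c, rfl⟩ := (stateRelations m q b bbar).mkQ_surjective u
  exact (Submodule.Quotient.mk_eq_zero _).mpr ⟨hu, (h.ker_excited hm hq hq1 hγ hb).le hu⟩

theorem repBar_injective : Function.Injective (repBar m q b bbar) := by
  refine (injective_iff_map_eq_zero _).mpr fun u hu => ?_
  obtain ⟨c, rfl⟩ := (stateRelations m q b bbar).mkQ_surjective u
  exact (Submodule.Quotient.mk_eq_zero _).mpr ⟨(h.ker_excited hm hq hq1 hγ hb).ge hu, hu⟩

omit hb in
theorem fourierGraph_unique {f g g' : QSeries m q} (hg : (f, g) ∈ fourierGraph m q ε γ)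
    (hg' : (f, g') ∈ fourierGraph m q ε γ) : g = g' := by
  have h1 := Submodule.add_mem _ hg (Submodule.smul_mem _ (-1 : ℂ) hg')
  have hneg : ∀ u : QSeries m q, (-1 : ℂ) • u = -u := fun u => neg_one_smul ℂ u
  rw [Prod.smul_mk, Prod.mk_add_mk, hneg, hneg] at h1
  have h2 : ((0 : QSeries m q), g - g') ∈ fourierGraph m q ε γ := by
    convert h1 using 2
    · exact (add_neg_cancel f).symm
    · exact sub_eq_add_neg g g'
  exact sub_eq_zero.mp (h.fourierGraph_snd_eq_zero hm hq hq1 hγ ε h2)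

omit hb in
theorem fourierTwo_eq {f g : QSeries m q} (hg : (f, g) ∈ fourierGraph m q ε γ) :
    fourierTwo m q ε γ f = g := by
  have hex : ∃ g, (f, g) ∈ fourierGraph m q ε γ := ⟨g, hg⟩
  rw [fourierTwo, dif_pos hex]
  exact h.fourierGraph_unique hm hq hq1 hγ ε hex.choose_spec hg

theorem fourierTwo_rep (c : List (Fin m) →₀ ℂ) :
    fourierTwo m q ε γ (rep m q b bbar ((stateRelations m q b bbar).mkQ c)) =
      repBar m q b bbar (((q ^ ((m : ℝ) ^ 2 / 4) : ℝ) : ℂ) • (stateRelations m q b bbar).mkQ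
        (lengthScale m (fun n => (((ε : ℤ) : ℂ) * Complex.I) ^ n) c)) := by
  rw [map_smul]
  exact h.fourierTwo_eq hm hq hq1 hγ ε (h.linearCombination_mem_fourierGraph hm hq hq1 hγ ε hb c)

/-- Injectivity of Π̄ makes `Function.invFun` a genuine inverse on its image, and q^{-m²/4} cancels
the ground-state constant. -/
theorem oscillatorFourier_mkQ (c : List (Fin m) →₀ ℂ) :
    oscillatorFourier m q b bbar ε γ ((stateRelations m q b bbar).mkQ c) =
      (stateRelations m q b bbar).mkQ
        (lengthScale m (fun n => (((ε : ℤ) : ℂ) * Complex.I) ^ n) c) := by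
  rw [oscillatorFourier, h.fourierTwo_rep hm hq hq1 hγ ε hb,
    Function.leftInverse_invFun (h.repBar_injective hm hq hq1 hγ hb), smul_smul,
    ← Complex.ofReal_mul, ← Real.rpow_add hq, neg_add_cancel, Real.rpow_zero, Complex.ofReal_one,
    one_smul]

end PolyCalculus
end

end QuantumEuclidean

end

/-- All conjuncts but the last say that the objects entering the definition of `𝔽^±` are well
defined: `Π` and `Π̄` are isomorphisms onto their images, the sum `V_[q^{-m/2}] ⊕ V_[q^{1-m/2}]` is
direct, the second Fourier transform is a single-valued map with this sum as domain, the image of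
`Π` lies in it and is mapped into the image of `Π̄`, and `𝔽^±` is linear. -/
theorem theorem7p2 (m : ℕ) (hm : 1 ≤ m) (q : ℝ) (hq0 : 0 < q) (hq1 : q < 1)
    (γ : ℝ) (hγ : 0 < γ) (b bbar : ℕ → ℂ)
    (hb : ∀ n : ℕ, 1 ≤ n → bbar n = ((q ^ (2 - (n : ℝ)) : ℝ) : ℂ) * b n) (ε : ℤˣ) :
    Function.Injective (rep m q b bbar) ∧
    Function.Injective (repBar m q b bbar) ∧
    (∀ f g g' : QSeries m q, (f, g) ∈ fourierGraph m q ε γ →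
      (f, g') ∈ fourierGraph m q ε γ → g = g') ∧
    Disjoint (gaussianClass m q (q ^ (-((m : ℝ) / 2)))) (gaussianClass m q (q ^ (1 - (m : ℝ) / 2))) ∧
    fourierDomain m q ε γ =
      gaussianClass m q (q ^ (-((m : ℝ) / 2))) ⊔ gaussianClass m q (q ^ (1 - (m : ℝ) / 2)) ∧
    (∀ u : StateSpace m q b bbar, rep m q b bbar u ∈
      gaussianClass m q (q ^ (-((m : ℝ) / 2))) ⊔ gaussianClass m q (q ^ (1 - (m : ℝ) / 2))) ∧
    (∀ u : StateSpace m q b bbar,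
      fourierTwo m q ε γ (rep m q b bbar u) ∈ LinearMap.range (repBar m q b bbar)) ∧
    IsLinearMap ℂ (oscillatorFourier m q b bbar ε γ) ∧
    ∀ w : List (Fin m), oscillatorFourier m q b bbar ε γ (state m q b bbar w) =
      (((ε : ℤ) : ℂ) * Complex.I) ^ w.length • state m q b bbar w := by
  obtain ⟨D, D', h⟩ := exists_polyCalculus hm hq0 hq1
  have hsurj := (stateRelations m q b bbar).mkQ_surjective
  have hosc := h.oscillatorFourier_mkQ hm hq0 hq1 hγ ε hb
  refine ⟨h.rep_injective hm hq0 hq1 hγ hb, h.repBar_injective hm hq0 hq1 hγ hb,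
    fun f g g' => h.fourierGraph_unique hm hq0 hq1 hγ ε, h.disjoint_gaussianClass hm hq0 hq1,
    h.fourierDomain_eq hm hq0 hq1 hγ ε, fun u => ?_, fun u => ?_, ⟨fun u v => ?_, fun a u => ?_⟩,
    fun w => ?_⟩
  · obtain ⟨c, rfl⟩ := hsurj u
    rw [← h.fourierDomain_eq hm hq0 hq1 hγ ε]
    exact ⟨_, h.linearCombination_mem_fourierGraph hm hq0 hq1 hγ ε hb c, rfl⟩
  · obtain ⟨c, rfl⟩ := hsurj u
    rw [h.fourierTwo_rep hm hq0 hq1 hγ ε hb]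
    exact ⟨_, rfl⟩
  · obtain ⟨c, rfl⟩ := hsurj u
    obtain ⟨d, rfl⟩ := hsurj v
    rw [← map_add, hosc, hosc, hosc, map_add, map_add]
  · obtain ⟨c, rfl⟩ := hsurj u
    rw [← map_smul, hosc, hosc, map_smul, map_smul]
  · rw [state, hosc, lengthScale_single, ← map_smul, Finsupp.smul_single, smul_eq_mul, mul_comm]
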